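/- **Setting.** Let $\mu,\chi>0$ and $\gamma,\kappa\ge 0$. Let $L^2=L^2(\mathbb R^3;\mathbb R^3)$, let $L^2_\sigma$ be the subspace of fields that are divergence free in the sense of distributions, and let $\mathbb P$ be the $L^2$-orthogonal projector onto $L^2_\sigma$. Let $\theta\in C_c^\infty(\mathbb R^3)$ be non-negative and even with $\int\theta=1$, and for $\varepsilon>0$ let $\theta_\varepsilon(x)=\varepsilon^{-3}\theta(x/\varepsilon)$ and $J_\varepsilon f=\theta_\varepsilon * f$. Fix $z_0=(u_0,w_0)\in L^2_\sigma\times L^2$. A *mollified solution* with parameter $\varepsilon>0$ and initial data $z_0$ is a weak solution $(u_\varepsilon,w_\varepsilon)$ of $$\partial_t u_\varepsilon+\mathbb P\big((J_\varepsilon u_\varepsilon)\cdot\nabla u_\varepsilon\big)=(\mu+\chi)\Delta u_\varepsilon+2\chi\operatorname{curl}w_\varepsilon,\qquad \operatorname{div}u_\varepsilon=0,$$ $$\partial_t w_\varepsilon+(J_\varepsilon u_\varepsilon)\cdot\nabla w_\varepsilon=\gamma\Delta w_\varepsilon+\kappa\nabla\operatorname{div}w_\varepsilon+2\chi\operatorname{curl}u_\varepsilon-4\chi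 w_\varepsilon,\qquad (u_\varepsilon,w_\varepsilon)|_{t=0}=z_0,$$ such that $u_\varepsilon,w_\varepsilon$ are bounded and weakly continuous from $[0,\infty)$ to $L^2$, $\nabla u_\varepsilon\in L^2(\mathbb R_+\times\mathbb R^3)$, $\nabla w_\varepsilon\in L^2(\mathbb R_+\times\mathbb R^3)$ if $\gamma>0$, $\operatorname{div}w_\varepsilon\in L^2(\mathbb R_+\times\mathbb R^3)$ if $\gamma=0<\kappa$, and, for all $t\ge s\ge0$ (terms with a zero coefficient being omitted), $$\|u_\varepsilon(t)\|_{L^2}^2+\|w_\varepsilon(t)\|_{L^2}^2+2\int_s^t\Big(\mu\|\nabla u_\varepsilon\|_{L^2}^2+\gamma\|\nabla w_\varepsilon\|_{L^2}^2+\kappa\|\operatorname{div}w_\varepsilon\|_{L^2}^2+\chi\|\operatorname{curl}u_\varepsilon-2w_\varepsilon\|_{L^2}^2\Big)=\|u_\varepsilon(s)\|_{L^2}^2+\|w_\varepsilon(s)\|_{L^2}^2 .$$ A *restricted Leray solution* of the micropolar system $$\partial_t u+u\cdot\nabla u+\nabla p=(\mu+\chi)\Delta u+2\chi\operatorname{curl}w,\quad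 \partial_t w+u\cdot\nabla w=\gamma\Delta w+\kappa\nabla\operatorname{div}w+2\chi\operatorname{curl}u-4\chi w,\quad \operatorname{div}u=0$$ with initial data $z_0$ is a pair $z=(u,w)$ that is the limit in $\mathscr D'((0,\infty)\times\mathbb R^3)$ of a sequence of mollified solutions with initial data $z_0$ and parameters $\varepsilon_n\to0$. **Theorem.** Let $z=(u,w)$ be a restricted Leray solution with initial data $z_0$. Then $u$ and $w$ are represented by weakly continuous functions from $[0,\infty)$ to $L^2$, which are necessarily unique and give a meaning to $u(t),w(t)$ for every $t\ge 0$, and the following hold. 1. $\|u(t)\|_{L^2}^2+\|w(t)\|_{L^2}^2\to0$ as $t\to+\infty$. 2. Let $z_L=(u_L,w_L)$ be the (weakly continuous, $L^2$-valued, weak) solution of the linear system $$\partial_t u_L=(\mu+\chi)\Delta u_L+2\chi\operatorname{curl}w_L,\quad \partial_t w_L=\gamma\Delta w_L+\kappa\nabla\operatorname{div}w_L+2\chi\operatorname{curl}u_L-4\chi w_L,\quad\operatorname{div}u_L=0$$ with initial data $z_0$. If $0\le\Gamma\le 5/2$ and $\|u_L(t)\|_{L^2}^2=O(t^{-\Gamma})$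 as $t\to+\infty$, then $\|u(t)\|_{L^2}^2+\|w(t)\|_{L^2}^2=O(t^{-\Gamma})$ as $t\to+\infty$. 3. Under the condition of item 2 and, if $\gamma=0$, the additional condition $\int_{\mathbb R^3}(1+|\xi|)|\widehat z_0(\xi)|\,d\xi<\infty$, there are a constant $C$ independent of $t$ and, when $\Gamma=0$, a function $\zeta$ with $\lim_{t\to+\infty}\zeta(t)=0$, such that for all $t\ge0$ $$\|(u-u_L)(t)\|_{L^2}^2+\|(w-w_L)(t)\|_{L^2}^2\le C\begin{cases}(1+t)^{-1/2}\,\zeta(t)&\text{if }\Gamma=0,\\(1+t)^{-1/2-2\Gamma}&\text{if }0<\Gamma<1,\\(1+t)^{-5/2}(\log(e+t))^2&\text{if }\Gamma=1,\\(1+t)^{-5/2}&\text{if }1<\Gamma\le5/2.\end{cases}$$ -/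

import Mathlib

open MeasureTheory Filter Set
open scoped Topology ENNReal ContDiff FourierTransform Laplacian Distributions Gradient

noncomputable section

namespace Micropolar

/-! ### Spaces and test functions -/

/-- The Euclidean space `ℝ³`. -/
abbrev R3 : Type := EuclideanSpace ℝ (Fin 3)

/-- Square integrable vector fields on `ℝ³` (modulo equality almost everywhere). -/
abbrev L2 : Type := Lp R3 2 (volume : Measure R3)

/-- Smooth compactly supported functions on `ℝ³`. -/
def IsTest {F : Type} [NormedAddCommGroup F] [NormedSpace ℝ F] (φ : R3 → F) : Prop :=
  ContDiff ℝ ∞ φ ∧ HasCompactSupport φ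

/-- The partial derivative `∂ⱼ φ` of a classical function. -/
def pd {F : Type} [NormedAddCommGroup F] [NormedSpace ℝ F] (j : Fin 3) (φ : R3 → F) (x : R3) : F :=
  fderiv ℝ φ x (EuclideanSpace.single j 1)

/-- The divergence of a classical vector field. -/
def div (φ : R3 → R3) (x : R3) : ℝ := ∑ j, (pd j φ x) j

/-- The curl of a classical vector field. -/
def curl (φ : R3 → R3) (x : R3) : R3 :=
  !₂[pd 1 φ x 2 - pd 2 φ x 1, pd 2 φ x 0 - pd 0 φ x 2, pd 0 φ x 1 - pd 1 φ x 0]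

theorem IsTest.pd {F : Type} [NormedAddCommGroup F] [NormedSpace ℝ F] {φ : R3 → F}
    (h : IsTest φ) (j : Fin 3) : IsTest (pd j φ) := by
  refine ⟨?_, ?_⟩
  · exact (h.1.fderiv_right (m := ∞) (by simp)).clm_apply contDiff_const
  · exact h.2.fderiv_apply (𝕜 := ℝ) _

theorem IsTest.gradient {ψ : R3 → ℝ} (h : IsTest ψ) : IsTest (∇ ψ) := by
  refine ⟨?_, ?_⟩
  · exact (InnerProductSpace.toDual ℝ R3).symm.contDiff.comp
      (h.1.fderiv_right (m := ∞) (by simp))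
  · exact (h.2.fderiv (𝕜 := ℝ)).comp_left (g := (InnerProductSpace.toDual ℝ R3).symm) (by simp)

theorem IsTest.memLp {φ : R3 → R3} (h : IsTest φ) : MemLp φ 2 (volume : Measure R3) :=
  h.1.continuous.memLp_of_hasCompactSupport h.2

/-- A test vector field, as an element of `L²`. -/
def IsTest.toL2 {φ : R3 → R3} (h : IsTest φ) : L2 := h.memLp.toLp φ

/-- The `L²` pairing `∫ f · φ dx` of a field `f ∈ L²` with a test field `φ`. -/
def pair (f : L2) (φ : R3 → R3) : ℝ := ∫ x, inner ℝ (f x) (φ x)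

theorem inner_toL2 (f : L2) {φ : R3 → R3} (h : IsTest φ) : inner ℝ f h.toL2 = pair f φ := by
  rw [L2.inner_def, pair]
  refine integral_congr_ae ?_
  filter_upwards [h.memLp.coeFn_toLp] with x hx
  rw [IsTest.toL2, hx]

/-- The space `L²_σ` of square integrable vector fields that are divergence free in the sense of
distributions: the orthogonal complement of the gradients of test functions
(see `mem_L2σ`). -/
def L2σ : Submodule ℝ L2 :=
  (Submodule.span ℝ {g : L2 | ∃ (ψ : R3 → ℝ) (h : IsTest ψ), g = h.gradient.toL2})ᗮ

theorem mem_L2σ (f : L2) : f ∈ L2σ ↔ ∀ ψ : R3 → ℝ, IsTest ψ → pair f (∇ ψ) = 0 := by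
  rw [L2σ, Submodule.mem_orthogonal']
  constructor
  · intro H ψ h
    rw [← inner_toL2 f h.gradient]
    exact H _ (Submodule.subset_span ⟨ψ, h, rfl⟩)
  · intro H g hg
    induction hg using Submodule.span_induction with
    | mem g hg =>
      obtain ⟨ψ, h, rfl⟩ := hg
      rw [inner_toL2]
      exact H ψ h
    | zero => simp
    | add a b _ _ ha hb => rw [inner_add_right, ha, hb, add_zero]
    | smul c a _ ha => rw [inner_smul_right, ha, mul_zero]

instance : L2σ.HasOrthogonalProjection := by
  have hc : IsClosed (L2σ : Set L2) := Submodule.isClosed_orthogonal _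
  have : CompleteSpace L2σ := hc.completeSpace_coe
  exact Submodule.HasOrthogonalProjection.ofCompleteSpace L2σ

/-- The Leray projector `ℙ`: the orthogonal projector of `L²` onto `L²_σ`. -/
def leray : L2 →L[ℝ] L2 := L2σ.starProjection

/-! ### Weak derivatives in `L²` and the quantities of the energy balance

Each of the following squared norms takes the value `∞` when the corresponding weak derivative
does not exist in `L²`. (A weak derivative in `L²` is unique, so each infimum is over at most one
element.) -/

/-- `g = ∂ⱼ f` in the sense of distributions. -/
def HasWeakPartial (j : Fin 3) (f g : L2) : Prop :=
  ∀ φ : R3 → R3, IsTest φ → pair f (pd j φ) = - pair g φ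

/-- `d = div f` in the sense of distributions. -/
def HasWeakDiv (f : L2) (d : Lp ℝ 2 (volume : Measure R3)) : Prop :=
  ∀ ψ : R3 → ℝ, IsTest ψ → pair f (∇ ψ) = - ∫ x, d x * ψ x

/-- `c = curl f` in the sense of distributions. -/
def HasWeakCurl (f c : L2) : Prop :=
  ∀ φ : R3 → R3, IsTest φ → pair f (curl φ) = pair c φ

/-- `‖∇ f‖²` in `L²`. -/
def gradSq (f : L2) : ℝ≥0∞ :=
  ⨅ (g : Fin 3 → L2) (_ : ∀ j, HasWeakPartial j f (g j)), ∑ j, ‖g j‖ₑ ^ 2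

/-- `‖div f‖²` in `L²`. -/
def divSq (f : L2) : ℝ≥0∞ :=
  ⨅ (d : Lp ℝ 2 (volume : Measure R3)) (_ : HasWeakDiv f d), ‖d‖ₑ ^ 2

/-- `‖curl f - 2 g‖²` in `L²`. -/
def curlSubSq (f g : L2) : ℝ≥0∞ :=
  ⨅ (c : L2) (_ : HasWeakCurl f c), ‖c - (2 : ℝ) • g‖ₑ ^ 2

/-! ### The systems -/

/-- The material coefficients: kinematic viscosity `μ > 0`, vortex viscosity `χ > 0`,
spin viscosity `γ ≥ 0` and gyroviscosity `κ ≥ 0`. -/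
structure Coeffs where
  μ : ℝ
  χ : ℝ
  γ : ℝ
  κ : ℝ
  μ_pos : 0 < μ
  χ_pos : 0 < χ
  γ_nonneg : 0 ≤ γ
  κ_nonneg : 0 ≤ κ

/-- Weak continuity on `[0,∞)` of a time-dependent field with values in `L²`. -/
def WeaklyCont (u : ℝ → L2) : Prop :=
  ∀ f : L2, ContinuousOn (fun t => inner ℝ (u t) f) (Ici 0)

/-- `(u,w)`, weakly continuous in time with values in `L²`, is the weak solution of the linear
micropolar system
`∂ₜu = (μ+χ)Δu + 2χ curl w`, `∂ₜw = γΔw + κ∇div w + 2χ curl u - 4χw`, `div u = 0`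
with initial data `(u₀,w₀)`; the equations are tested against smooth compactly supported fields
and integrated in time. -/
structure IsLinearSolution (c : Coeffs) (u₀ w₀ : L2) (u w : ℝ → L2) : Prop where
  contU : WeaklyCont u
  contW : WeaklyCont w
  divFree : ∀ t, 0 ≤ t → u t ∈ L2σ
  eqU : ∀ φ : R3 → R3, IsTest φ → ∀ t, 0 ≤ t →
    pair (u t) φ = pair u₀ φ + ∫ s in (0 : ℝ)..t,
      ((c.μ + c.χ) * pair (u s) (Δ φ) + 2 * c.χ * pair (w s) (curl φ))
  eqW : ∀ φ : R3 → R3, IsTest φ → ∀ t, 0 ≤ t →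
    pair (w t) φ = pair w₀ φ + ∫ s in (0 : ℝ)..t,
      (c.γ * pair (w s) (Δ φ) + c.κ * pair (w s) (∇ (div φ))
        + 2 * c.χ * pair (u s) (curl φ) - 4 * c.χ * pair (w s) φ)

/-- A mollifying profile: smooth, compactly supported, non-negative, even, of integral one. -/
structure IsMollifier (θ : R3 → ℝ) : Prop where
  test : IsTest θ
  nonneg : ∀ x, 0 ≤ θ x
  even : ∀ x, θ (-x) = θ x
  integral_eq_one : ∫ x, θ x = 1

/-- The mollification `J_ε f = θ_ε * f`, where `θ_ε(x) = ε⁻³ θ(x/ε)`. -/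
def mollify (θ : R3 → ℝ) (ε : ℝ) (f : L2) (x : R3) : R3 :=
  ∫ y, ((ε ^ 3)⁻¹ * θ (ε⁻¹ • (x - y))) • f y

/-- `(u,w)` is a mollified solution, that is, a finite energy weak solution, satisfying the energy
equality, of the mollified micropolar system
`∂ₜu + ℙ((J_ε u)·∇u) = (μ+χ)Δu + 2χ curl w`,
`∂ₜw + (J_ε u)·∇w = γΔw + κ∇div w + 2χ curl u - 4χw`, `div u = 0`
with initial data `(u₀,w₀)`. The transport terms are written in divergence form
(`J_ε u` is divergence free) and the projector `ℙ` is moved to the test field. In the energy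
equality `0 * ∞ = 0`, so that terms with a zero coefficient do not appear. -/
structure IsMollifiedSolution (c : Coeffs) (θ : R3 → ℝ) (ε : ℝ) (u₀ w₀ : L2)
    (u w : ℝ → L2) : Prop where
  contU : WeaklyCont u
  contW : WeaklyCont w
  bdd : ∃ C : ℝ, ∀ t, 0 ≤ t → ‖u t‖ ≤ C ∧ ‖w t‖ ≤ C
  gradU : ∫⁻ t in Ioi (0 : ℝ), gradSq (u t) < ⊤
  gradW : 0 < c.γ → ∫⁻ t in Ioi (0 : ℝ), gradSq (w t) < ⊤
  divW : c.γ = 0 → 0 < c.κ → ∫⁻ t in Ioi (0 : ℝ), divSq (w t) < ⊤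
  divFree : ∀ t, 0 ≤ t → u t ∈ L2σ
  eqU : ∀ (φ : R3 → R3) (hφ : IsTest φ), ∀ t, 0 ≤ t →
    pair (u t) φ = pair u₀ φ + ∫ s in (0 : ℝ)..t,
      ((∑ j, ∫ x, mollify θ ε (u s) x j * inner ℝ (u s x) (leray (hφ.pd j).toL2 x))
        + (c.μ + c.χ) * pair (u s) (Δ φ) + 2 * c.χ * pair (w s) (curl φ))
  eqW : ∀ φ : R3 → R3, IsTest φ → ∀ t, 0 ≤ t →
    pair (w t) φ = pair w₀ φ + ∫ s in (0 : ℝ)..t,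
      ((∑ j, ∫ x, mollify θ ε (u s) x j * inner ℝ (w s x) (pd j φ x))
        + c.γ * pair (w s) (Δ φ) + c.κ * pair (w s) (∇ (div φ))
        + 2 * c.χ * pair (u s) (curl φ) - 4 * c.χ * pair (w s) φ)
  energy : ∀ s t, 0 ≤ s → s ≤ t →
    ‖u t‖ₑ ^ 2 + ‖w t‖ₑ ^ 2
      + ENNReal.ofReal (2 * c.μ) * (∫⁻ r in Ioc s t, gradSq (u r))
      + ENNReal.ofReal (2 * c.γ) * (∫⁻ r in Ioc s t, gradSq (w r))
      + ENNReal.ofReal (2 * c.κ) * (∫⁻ r in Ioc s t, divSq (w r))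
      + ENNReal.ofReal (2 * c.χ) * (∫⁻ r in Ioc s t, curlSubSq (u r) (w r))
    = ‖u s‖ₑ ^ 2 + ‖w s‖ₑ ^ 2

/-- The open set `(0,∞) × ℝ³`. -/
def SpaceTime : TopologicalSpace.Opens (ℝ × R3) :=
  ⟨Ioi (0 : ℝ) ×ˢ (univ : Set R3), isOpen_Ioi.prod isOpen_univ⟩

/-- The action `∫₀^∞ ∫ φ(t,x) u(t,x) dx dt` of a time-dependent field `u` on a scalar test
function `φ` on `(0,∞) × ℝ³`. -/
def act (u : ℝ → L2) (φ : 𝓓(SpaceTime, ℝ)) : R3 :=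
  ∫ t in Ioi (0 : ℝ), ∫ x, φ (t, x) • u t x

/-- The pair `(U,W)` of (vector-valued) distributions on `(0,∞) × ℝ³` is a restricted Leray
solution with initial data `(u₀,w₀)`: it is the limit, in the sense of distributions, of mollified
solutions with parameters `ε_n → 0`. -/
def IsRestrictedLeray (c : Coeffs) (θ : R3 → ℝ) (u₀ w₀ : L2)
    (U W : 𝓓'(SpaceTime, R3)) : Prop :=
  ∃ (ε : ℕ → ℝ) (u w : ℕ → ℝ → L2),
    (∀ n, 0 < ε n) ∧ Tendsto ε atTop (𝓝 0) ∧
    (∀ n, IsMollifiedSolution c θ (ε n) u₀ w₀ (u n) (w n)) ∧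
    ∀ φ : 𝓓(SpaceTime, ℝ),
      Tendsto (fun n => act (u n) φ) atTop (𝓝 (U φ)) ∧
      Tendsto (fun n => act (w n) φ) atTop (𝓝 (W φ))

/-- `u`, weakly continuous on `[0,∞)` with values in `L²`, represents the distribution `U`.
Such a `u` is determined by `U` on `[0,∞)`, and gives a meaning to `U` at every time `t ≥ 0`. -/
def Represents (u : ℝ → L2) (U : 𝓓'(SpaceTime, R3)) : Prop :=
  WeaklyCont u ∧ ∀ φ : 𝓓(SpaceTime, ℝ), U φ = act u φ

/-! ### The Fourier transform of a real vector field -/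

/-- The inclusion of `ℝ³` into `ℂ³`. -/
def complexify : R3 →L[ℝ] EuclideanSpace ℂ (Fin 3) :=
  LinearMap.toContinuousLinearMap
    { toFun := fun v => WithLp.toLp 2 (fun i => (v i : ℂ))
      map_add' := fun v w => by ext i; simp
      map_smul' := fun a v => by ext i; simp }

/-- The Fourier(–Plancherel) transform of a real vector field in `L²`. -/
def fourierL2 (f : L2) : Lp (EuclideanSpace ℂ (Fin 3)) 2 (volume : Measure R3) :=
  𝓕 (complexify.compLp f)

/-- The condition `∫ (1+|ξ|) |ẑ₀(ξ)| dξ < ⊤` for `z₀ = (u₀,w₀)`. -/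
def FourierCond (u₀ w₀ : L2) : Prop :=
  Integrable (fun ξ : R3 => (1 + ‖ξ‖) * √(‖fourierL2 u₀ ξ‖ ^ 2 + ‖fourierL2 w₀ ξ‖ ^ 2))

/-- The squared norm of `(u,w)` in `L² × L²`. -/
def energy (u w : L2) : ℝ := ‖u‖ ^ 2 + ‖w‖ ^ 2

end Micropolar

end

/-! The dissipation controls more than gradients. Since `χ‖curl u - 2w‖²` and `μ‖∇u‖²` together
dominate a multiple of `‖w‖²`, the field `w` is damped at every frequency, even if `γ = κ = 0`, and
`u` is damped at rate at least a multiple of `ρ²` at frequencies above `ρ` (`le_dform_self`). Only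
the low frequencies of `u` escape, so Fourier splitting applies: on `[T, 2T]`, with `ρ²`
proportional to `1/T`, the energy `E = ‖u‖² + ‖w‖²` satisfies `E(2T) ≤ E(T)/16 +` (low frequencies
of `u`); see `add_mul_le_of_dform` and `energy_two_mul_le_of_low`.

The low frequencies are compared with those of the linear flow. The transport terms are divergences
of products of `L²` fields, so their Fourier transforms are bounded by a multiple of `|ξ| E`. On a
ball of radius `ρ` in `ℝ³` the squared difference with the linear flow is therefore at most a
multiple of `ρ⁵ (∫₀ᵗ E)²` (`low_freq`). If `E = O(t^(-a))`, this remainder is `O(t^(-1/2-2a))` for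
`a < 1`, `O(t^(-5/2))` for `a > 1`, and carries a squared logarithm for `a = 1`. A bootstrap from
the bounded energy raises the exponent through `0, 1/2, 3/2, 5/2`, stopping at `Γ`
(`exists_energy_decay`). For item 1 the low frequencies are compared with the initial data instead,
whose mass in a shrinking ball tends to zero (`exists_energy_le`).

For the difference with `z_L`, the cancellation `∫ (J_ε u)·∇(|v|²) = 0` leaves a term bounded by
`‖u‖ ‖z - z_L‖ ∫ |ξ| |ẑ_L|`. The last integral is `O(t^(-5/4) ‖z_L(t/2)‖)` up to an exponentially
small term; when `γ = 0`, the high frequencies decay only at a constant rate, and the integrability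
condition on `ẑ₀` is what makes the integral finite (`exists_grad_bound`). Fourier splitting then
gives the recursion `diff_two_mul_le`.

The fields are not smooth enough to be tested against themselves. All identities are therefore
written for Fourier transforms truncated to a bounded set of frequencies (`IsFlow`), where solutions
are locally Lipschitz in time, and the truncation is removed only in inequalities. Every constant is
independent of `ε` and of the mollified solution. A uniform modulus of continuity (`exists_modulus`)
turns distributional convergence into weak convergence at each time, and the bounds pass to the
limit by weak lower semicontinuity (`IsRestrictedLeray.energy_le`). -/

noncomputable section

namespace Micropolar

section

/-! ### Weakly continuous and weakly differentiable curves in a Hilbert space. -/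

section Hilbert

variable {H : Type*} [NormedAddCommGroup H] [InnerProductSpace ℝ H]

/-- Weak continuity on `[0,∞)` of a curve in a Hilbert space. -/
def WCont (F : ℝ → H) : Prop :=
  ∀ g : H, ContinuousOn (fun t => inner ℝ (F t) g) (Ici 0)

/-- Each scalar function `⟨F t, x⟩` is bounded on the compact interval; the uniform boundedness
principle, for the functionals indexed by the times of the interval, makes the bound uniform in `x`.
-/
theorem WCont.exists_bound [CompleteSpace H] {F : ℝ → H} (hF : WCont F) (b : ℝ) :
    ∃ C, 0 ≤ C ∧ ∀ t, 0 ≤ t → t ≤ b → ‖F t‖ ≤ C := by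
  have key : ∀ x : H, ∃ C, ∀ i : Icc (0 : ℝ) b, ‖innerSL ℝ (F i) x‖ ≤ C := by
    intro x
    have hc : ContinuousOn (fun t => inner ℝ (F t) x) (Icc 0 b) :=
      (hF x).mono Icc_subset_Ici_self
    obtain ⟨C, hC⟩ := isCompact_Icc.exists_bound_of_continuousOn hc
    exact ⟨C, fun i => by simpa using hC i i.2⟩
  obtain ⟨C, hC⟩ := banach_steinhaus key
  refine ⟨max C 0, le_max_right _ _, fun t h0 hb => ?_⟩
  have := hC ⟨t, h0, hb⟩
  rw [innerSL_apply_norm] at this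
  exact this.trans (le_max_left _ _)

/-- Weak convergence of one factor and norm convergence of the other suffice: the increment of `z`
is multiplied by a locally bounded factor. -/
theorem WCont.continuousOn_inner [CompleteSpace H] {F z : ℝ → H} (hF : WCont F)
    (hz : ContinuousOn z (Ici 0)) : ContinuousOn (fun t => inner ℝ (F t) (z t)) (Ici 0) := by
  intro r hr
  obtain ⟨C, hC0, hC⟩ := hF.exists_bound (r + 1)
  have h1 : Tendsto (fun t => inner ℝ (F t) (z r)) (𝓝[Ici 0] r) (𝓝 (inner ℝ (F r) (z r))) :=
    hF (z r) r hr
  have h2 : Tendsto (fun t => inner ℝ (F t) (z t - z r)) (𝓝[Ici 0] r) (𝓝 0) := by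
    have h3 : Tendsto (fun t => C * ‖z t - z r‖) (𝓝[Ici 0] r) (𝓝 0) := by
      have : Tendsto z (𝓝[Ici 0] r) (𝓝 (z r)) := hz r hr
      have := (tendsto_iff_norm_sub_tendsto_zero.1 this).const_mul C
      simpa using this
    refine squeeze_zero_norm' ?_ h3
    have h4 : ∀ᶠ t in 𝓝[Ici 0] r, t ≤ r + 1 :=
      nhdsWithin_le_nhds (Iic_mem_nhds (by linarith))
    filter_upwards [self_mem_nhdsWithin, h4] with t ht0 ht1
    exact (norm_inner_le_norm _ _).trans
      (mul_le_mul_of_nonneg_right (hC t ht0 ht1) (norm_nonneg _))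
  have := h1.add h2
  simp only [add_zero] at this
  refine this.congr fun t => ?_
  rw [← inner_add_right]; simp

theorem WCont.sub {F G : ℝ → H} (hF : WCont F) (hG : WCont G) : WCont (fun t => F t - G t) := by
  intro g
  simp only [inner_sub_left]
  exact (hF g).sub (hG g)

theorem WCont.const_smul {F : ℝ → H} (hF : WCont F) (c : ℝ) : WCont (fun t => c • F t) := by
  intro g
  simp only [real_inner_smul_left]
  exact continuousOn_const.mul (hF g)

theorem WCont.zero : WCont (fun _ : ℝ => (0 : H)) := fun g => by
  simpa using continuousOn_const

theorem WCont.sum {ι : Type*} {s : Finset ι} {F : ι → ℝ → H} (hF : ∀ i ∈ s, WCont (F i)) :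
    WCont (fun t => ∑ i ∈ s, F i t) := by
  intro g
  simp only [sum_inner]
  exact continuousOn_finsetSum _ fun i hi => hF i hi g

theorem WCont.map [CompleteSpace H] {K : Type*} [NormedAddCommGroup K] [InnerProductSpace ℝ K]
    [CompleteSpace K] {F : ℝ → H} (hF : WCont F) (L : H →L[ℝ] K) : WCont (fun t => L (F t)) := by
  intro g
  simpa only [ContinuousLinearMap.adjoint_inner_right] using
    hF (ContinuousLinearMap.adjoint L g)

/-- `y` is weakly differentiable on `[0,∞)` with weakly continuous derivative `F`,
in integrated form. -/
structure HasWeakDeriv (y F : ℝ → H) : Prop where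
  cont : WCont F
  eq : ∀ g : H, ∀ t, 0 ≤ t → inner ℝ (y t) g = inner ℝ (y 0) g + ∫ r in (0 : ℝ)..t, inner ℝ (F r) g

theorem intervalIntegrable_of_continuousOn_Ici {f : ℝ → ℝ} (hf : ContinuousOn f (Ici 0)) {s t : ℝ}
    (hs : 0 ≤ s) (ht : 0 ≤ t) : IntervalIntegrable f volume s t :=
  (hf.mono fun _ hx => (le_min hs ht).trans hx.1).intervalIntegrable

namespace HasWeakDeriv

variable {y F y₁ y₂ F₁ F₂ : ℝ → H}

theorem sub_eq (h : HasWeakDeriv y F) (g : H) {s t : ℝ} (hs : 0 ≤ s) (ht : 0 ≤ t) :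
    inner ℝ (y t) g - inner ℝ (y s) g = ∫ r in s..t, inner ℝ (F r) g := by
  rw [h.eq g t ht, h.eq g s hs]
  have := intervalIntegral.integral_add_adjacent_intervals
    (intervalIntegrable_of_continuousOn_Ici (h.cont g) le_rfl hs)
    (intervalIntegrable_of_continuousOn_Ici (h.cont g) hs ht)
  linarith

theorem hasDerivAt (h : HasWeakDeriv y F) (g : H) {r : ℝ} (hr : 0 < r) :
    HasDerivAt (fun t => inner ℝ (y t) g) (inner ℝ (F r) g) r := by
  -- Freezing the integrand at negative times gives a function continuous on all of `ℝ`, to which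
  -- the fundamental theorem of calculus applies.
  set φ : ℝ → ℝ := fun t => inner ℝ (F (max t 0)) g
  have hφ : Continuous φ :=
    (h.cont g).comp_continuous (continuous_id.max continuous_const) fun t => mem_Ici.2 (le_max_right _ _)
  have h1 : HasDerivAt (fun t => inner ℝ (y 0) g + ∫ r in (0 : ℝ)..t, φ r) (φ r) r :=
    (hφ.integral_hasStrictDerivAt 0 r).hasDerivAt.const_add _
  have h2 : φ r = inner ℝ (F r) g := by simp [φ, max_eq_left hr.le]
  rw [h2] at h1
  refine h1.congr_of_eventuallyEq ?_
  filter_upwards [Ioi_mem_nhds hr] with t ht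
  rw [h.eq g t (le_of_lt ht)]
  congr 1
  refine intervalIntegral.integral_congr fun x hx => ?_
  rw [uIcc_of_le (le_of_lt ht)] at hx
  simp [φ, max_eq_left hx.1]

/-- Testing the increment against itself gives `‖y t - y s‖² ≤ C ‖y t - y s‖ |t - s|`. A weak
derivative thus yields a norm Lipschitz bound. -/
theorem exists_lipschitz [CompleteSpace H] (h : HasWeakDeriv y F) (b : ℝ) :
    ∃ C, 0 ≤ C ∧ ∀ s t, 0 ≤ s → s ≤ b → 0 ≤ t → t ≤ b → ‖y t - y s‖ ≤ C * |t - s| := by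
  obtain ⟨C, hC0, hC⟩ := h.cont.exists_bound b
  refine ⟨C, hC0, fun s t hs hsb ht htb => ?_⟩
  have h1 : inner ℝ (y t - y s) (y t - y s) = ∫ r in s..t, inner ℝ (F r) (y t - y s) := by
    rw [inner_sub_left, h.sub_eq _ hs ht]
  have h2 : ‖∫ r in s..t, inner ℝ (F r) (y t - y s)‖ ≤ (C * ‖y t - y s‖) * |t - s| := by
    refine intervalIntegral.norm_integral_le_of_norm_le_const fun r hr => ?_
    have hr' : 0 ≤ r ∧ r ≤ b := by
      rcases le_total s t with hst | hst
      · rw [uIoc_of_le hst] at hr; exact ⟨hs.trans hr.1.le, hr.2.trans htb⟩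
      · rw [uIoc_of_ge hst] at hr; exact ⟨ht.trans hr.1.le, hr.2.trans hsb⟩
    exact (norm_inner_le_norm _ _).trans
      (mul_le_mul_of_nonneg_right (hC r hr'.1 hr'.2) (norm_nonneg _))
  rw [← h1, real_inner_self_eq_norm_sq, Real.norm_of_nonneg (by positivity)] at h2
  by_cases h0 : ‖y t - y s‖ = 0
  · rw [h0]; positivity
  · have : 0 < ‖y t - y s‖ := lt_of_le_of_ne (norm_nonneg _) (Ne.symm h0)
    nlinarith

theorem continuousOn [CompleteSpace H] (h : HasWeakDeriv y F) : ContinuousOn y (Ici 0) := by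
  intro r hr
  obtain ⟨C, hC0, hC⟩ := h.exists_lipschitz (r + 1)
  have h3 : Tendsto (fun t => C * |t - r|) (𝓝[Ici 0] r) (𝓝 0) := by
    have : Continuous fun t => C * |t - r| := by fun_prop
    have := this.tendsto r
    simp only [sub_self, abs_zero, mul_zero] at this
    exact this.mono_left nhdsWithin_le_nhds
  refine tendsto_iff_norm_sub_tendsto_zero.2 (squeeze_zero' (.of_forall fun _ => norm_nonneg _) ?_ h3)
  have h4 : ∀ᶠ t in 𝓝[Ici 0] r, t ≤ r + 1 :=
    nhdsWithin_le_nhds (Iic_mem_nhds (by linarith))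
  filter_upwards [self_mem_nhdsWithin, h4] with t ht0 ht1
  exact hC r t hr (by linarith) ht0 ht1

/-- The product rule survives although the derivatives are only weak: once one factor at a time is
frozen at `r`, the remaining term is the product of the two increments, which is quadratic in `t -
r` by the Lipschitz bounds. -/
theorem hasDerivAt_inner [CompleteSpace H] (h₁ : HasWeakDeriv y₁ F₁) (h₂ : HasWeakDeriv y₂ F₂)
    {r : ℝ} (hr : 0 < r) :
    HasDerivAt (fun t => inner ℝ (y₁ t) (y₂ t))
      (inner ℝ (F₁ r) (y₂ r) + inner ℝ (F₂ r) (y₁ r)) r := by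
  obtain ⟨C₁, hC₁0, hC₁⟩ := h₁.exists_lipschitz (r + 1)
  obtain ⟨C₂, hC₂0, hC₂⟩ := h₂.exists_lipschitz (r + 1)
  have hmid : HasDerivAt (fun t => inner ℝ (y₁ t - y₁ r) (y₂ t - y₂ r)) 0 r := by
    have hO : (fun t => inner ℝ (y₁ t - y₁ r) (y₂ t - y₂ r)) =O[𝓝 r]
        fun t => ‖t - r‖ ^ 2 := by
      refine Asymptotics.IsBigO.of_bound (C₁ * C₂) ?_
      filter_upwards [Ioo_mem_nhds hr (lt_add_one r)] with t ht
      refine (norm_inner_le_norm _ _).trans ?_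
      have e1 := hC₁ r t hr.le (by linarith) ht.1.le ht.2.le
      have e2 := hC₂ r t hr.le (by linarith) ht.1.le ht.2.le
      calc _ ≤ (C₁ * |t - r|) * (C₂ * |t - r|) := by gcongr
        _ = _ := by rw [norm_pow, norm_norm, Real.norm_eq_abs]; ring
    exact (hO.hasFDerivAt (by norm_num)).hasDerivAt
  have := ((h₁.hasDerivAt (y₂ r) hr).add (h₂.hasDerivAt (y₁ r) hr)).add hmid
  have := this.sub_const (inner ℝ (y₁ r) (y₂ r))
  simp only [add_zero] at this
  refine this.congr_of_eventuallyEq (.of_forall fun t => ?_)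
  simp only [inner_sub_left, inner_sub_right, Pi.add_apply]
  rw [real_inner_comm (y₁ r) (y₂ t)]
  ring

theorem continuousOn_rate [CompleteSpace H] (h₁ : HasWeakDeriv y₁ F₁) (h₂ : HasWeakDeriv y₂ F₂) :
    ContinuousOn (fun r => inner ℝ (F₁ r) (y₂ r) + inner ℝ (F₂ r) (y₁ r)) (Ici 0) :=
  (h₁.cont.continuousOn_inner h₂.continuousOn).add (h₂.cont.continuousOn_inner h₁.continuousOn)

theorem inner_sub_inner [CompleteSpace H] (h₁ : HasWeakDeriv y₁ F₁) (h₂ : HasWeakDeriv y₂ F₂)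
    {s t : ℝ} (hs : 0 ≤ s) (hst : s ≤ t) :
    inner ℝ (y₁ t) (y₂ t) - inner ℝ (y₁ s) (y₂ s) =
      ∫ r in s..t, (inner ℝ (F₁ r) (y₂ r) + inner ℝ (F₂ r) (y₁ r)) := by
  symm
  refine intervalIntegral.integral_eq_sub_of_hasDerivAt_of_le
    (f := fun t => inner ℝ (y₁ t) (y₂ t)) hst ?_ ?_ ?_
  · have hc₁ : ContinuousOn y₁ (Ici 0) := h₁.continuousOn
    have hc₂ : ContinuousOn y₂ (Ici 0) := h₂.continuousOn
    exact (hc₁.inner (𝕜 := ℝ) hc₂).mono fun x hx => hs.trans hx.1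
  · exact fun r hr => h₁.hasDerivAt_inner h₂ (hs.trans_lt hr.1)
  · exact intervalIntegrable_of_continuousOn_Ici (h₁.continuousOn_rate h₂) hs (hs.trans hst)

theorem sub (h₁ : HasWeakDeriv y₁ F₁) (h₂ : HasWeakDeriv y₂ F₂) :
    HasWeakDeriv (fun t => y₁ t - y₂ t) (fun t => F₁ t - F₂ t) := by
  refine ⟨h₁.cont.sub h₂.cont, fun g t ht => ?_⟩
  simp only [inner_sub_left]
  rw [intervalIntegral.integral_sub (intervalIntegrable_of_continuousOn_Ici (h₁.cont g) le_rfl ht)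
    (intervalIntegrable_of_continuousOn_Ici (h₂.cont g) le_rfl ht), h₁.eq g t ht, h₂.eq g t ht]
  ring

end HasWeakDeriv

end Hilbert

/-! ### Fourier multipliers with bounded matrix symbols -/

/-- `ℂ³`. -/
abbrev V : Type := EuclideanSpace ℂ (Fin 3)

/-- Square integrable complex vector fields. -/
abbrev LC : Type := Lp V 2 (volume : Measure R3)

/-- Bounded measurable matrix-valued symbols. -/
structure IsSymb (τ : R3 → V →L[ℝ] V) : Prop where
  meas : StronglyMeasurable τ
  bdd : ∃ C, ∀ ξ, ‖τ ξ‖ ≤ C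

theorem IsSymb.aesm {τ : R3 → V →L[ℝ] V} (h : IsSymb τ) (f : LC) :
    AEStronglyMeasurable (fun ξ => τ ξ (f ξ)) volume :=
  (ContinuousLinearMap.id ℝ (V →L[ℝ] V)).aestronglyMeasurable_comp₂
    h.meas.aestronglyMeasurable (Lp.aestronglyMeasurable f)

theorem IsSymb.memLp {τ : R3 → V →L[ℝ] V} (h : IsSymb τ) (f : LC) :
    MemLp (fun ξ => τ ξ (f ξ)) 2 volume := by
  obtain ⟨C, hC⟩ := h.bdd
  refine (Lp.memLp f).of_le_mul (c := C) (h.aesm f) (.of_forall fun ξ => ?_)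
  exact (τ ξ).le_of_opNorm_le (hC ξ) _

theorem IsSymb.norm_toLp_le {τ : R3 → V →L[ℝ] V} (h : IsSymb τ) {C : ℝ} (hC : ∀ ξ, ‖τ ξ‖ ≤ C)
    (f : LC) : ‖(h.memLp f).toLp _‖ ≤ C * ‖f‖ := by
  refine Lp.norm_le_mul_norm_of_ae_le_mul ?_
  filter_upwards [(h.memLp f).coeFn_toLp] with ξ hξ
  rw [hξ]
  exact (τ ξ).le_of_opNorm_le (hC ξ) _

open Classical in
/-- Multiplication by a bounded matrix-valued symbol, as an operator on `L²`. -/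
def mul (τ : R3 → V →L[ℝ] V) : LC →L[ℝ] LC :=
  if h : IsSymb τ then
    LinearMap.mkContinuousOfExistsBound
      { toFun := fun f => (h.memLp f).toLp _
        map_add' := fun f g => by
          rw [← MemLp.toLp_add]
          refine MemLp.toLp_congr _ _ ?_
          filter_upwards [Lp.coeFn_add f g] with ξ hξ
          rw [hξ, Pi.add_apply, Pi.add_apply, map_add]
        map_smul' := fun a f => by
          rw [RingHom.id_apply, ← MemLp.toLp_const_smul]
          refine MemLp.toLp_congr _ _ ?_
          filter_upwards [Lp.coeFn_smul a f] with ξ hξ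
          rw [hξ, Pi.smul_apply, Pi.smul_apply, map_smul] }
      (by obtain ⟨C, hC⟩ := h.bdd; exact ⟨C, h.norm_toLp_le hC⟩)
  -- A convention for unbounded symbols, which keeps the operator total; the lemmas below assume
  -- `IsSymb`.
  else 0

section Mul

variable {σ τ σ' τ' : R3 → V →L[ℝ] V}

theorem mul_apply (h : IsSymb τ) (f : LC) : mul τ f = (h.memLp f).toLp _ := by
  rw [mul, dif_pos h]; rfl

theorem mul_coe (h : IsSymb τ) (f : LC) : mul τ f =ᵐ[volume] fun ξ => τ ξ (f ξ) := by
  rw [mul_apply h]; exact MemLp.coeFn_toLp _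

theorem inner_mul_mul (hσ : IsSymb σ) (hτ : IsSymb τ) (f g : LC) :
    inner ℝ (mul σ f) (mul τ g) = ∫ ξ, inner ℝ (σ ξ (f ξ)) (τ ξ (g ξ)) := by
  rw [L2.inner_def]
  refine integral_congr_ae ?_
  filter_upwards [mul_coe hσ f, mul_coe hτ g] with ξ h1 h2
  rw [h1, h2]

theorem integrable_inner_mul_mul (hσ : IsSymb σ) (hτ : IsSymb τ) (f g : LC) :
    Integrable (fun ξ => inner ℝ (σ ξ (f ξ)) (τ ξ (g ξ))) := by
  refine (L2.integrable_inner (𝕜 := ℝ) (mul σ f) (mul τ g)).congr ?_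
  filter_upwards [mul_coe hσ f, mul_coe hτ g] with ξ h1 h2
  rw [h1, h2]

end Mul

/-- Bounded measurable sets of frequencies. -/
structure IsCut (S : Set R3) : Prop where
  meas : MeasurableSet S
  bdd : Bornology.IsBounded S

theorem IsCut.closedBall (R : ℝ) : IsCut (Metric.closedBall (0 : R3) R) :=
  ⟨measurableSet_closedBall, Metric.isBounded_closedBall⟩

theorem IsCut.inter {S A : Set R3} (hS : IsCut S) (hA : MeasurableSet A) : IsCut (S ∩ A) :=
  ⟨hS.meas.inter hA, hS.bdd.subset inter_subset_left⟩

theorem IsCut.isSymb {S : Set R3} (hS : IsCut S) {σ : R3 → V →L[ℝ] V} (hσ : Continuous σ) :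
    IsSymb (S.indicator σ) := by
  refine ⟨hσ.stronglyMeasurable.indicator hS.meas, ?_⟩
  obtain ⟨C, hC⟩ := hS.bdd.isCompact_closure.exists_bound_of_continuousOn hσ.continuousOn
  refine ⟨max C 0, fun ξ => ?_⟩
  by_cases h : ξ ∈ S
  · rw [indicator_of_mem h]; exact (hC ξ (subset_closure h)).trans (le_max_left _ _)
  · rw [indicator_of_notMem h, norm_zero]; exact le_max_right _ _

/-- The truncated multiplier `1_S σ`. -/
def dop (S : Set R3) (σ : R3 → V →L[ℝ] V) : LC →L[ℝ] LC := mul (S.indicator σ)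

/-- The spectral projection onto the frequencies in `S`. -/
def proj (S : Set R3) : LC →L[ℝ] LC := dop S (fun _ => ContinuousLinearMap.id ℝ V)

section Dop

variable {S : Set R3} {σ τ σ' τ' : R3 → V →L[ℝ] V}

theorem dop_coe (hS : IsCut S) (hσ : Continuous σ) (f : LC) :
    dop S σ f =ᵐ[volume] S.indicator fun ξ => σ ξ (f ξ) := by
  filter_upwards [mul_coe (hS.isSymb hσ) f] with ξ hξ
  rw [dop, hξ]
  by_cases h : ξ ∈ S <;> simp [h]

theorem proj_coe (hS : IsCut S) (f : LC) : proj S f =ᵐ[volume] S.indicator f :=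
  dop_coe hS continuous_const f

theorem integrableOn_inner_dop (hS : IsCut S) (hσ : Continuous σ) (hτ : Continuous τ) (f g : LC) :
    IntegrableOn (fun ξ => inner ℝ (σ ξ (f ξ)) (τ ξ (g ξ))) S := by
  refine (integrable_inner_mul_mul (hS.isSymb hσ) (hS.isSymb hτ) f g).integrableOn.congr_fun ?_
    hS.meas
  intro ξ h
  simp [h]

theorem inner_dop_dop (hS : IsCut S) (hσ : Continuous σ) (hτ : Continuous τ) (f g : LC) :
    inner ℝ (dop S σ f) (dop S τ g) = ∫ ξ in S, inner ℝ (σ ξ (f ξ)) (τ ξ (g ξ)) := by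
  rw [dop, dop, inner_mul_mul (hS.isSymb hσ) (hS.isSymb hτ), ← integral_indicator hS.meas]
  refine integral_congr_ae (.of_forall fun ξ => ?_)
  by_cases h : ξ ∈ S <;> simp [h]

theorem inner_dop_right (hS : IsCut S) (hτ : Continuous τ) (f g : LC) :
    inner ℝ f (dop S τ g) = ∫ ξ in S, inner ℝ (f ξ) (τ ξ (g ξ)) := by
  rw [L2.inner_def, ← integral_indicator hS.meas]
  refine integral_congr_ae ?_
  filter_upwards [dop_coe hS hτ g] with ξ h1
  rw [h1]
  by_cases h : ξ ∈ S <;> simp [h]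

theorem inner_dop_proj (hS : IsCut S) (hτ : Continuous τ) (f g : LC) :
    inner ℝ (proj S f) (dop S τ g) = inner ℝ f (dop S τ g) := by
  rw [proj, inner_dop_dop hS continuous_const hτ, inner_dop_right hS hτ]; rfl

theorem inner_proj_right (hS : IsCut S) (f g : LC) :
    inner ℝ f (proj S g) = inner ℝ (proj S f) (proj S g) :=
  (inner_dop_proj hS continuous_const f g).symm

theorem dop_proj_subset {S' : Set R3} (hS : IsCut S) (hS' : IsCut S') (h : S ⊆ S')
    (hσ : Continuous σ) (f : LC) : dop S σ (proj S' f) = dop S σ f := by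
  refine Lp.ext ?_
  filter_upwards [dop_coe hS hσ (proj S' f), dop_coe hS hσ f, proj_coe hS' f] with ξ h1 h2 h3
  rw [h1, h2]
  by_cases hξ : ξ ∈ S
  · simp [hξ, h3, h hξ]
  · simp [hξ]

theorem dop_proj (hS : IsCut S) (hσ : Continuous σ) (f : LC) : dop S σ (proj S f) = dop S σ f :=
  dop_proj_subset hS hS subset_rfl hσ f

theorem proj_proj_subset {S' : Set R3} (hS : IsCut S) (hS' : IsCut S') (h : S ⊆ S') (f : LC) :
    proj S (proj S' f) = proj S f :=
  dop_proj_subset hS hS' h continuous_const f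

theorem norm_dop_sq (hS : IsCut S) (hσ : Continuous σ) (f : LC) :
    ‖dop S σ f‖ ^ 2 = ∫ ξ in S, ‖σ ξ (f ξ)‖ ^ 2 := by
  rw [← real_inner_self_eq_norm_sq, inner_dop_dop hS hσ hσ]
  simp_rw [real_inner_self_eq_norm_sq]

theorem integrableOn_norm_dop_sq (hS : IsCut S) (hσ : Continuous σ) (f : LC) :
    IntegrableOn (fun ξ => ‖σ ξ (f ξ)‖ ^ 2) S := by
  simpa only [real_inner_self_eq_norm_sq] using integrableOn_inner_dop hS hσ hσ f f

theorem norm_proj_sq (hS : IsCut S) (f : LC) : ‖proj S f‖ ^ 2 = ∫ ξ in S, ‖f ξ‖ ^ 2 :=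
  norm_dop_sq hS continuous_const f

theorem norm_proj_le (hS : IsCut S) (f : LC) : ‖proj S f‖ ≤ ‖f‖ := by
  refine Lp.norm_le_norm_of_ae_le ?_
  filter_upwards [proj_coe hS f] with ξ hξ
  rw [hξ]
  exact norm_indicator_le_norm_self _ _

theorem norm_proj_le_of_subset {S' : Set R3} (hS : IsCut S) (hS' : IsCut S') (h : S ⊆ S') (f : LC) :
    ‖proj S f‖ ≤ ‖proj S' f‖ := by
  rw [← proj_proj_subset hS hS' h]; exact norm_proj_le hS _

theorem inner_proj_sub (hS : IsCut S) (f g : LC) : inner ℝ (f - proj S f) (proj S g) = 0 := by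
  rw [inner_sub_left, inner_proj_right hS, sub_self]

theorem norm_sub_proj_sq (hS : IsCut S) (f : LC) : ‖f - proj S f‖ ^ 2 = ‖f‖ ^ 2 - ‖proj S f‖ ^ 2 := by
  have := norm_add_sq_real (f - proj S f) (proj S f)
  rw [sub_add_cancel, inner_proj_sub hS] at this
  linarith

end Dop

end

section

/-! ### The Fourier transform of real fields -/

theorem norm_complexify (v : R3) : ‖complexify v‖ = ‖v‖ := by
  rw [EuclideanSpace.norm_eq, EuclideanSpace.norm_eq]
  simp [complexify]

theorem norm_compLp_complexify (f : L2) : ‖complexify.compLp f‖ = ‖f‖ := by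
  refine le_antisymm ?_ ?_
  · refine Lp.norm_le_norm_of_ae_le ?_
    filter_upwards [complexify.coeFn_compLp f] with x hx
    rw [hx, norm_complexify]
  · refine Lp.norm_le_norm_of_ae_le ?_
    filter_upwards [complexify.coeFn_compLp f] with x hx
    rw [hx, norm_complexify]

/-- The inclusion of real fields into complex fields. -/
def cpx : L2 →ₗᵢ[ℝ] LC where
  toLinearMap := (complexify.compLpL 2 (volume : Measure R3)).toLinearMap
  norm_map' := norm_compLp_complexify

theorem cpx_coe (f : L2) : cpx f =ᵐ[volume] fun x => complexify (f x) :=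
  complexify.coeFn_compLp f

/-- The Fourier transform of complex fields, as a real linear isometry. -/
def FC : LC ≃ₗᵢ[ℝ] LC where
  toFun := (Lp.fourierTransformₗᵢ R3 V)
  invFun := (Lp.fourierTransformₗᵢ R3 V).symm
  left_inv := (Lp.fourierTransformₗᵢ R3 V).left_inv
  right_inv := (Lp.fourierTransformₗᵢ R3 V).right_inv
  map_add' := (Lp.fourierTransformₗᵢ R3 V).map_add
  map_smul' a f := by
    have h2 : ∀ g : LC, a • g = (a : ℂ) • g := fun g => by
      refine Lp.ext ?_
      filter_upwards [Lp.coeFn_smul a g, Lp.coeFn_smul (a : ℂ) g] with x h1 h2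
      rw [h1, h2]
      ext i
      simp
    rw [h2, RingHom.id_apply, h2]
    exact (Lp.fourierTransformₗᵢ R3 V).map_smul _ f
  norm_map' := (Lp.fourierTransformₗᵢ R3 V).norm_map

theorem FC_apply (f : LC) : FC f = 𝓕 f := rfl

/-- The Fourier transform of real fields, as a real linear isometry. -/
def Ftr : L2 →ₗᵢ[ℝ] LC := FC.toLinearIsometry.comp cpx

theorem inner_Ftr (f g : L2) : inner ℝ (Ftr f) (Ftr g) = inner ℝ f g := Ftr.inner_map_map f g

theorem inner_I_smul_cpx (f g : L2) : inner ℝ (cpx f) (Complex.I • cpx g) = 0 := by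
  rw [L2.inner_def]
  refine integral_eq_zero_of_ae ?_
  filter_upwards [cpx_coe f, cpx_coe g, Lp.coeFn_smul Complex.I (cpx g)] with x h1 h2 h3
  rw [h3, Pi.smul_apply, h1, h2]
  simp [PiLp.inner_apply, complexify]

theorem FC_I_smul (f : LC) : FC (Complex.I • f) = Complex.I • FC f :=
  (Lp.fourierTransformₗᵢ R3 V).map_smul _ f

/-- This encodes, on the Fourier side, that the fields are real. Weak formulations provide pairings
with real test fields only; the orthogonality supplies the pairings with `i` times their transforms.
-/
theorem inner_I_smul_Ftr (f g : L2) : inner ℝ (Ftr f) (Complex.I • Ftr g) = 0 := by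
  change inner ℝ (FC (cpx f)) (Complex.I • FC (cpx g)) = 0
  rw [← FC_I_smul, FC.inner_map_map, inner_I_smul_cpx]

theorem IsTest.cpx {φ : R3 → R3} (h : IsTest φ) : IsTest (fun x => complexify (φ x)) :=
  ⟨complexify.contDiff.comp h.1, h.2.comp_left (g := complexify) (by simp)⟩

/-- A complex test field as a Schwartz function. -/
def IsTest.toS {Φ : R3 → V} (h : IsTest Φ) : SchwartzMap R3 V := h.2.toSchwartzMap h.1

theorem IsTest.toS_apply {Φ : R3 → V} (h : IsTest Φ) (x : R3) : h.toS x = Φ x := rfl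

theorem Ftr_toL2 {φ : R3 → R3} (h : IsTest φ) :
    Ftr h.toL2 =ᵐ[volume] 𝓕 (fun x => complexify (φ x)) := by
  have h1 : Micropolar.cpx h.toL2 = h.cpx.toS.toLp 2 (volume : Measure R3) := by
    refine Lp.ext ?_
    filter_upwards [cpx_coe h.toL2, h.memLp.coeFn_toLp,
      SchwartzMap.coeFn_toLp h.cpx.toS 2 (volume : Measure R3)] with x h1 h2 h3
    rw [h1, h3, IsTest.toS_apply, IsTest.toL2, h2]
  have h2 : Ftr h.toL2 = (𝓕 h.cpx.toS).toLp 2 := by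
    rw [← SchwartzMap.toLp_fourier_eq, ← h1]; rfl
  rw [h2]
  exact SchwartzMap.coeFn_toLp (𝓕 h.cpx.toS) 2 (volume : Measure R3)

/-! ### Density of test fields -/

/-- The derivatives of `χ(a x) - 1` vanish for `‖a x‖ < 1`, and elsewhere the factor `a ‖x‖` is at
least one. A power of `‖x‖` is thereby exchanged for the small factor `a`. -/
theorem exists_cutoff_bound (χ : ContDiffBump (0 : R3)) (h1 : χ.rIn = 1) (i : ℕ) :
    ∃ C, ∀ a : ℝ, 0 < a → a ≤ 1 → ∀ x : R3,
      ‖iteratedFDeriv ℝ i (fun x => χ (a • x) - 1) x‖ ≤ C * (a * ‖x‖) := by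
  set ψ : R3 → ℝ := fun x => χ x - 1 with hψ
  have hψs : ContDiff ℝ ∞ ψ := χ.contDiff.sub contDiff_const
  obtain ⟨C, hC⟩ : ∃ C, ∀ x, ‖iteratedFDeriv ℝ i ψ x‖ ≤ C := by
    obtain ⟨C, hC⟩ := (χ.hasCompactSupport.iteratedFDeriv (𝕜 := ℝ) i).exists_bound_of_continuous
      (χ.contDiff (n := ⊤) |>.continuous_iteratedFDeriv (m := i) (by exact_mod_cast le_top))
    refine ⟨C + 1, fun x => ?_⟩
    have e : iteratedFDeriv ℝ i ψ x
        = iteratedFDeriv ℝ i χ x - iteratedFDeriv ℝ i (fun _ : R3 => (1 : ℝ)) x := by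
      have := iteratedFDeriv_sub_apply (𝕜 := ℝ) (i := i) (x := x) (f := χ) (g := fun _ : R3 => (1 : ℝ))
        (χ.contDiff.contDiffAt) contDiff_const.contDiffAt
      exact this
    rw [e]
    refine (norm_sub_le _ _).trans (add_le_add (hC x) ?_)
    rcases Nat.eq_zero_or_pos i with rfl | hi
    · simp
    · rw [iteratedFDeriv_const_of_ne hi.ne']; simp
  have hz : ∀ y : R3, ‖y‖ < 1 → iteratedFDeriv ℝ i ψ y = 0 := by
    intro y hy
    have : ψ =ᶠ[𝓝 y] fun _ => 0 := by
      have : Metric.ball (0 : R3) 1 ∈ 𝓝 y :=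
        Metric.isOpen_ball.mem_nhds (by simpa using hy)
      filter_upwards [this] with z hz
      have : χ z = 1 := χ.one_of_mem_closedBall (by rw [h1]; exact Metric.ball_subset_closedBall hz)
      simp [hψ, this]
    rw [this.iteratedFDeriv ℝ i |>.self_of_nhds]
    simp
  have hC0 : 0 ≤ C := (norm_nonneg _).trans (hC 0)
  refine ⟨C, fun a ha ha1 x => ?_⟩
  have := congrFun (iteratedFDeriv_comp_const_smul (i := i) a (hψs.of_le (by exact_mod_cast le_top))) x
  have h2 : (fun x => χ (a • x) - 1) = fun z => ψ (a • z) := rfl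
  rw [h2, this, norm_smul]
  have hn : ‖a • x‖ = a * ‖x‖ := by rw [norm_smul, Real.norm_of_nonneg ha.le]
  have hp : ‖a ^ i‖ ≤ 1 := by
    rw [norm_pow, Real.norm_of_nonneg ha.le]; exact pow_le_one₀ ha.le ha1
  by_cases hx : ‖a • x‖ < 1
  · rw [hz _ hx, norm_zero, mul_zero]; positivity
  · rw [not_lt, hn] at hx
    calc _ ≤ 1 * C := mul_le_mul hp (hC _) (norm_nonneg _) zero_le_one
      _ ≤ C * (a * ‖x‖) := by nlinarith

/-- By the Leibniz rule and the cutoff bound, each Schwartz seminorm of the error made by cutting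
off at scale `n + 1` is at most `1/(n+1)` times a constant involving seminorms with one more power
of `‖x‖`. -/
theorem dense_compactSupport : Dense {f : SchwartzMap R3 V | HasCompactSupport f} := by
  intro f
  let χ : ContDiffBump (0 : R3) := ⟨1, 2, one_pos, one_lt_two⟩
  choose C hC using exists_cutoff_bound χ rfl
  have hcs : ∀ n : ℕ, HasCompactSupport (fun x : R3 => χ (((n : ℝ) + 1)⁻¹ • x) • f x) := fun n => by
    have h0 : ((n : ℝ) + 1)⁻¹ ≠ 0 := by positivity
    have := χ.hasCompactSupport.comp_homeomorph (Homeomorph.smulOfNeZero _ h0)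
    exact this.smul_right
  have hsm : ∀ n : ℕ, ContDiff ℝ ∞ (fun x : R3 => χ (((n : ℝ) + 1)⁻¹ • x)) := fun n =>
    χ.contDiff.comp (contDiff_const_smul _)
  let g : ℕ → SchwartzMap R3 V := fun n =>
    (hcs n).toSchwartzMap ((hsm n).smul (f.smooth ⊤))
  have hg : ∀ n x, g n x = χ (((n : ℝ) + 1)⁻¹ • x) • f x := fun _ _ => rfl
  refine mem_closure_of_tendsto (b := atTop) (f := g) ?_ (.of_forall fun n => hcs n)
  rw [(schwartz_withSeminorms ℝ R3 V).tendsto_nhds]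
  rintro ⟨k, m⟩ ε hε
  set M : ℝ := ∑ i ∈ Finset.range (m + 1), (m.choose i : ℝ) * |C i| *
    SchwartzMap.seminorm ℝ (k + 1) (m - i) f
  have hM : 0 ≤ M := Finset.sum_nonneg fun i _ => by positivity
  have key : ∀ n : ℕ, SchwartzMap.seminorm ℝ k m (g n - f) ≤ ((n : ℝ) + 1)⁻¹ * M := by
    intro n
    set a := ((n : ℝ) + 1)⁻¹
    have ha : 0 < a := by positivity
    have ha1 : a ≤ 1 := inv_le_one_of_one_le₀ (by linarith [n.cast_nonneg (α := ℝ)])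
    refine SchwartzMap.seminorm_le_bound ℝ k m _ (by positivity) fun x => ?_
    have e : (⇑(g n - f) : R3 → V) = fun y => (χ (a • y) - 1) • f y := by
      ext1 y
      rw [sub_apply, hg, sub_smul, one_smul]
    rw [e]
    have hb := norm_iteratedFDeriv_smul_le (𝕜 := ℝ) (N := ∞) (n := m)
      ((hsm n).sub (contDiff_const (c := (1 : ℝ)))) (f.smooth ⊤) x (by exact_mod_cast le_top)
    calc ‖x‖ ^ k * _ ≤ ‖x‖ ^ k * ∑ i ∈ Finset.range (m + 1), (m.choose i : ℝ) *
          ‖iteratedFDeriv ℝ i (fun y => χ (a • y) - 1) x‖ * ‖iteratedFDeriv ℝ (m - i) f x‖ :=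
          mul_le_mul_of_nonneg_left hb (by positivity)
      _ ≤ a * M := by
          rw [Finset.mul_sum, Finset.mul_sum]
          refine Finset.sum_le_sum fun i _ => ?_
          have h1 := hC i a ha ha1 x
          have h2 := SchwartzMap.le_seminorm ℝ (k + 1) (m - i) f x
          have h3 : C i * (a * ‖x‖) ≤ |C i| * (a * ‖x‖) :=
            mul_le_mul_of_nonneg_right (le_abs_self _) (by positivity)
          calc _ ≤ ‖x‖ ^ k * ((m.choose i : ℝ) * (|C i| * (a * ‖x‖)) *
                ‖iteratedFDeriv ℝ (m - i) f x‖) := by gcongr; exact h1.trans h3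
            _ = a * ((m.choose i : ℝ) * |C i| *
                (‖x‖ ^ (k + 1) * ‖iteratedFDeriv ℝ (m - i) f x‖)) := by ring
            _ ≤ _ := by gcongr
  have hlim : Tendsto (fun n : ℕ => ((n : ℝ) + 1)⁻¹ * M) atTop (𝓝 0) := by
    have := (tendsto_one_div_add_atTop_nhds_zero_nat (𝕜 := ℝ)).mul_const M
    simpa using this
  filter_upwards [hlim.eventually (gt_mem_nhds hε)] with n hn
  exact (key n).trans_lt hn

/-- The weight `1 + |ξ|²`. -/
def wt (ξ : R3) : ℝ := 1 + ‖ξ‖ ^ 2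

theorem wt_pos (ξ : R3) : 0 < wt ξ := by unfold wt; positivity

theorem wt_growth (r : ℝ) : Function.HasTemperateGrowth (fun ξ => wt ξ ^ r) :=
  Function.hasTemperateGrowth_one_add_norm_sq_rpow R3 r

/-- `(1+|ξ|²) 𝓕 f` for Schwartz `f`, as an element of `L²`. -/
def weighted (f : SchwartzMap R3 V) : LC :=
  (SchwartzMap.smulLeftCLM V (fun ξ => wt ξ ^ (1 : ℝ)) (𝓕 f)).toLp 2

theorem weighted_coe (f : SchwartzMap R3 V) :
    weighted f =ᵐ[volume] fun ξ => wt ξ • 𝓕 (f : R3 → V) ξ := by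
  filter_upwards [SchwartzMap.coeFn_toLp
    (SchwartzMap.smulLeftCLM V (fun ξ => wt ξ ^ (1 : ℝ)) (𝓕 f)) 2 volume] with ξ h
  rw [weighted, h, SchwartzMap.smulLeftCLM_apply_apply (wt_growth 1), Real.rpow_one]
  rfl

theorem continuous_weighted : Continuous weighted := by
  unfold weighted
  exact SchwartzMap.continuous_toLp.comp
    ((SchwartzMap.smulLeftCLM V _).continuous.comp (FourierTransform.continuous_fourier))

/-- The weight acts bijectively on Schwartz functions, since its inverse is also of temperate
growth, and Schwartz functions are dense in `L²`. -/
theorem denseRange_weighted : DenseRange weighted := by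
  have h1 : Function.Surjective fun f : SchwartzMap R3 V =>
      SchwartzMap.smulLeftCLM V (fun ξ => wt ξ ^ (1 : ℝ)) (𝓕 f) := by
    intro g
    refine ⟨𝓕⁻ (SchwartzMap.smulLeftCLM V (fun ξ => wt ξ ^ (-1 : ℝ)) g), ?_⟩
    ext1 ξ
    simp only [FourierTransform.fourier_fourierInv_eq]
    rw [SchwartzMap.smulLeftCLM_apply_apply (wt_growth 1),
      SchwartzMap.smulLeftCLM_apply_apply (wt_growth (-1)), smul_smul, ← Real.rpow_add (wt_pos ξ)]
    simp
  have h2 : DenseRange (SchwartzMap.toLpCLM ℝ V 2 (volume : Measure R3)) :=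
    SchwartzMap.denseRange_toLpCLM ENNReal.ofNat_ne_top
  exact h2.comp h1.denseRange (SchwartzMap.toLpCLM ℝ V 2 (volume : Measure R3)).continuous

theorem IsTest.re {Φ : R3 → V} (h : IsTest Φ) :
    IsTest (fun x => (WithLp.toLp 2 fun i => (Φ x i).re : R3)) := by
  refine ⟨?_, h.2.comp_left (g := fun v : V => (WithLp.toLp 2 fun i => (v i).re : R3)) (by ext; simp)⟩
  rw [contDiff_euclidean]
  intro i
  exact (Complex.reCLM.comp ((EuclideanSpace.proj i : V →L[ℂ] ℂ).restrictScalars ℝ)).contDiff.comp h.1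

theorem IsTest.im {Φ : R3 → V} (h : IsTest Φ) :
    IsTest (fun x => (WithLp.toLp 2 fun i => (Φ x i).im : R3)) := by
  refine ⟨?_, h.2.comp_left (g := fun v : V => (WithLp.toLp 2 fun i => (v i).im : R3)) (by ext; simp)⟩
  rw [contDiff_euclidean]
  intro i
  exact (Complex.imCLM.comp ((EuclideanSpace.proj i : V →L[ℂ] ℂ).restrictScalars ℝ)).contDiff.comp h.1

/-- A continuous functional vanishing on the fields `(1+|ξ|²) φ̂` and `i(1+|ξ|²) φ̂`, with `φ` a real
test field, vanishes. -/
theorem eq_zero_of_tests (L : LC →L[ℝ] ℝ)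
    (h : ∀ (φ : R3 → R3) (hφ : IsTest φ),
      L (weighted hφ.cpx.toS) = 0 ∧ L (Complex.I • weighted hφ.cpx.toS) = 0) : L = 0 := by
  have hd : Dense (weighted '' {f : SchwartzMap R3 V | HasCompactSupport f}) :=
    denseRange_weighted.dense_image continuous_weighted dense_compactSupport
  have : (L : LC → ℝ) = fun _ => 0 := by
    refine Continuous.ext_on hd L.continuous continuous_const ?_
    rintro _ ⟨f, hf, rfl⟩
    have ht : IsTest (f : R3 → V) := ⟨f.smooth ⊤, hf⟩
    have e : weighted f = weighted ht.re.cpx.toS + Complex.I • weighted ht.im.cpx.toS := by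
      have e1 : f = ht.re.cpx.toS + Complex.I • ht.im.cpx.toS := by
        ext x i
        simp [IsTest.toS_apply, complexify, mul_comm Complex.I]
      have e2 : 𝓕 f = 𝓕 ht.re.cpx.toS + Complex.I • 𝓕 ht.im.cpx.toS := by
        conv_lhs => rw [e1]
        rw [FourierTransform.fourier_add, FourierTransform.fourier_smul]
      refine Lp.ext ?_
      filter_upwards [weighted_coe f, weighted_coe ht.re.cpx.toS, weighted_coe ht.im.cpx.toS,
        Lp.coeFn_add (weighted ht.re.cpx.toS) (Complex.I • weighted ht.im.cpx.toS),
        Lp.coeFn_smul Complex.I (weighted ht.im.cpx.toS)] with ξ h1 h2 h3 h4 h5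
      have e3 : 𝓕 (f : R3 → V) ξ = 𝓕 (ht.re.cpx.toS : R3 → V) ξ
          + Complex.I • 𝓕 (ht.im.cpx.toS : R3 → V) ξ := congrArg (fun g : SchwartzMap R3 V => g ξ) e2
      rw [h4, Pi.add_apply, h5, Pi.smul_apply, h1, h2, h3, e3, smul_add, smul_comm]
    rw [e, map_add, (h _ ht.re).1, (h _ ht.im).2, add_zero]
  ext f
  exact congrFun this f

end

section

/-! ### Constant coefficient differential operators and their symbols -/

/-- `D` is a differential operator of order at most `k` on test fields, with symbol `σ`. -/
structure IsOp (k : ℕ) (D : (R3 → R3) → R3 → R3) (σ : R3 → V →L[ℝ] V) : Prop where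
  test : ∀ {φ}, IsTest φ → IsTest (D φ)
  fourier : ∀ {φ}, IsTest φ → ∀ ξ,
    𝓕 (fun x => complexify (D φ x)) ξ = σ ξ (𝓕 (fun x => complexify (φ x)) ξ)
  cont : Continuous σ
  growth : ∃ C, ∀ ξ, ‖σ ξ‖ ≤ C * (1 + ‖ξ‖) ^ k
  map_I : ∀ ξ v, σ ξ (Complex.I • v) = Complex.I • σ ξ v

theorem IsTest.integrable_cpx {φ : R3 → R3} (h : IsTest φ) :
    Integrable (fun x => complexify (φ x)) (volume : Measure R3) :=
  h.cpx.1.continuous.integrable_of_hasCompactSupport h.cpx.2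

theorem IsTest.add {F : Type} [NormedAddCommGroup F] [NormedSpace ℝ F] {φ ψ : R3 → F}
    (h : IsTest φ) (h' : IsTest ψ) : IsTest (fun x => φ x + ψ x) :=
  ⟨h.1.add h'.1, h.2.add h'.2⟩

theorem IsTest.neg {F : Type} [NormedAddCommGroup F] [NormedSpace ℝ F] {φ : R3 → F}
    (h : IsTest φ) : IsTest (fun x => - φ x) :=
  ⟨h.1.neg, h.2.neg⟩

namespace IsOp

variable {k l : ℕ} {D E : (R3 → R3) → R3 → R3} {σ τ : R3 → V →L[ℝ] V}

theorem growth_nonneg (h : IsOp k D σ) : ∃ C, 0 ≤ C ∧ ∀ ξ, ‖σ ξ‖ ≤ C * (1 + ‖ξ‖) ^ k := by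
  obtain ⟨C, hC⟩ := h.growth
  refine ⟨|C|, abs_nonneg _, fun ξ => (hC ξ).trans ?_⟩
  gcongr
  exact le_abs_self C

theorem id : IsOp 0 (fun φ => φ) (fun _ => ContinuousLinearMap.id ℝ V) where
  test h := h
  fourier _ _ := rfl
  cont := continuous_const
  growth := ⟨1, fun ξ => by simp⟩
  map_I _ _ := rfl

theorem add (h : IsOp k D σ) (h' : IsOp k E τ) :
    IsOp k (fun φ x => D φ x + E φ x) (fun ξ => σ ξ + τ ξ) where
  test hφ := (h.test hφ).add (h'.test hφ)
  fourier {φ} hφ ξ := by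
    have := congrArg (fun g : SchwartzMap R3 V => g ξ)
      (FourierTransform.fourier_add (h.test hφ).cpx.toS (h'.test hφ).cpx.toS)
    rw [add_apply, ← h.fourier hφ, ← h'.fourier hφ]
    simp only [map_add]
    exact this
  cont := h.cont.add h'.cont
  growth := by
    obtain ⟨C, hC⟩ := h.growth
    obtain ⟨C', hC'⟩ := h'.growth
    exact ⟨C + C', fun ξ => (norm_add_le _ _).trans (by linarith [hC ξ, hC' ξ])⟩
  map_I ξ v := by simp [h.map_I, h'.map_I]

theorem neg (h : IsOp k D σ) : IsOp k (fun φ x => - D φ x) (fun ξ => - σ ξ) where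
  test hφ := (h.test hφ).neg
  fourier {φ} hφ ξ := by
    rw [neg_apply, ← h.fourier hφ]
    simp only [map_neg]
    rw [Real.fourier_eq, Real.fourier_eq, ← integral_neg]
    simp
  cont := h.cont.neg
  growth := by simpa using h.growth
  map_I ξ v := by simp [h.map_I]

theorem comp (h : IsOp k D σ) (h' : IsOp l E τ) :
    IsOp (k + l) (fun φ => D (E φ)) (fun ξ => (σ ξ).comp (τ ξ)) where
  test hφ := h.test (h'.test hφ)
  fourier {φ} hφ ξ := by
    rw [h.fourier (h'.test hφ), h'.fourier hφ]; rfl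
  cont := h.cont.clm_comp h'.cont
  growth := by
    obtain ⟨C, hC0, hC⟩ := h.growth_nonneg
    obtain ⟨C', hC0', hC'⟩ := h'.growth_nonneg
    refine ⟨C * C', fun ξ => ((σ ξ).opNorm_comp_le (τ ξ)).trans ?_⟩
    calc _ ≤ (C * (1 + ‖ξ‖) ^ k) * (C' * (1 + ‖ξ‖) ^ l) := by gcongr; exacts [hC ξ, hC' ξ]
      _ = _ := by ring
  map_I ξ v := by simp [h.map_I, h'.map_I]

theorem congr (h : IsOp k D σ) (hD : ∀ φ, IsTest φ → ∀ x, D φ x = E φ x) : IsOp k E σ where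
  test {φ} hφ := by rw [← (funext (hD φ hφ) : D φ = E φ)]; exact h.test hφ
  fourier {φ} hφ := by rw [← (funext (hD φ hφ) : D φ = E φ)]; exact h.fourier hφ
  cont := h.cont
  growth := h.growth
  map_I := h.map_I

end IsOp

/-- The symbol `2πiξⱼ` of `∂ⱼ`. -/
def sD (j : Fin 3) (ξ : R3) : V →L[ℝ] V :=
  (ξ j) • ((2 * Real.pi * Complex.I : ℂ) • ContinuousLinearMap.id ℂ V).restrictScalars ℝ

/-- The elementary matrix sending `v` to `v k e_i`, on `ℂ³`. -/
def elC (i k : Fin 3) : V →L[ℝ] V :=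
  ((EuclideanSpace.proj k : V →L[ℂ] ℂ).smulRight (EuclideanSpace.single i (1 : ℂ))).restrictScalars ℝ

/-- The elementary matrix sending `v` to `v k e_i`, on `ℝ³`. -/
def elR (i k : Fin 3) : R3 →L[ℝ] R3 :=
  (EuclideanSpace.proj k : R3 →L[ℝ] ℝ).smulRight (EuclideanSpace.single i (1 : ℝ))

theorem sD_apply (j : Fin 3) (ξ : R3) (v : V) (i : Fin 3) :
    sD j ξ v i = (2 * Real.pi * ξ j : ℝ) * (Complex.I * v i) := by
  simp [sD]; ring

theorem elC_apply (i k : Fin 3) (v : V) (l : Fin 3) : elC i k v l = if l = i then v k else 0 := by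
  simp [elC]

theorem elR_apply (i k : Fin 3) (v : R3) (l : Fin 3) : elR i k v l = if l = i then v k else 0 := by
  simp [elR]

theorem isOp_el (i k : Fin 3) : IsOp 0 (fun φ x => elR i k (φ x)) (fun _ => elC i k) where
  test hφ := ⟨(elR i k).contDiff.comp hφ.1, hφ.2.comp_left (g := elR i k) (by simp)⟩
  fourier {φ} hφ ξ := by
    have e : ∀ x, complexify (elR i k (φ x)) = elC i k (complexify (φ x)) := by
      intro x; ext l
      rw [elC_apply]
      simp only [complexify, LinearMap.coe_toContinuousLinearMap', LinearMap.coe_mk,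
        AddHom.coe_mk, elR_apply]
      split_ifs <;> simp
    simp_rw [e]
    rw [Real.fourier_eq, Real.fourier_eq]
    rw [← ContinuousLinearMap.integral_comp_comm]
    · refine integral_congr_ae (.of_forall fun x => ?_)
      simp only [elC, Circle.smul_def]
      exact (map_smul ((EuclideanSpace.proj k : V →L[ℂ] ℂ).smulRight
        (EuclideanSpace.single i (1 : ℂ))) _ _).symm
    · exact (Real.fourierIntegral_convergent_iff _).2 hφ.integrable_cpx
  cont := continuous_const
  growth := ⟨‖elC i k‖, fun ξ => by simp⟩
  map_I _ _ := map_smul ((EuclideanSpace.proj k : V →L[ℂ] ℂ).smulRight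
        (EuclideanSpace.single i (1 : ℂ))) _ _

theorem continuous_sD (j : Fin 3) : Continuous (sD j) := by
  unfold sD; fun_prop

theorem norm_sD_apply (j : Fin 3) (ξ : R3) (v : V) : ‖sD j ξ v‖ = 2 * Real.pi * |ξ j| * ‖v‖ := by
  have : sD j ξ v = (ξ j) • ((2 * Real.pi * Complex.I : ℂ) • v) := rfl
  rw [this, norm_smul, norm_smul]
  simp [abs_of_pos Real.pi_pos]; ring

theorem norm_sD_le (j : Fin 3) (ξ : R3) (v : V) : ‖sD j ξ v‖ ≤ 2 * Real.pi * ‖ξ‖ * ‖v‖ := by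
  rw [norm_sD_apply]
  have : |ξ j| ≤ ‖ξ‖ := by simpa using PiLp.norm_apply_le ξ j
  gcongr

theorem isOp_pd (j : Fin 3) : IsOp 1 (pd j) (sD j) where
  test hφ := hφ.pd j
  fourier {φ} hφ ξ := by
    have h1 := SchwartzMap.fourier_lineDerivOp_eq hφ.cpx.toS (EuclideanSpace.single j (1 : ℝ))
    have h2 : (LineDeriv.lineDerivOp (EuclideanSpace.single j (1 : ℝ)) hφ.cpx.toS)
        = (hφ.pd j).cpx.toS := by
      ext1 x
      rw [SchwartzMap.lineDerivOp_apply_eq_fderiv, IsTest.toS_apply]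
      have := (complexify.hasFDerivAt (x := φ x)).comp x
        ((hφ.1.differentiable (by simp)) x).hasFDerivAt
      have h3 : fderiv ℝ (⇑hφ.cpx.toS) x = complexify.comp (fderiv ℝ φ x) := this.fderiv
      rw [h3]; rfl
    rw [h2] at h1
    have h4 := congrArg (fun g : SchwartzMap R3 V => g ξ) h1
    simp only [smul_apply] at h4
    rw [SchwartzMap.smulLeftCLM_apply_apply (by fun_prop)] at h4
    change 𝓕 (fun x => complexify (pd j φ x)) ξ = _ • _ • 𝓕 (fun x => complexify (φ x)) ξ at h4
    rw [h4]
    ext i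
    rw [sD_apply]
    simp [EuclideanSpace.inner_single_right]; ring
  cont := continuous_sD j
  growth := by
    refine ⟨2 * Real.pi, fun ξ => ContinuousLinearMap.opNorm_le_bound _ (by positivity) fun v => ?_⟩
    refine (norm_sD_le j ξ v).trans ?_
    rw [pow_one]
    gcongr
    linarith
  map_I ξ v := by
    have : ∀ v, sD j ξ v = (ξ j) • ((2 * Real.pi * Complex.I : ℂ) • v) := fun _ => rfl
    rw [this, this, smul_comm Complex.I, smul_comm Complex.I]

/-- The symbol of the Laplacian. -/
def sLap (ξ : R3) : V →L[ℝ] V :=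
  (sD 0 ξ).comp (sD 0 ξ) + (sD 1 ξ).comp (sD 1 ξ) + (sD 2 ξ).comp (sD 2 ξ)

/-- The symbol of the operator `φ ↦ (div φ) e₀`. -/
def sDiv (ξ : R3) : V →L[ℝ] V :=
  (elC 0 0).comp (sD 0 ξ) + (elC 0 1).comp (sD 1 ξ) + (elC 0 2).comp (sD 2 ξ)

/-- The symbol of the operator `φ ↦ ∇ φ₀`. -/
def sGrad (ξ : R3) : V →L[ℝ] V :=
  (elC 0 0).comp (sD 0 ξ) + (elC 1 0).comp (sD 1 ξ) + (elC 2 0).comp (sD 2 ξ)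

/-- The symbol of the curl. -/
def sCurl (ξ : R3) : V →L[ℝ] V :=
  (elC 0 2).comp (sD 1 ξ) + -(elC 0 1).comp (sD 2 ξ) + ((elC 1 0).comp (sD 2 ξ)
    + -(elC 1 2).comp (sD 0 ξ)) + ((elC 2 1).comp (sD 0 ξ) + -(elC 2 0).comp (sD 1 ξ))

theorem gradient_apply {ψ : R3 → ℝ} (x : R3) (i : Fin 3) : ∇ ψ x i = pd i ψ x := by
  have h := inner_gradient_left (f := ψ) (x := x) (y := EuclideanSpace.single i 1) (𝕜 := ℝ)
  rw [EuclideanSpace.inner_single_right] at h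
  rw [pd]
  simpa using h

theorem pd_comp_apply {φ : R3 → R3} (h : IsTest φ) (j k : Fin 3) (x : R3) :
    pd j (fun x => φ x k) x = pd j φ x k := by
  have := ((EuclideanSpace.proj k : R3 →L[ℝ] ℝ).hasFDerivAt (x := φ x)).comp x
        ((h.1.differentiable (by simp)) x).hasFDerivAt
  have h2 : fderiv ℝ (fun x => φ x k) x = _ := this.fderiv
  rw [pd, h2]; rfl

theorem isOp_lap : IsOp 2 (fun φ => Δ φ) sLap := by
  refine ((((isOp_pd 0).comp (isOp_pd 0)).add ((isOp_pd 1).comp (isOp_pd 1))).add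
    ((isOp_pd 2).comp (isOp_pd 2))).congr fun φ hφ x => ?_
  rw [InnerProductSpace.laplacian_eq_iteratedFDeriv_orthonormalBasis φ
    (EuclideanSpace.basisFun (Fin 3) ℝ)]
  simp only [Fin.sum_univ_three]
  have key : ∀ j : Fin 3, pd j (pd j φ) x = iteratedFDeriv ℝ 2 φ x
      ![EuclideanSpace.basisFun (Fin 3) ℝ j, EuclideanSpace.basisFun (Fin 3) ℝ j] := by
    intro j
    rw [iteratedFDeriv_two_apply]
    have hd : DifferentiableAt ℝ (fderiv ℝ φ) x :=
      (hφ.1.fderiv_right (m := 1) (by norm_cast)).differentiable one_ne_zero x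
    have : pd j φ = fun y => fderiv ℝ φ y (EuclideanSpace.single j 1) := rfl
    rw [this, pd, fderiv_clm_apply hd (differentiableAt_const _)]
    simp
  rw [key, key, key]

/-- The operator `φ ↦ (div φ) e₀`. -/
def divE (φ : R3 → R3) (x : R3) : R3 := EuclideanSpace.single 0 (div φ x)

/-- The operator `φ ↦ ∇ φ₀`. -/
def gradE (φ : R3 → R3) : R3 → R3 := ∇ (fun x => φ x 0)

/-- The divergence and the gradient are carried by the first coordinate of a vector field, so that
all operators of the system act between vector fields and fit the single notion `IsOp`. -/
theorem isOp_div : IsOp 1 divE sDiv := by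
  refine ((((isOp_el 0 0).comp (isOp_pd 0)).add ((isOp_el 0 1).comp (isOp_pd 1))).add
    ((isOp_el 0 2).comp (isOp_pd 2))).congr fun φ hφ x => ?_
  ext l
  simp only [PiLp.add_apply, elR_apply, divE, div, Fin.sum_univ_three, PiLp.single_apply]
  split_ifs <;> simp

theorem isOp_grad : IsOp 1 gradE sGrad := by
  refine ((((isOp_el 0 0).comp (isOp_pd 0)).add ((isOp_el 1 0).comp (isOp_pd 1))).add
    ((isOp_el 2 0).comp (isOp_pd 2))).congr fun φ hφ x => ?_
  ext l
  rw [gradE, gradient_apply, pd_comp_apply hφ]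
  fin_cases l <;> simp [elR_apply]

theorem isOp_gradDiv : IsOp 2 (fun φ => ∇ (div φ)) (fun ξ => (sGrad ξ).comp (sDiv ξ)) := by
  refine (isOp_grad.comp isOp_div).congr fun φ hφ x => ?_
  simp [gradE, divE]

theorem isOp_curl : IsOp 1 curl sCurl := by
  refine (((((isOp_el 0 2).comp (isOp_pd 1)).add ((isOp_el 0 1).comp (isOp_pd 2)).neg)).add
    ((((isOp_el 1 0).comp (isOp_pd 2)).add ((isOp_el 1 2).comp (isOp_pd 0)).neg)) |>.add
    ((((isOp_el 2 1).comp (isOp_pd 0)).add ((isOp_el 2 0).comp (isOp_pd 1)).neg))).congr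
    fun φ hφ x => ?_
  ext l
  fin_cases l <;> simp [elR_apply, curl] <;> ring

/-! Pointwise identities between the symbols. -/

theorem V_inner (a b : V) : inner ℝ a b = ∑ i, ((a i).re * (b i).re + (a i).im * (b i).im) := by
  change (inner ℂ a b).re = _
  simp [PiLp.inner_apply]
  congr 1; ext i; ring

theorem inner_sLap (ξ : R3) (a b : V) :
    inner ℝ a (sLap ξ b) = - ∑ j, inner ℝ (sD j ξ a) (sD j ξ b) := by
  simp only [V_inner, Fin.sum_univ_three, sLap, add_apply,
    ContinuousLinearMap.comp_apply, PiLp.add_apply, sD_apply, Complex.add_re, Complex.add_im,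
    Complex.mul_re, Complex.mul_im, Complex.ofReal_re, Complex.ofReal_im, Complex.I_re,
    Complex.I_im]
  ring

theorem sCurl_apply (ξ : R3) (a : V) : sCurl ξ a =
    !₂[((2 * Real.pi : ℝ) : ℂ) * (Complex.I * (ξ 1 * a 2 - ξ 2 * a 1)),
      ((2 * Real.pi : ℝ) : ℂ) * (Complex.I * (ξ 2 * a 0 - ξ 0 * a 2)),
      ((2 * Real.pi : ℝ) : ℂ) * (Complex.I * (ξ 0 * a 1 - ξ 1 * a 0))] := by
  ext i
  fin_cases i <;> simp [sCurl, elC_apply, sD_apply] <;> ring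

theorem sDiv_apply (ξ : R3) (a : V) (i : Fin 3) : sDiv ξ a i =
    if i = 0 then ((2 * Real.pi : ℝ) : ℂ) * (Complex.I * (ξ 0 * a 0 + ξ 1 * a 1 + ξ 2 * a 2)) else 0 := by
  fin_cases i <;> simp [sDiv, elC_apply, sD_apply]
  ring

theorem sGrad_apply (ξ : R3) (a : V) (i : Fin 3) : sGrad ξ a i =
    ((2 * Real.pi : ℝ) : ℂ) * (Complex.I * (ξ i * a 0)) := by
  fin_cases i <;> simp [sGrad, elC_apply, sD_apply] <;> ring

theorem inner_sCurl (ξ : R3) (a b : V) : inner ℝ a (sCurl ξ b) = inner ℝ (sCurl ξ a) b := by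
  simp only [V_inner, Fin.sum_univ_three, sCurl_apply]
  simp
  ring

theorem inner_sGrad (ξ : R3) (a b : V) : inner ℝ a (sGrad ξ b) = - inner ℝ (sDiv ξ a) b := by
  simp only [V_inner, Fin.sum_univ_three, sGrad_apply, sDiv_apply]
  simp
  ring

/-- Polarised form of `|ξ × a|² = |ξ|²|a|² - |ξ·a|²`. On divergence free fields the curl and the
gradient have the same quadratic form. -/
theorem inner_sCurl_sCurl (ξ : R3) (a b : V) : inner ℝ (sCurl ξ a) (sCurl ξ b) =
    ∑ j, inner ℝ (sD j ξ a) (sD j ξ b) - inner ℝ (sDiv ξ a) (sDiv ξ b) := by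
  simp only [V_inner, Fin.sum_univ_three, sCurl_apply, sDiv_apply, sD_apply]
  simp
  ring

theorem sum_norm_sD_sq (ξ : R3) (a : V) :
    ∑ j, ‖sD j ξ a‖ ^ 2 = (2 * Real.pi) ^ 2 * ‖ξ‖ ^ 2 * ‖a‖ ^ 2 := by
  simp_rw [norm_sD_apply]
  rw [EuclideanSpace.norm_sq_eq ξ]
  simp only [Fin.sum_univ_three, Real.norm_eq_abs]
  ring

end

section

/-! ### From weak formulations to symbols -/

theorem IsOp.mono {k l : ℕ} {D : (R3 → R3) → R3 → R3} {σ : R3 → V →L[ℝ] V} (h : IsOp k D σ)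
    (hkl : k ≤ l) : IsOp l D σ where
  test := h.test
  fourier := h.fourier
  cont := h.cont
  growth := by
    obtain ⟨C, hC0, hC⟩ := h.growth_nonneg
    refine ⟨C, fun ξ => (hC ξ).trans ?_⟩
    gcongr
    linarith [norm_nonneg ξ]
  map_I := h.map_I

/-- The symbol `σ` divided by the weight `1 + |ξ|²`. -/
def bsym (σ : R3 → V →L[ℝ] V) (ξ : R3) : V →L[ℝ] V := (wt ξ)⁻¹ • σ ξ

theorem continuous_wt : Continuous wt := by unfold wt; fun_prop

section Weak

variable {D : (R3 → R3) → R3 → R3} {σ σ' : R3 → V →L[ℝ] V} {S : Set R3}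

/-- Division by `1 + |ξ|²` makes symbols of order two bounded. A weak equation then says that a
continuous functional on `L²` vanishes on the weighted transforms of test fields, and density gives
that it vanishes everywhere. -/
theorem IsOp.isSymb_bsym (h : IsOp 2 D σ) : IsSymb (bsym σ) := by
  obtain ⟨C, hC0, hC⟩ := h.growth_nonneg
  have hc : Continuous (bsym σ) := by
    refine Continuous.smul (continuous_wt.inv₀ fun ξ => (wt_pos ξ).ne') h.cont
  refine ⟨hc.stronglyMeasurable, C * 2, fun ξ => ?_⟩
  rw [bsym, norm_smul, norm_inv, Real.norm_of_nonneg (wt_pos ξ).le, inv_mul_le_iff₀ (wt_pos ξ)]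
  refine (hC ξ).trans ?_
  have : (1 + ‖ξ‖) ^ 2 ≤ 2 * wt ξ := by unfold wt; nlinarith [sq_nonneg (1 - ‖ξ‖)]
  nlinarith

theorem IsOp.mul_weighted (h : IsOp 2 D σ) {φ : R3 → R3} (hφ : IsTest φ) :
    mul (bsym σ) (weighted hφ.cpx.toS) = Ftr (h.test hφ).toL2 := by
  refine Lp.ext ?_
  filter_upwards [mul_coe h.isSymb_bsym (weighted hφ.cpx.toS), weighted_coe hφ.cpx.toS,
    Ftr_toL2 (h.test hφ)] with ξ h1 h2 h3
  rw [h1, h2, h3, h.fourier hφ, bsym, ContinuousLinearMap.map_smul, smul_apply, smul_smul,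
    mul_inv_cancel₀ (wt_pos ξ).ne', one_smul]
  rfl

theorem IsOp.mul_I_smul (h : IsOp 2 D σ) (f : LC) :
    mul (bsym σ) (Complex.I • f) = Complex.I • mul (bsym σ) f := by
  refine Lp.ext ?_
  filter_upwards [mul_coe h.isSymb_bsym (Complex.I • f), mul_coe h.isSymb_bsym f,
    Lp.coeFn_smul Complex.I f, Lp.coeFn_smul Complex.I (mul (bsym σ) f)] with ξ h1 h2 h3 h4
  rw [h1, h3, h4, Pi.smul_apply, Pi.smul_apply, h2, bsym, smul_apply, h.map_I, smul_apply,
    smul_comm]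

theorem inner_Ftr_toL2 (f : L2) {φ : R3 → R3} (hφ : IsTest φ) :
    inner ℝ (Ftr f) (Ftr hφ.toL2) = pair f φ := by
  rw [inner_Ftr, inner_toL2]

theorem IsOp.inner_mul_weighted (h : IsOp 2 D σ) (f : L2) {φ : R3 → R3} (hφ : IsTest φ) :
    inner ℝ (Ftr f) (mul (bsym σ) (weighted hφ.cpx.toS)) = pair f (D φ) := by
  rw [h.mul_weighted hφ, inner_Ftr_toL2]

theorem IsOp.inner_mul_I_weighted (h : IsOp 2 D σ) (f : L2) {φ : R3 → R3} (hφ : IsTest φ) :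
    inner ℝ (Ftr f) (mul (bsym σ) (Complex.I • weighted hφ.cpx.toS)) = 0 := by
  rw [h.mul_I_smul, h.mul_weighted hφ, inner_I_smul_Ftr]

theorem IsOp.mul_bsym_dop (h : IsOp 2 D σ) (hS : IsCut S) (g : LC) :
    mul (bsym σ) (dop S (fun ξ => wt ξ • ContinuousLinearMap.id ℝ V) g) = dop S σ g := by
  have hw : Continuous fun ξ => wt ξ • ContinuousLinearMap.id ℝ V :=
    continuous_wt.smul continuous_const
  refine Lp.ext ?_
  filter_upwards [mul_coe h.isSymb_bsym (dop S (fun ξ => wt ξ • ContinuousLinearMap.id ℝ V) g),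
    dop_coe hS hw g, dop_coe hS h.cont g] with ξ h1 h2 h3
  rw [h1, h2, h3]
  by_cases hξ : ξ ∈ S
  · simp [hξ, bsym, smul_smul, mul_inv_cancel₀ (wt_pos ξ).ne']
  · simp [hξ]

/-- The functional `L` expressing the weak relation vanishes by density. Evaluating it at `1_S (1 +
|ξ|²) p` undoes the weight and gives the relation truncated to `S`. -/
theorem inner_dop_of_weak (h : IsOp 2 D σ) (hS : IsCut S) {f g : L2}
    (H : ∀ φ, IsTest φ → pair f (D φ) = pair g φ) (p : LC) :
    inner ℝ (Ftr f) (dop S σ p) = inner ℝ (Ftr g) (proj S p) := by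
  have hid : IsOp 2 (fun φ => φ) (fun _ => ContinuousLinearMap.id ℝ V) := IsOp.id.mono (by norm_num)
  set L : LC →L[ℝ] ℝ := (innerSL ℝ (Ftr f)).comp (mul (bsym σ)) -
    (innerSL ℝ (Ftr g)).comp (mul (bsym fun _ => ContinuousLinearMap.id ℝ V))
  have hLa : ∀ G, L G = inner ℝ (Ftr f) (mul (bsym σ) G) -
      inner ℝ (Ftr g) (mul (bsym fun _ => ContinuousLinearMap.id ℝ V) G) := fun _ => rfl
  have hL : L = 0 := by
    refine eq_zero_of_tests L fun φ hφ => ⟨?_, ?_⟩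
    · rw [hLa, h.inner_mul_weighted _ hφ, hid.inner_mul_weighted _ hφ, H φ hφ, sub_self]
    · rw [hLa, h.inner_mul_I_weighted _ hφ, hid.inner_mul_I_weighted _ hφ, sub_self]
  have := hLa (dop S (fun ξ => wt ξ • ContinuousLinearMap.id ℝ V) p)
  rw [hL, h.mul_bsym_dop hS, hid.mul_bsym_dop hS] at this
  exact (sub_eq_zero.1 this.symm)

theorem inner_dop_adjoint (hS : IsCut S) (hσ : Continuous σ) (hσ' : Continuous σ')
    (hadj : ∀ ξ a b, inner ℝ a (σ ξ b) = inner ℝ (σ' ξ a) b) (f g : LC) :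
    inner ℝ f (dop S σ g) = inner ℝ (dop S σ' f) g := by
  rw [inner_dop_right hS hσ, real_inner_comm, inner_dop_right hS hσ']
  simp_rw [hadj, real_inner_comm]

theorem inner_proj_left (hS : IsCut S) (f g : LC) :
    inner ℝ (proj S f) g = inner ℝ f (proj S g) :=
  (inner_dop_adjoint hS continuous_const continuous_const (fun _ _ _ => rfl) f g).symm

theorem dop_Ftr_of_weak (h : IsOp 2 D σ) (hS : IsCut S) (hσ' : Continuous σ')
    (hadj : ∀ ξ a b, inner ℝ a (σ ξ b) = inner ℝ (σ' ξ a) b) {f g : L2}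
    (H : ∀ φ, IsTest φ → pair f (D φ) = pair g φ) :
    dop S σ' (Ftr f) = proj S (Ftr g) := by
  refine ext_inner_right ℝ fun p => ?_
  rw [← inner_dop_adjoint hS h.cont hσ' hadj, inner_dop_of_weak h hS H,
    inner_proj_left hS]

/-- The functional `g ↦ ∫₀ᵗ ⟨F r, g⟩ dr`. -/
theorem exists_integral_functional {H : Type*} [NormedAddCommGroup H] [InnerProductSpace ℝ H]
    [CompleteSpace H] {F : ℝ → H} (hF : WCont F) {t : ℝ} (ht : 0 ≤ t) :
    ∃ L : H →L[ℝ] ℝ, ∀ g, L g = ∫ r in (0 : ℝ)..t, inner ℝ (F r) g := by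
  obtain ⟨C, hC0, hC⟩ := hF.exists_bound t
  have hi : ∀ g, IntervalIntegrable (fun r => inner ℝ (F r) g) volume 0 t := fun g =>
    intervalIntegrable_of_continuousOn_Ici (hF g) le_rfl ht
  refine ⟨LinearMap.mkContinuous
    { toFun := fun g => ∫ r in (0 : ℝ)..t, inner ℝ (F r) g
      map_add' := fun g g' => by
        simp only [inner_add_right]
        exact intervalIntegral.integral_add (hi g) (hi g')
      map_smul' := fun a g => by
        simp only [inner_smul_right, intervalIntegral.integral_const_mul]
        rfl } (C * t) fun g => ?_, fun g => rfl⟩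
  have : ‖∫ r in (0 : ℝ)..t, inner ℝ (F r) g‖ ≤ (C * ‖g‖) * |t - 0| := by
    refine intervalIntegral.norm_integral_le_of_norm_le_const fun r hr => ?_
    rw [uIoc_of_le ht] at hr
    exact (norm_inner_le_norm _ _).trans
      (mul_le_mul_of_nonneg_right (hC r hr.1.le hr.2) (norm_nonneg _))
  rw [sub_zero, abs_of_nonneg ht] at this
  refine this.trans (le_of_eq (by ring))

/-- The time integral of the weighted pairings is itself a continuous functional of the test field
(`exists_integral_functional`), so the density argument applies at each fixed time. After truncation
to `S` the right-hand side consists of bounded operators applied to weakly continuous curves. -/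
theorem hasWeakDeriv_of_weak {ι : Type} [Fintype ι] {D : ι → (R3 → R3) → R3 → R3}
    {σ : ι → R3 → V →L[ℝ] V} (hD : ∀ i, IsOp 2 (D i) (σ i)) {u : ℝ → L2} {f : ι → ℝ → L2}
    (hf : ∀ i, WCont (f i))
    (H : ∀ φ, IsTest φ → ∀ t, 0 ≤ t → pair (u t) φ = pair (u 0) φ +
      ∫ s in (0 : ℝ)..t, ∑ i, pair (f i s) (D i φ)) (hS : IsCut S) :
    HasWeakDeriv (fun t => proj S (Ftr (u t)))
      (fun t => ∑ i, ContinuousLinearMap.adjoint (dop S (σ i)) (Ftr (f i t))) := by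
  have hFf : ∀ i, WCont fun t => Ftr (f i t) := fun i => (hf i).map Ftr.toContinuousLinearMap
  refine ⟨WCont.sum fun i _ => (hFf i).map _, fun g t ht => ?_⟩
  set B : LC →L[ℝ] LC := mul (bsym fun _ => ContinuousLinearMap.id ℝ V)
  set F : ℝ → LC := fun r => ∑ i, ContinuousLinearMap.adjoint (mul (bsym (σ i))) (Ftr (f i r))
  have hF : WCont F := WCont.sum fun i _ => (hFf i).map _
  have hFg : ∀ r p, inner ℝ (F r) p = ∑ i, inner ℝ (Ftr (f i r)) (mul (bsym (σ i)) p) := by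
    intro r p
    simp only [F, sum_inner, ContinuousLinearMap.adjoint_inner_left]
  obtain ⟨I, hI⟩ := exists_integral_functional hF ht
  have hid : IsOp 2 (fun φ => φ) (fun _ => ContinuousLinearMap.id ℝ V) := IsOp.id.mono (by norm_num)
  set L : LC →L[ℝ] ℝ := (innerSL ℝ (Ftr (u t) - Ftr (u 0))).comp B - I
  have hLa : ∀ G, L G = inner ℝ (Ftr (u t) - Ftr (u 0)) (B G) - I G := fun _ => rfl
  have hL : L = 0 := by
    refine eq_zero_of_tests L fun φ hφ => ⟨?_, ?_⟩
    · rw [hLa, inner_sub_left, hid.inner_mul_weighted _ hφ, hid.inner_mul_weighted _ hφ, H φ hφ t ht, hI]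
      simp only [hFg, fun i r => (hD i).inner_mul_weighted (f i r) hφ]
      ring
    · rw [hLa, inner_sub_left, hid.inner_mul_I_weighted _ hφ, hid.inner_mul_I_weighted _ hφ, hI]
      simp only [hFg, fun i r => (hD i).inner_mul_I_weighted (f i r) hφ]
      simp
  have := hLa (dop S (fun ξ => wt ξ • ContinuousLinearMap.id ℝ V) g)
  rw [hL, hid.mul_bsym_dop hS, hI, inner_sub_left] at this
  simp only [hFg, (hD _).mul_bsym_dop hS] at this
  simp only [inner_proj_left hS, sum_inner, ContinuousLinearMap.adjoint_inner_left]
  change 0 = inner ℝ (Ftr (u t)) (proj S g) - inner ℝ (Ftr (u 0)) (proj S g) - _ at this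
  linarith

theorem tendsto_norm_proj_sq (f : LC) :
    Tendsto (fun R : ℝ => ‖proj (Metric.closedBall 0 R) f‖ ^ 2) atTop (𝓝 (‖f‖ ^ 2)) := by
  have h0 : Integrable (fun ξ => ‖f ξ‖ ^ 2) :=
    (memLp_two_iff_integrable_sq_norm (Lp.aestronglyMeasurable f)).1 (Lp.memLp f)
  have h1 := tendsto_setIntegral_of_monotone (μ := volume) (f := fun ξ => ‖f ξ‖ ^ 2)
    (s := fun R : ℝ => Metric.closedBall (0 : R3) R) (fun R => measurableSet_closedBall)
    (fun R R' h => Metric.closedBall_subset_closedBall h) h0.integrableOn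
  have hU : (⋃ R : ℝ, Metric.closedBall (0 : R3) R) = univ := by
    ext ξ; simpa using ⟨‖ξ‖, le_rfl⟩
  rw [hU, setIntegral_univ] at h1
  have h2 : ‖f‖ ^ 2 = ∫ ξ, ‖f ξ‖ ^ 2 := by
    rw [← real_inner_self_eq_norm_sq, L2.inner_def]
    simp_rw [real_inner_self_eq_norm_sq]
  rw [h2]
  exact h1.congr fun R => (norm_proj_sq (IsCut.closedBall R) f).symm

theorem tendsto_norm_sub_proj (f : LC) :
    Tendsto (fun R : ℝ => ‖f - proj (Metric.closedBall 0 R) f‖) atTop (𝓝 0) := by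
  have h := (tendsto_norm_proj_sq f).const_sub (‖f‖ ^ 2)
  rw [sub_self] at h
  have h2 := (Real.continuous_sqrt.tendsto 0).comp h
  rw [Real.sqrt_zero] at h2
  refine h2.congr fun R => ?_
  rw [Function.comp_apply, ← norm_sub_proj_sq (IsCut.closedBall R), Real.sqrt_sq (norm_nonneg _)]

theorem tendsto_proj (f : LC) :
    Tendsto (fun R : ℝ => proj (Metric.closedBall 0 R) f) atTop (𝓝 f) := by
  rw [tendsto_iff_norm_sub_tendsto_zero]
  exact (tendsto_norm_sub_proj f).congr fun R => norm_sub_rev _ _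

theorem eq_zero_of_pair {f : L2} (H : ∀ φ, IsTest φ → pair f φ = 0) : f = 0 := by
  have hid : IsOp 2 (fun φ => φ) (fun _ => ContinuousLinearMap.id ℝ V) := IsOp.id.mono (by norm_num)
  have h1 : ∀ R : ℝ, proj (Metric.closedBall 0 R) (Ftr f) = 0 := fun R => by
    refine ext_inner_right ℝ fun p => ?_
    have := inner_dop_of_weak hid (IsCut.closedBall R) (f := f) (g := 0)
      (fun φ hφ => by rw [H φ hφ, ← inner_toL2 0 hφ, inner_zero_left]) p
    rw [map_zero, inner_zero_left] at this
    rw [inner_zero_left, inner_proj_left (IsCut.closedBall R)]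
    exact this
  have h2 : Ftr f = 0 := by
    have h3 := tendsto_proj (Ftr f)
    simp only [h1] at h3
    exact tendsto_nhds_unique h3 tendsto_const_nhds
  exact Ftr.injective (by rw [h2, map_zero])

/-! ### Dissipation terms -/

theorem pair_neg (f : L2) {φ : R3 → R3} (hφ : IsTest φ) : pair (-f) φ = - pair f φ := by
  rw [← inner_toL2 _ hφ, ← inner_toL2 _ hφ, inner_neg_left]

theorem inner_sD (j : Fin 3) (ξ : R3) (a b : V) : inner ℝ a (sD j ξ b) = inner ℝ ((-sD j) ξ a) b := by
  simp only [V_inner, Fin.sum_univ_three, Pi.neg_apply, neg_apply, PiLp.neg_apply, sD_apply]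
  simp
  ring

theorem dop_neg (hS : IsCut S) (hσ : Continuous σ) (f : LC) : dop S (-σ) f = - dop S σ f := by
  refine Lp.ext ?_
  filter_upwards [dop_coe hS hσ f, dop_coe hS hσ.neg f, Lp.coeFn_neg (dop S σ f)] with ξ h1 h2 h3
  rw [h3, h2, Pi.neg_apply, h1]
  by_cases h : ξ ∈ S <;> simp [h]

/-- Every competitor in the infimum has its Fourier transform prescribed by the symbol, and
truncation lowers the norm. Without a competitor the infimum is `∞` and nothing is claimed. The next
bounds follow the same pattern. -/
theorem le_gradSq (hS : IsCut S) (f : L2) :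
    ENNReal.ofReal (∑ j, ‖dop S (sD j) (Ftr f)‖ ^ 2) ≤ gradSq f := by
  refine le_iInf₂ fun g hg => ?_
  rw [ENNReal.ofReal_sum_of_nonneg fun _ _ => by positivity]
  refine Finset.sum_le_sum fun j _ => ?_
  have h1 := dop_Ftr_of_weak ((isOp_pd j).mono (by norm_num)) hS (continuous_sD j).neg (inner_sD j)
    (f := f) (g := - g j) (fun φ hφ => by rw [hg j φ hφ, pair_neg _ hφ])
  rw [dop_neg hS (continuous_sD j)] at h1
  have h2 : ‖dop S (sD j) (Ftr f)‖ ≤ ‖g j‖ := by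
    rw [← norm_neg, h1]
    exact (norm_proj_le hS _).trans (by rw [LinearIsometry.norm_map, norm_neg])
  rw [← ofReal_norm, ← ENNReal.ofReal_pow (norm_nonneg _)]
  gcongr

theorem le_curlSubSq (hS : IsCut S) (f g : L2) :
    ENNReal.ofReal (‖dop S sCurl (Ftr f) - (2 : ℝ) • proj S (Ftr g)‖ ^ 2) ≤ curlSubSq f g := by
  refine le_iInf₂ fun c hc => ?_
  have h1 := dop_Ftr_of_weak (isOp_curl.mono (by norm_num)) hS isOp_curl.cont inner_sCurl
    (f := f) (g := c) hc
  rw [h1, ← map_smul, ← map_sub, ← map_smul, ← map_sub, ← ofReal_norm,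
    ← ENNReal.ofReal_pow (norm_nonneg _)]
  gcongr
  exact (norm_proj_le hS _).trans (by rw [LinearIsometry.norm_map])

theorem inner_sGrad' (ξ : R3) (a b : V) :
    inner ℝ a (sGrad ξ b) = inner ℝ ((-sDiv) ξ a) b := by
  rw [inner_sGrad]; simp [inner_neg_left]

theorem le_divSq (hS : IsCut S) (f : L2) :
    ENNReal.ofReal (‖dop S sDiv (Ftr f)‖ ^ 2) ≤ divSq f := by
  refine le_iInf₂ fun d hd => ?_
  -- The scalar divergence is placed on the first axis, to match `gradE` and `sDiv`.
  set A : ℝ →L[ℝ] R3 := (ContinuousLinearMap.id ℝ ℝ).smulRight (EuclideanSpace.single 0 1)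
  have hA : ‖A‖ ≤ 1 := ContinuousLinearMap.opNorm_le_bound _ zero_le_one fun x => by
    simp [A, norm_smul]
  have h1 := dop_Ftr_of_weak (isOp_grad.mono (by norm_num)) hS isOp_div.cont.neg inner_sGrad'
    (f := f) (g := - A.compLp d) (fun φ hφ => by
      have ht : IsTest fun x => φ x 0 :=
        ⟨(EuclideanSpace.proj 0 : R3 →L[ℝ] ℝ).contDiff.comp hφ.1,
          hφ.2.comp_left (g := fun v : R3 => v 0) rfl⟩
      rw [gradE, hd _ ht, pair_neg _ hφ, pair]
      congr 1
      refine integral_congr_ae ?_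
      filter_upwards [A.coeFn_compLp d] with x hx
      rw [hx]
      simp [A, inner_smul_left, EuclideanSpace.inner_single_left])
  rw [dop_neg hS isOp_div.cont] at h1
  rw [← ofReal_norm, ← ENNReal.ofReal_pow (norm_nonneg _)]
  gcongr
  rw [← norm_neg, h1]
  refine (norm_proj_le hS _).trans ?_
  rw [LinearIsometry.norm_map, norm_neg]
  refine (A.norm_compLp_le d).trans ?_
  nlinarith [norm_nonneg d]

/-! ### Divergence free fields and the Leray projector -/

theorem dop_sDiv_of_mem {f : L2} (hf : f ∈ L2σ) (hS : IsCut S) : dop S sDiv (Ftr f) = 0 := by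
  have h1 := dop_Ftr_of_weak (isOp_grad.mono (by norm_num)) hS isOp_div.cont.neg inner_sGrad'
    (f := f) (g := 0) (fun φ hφ => by
      have ht : IsTest fun x => φ x 0 :=
        ⟨(EuclideanSpace.proj 0 : R3 →L[ℝ] ℝ).contDiff.comp hφ.1,
          hφ.2.comp_left (g := fun v : R3 => v 0) rfl⟩
      rw [← inner_toL2 0 hφ, inner_zero_left]
      exact (mem_L2σ f).1 hf _ ht)
  rw [dop_neg hS isOp_div.cont, map_zero, map_zero] at h1
  exact neg_eq_zero.1 h1

theorem IsOp.proj_Ftr {k : ℕ} (h : IsOp k D σ) (hS : IsCut S) {φ : R3 → R3} (hφ : IsTest φ) :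
    proj S (Ftr (h.test hφ).toL2) = dop S σ (Ftr hφ.toL2) := by
  refine Lp.ext ?_
  filter_upwards [proj_coe hS (Ftr (h.test hφ).toL2), dop_coe hS h.cont (Ftr hφ.toL2),
    Ftr_toL2 (h.test hφ), Ftr_toL2 hφ] with ξ h1 h2 h3 h4
  rw [h1, h2]
  by_cases hξ : ξ ∈ S
  · simp only [indicator_of_mem hξ]; rw [h3, h4, h.fourier hφ]
  · simp [hξ]

/-- The orthogonal of `L2σ` is the closure of the span of the gradients. The pairing is continuous
in `p`, and on a gradient it becomes a pairing with the divergence of `q`. -/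
theorem inner_eq_zero_of_mem_orthogonal {p : L2} (hp : p ∈ L2σᗮ) (hS : IsCut S) {q : LC}
    (hq : dop S sDiv q = 0) : inner ℝ (Ftr p) (proj S q) = 0 := by
  set K : Submodule ℝ L2 := LinearMap.ker
    (((innerSL ℝ (proj S q)).comp Ftr.toContinuousLinearMap) : L2 →L[ℝ] ℝ).toLinearMap
  have hK : IsClosed (K : Set L2) :=
    ContinuousLinearMap.isClosed_ker ((innerSL ℝ (proj S q)).comp Ftr.toContinuousLinearMap)
  have hle : (Submodule.span ℝ {g : L2 | ∃ (ψ : R3 → ℝ) (h : IsTest ψ), g = h.gradient.toL2}) ≤ K := by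
    rw [Submodule.span_le]
    rintro _ ⟨ψ, hψ, rfl⟩
    change inner ℝ (proj S q) (Ftr hψ.gradient.toL2) = 0
    have ht : IsTest (fun x => EuclideanSpace.single (0 : Fin 3) (ψ x) : R3 → R3) := by
      have := (ContinuousLinearMap.id ℝ ℝ).smulRight (EuclideanSpace.single (0 : Fin 3) (1 : ℝ))
      refine ⟨?_, hψ.2.comp_left (g := fun a : ℝ => (EuclideanSpace.single (0 : Fin 3) a : R3))
        (by simp)⟩
      rw [contDiff_euclidean]
      intro i
      by_cases hi : i = 0
      · subst hi; simpa using hψ.1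
      · simpa [hi] using contDiff_const
    have e : hψ.gradient.toL2 = (isOp_grad.test ht).toL2 := by
      have : gradE (fun x => EuclideanSpace.single (0 : Fin 3) (ψ x)) = ∇ ψ := by simp [gradE]
      simp only [IsTest.toL2, this]
    rw [e, real_inner_comm, inner_proj_right hS, isOp_grad.proj_Ftr hS ht, real_inner_comm,
      inner_dop_proj hS isOp_grad.cont, inner_dop_adjoint hS isOp_grad.cont isOp_div.cont.neg
        inner_sGrad', dop_neg hS isOp_div.cont, hq, neg_zero, inner_zero_left]
  have hp' : p ∈ K := by
    rw [L2σ, Submodule.orthogonal_orthogonal_eq_closure] at hp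
    exact Submodule.topologicalClosure_minimal _ hle hK hp
  rw [real_inner_comm]
  exact hp'

theorem inner_Ftr_leray (T : L2) (hS : IsCut S) {q : LC} (hq : dop S sDiv q = 0) :
    inner ℝ (Ftr (leray T)) (proj S q) = inner ℝ (Ftr T) (proj S q) := by
  have h1 : T - leray T ∈ L2σᗮ := L2σ.sub_starProjection_mem_orthogonal T
  have h2 := inner_eq_zero_of_mem_orthogonal h1 hS hq
  rw [map_sub, inner_sub_left] at h2
  linarith

theorem dop_sDiv_dop_sD (hS : IsCut S) (j : Fin 3) {q : LC} (hq : dop S sDiv q = 0) :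
    dop S sDiv (dop S (sD j) q) = 0 := by
  refine Lp.ext ?_
  have h0 : dop S sDiv q =ᵐ[volume] 0 := by rw [hq]; exact Lp.coeFn_zero _ _ _
  filter_upwards [dop_coe hS isOp_div.cont (dop S (sD j) q), dop_coe hS (continuous_sD j) q,
    dop_coe hS isOp_div.cont q, h0, Lp.coeFn_zero V 2 (volume : Measure R3)] with ξ h1 h2 h3 h4 h5
  rw [h1, h5]
  by_cases hξ : ξ ∈ S
  · rw [h3] at h4
    simp only [hξ, indicator_of_mem, Pi.zero_apply] at h4 ⊢
    rw [h2]
    simp only [hξ, indicator_of_mem]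
    ext i
    have h6 := congrArg (fun v : V => v i) h4
    simp only [sDiv_apply, PiLp.zero_apply] at h6
    rw [sDiv_apply]
    split_ifs at h6 ⊢
    · simp only [sD_apply, PiLp.zero_apply]
      linear_combination ((2 * Real.pi * ξ j : ℝ) : ℂ) * Complex.I * h6
    · rfl
  · simp [hξ]

/-- This removes the projector from the transport term: the derivative of a divergence free field is
divergence free, so the part of `T` orthogonal to `L2σ` is not seen. -/
theorem inner_Ftr_leray_dop (T : L2) (hS : IsCut S) (j : Fin 3) {q : LC} (hq : dop S sDiv q = 0) :
    inner ℝ (Ftr (leray T)) (dop S (sD j) q) = inner ℝ (Ftr T) (dop S (sD j) q) := by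
  have h := inner_Ftr_leray T hS (dop_sDiv_dop_sD hS j hq)
  have e : proj S (dop S (sD j) q) = dop S (sD j) q := by
    refine Lp.ext ?_
    filter_upwards [proj_coe hS (dop S (sD j) q), dop_coe hS (continuous_sD j) q] with ξ h1 h2
    rw [h1]
    by_cases hξ : ξ ∈ S
    · simp [hξ]
    · rw [h2]; simp [hξ]
  rwa [e] at h

end Weak

end

section

/-! ### Mollification -/

/-- `K * f`. -/
def moll (K : R3 → ℝ) (f : L2) (x : R3) : R3 := ∫ y, K (x - y) • f y

theorem IsMollifier.scale {θ : R3 → ℝ} (h : IsMollifier θ) {ε : ℝ} (hε : 0 < ε) :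
    IsMollifier (fun z => (ε ^ 3)⁻¹ * θ (ε⁻¹ • z)) where
  test := by
    refine ⟨contDiff_const.mul (h.test.1.comp (contDiff_const_smul _)), ?_⟩
    have h0 : ε⁻¹ ≠ 0 := by positivity
    have := h.test.2.comp_homeomorph (Homeomorph.smulOfNeZero _ h0)
    exact this.mul_left
  nonneg x := mul_nonneg (by positivity) (h.nonneg _)
  even x := by rw [smul_neg, h.even]
  integral_eq_one := by
    rw [integral_const_mul, Measure.integral_comp_inv_smul, h.integral_eq_one]
    simp [abs_of_pos hε, hε.ne']

section Moll

variable {K : R3 → ℝ}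

theorem IsMollifier.test_shift (hK : IsMollifier K) (x v : R3) :
    IsTest (fun y => K (x - y) • v) := by
  refine ⟨(hK.test.1.comp (contDiff_const.sub contDiff_id)).smul contDiff_const, ?_⟩
  exact (hK.test.2.comp_homeomorph (Homeomorph.subLeft x)).smul_right

theorem IsMollifier.continuous (hK : IsMollifier K) : Continuous K := hK.test.1.continuous

theorem L2_locallyIntegrable (f : L2) : LocallyIntegrable f (volume : Measure R3) :=
  (Lp.memLp f).locallyIntegrable (by norm_num)

theorem IsMollifier.integrable_smul (hK : IsMollifier K) (f : L2) (x : R3) :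
    Integrable (fun y => K (x - y) • f y) := by
  have := (L2_locallyIntegrable f).integrable_smul_left_of_hasCompactSupport
    (hK.continuous.comp (continuous_const.sub continuous_id))
    (hK.test.2.comp_homeomorph (Homeomorph.subLeft x))
  exact this

/-- Point values of a mollified field are `L²` pairings. Hence they obey a uniform bound and pass to
limits under weak convergence. -/
theorem inner_moll (hK : IsMollifier K) (f : L2) (x v : R3) :
    inner ℝ (moll K f x) v = inner ℝ f (hK.test_shift x v).toL2 := by
  rw [inner_toL2, pair, moll, real_inner_comm, ← integral_inner (hK.integrable_smul f x)]
  refine integral_congr_ae (.of_forall fun y => ?_)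
  simp only [inner_smul_right]
  rw [real_inner_comm]

/-- The `L²` norm of the kernel. -/
def kerNorm (K : R3 → ℝ) : ℝ := √(∫ y, K y ^ 2)

theorem norm_moll_le (hK : IsMollifier K) (f : L2) (x : R3) : ‖moll K f x‖ ≤ kerNorm K * ‖f‖ := by
  have h1 := inner_moll hK f x (moll K f x)
  rw [real_inner_self_eq_norm_sq] at h1
  have h2 : ‖(hK.test_shift x (moll K f x)).toL2‖ = kerNorm K * ‖moll K f x‖ := by
    rw [← sq_eq_sq₀ (norm_nonneg _) (by unfold kerNorm; positivity), mul_pow, kerNorm,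
      Real.sq_sqrt (by positivity), ← real_inner_self_eq_norm_sq, inner_toL2, pair,
      ← integral_mul_const]
    have e : ∫ y, K y ^ 2 * ‖moll K f x‖ ^ 2 = ∫ y, K (x - y) ^ 2 * ‖moll K f x‖ ^ 2 :=
      (integral_sub_left_eq_self (fun y => K y ^ 2 * ‖moll K f x‖ ^ 2) volume x).symm
    rw [e]
    refine integral_congr_ae ?_
    filter_upwards [(hK.test_shift x (moll K f x)).memLp.coeFn_toLp] with y hy
    rw [IsTest.toL2, hy, real_inner_self_eq_norm_sq, norm_smul, mul_pow, Real.norm_eq_abs, sq_abs]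
  have h3 := real_inner_le_norm f (hK.test_shift x (moll K f x)).toL2
  rw [h2, ← h1] at h3
  by_cases h0 : ‖moll K f x‖ = 0
  · rw [h0]; unfold kerNorm; positivity
  · have : 0 < ‖moll K f x‖ := lt_of_le_of_ne (norm_nonneg _) (Ne.symm h0)
    nlinarith

theorem continuous_moll (hK : IsMollifier K) (f : L2) : Continuous (moll K f) :=
  hK.test.2.continuous_convolution_right (ContinuousLinearMap.lsmul ℝ ℝ).flip
    (L2_locallyIntegrable f) hK.continuous

theorem lintegral_shift (hK : IsMollifier K) (x : R3) :
    ∫⁻ y, ENNReal.ofReal (K (x - y)) = 1 := by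
  rw [lintegral_sub_left_eq_self (fun y => ENNReal.ofReal (K y)),
    ← ofReal_integral_eq_lintegral_ofReal
      (hK.continuous.integrable_of_hasCompactSupport hK.test.2) (.of_forall hK.nonneg),
    hK.integral_eq_one, ENNReal.ofReal_one]

/-- Cauchy–Schwarz for the probability density `K(x - y) dy`, the kernel being split as `k^(1/2) ·
k^(1/2)`. Integrated in `x`, it shows that mollification does not increase the `L²` norm, whatever
the kernel. -/
theorem enorm_moll_sq_le (hK : IsMollifier K) (f : L2) (x : R3) :
    ‖moll K f x‖ₑ ^ 2 ≤ ∫⁻ y, ENNReal.ofReal (K (x - y)) * ‖f y‖ₑ ^ 2 := by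
  set k : R3 → ℝ≥0∞ := fun y => ENNReal.ofReal (K (x - y))
  have hk : Measurable k :=
    (hK.continuous.comp (continuous_const.sub continuous_id)).measurable.ennreal_ofReal
  have hf : AEMeasurable (fun y => ‖f y‖ₑ) volume := (Lp.aestronglyMeasurable f).enorm
  have h1 : ‖moll K f x‖ₑ ≤ ∫⁻ y, k y * ‖f y‖ₑ := by
    refine (enorm_integral_le_lintegral_enorm _).trans (le_of_eq ?_)
    refine lintegral_congr fun y => ?_
    rw [enorm_smul, Real.enorm_eq_ofReal (hK.nonneg _)]
  have h2 := ENNReal.lintegral_mul_le_Lp_mul_Lq volume Real.HolderConjugate.two_two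
    (f := fun y => k y ^ (1 / 2 : ℝ)) (g := fun y => k y ^ (1 / 2 : ℝ) * ‖f y‖ₑ)
    (hk.pow_const _).aemeasurable ((hk.pow_const _).aemeasurable.mul hf)
  have e1 : ∀ y, ((fun y => k y ^ (1 / 2 : ℝ)) * fun y => k y ^ (1 / 2 : ℝ) * ‖f y‖ₑ) y
      = k y * ‖f y‖ₑ := by
    intro y
    simp only [Pi.mul_apply]
    rw [← mul_assoc, ← ENNReal.rpow_add_of_nonneg _ _ (by norm_num) (by norm_num)]
    norm_num
  have e2 : ∀ y, (k y ^ (1 / 2 : ℝ)) ^ (2 : ℝ) = k y := by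
    intro y; rw [← ENNReal.rpow_mul]; norm_num
  simp only [e1, ENNReal.mul_rpow_of_nonneg _ _ (zero_le_two (α := ℝ)), e2] at h2
  have e3 : ∫⁻ y, k y = 1 := lintegral_shift hK x
  rw [e3, ENNReal.one_rpow, one_mul] at h2
  calc ‖moll K f x‖ₑ ^ 2 ≤ ((∫⁻ y, k y * ‖f y‖ₑ ^ (2 : ℝ)) ^ (1 / 2 : ℝ)) ^ 2 := by
        gcongr; exact h1.trans h2
    _ = ∫⁻ y, k y * ‖f y‖ₑ ^ (2 : ℝ) := by
        rw [← ENNReal.rpow_natCast, ← ENNReal.rpow_mul]; norm_num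
    _ = _ := by simp only [ENNReal.rpow_two]; rfl

theorem lintegral_moll_sq_le (hK : IsMollifier K) (f : L2) :
    ∫⁻ x, ‖moll K f x‖ₑ ^ 2 ≤ ‖f‖ₑ ^ 2 := by
  have hf : AEMeasurable (fun y => ‖f y‖ₑ) volume := (Lp.aestronglyMeasurable f).enorm
  calc ∫⁻ x, ‖moll K f x‖ₑ ^ 2 ≤ ∫⁻ x, ∫⁻ y, ENNReal.ofReal (K (x - y)) * ‖f y‖ₑ ^ 2 :=
        lintegral_mono fun x => enorm_moll_sq_le hK f x
    _ = ∫⁻ y, ∫⁻ x, ENNReal.ofReal (K (x - y)) * ‖f y‖ₑ ^ 2 := by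
        refine lintegral_lintegral_swap ?_
        refine AEMeasurable.mul ?_ (hf.comp_snd.pow_const 2)
        exact (hK.continuous.comp (continuous_fst.sub continuous_snd)).measurable.ennreal_ofReal.aemeasurable
    _ = ∫⁻ y, ‖f y‖ₑ ^ 2 := by
        refine lintegral_congr fun y => ?_
        rw [lintegral_mul_const']
        · have e : ∀ x, K (x - y) = K (y - x) := fun x => by rw [← hK.even, neg_sub]
          simp only [e, lintegral_shift hK, one_mul]
        · exact ENNReal.pow_ne_top enorm_ne_top
    _ = ‖f‖ₑ ^ 2 := by
        rw [Lp.enorm_def, eLpNorm_eq_lintegral_rpow_enorm_toReal (by norm_num) (by norm_num)]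
        rw [← ENNReal.rpow_natCast, ← ENNReal.rpow_mul]
        simp

/-! ### Multiplication by bounded continuous functions -/

/-- Bounded continuous scalar functions. -/
structure IsBC (a : R3 → ℝ) : Prop where
  cont : Continuous a
  bdd : ∃ C, ∀ x, |a x| ≤ C

theorem IsBC.memLp {a : R3 → ℝ} (h : IsBC a) (f : L2) : MemLp (fun x => a x • f x) 2 volume := by
  obtain ⟨C, hC⟩ := h.bdd
  refine (Lp.memLp f).of_le_mul (c := C)
    (h.cont.aestronglyMeasurable.smul (Lp.aestronglyMeasurable f)) (.of_forall fun x => ?_)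
  rw [norm_smul]
  exact mul_le_mul_of_nonneg_right (hC x) (norm_nonneg _)

open Classical in
/-- Multiplication of a real field by a bounded continuous function. -/
def rmul (a : R3 → ℝ) (f : L2) : L2 := if h : IsBC a then (h.memLp f).toLp _ else 0

theorem rmul_coe {a : R3 → ℝ} (h : IsBC a) (f : L2) : rmul a f =ᵐ[volume] fun x => a x • f x := by
  rw [rmul, dif_pos h]; exact MemLp.coeFn_toLp _

/-- Multiplication of a complex field by a bounded continuous function. -/
def cmul (a : R3 → ℝ) : LC →L[ℝ] LC := mul (fun x => a x • ContinuousLinearMap.id ℝ V)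

theorem IsBC.isSymb {a : R3 → ℝ} (h : IsBC a) : IsSymb (fun x => a x • ContinuousLinearMap.id ℝ V) := by
  obtain ⟨C, hC⟩ := h.bdd
  refine ⟨(h.cont.smul continuous_const).stronglyMeasurable, C, fun x => ?_⟩
  rw [norm_smul]
  calc |a x| * _ ≤ |a x| * 1 := by gcongr; exact ContinuousLinearMap.norm_id_le
    _ ≤ C := by rw [mul_one]; exact hC x

theorem cmul_coe {a : R3 → ℝ} (h : IsBC a) (f : LC) : cmul a f =ᵐ[volume] fun x => a x • f x :=
  mul_coe h.isSymb f

theorem cpx_rmul {a : R3 → ℝ} (h : IsBC a) (f : L2) : cpx (rmul a f) = cmul a (cpx f) := by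
  refine Lp.ext ?_
  filter_upwards [cpx_coe (rmul a f), cmul_coe h (cpx f), rmul_coe h f, cpx_coe f] with x h1 h2 h3 h4
  rw [h1, h2, h3, h4, map_smul]

theorem inner_rmul {a : R3 → ℝ} (h : IsBC a) (f g : L2) :
    inner ℝ (rmul a f) g = ∫ x, a x * inner ℝ (f x) (g x) := by
  rw [L2.inner_def]
  refine integral_congr_ae ?_
  filter_upwards [rmul_coe h f] with x hx
  rw [hx, real_inner_smul_left]

theorem inner_rmul_comm {a : R3 → ℝ} (h : IsBC a) (f g : L2) :
    inner ℝ (rmul a f) g = inner ℝ f (rmul a g) := by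
  rw [inner_rmul h, real_inner_comm, inner_rmul h]
  exact integral_congr_ae (.of_forall fun x => by simp only [real_inner_comm])

theorem isBC_moll (hK : IsMollifier K) (f : L2) (j : Fin 3) : IsBC (fun x => moll K f x j) := by
  refine ⟨(EuclideanSpace.proj j : R3 →L[ℝ] ℝ).continuous.comp (continuous_moll hK f),
    kerNorm K * ‖f‖, fun x => ?_⟩
  exact (by simpa using PiLp.norm_apply_le (moll K f x) j : |moll K f x j| ≤ ‖moll K f x‖).trans
    (norm_moll_le hK f x)

/-- For a fixed field `g` the multiplier converges pointwise as `s → r` by `inner_moll` and is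
locally bounded uniformly in `x`, so dominated convergence gives continuity in norm. The factor `f`
of `WCont.rmul` can then be merely weakly continuous, the multiplication being moved onto the test
field. -/
theorem continuousOn_rmul (hK : IsMollifier K) {u : ℝ → L2} (hu : WCont u) (j : Fin 3) (g : L2) :
    ContinuousOn (fun s => rmul (fun x => moll K (u s) x j) g) (Ici 0) := by
  intro r hr
  obtain ⟨C, hC0, hC⟩ := hu.exists_bound (r + 1)
  have hk : 0 ≤ kerNorm K := by unfold kerNorm; positivity
  have hg : Integrable (fun x => ‖g x‖ ^ 2) :=
    (memLp_two_iff_integrable_sq_norm (Lp.aestronglyMeasurable g)).1 (Lp.memLp g)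
  have habs : ∀ (s : ℝ) (x : R3), 0 ≤ s → s ≤ r + 1 → |moll K (u s) x j| ≤ kerNorm K * C := by
    intro s x h0 h1
    refine (by simpa using PiLp.norm_apply_le (moll K (u s) x) j :
      |moll K (u s) x j| ≤ ‖moll K (u s) x‖).trans ((norm_moll_le hK _ x).trans ?_)
    gcongr
    exact hC s h0 h1
  have key : Tendsto (fun s => ∫ x, (moll K (u s) x j - moll K (u r) x j) ^ 2 * ‖g x‖ ^ 2)
      (𝓝[Ici 0] r) (𝓝 (∫ x : R3, (0 : ℝ))) := by
    refine tendsto_integral_filter_of_dominated_convergence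
      (fun x => (2 * (kerNorm K * C)) ^ 2 * ‖g x‖ ^ 2) ?_ ?_ (hg.const_mul _) ?_
    · refine .of_forall fun s => ?_
      exact (((isBC_moll hK (u s) j).cont.sub (isBC_moll hK (u r) j).cont).pow 2).aestronglyMeasurable.mul
        hg.aestronglyMeasurable
    · have h4 : ∀ᶠ t in 𝓝[Ici 0] r, t ≤ r + 1 :=
        nhdsWithin_le_nhds (Iic_mem_nhds (by linarith))
      filter_upwards [self_mem_nhdsWithin, h4] with s hs0 hs1
      refine .of_forall fun x => ?_
      rw [Real.norm_of_nonneg (by positivity)]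
      gcongr ?_ * _
      refine sq_le_sq' ?_ ?_ <;>
        linarith [abs_le.1 (habs s x hs0 hs1), abs_le.1 (habs r x hr (by linarith))]
    · refine .of_forall fun x => ?_
      have h1 : Tendsto (fun s => moll K (u s) x j) (𝓝[Ici 0] r) (𝓝 (moll K (u r) x j)) := by
        have := hu ((hK.test_shift x (EuclideanSpace.single j 1)).toL2) r hr
        simp only [ContinuousWithinAt, ← inner_moll hK] at this
        simpa [EuclideanSpace.inner_single_right] using this
      have h2 := ((h1.sub_const (moll K (u r) x j)).pow 2).mul_const (‖g x‖ ^ 2)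
      simpa using h2
  rw [integral_zero] at key
  have hn : ∀ s, ‖rmul (fun x => moll K (u s) x j) g - rmul (fun x => moll K (u r) x j) g‖
      = √(∫ x, (moll K (u s) x j - moll K (u r) x j) ^ 2 * ‖g x‖ ^ 2) := by
    intro s
    rw [← Real.sqrt_sq (norm_nonneg (_ - _)), ← real_inner_self_eq_norm_sq, L2.inner_def]
    congr 1
    refine integral_congr_ae ?_
    filter_upwards [rmul_coe (isBC_moll hK (u s) j) g, rmul_coe (isBC_moll hK (u r) j) g,
      Lp.coeFn_sub (rmul (fun x => moll K (u s) x j) g) (rmul (fun x => moll K (u r) x j) g)]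
      with x h1 h2 h3
    rw [h3, Pi.sub_apply, h1, h2, ← sub_smul, real_inner_self_eq_norm_sq, norm_smul, mul_pow,
      Real.norm_eq_abs, sq_abs]
  refine tendsto_iff_norm_sub_tendsto_zero.2 ?_
  simp_rw [hn]
  have := (Real.continuous_sqrt.tendsto 0).comp key
  rwa [Real.sqrt_zero] at this

theorem WCont.rmul (hK : IsMollifier K) {u f : ℝ → L2} (hu : WCont u) (hf : WCont f) (j : Fin 3) :
    WCont (fun s => rmul (fun x => moll K (u s) x j) (f s)) := by
  intro g
  simp_rw [inner_rmul_comm (isBC_moll hK _ j)]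
  exact hf.continuousOn_inner (continuousOn_rmul hK hu j g)

/-! ### The Fourier transform of integrable fields -/

/-- The Plancherel transform and the Fourier integral of a field in `L¹ ∩ L²` have the same pairings
with smooth compactly supported functions, because both satisfy `∫ ĝ T = ∫ g T̂`. -/
theorem FC_ae_eq {T : LC} (hT : Integrable T) : FC T =ᵐ[volume] 𝓕 (T : R3 → V) := by
  have hc : Continuous (𝓕 (T : R3 → V)) :=
    VectorFourier.fourierIntegral_continuous Real.continuous_fourierChar
      (by exact continuous_inner) hT
  refine ae_eq_of_integral_contDiff_smul_eq ((Lp.memLp (FC T)).locallyIntegrable (by norm_num))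
    hc.locallyIntegrable fun g hg hgs => ?_
  have hgc : IsTest (fun x => (g x : ℂ)) :=
    ⟨Complex.ofRealCLM.contDiff.comp hg, hgs.comp_left (g := fun a : ℝ => (a : ℂ)) (by simp)⟩
  set G : SchwartzMap R3 ℂ := hgc.2.toSchwartzMap hgc.1
  have hG : ∀ x, G x = (g x : ℂ) := fun _ => rfl
  have h1 := congrArg (fun D => D G) (Lp.fourier_toTemperedDistribution_eq T)
  simp only [TemperedDistribution.fourier_apply, Lp.toTemperedDistribution_apply] at h1
  have h2 : ∫ ξ, 𝓕 (G : R3 → ℂ) ξ • T ξ = ∫ x, G x • 𝓕 (T : R3 → V) x := by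
    simpa using! VectorFourier.integral_fourierIntegral_smul_eq_flip (L := innerₗ R3)
      (f := (G : R3 → ℂ)) (g := (T : R3 → V)) Real.continuous_fourierChar
      (by exact continuous_inner) G.integrable hT
  have h3 : ∀ x, (𝓕 G : SchwartzMap R3 ℂ) x = 𝓕 (G : R3 → ℂ) x := fun _ => rfl
  simp_rw [h3] at h1
  rw [h1] at h2
  simp_rw [hG] at h2
  rw [FC_apply]
  simpa only [Complex.coe_smul] using h2

theorem norm_FC_le {T : LC} (hT : Integrable T) : ∀ᵐ ξ, ‖FC T ξ‖ ≤ ∫ x, ‖T x‖ := by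
  filter_upwards [FC_ae_eq hT] with ξ hξ
  rw [hξ]
  exact VectorFourier.norm_fourierIntegral_le_integral_norm _ _ _ _ _

theorem abs_inner_FC_le {T g : LC} (hT : Integrable T) (hg : Integrable g) :
    |inner ℝ (FC T) g| ≤ (∫ x, ‖T x‖) * ∫ ξ, ‖g ξ‖ := by
  rw [L2.inner_def, ← integral_const_mul, ← Real.norm_eq_abs]
  refine norm_integral_le_of_norm_le (hg.norm.const_mul _) ?_
  filter_upwards [norm_FC_le hT] with ξ hξ
  exact (norm_inner_le_norm _ _).trans (mul_le_mul_of_nonneg_right hξ (norm_nonneg _))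

end Moll

end

/-! ### Transport by the mollified velocity, on the Fourier side. -/

section

section Moll

variable {K : R3 → ℝ}

/-! ### The mollification of a divergence free field is divergence free -/

theorem inner_gradient (ψ : R3 → ℝ) (x v : R3) : inner ℝ v (∇ ψ x) = fderiv ℝ ψ x v := by
  rw [real_inner_comm]; exact InnerProductSpace.toDual_symm_apply

theorem isTest_convolution (hK : IsMollifier K) {ψ : R3 → ℝ} (hψ : IsTest ψ) :
    IsTest (convolution K ψ (ContinuousLinearMap.lsmul ℝ ℝ) volume) :=
  ⟨hψ.2.contDiff_convolution_right _ hK.continuous.locallyIntegrable hψ.1,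
    hK.test.2.convolution _ hψ.2⟩

theorem inner_gradient_convolution (hK : IsMollifier K) {ψ : R3 → ℝ} (hψ : IsTest ψ) (y v : R3) :
    inner ℝ v (∇ (convolution K ψ (ContinuousLinearMap.lsmul ℝ ℝ) volume) y)
      = ∫ x, K (x - y) * inner ℝ v (∇ ψ x) := by
  have hψ1 : ContDiff ℝ 1 ψ := hψ.1.of_le (by simp)
  rw [inner_gradient, (hψ.2.hasFDerivAt_convolution_right (ContinuousLinearMap.lsmul ℝ ℝ)
    hK.continuous.locallyIntegrable hψ1 y).fderiv]
  have hc : Continuous (fderiv ℝ ψ) := hψ1.continuous_fderiv (by norm_num)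
  rw [convolution_precompR_apply _ hK.continuous.locallyIntegrable (hψ.2.fderiv (𝕜 := ℝ)) hc,
    convolution_def, ← integral_sub_left_eq_self (fun x => (K (x - y) * inner ℝ v (∇ ψ x))) volume y]
  refine integral_congr_ae (.of_forall fun x => ?_)
  simp only [inner_gradient]
  rw [show y - x - y = -x by abel, hK.even]
  simp

/-- By Fubini and the evenness of `K`, the kernel is moved onto `ψ`; the convolution of `K` with `ψ`
is again a test function, against whose gradient `f` integrates to zero. -/
theorem integral_moll_gradient (hK : IsMollifier K) {f : L2} (hf : f ∈ L2σ) {ψ : R3 → ℝ}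
    (hψ : IsTest ψ) : ∫ x, inner ℝ (moll K f x) (∇ ψ x) = 0 := by
  have e1 : ∀ x, inner ℝ (moll K f x) (∇ ψ x) = ∫ y, K (x - y) * inner ℝ (f y) (∇ ψ x) := by
    intro x
    rw [moll, real_inner_comm, ← integral_inner (hK.integrable_smul f x)]
    refine integral_congr_ae (.of_forall fun y => ?_)
    simp only [inner_smul_right]
    rw [real_inner_comm]
  simp_rw [e1]
  obtain ⟨M, hM⟩ := hK.continuous.bounded_above_of_compact_support hK.test.2
  have hM0 : 0 ≤ M := (norm_nonneg _).trans (hM 0)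
  -- All `y` for which the integrand can be nonzero lie in the compact set `supp ∇ψ - supp K`; there
  -- `f` is integrable, as Fubini requires.
  set B : Set R3 := (fun p : R3 × R3 => p.1 - p.2) '' (tsupport (∇ ψ) ×ˢ tsupport K)
  have hB : IsCompact B := (hψ.gradient.2.isCompact.prod hK.test.2.isCompact).image continuous_sub
  have hint : Integrable (fun p : R3 × R3 => K (p.1 - p.2) * inner ℝ (f p.2) (∇ ψ p.1))
      (volume.prod volume) := by
    have i1 : Integrable (fun x => M * ‖∇ ψ x‖) :=
      (hψ.gradient.1.continuous.integrable_of_hasCompactSupport hψ.gradient.2).norm.const_mul M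
    have i2 : Integrable (B.indicator fun y => ‖f y‖) :=
      (integrable_indicator_iff hB.measurableSet).2
        ((L2_locallyIntegrable f).integrableOn_isCompact hB).norm
    refine (i1.mul_prod i2).mono' ?_ (.of_forall fun p => ?_)
    · refine AEStronglyMeasurable.mul
        (hK.continuous.comp (continuous_fst.sub continuous_snd)).aestronglyMeasurable ?_
      exact (Lp.aestronglyMeasurable f).comp_snd.inner
        (hψ.gradient.1.continuous.comp continuous_fst).aestronglyMeasurable
    · by_cases h0 : ∇ ψ p.1 = 0
      · simp [h0]
      by_cases h1 : K (p.1 - p.2) = 0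
      · rw [h1, zero_mul, norm_zero]
        exact mul_nonneg (by positivity) (indicator_nonneg (fun _ _ => norm_nonneg _) _)
      have hp : p.2 ∈ B :=
        ⟨(p.1, p.1 - p.2), ⟨subset_tsupport _ h0, subset_tsupport _ h1⟩, by simp⟩
      rw [indicator_of_mem hp, norm_mul]
      calc ‖K (p.1 - p.2)‖ * ‖inner ℝ (f p.2) (∇ ψ p.1)‖
          ≤ M * (‖f p.2‖ * ‖∇ ψ p.1‖) := by
            gcongr; exacts [hM _, norm_inner_le_norm _ _]
        _ = _ := by ring
  rw [integral_integral_swap hint]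
  simp_rw [← inner_gradient_convolution hK hψ]
  exact (mem_L2σ f).1 hf _ (isTest_convolution hK hψ)

/-! ### The transport operator -/

theorem memLp_moll (hK : IsMollifier K) (f : L2) : MemLp (moll K f) 2 volume := by
  refine ⟨(continuous_moll hK f).aestronglyMeasurable, ?_⟩
  rw [eLpNorm_lt_top_iff_lintegral_rpow_enorm_lt_top (by norm_num) (by norm_num)]
  simpa using (lintegral_moll_sq_le hK f).trans_lt (ENNReal.pow_lt_top enorm_lt_top)

theorem integral_norm_moll_sq_le (hK : IsMollifier K) (f : L2) :
    ∫ x, ‖moll K f x‖ ^ 2 ≤ ‖f‖ ^ 2 := by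
  rw [integral_eq_lintegral_of_nonneg_ae (.of_forall fun x => sq_nonneg ‖moll K f x‖)
    (by exact ((continuous_moll hK f).norm.pow 2).aestronglyMeasurable)]
  refine ENNReal.toReal_le_of_le_ofReal (by positivity) ?_
  calc _ = ∫⁻ x, ‖moll K f x‖ₑ ^ 2 := by
        refine lintegral_congr fun x => ?_
        rw [ENNReal.ofReal_pow (norm_nonneg _), ofReal_norm]
    _ ≤ _ := lintegral_moll_sq_le hK f
    _ = _ := by rw [ENNReal.ofReal_pow (norm_nonneg _), ofReal_norm]

theorem integral_norm_LC_sq (q : LC) : ∫ x, ‖q x‖ ^ 2 = ‖q‖ ^ 2 := by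
  rw [← real_inner_self_eq_norm_sq, L2.inner_def]
  simp_rw [real_inner_self_eq_norm_sq]

theorem integral_mul_norm_le {ν : Measure R3} {f g : R3 → ℝ} (hf : MemLp f 2 ν) (hg : MemLp g 2 ν)
    (hf0 : ∀ x, 0 ≤ f x) (hg0 : ∀ x, 0 ≤ g x) :
    ∫ x, f x * g x ∂ν ≤ √(∫ x, f x ^ 2 ∂ν) * √(∫ x, g x ^ 2 ∂ν) := by
  have := integral_mul_le_Lp_mul_Lq_of_nonneg (μ := ν)
    Real.HolderConjugate.two_two (.of_forall hf0) (.of_forall hg0) (by simpa using hf)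
    (by simpa using hg)
  simpa [Real.sqrt_eq_rpow] using this

theorem integrable_norm_mul_norm (hK : IsMollifier K) (f : L2) (q : LC) :
    Integrable (fun x => ‖moll K f x‖ * ‖q x‖) :=
  (memLp_moll hK f).norm.integrable_mul (Lp.memLp q).norm

theorem integrable_cmul (hK : IsMollifier K) (f : L2) (j : Fin 3) (q : LC) :
    Integrable (cmul (fun x => moll K f x j) q) ∧
      ∫ x, ‖cmul (fun x => moll K f x j) q x‖ ≤ ‖f‖ * ‖q‖ := by
  have h1 := integrable_norm_mul_norm hK f q
  have h2 : ∀ᵐ x, ‖cmul (fun x => moll K f x j) q x‖ ≤ ‖moll K f x‖ * ‖q x‖ := by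
    filter_upwards [cmul_coe (isBC_moll hK f j) q] with x hx
    rw [hx, norm_smul]
    gcongr
    exact PiLp.norm_apply_le (moll K f x) j
  refine ⟨h1.mono' (Lp.aestronglyMeasurable _) h2, ?_⟩
  have h3 : Integrable (cmul (fun x => moll K f x j) q) :=
    h1.mono' (Lp.aestronglyMeasurable _) h2
  calc _ ≤ ∫ x, ‖moll K f x‖ * ‖q x‖ := integral_mono_ae h3.norm h1 h2
    _ ≤ √(∫ x, ‖moll K f x‖ ^ 2) * √(∫ x, ‖q x‖ ^ 2) :=
        integral_mul_norm_le (memLp_moll hK f).norm (Lp.memLp q).norm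
          (fun _ => norm_nonneg _) fun _ => norm_nonneg _
    _ ≤ √(‖f‖ ^ 2) * √(‖q‖ ^ 2) := by
        rw [integral_norm_LC_sq]
        gcongr
        exact integral_norm_moll_sq_le hK f
    _ = _ := by rw [Real.sqrt_sq (norm_nonneg _), Real.sqrt_sq (norm_nonneg _)]

/-- Multiplication by `(K * f)ⱼ`, on the Fourier side. -/
def conv (K : R3 → ℝ) (f : L2) (j : Fin 3) : LC →L[ℝ] LC :=
  (FC.toContinuousLinearEquiv : LC →L[ℝ] LC).comp ((cmul (fun x => moll K f x j)).comp
    (FC.symm.toContinuousLinearEquiv : LC →L[ℝ] LC))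

theorem conv_apply (f : L2) (j : Fin 3) (q : LC) :
    conv K f j q = FC (cmul (fun x => moll K f x j) (FC.symm q)) := rfl

theorem Ftr_rmul (hK : IsMollifier K) (f : L2) (j : Fin 3) (g : L2) :
    Ftr (rmul (fun x => moll K f x j) g) = conv K f j (Ftr g) := by
  rw [conv_apply]
  have e : ∀ h, Ftr h = FC (cpx h) := fun _ => rfl
  rw [e, e, LinearIsometryEquiv.symm_apply_apply, cpx_rmul (isBC_moll hK f j)]

theorem integrableOn_norm_mul {S : Set R3} (hS : IsCut S) (p : LC) :
    IntegrableOn (fun ξ => ‖ξ‖ * ‖p ξ‖) S := by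
  obtain ⟨R, hR⟩ := hS.bdd.exists_norm_le
  have h1 : IntegrableOn (fun ξ => ‖p ξ‖) S :=
    ((((Lp.memLp p).locallyIntegrable (by norm_num)).integrableOn_isCompact
      (isCompact_closedBall (0 : R3) R)).mono_set (fun x hx => by simpa using hR x hx)).norm
  refine (h1.const_mul R).mono'
    (continuous_norm.aestronglyMeasurable.mul (Lp.aestronglyMeasurable p).norm.restrict) ?_
  refine (ae_restrict_iff' hS.meas).2 (.of_forall fun ξ hξ => ?_)
  rw [norm_mul, norm_norm, norm_norm]
  gcongr
  exact hR _ hξ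

theorem integrable_dop_sD {S : Set R3} (hS : IsCut S) (j : Fin 3) (p : LC) :
    Integrable (dop S (sD j) p) ∧
      ∫ ξ, ‖dop S (sD j) p ξ‖ ≤ 2 * Real.pi * ∫ ξ in S, ‖ξ‖ * ‖p ξ‖ := by
  have h1 := (integrable_indicator_iff hS.meas).2
    ((integrableOn_norm_mul hS p).const_mul (2 * Real.pi))
  have h2 : ∀ᵐ ξ, ‖dop S (sD j) p ξ‖
      ≤ S.indicator (fun ξ => 2 * Real.pi * (‖ξ‖ * ‖p ξ‖)) ξ := by
    filter_upwards [dop_coe hS (continuous_sD j) p] with ξ hξ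
    rw [hξ]
    by_cases hm : ξ ∈ S
    · simp only [hm, indicator_of_mem]
      rw [← mul_assoc]; exact norm_sD_le j ξ _
    · simp [hm]
  refine ⟨h1.mono' (Lp.aestronglyMeasurable _) h2, ?_⟩
  have h3 : Integrable (dop S (sD j) p) := h1.mono' (Lp.aestronglyMeasurable _) h2
  calc _ ≤ _ := integral_mono_ae h3.norm h1 h2
    _ = _ := by rw [integral_indicator hS.meas, integral_const_mul]

/-- The product of two `L²` fields is in `L¹`, so its Fourier transform is bounded, and the
derivative on the test field contributes the weight `2π|ξ|`, once for each of the three coordinates.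
The bound does not depend on the kernel, hence is uniform in `ε`. -/
theorem abs_sum_inner_conv_le (hK : IsMollifier K) (f : L2) (q p : LC) {S : Set R3}
    (hS : IsCut S) : |∑ j, inner ℝ (conv K f j q) (dop S (sD j) p)|
      ≤ 6 * Real.pi * (‖f‖ * ‖q‖) * ∫ ξ in S, ‖ξ‖ * ‖p ξ‖ := by
  calc _ ≤ ∑ j : Fin 3, |inner ℝ (conv K f j q) (dop S (sD j) p)| := Finset.abs_sum_le_sum_abs _ _
    _ ≤ ∑ j : Fin 3, (‖f‖ * ‖q‖) * (2 * Real.pi * ∫ ξ in S, ‖ξ‖ * ‖p ξ‖) := by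
        refine Finset.sum_le_sum fun j _ => ?_
        have h1 := integrable_cmul hK f j (FC.symm q)
        have h2 := integrable_dop_sD hS j p
        rw [conv_apply]
        refine (abs_inner_FC_le h1.1 h2.1).trans ?_
        rw [LinearIsometryEquiv.norm_map] at h1
        exact mul_le_mul h1.2 h2.2 (integral_nonneg fun _ => norm_nonneg _) (by positivity)
    _ = _ := by rw [Finset.sum_const, Finset.card_univ, Fintype.card_fin]; simp; ring

/-! ### The cancellation property -/

/-- By the Leibniz rule the sum is the integral of `(K * f)·∇(φ·ψ)`, and `K * f` is divergence free.
-/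
theorem sum_inner_rmul_pd (hK : IsMollifier K) {f : L2} (hf : f ∈ L2σ) {φ ψ : R3 → R3}
    (hφ : IsTest φ) (hψ : IsTest ψ) :
    ∑ j, (inner ℝ (rmul (fun x => moll K f x j) hφ.toL2) (hψ.pd j).toL2
      + inner ℝ (rmul (fun x => moll K f x j) hψ.toL2) (hφ.pd j).toL2) = 0 := by
  have hη : IsTest (fun x => inner ℝ (φ x) (ψ x)) :=
    ⟨hφ.1.inner ℝ hψ.1, hφ.2.mono fun x hx h0 => hx (by simp only [h0, inner_zero_left])⟩
  have hint : ∀ (α β : R3 → R3), IsTest α → IsTest β → ∀ j,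
      Integrable (fun x => moll K f x j * inner ℝ (α x) (β x)) := by
    intro α β hα hβ j
    refine Continuous.integrable_of_hasCompactSupport
      ((isBC_moll hK f j).cont.mul (hα.1.continuous.inner hβ.1.continuous)) ?_
    exact hα.2.mono fun x hx h0 => hx (by simp only [h0, inner_zero_left, mul_zero])
  have e : ∀ (α β : R3 → R3) (hα : IsTest α) (hβ : IsTest β) (j : Fin 3),
      inner ℝ (rmul (fun x => moll K f x j) hα.toL2) hβ.toL2
        = ∫ x, moll K f x j * inner ℝ (α x) (β x) := by
    intro α β hα hβ j
    rw [inner_rmul (isBC_moll hK f j)]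
    refine integral_congr_ae ?_
    filter_upwards [hα.memLp.coeFn_toLp, hβ.memLp.coeFn_toLp] with x h1 h2
    rw [IsTest.toL2, IsTest.toL2, h1, h2]
  simp_rw [e]
  rw [← integral_moll_gradient hK hf hη]
  have e2 : ∀ x, inner ℝ (moll K f x) (∇ (fun x => inner ℝ (φ x) (ψ x)) x)
      = ∑ j, (moll K f x j * inner ℝ (φ x) (pd j ψ x) + moll K f x j * inner ℝ (ψ x) (pd j φ x)) := by
    intro x
    have hd : ∀ j, fderiv ℝ (fun x => inner ℝ (φ x) (ψ x)) x (EuclideanSpace.single j 1)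
        = inner ℝ (φ x) (pd j ψ x) + inner ℝ (ψ x) (pd j φ x) := by
      intro j
      rw [fderiv_inner_apply ℝ (hφ.1.differentiable (by simp) x) (hψ.1.differentiable (by simp) x),
        real_inner_comm (ψ x) (fderiv ℝ φ x _)]
      rfl
    have hs : moll K f x = ∑ j, moll K f x j • EuclideanSpace.single j (1 : ℝ) := by
      ext i; simp [Finset.sum_apply, Pi.single_apply]
    rw [inner_gradient]
    conv_lhs => rw [hs]
    rw [map_sum]
    refine Finset.sum_congr rfl fun j _ => ?_
    rw [map_smul, hd, smul_eq_mul, mul_add]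
  simp_rw [e2]
  rw [integral_finsetSum _ fun j _ => by
    exact (hint _ _ hφ (hψ.pd j) j).add (hint _ _ hψ (hφ.pd j) j)]
  refine Finset.sum_congr rfl fun j _ => ?_
  rw [integral_add (hint _ _ hφ (hψ.pd j) j) (hint _ _ hψ (hφ.pd j) j)]

theorem cmul_I_smul {a : R3 → ℝ} (h : IsBC a) (q : LC) :
    cmul a (Complex.I • q) = Complex.I • cmul a q := by
  refine Lp.ext ?_
  filter_upwards [cmul_coe h (Complex.I • q), cmul_coe h q, Lp.coeFn_smul Complex.I q,
    Lp.coeFn_smul Complex.I (cmul a q)] with x h1 h2 h3 h4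
  rw [h1, h4, Pi.smul_apply, h2, h3, Pi.smul_apply, smul_comm]

theorem FC_symm_I_smul (q : LC) : FC.symm (Complex.I • q) = Complex.I • FC.symm q := by
  rw [LinearIsometryEquiv.symm_apply_eq, FC_I_smul, LinearIsometryEquiv.apply_symm_apply]

theorem inner_I_smul_I_smul (p q : LC) :
    inner ℝ (Complex.I • p) (Complex.I • q) = inner ℝ p q := by
  rw [L2.inner_def, L2.inner_def]
  refine integral_congr_ae ?_
  filter_upwards [Lp.coeFn_smul Complex.I p, Lp.coeFn_smul Complex.I q] with x h1 h2
  rw [h1, h2, Pi.smul_apply, Pi.smul_apply]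
  simp [PiLp.inner_apply, Complex.inner]
  
/-- The symmetrised trilinear form, in terms of weighted Fourier transforms. -/
def tform (K : R3 → ℝ) (f : L2) (G : LC) : LC →L[ℝ] ℝ :=
  ∑ j, ((innerSL ℝ (conv K f j (mul (bsym fun _ => ContinuousLinearMap.id ℝ V) G))).comp
      (mul (bsym (sD j)))
    + (innerSL ℝ (mul (bsym (sD j)) G)).comp
      ((conv K f j).comp (mul (bsym fun _ => ContinuousLinearMap.id ℝ V))))

theorem tform_apply (f : L2) (G G' : LC) : tform K f G G' =
    ∑ j, (inner ℝ (conv K f j (mul (bsym fun _ => ContinuousLinearMap.id ℝ V) G))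
        (mul (bsym (sD j)) G')
      + inner ℝ (conv K f j (mul (bsym fun _ => ContinuousLinearMap.id ℝ V) G'))
        (mul (bsym (sD j)) G)) := by
  simp only [tform, _root_.sum_apply, _root_.add_apply,
    ContinuousLinearMap.comp_apply, innerSL_apply_apply]
  refine Finset.sum_congr rfl fun j _ => ?_
  rw [real_inner_comm (conv K f j _) (mul (bsym (sD j)) G)]

theorem tform_comm (f : L2) (G G' : LC) : tform K f G G' = tform K f G' G := by
  rw [tform_apply, tform_apply]
  exact Finset.sum_congr rfl fun j _ => add_comm _ _

theorem conv_I_smul (hK : IsMollifier K) (f : L2) (j : Fin 3) (q : LC) :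
    conv K f j (Complex.I • q) = Complex.I • conv K f j q := by
  rw [conv_apply, conv_apply, FC_symm_I_smul, cmul_I_smul (isBC_moll hK f j), FC_I_smul]

/-- Mixed pairings of a real field with `i` times a real field vanish term by term; pairings of two
fields multiplied by `i` reduce to the real case. -/
theorem tform_tests (hK : IsMollifier K) {f : L2} (hf : f ∈ L2σ) {φ ψ : R3 → R3}
    (hφ : IsTest φ) (hψ : IsTest ψ) :
    tform K f (weighted hφ.cpx.toS) (weighted hψ.cpx.toS) = 0 ∧
    tform K f (weighted hφ.cpx.toS) (Complex.I • weighted hψ.cpx.toS) = 0 ∧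
    tform K f (Complex.I • weighted hφ.cpx.toS) (Complex.I • weighted hψ.cpx.toS) = 0 := by
  have b1 : ∀ {φ : R3 → R3} (hφ : IsTest φ), mul (bsym fun _ => ContinuousLinearMap.id ℝ V)
      (weighted hφ.cpx.toS) = Ftr hφ.toL2 := fun hφ => (IsOp.id.mono zero_le_two).mul_weighted hφ
  have b2 : ∀ {φ : R3 → R3} (hφ : IsTest φ) (j), mul (bsym (sD j)) (weighted hφ.cpx.toS)
      = Ftr (hφ.pd j).toL2 := fun hφ j => ((isOp_pd j).mono one_le_two).mul_weighted hφ
  have b3 : ∀ q, mul (bsym fun _ => ContinuousLinearMap.id ℝ V) (Complex.I • q)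
      = Complex.I • mul (bsym fun _ => ContinuousLinearMap.id ℝ V) q :=
    fun q => (IsOp.id.mono zero_le_two).mul_I_smul q
  have b4 : ∀ j q, mul (bsym (sD j)) (Complex.I • q) = Complex.I • mul (bsym (sD j)) q :=
    fun j q => ((isOp_pd j).mono one_le_two).mul_I_smul q
  have h0 : tform K f (weighted hφ.cpx.toS) (weighted hψ.cpx.toS) = 0 := by
    rw [tform_apply, ← sum_inner_rmul_pd hK hf hφ hψ]
    simp_rw [b1 hφ, b1 hψ, b2 hφ, b2 hψ, ← Ftr_rmul hK, inner_Ftr]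
  refine ⟨h0, ?_, ?_⟩
  · rw [tform_apply]
    refine Finset.sum_eq_zero fun j _ => ?_
    rw [b3, b4, conv_I_smul hK, b1 hφ, b1 hψ, b2 hφ, b2 hψ, ← Ftr_rmul hK, ← Ftr_rmul hK,
      inner_I_smul_Ftr, real_inner_comm, inner_I_smul_Ftr, add_zero]
  · rw [← h0, tform_apply, tform_apply]
    simp_rw [b3, b4, conv_I_smul hK, inner_I_smul_I_smul]

/-- The form is continuous and symmetric, so the density argument may be applied in one variable and
then in the other. -/
theorem tform_self (hK : IsMollifier K) {f : L2} (hf : f ∈ L2σ) (G : LC) : tform K f G G = 0 := by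
  have h1 : ∀ (φ : R3 → R3) (hφ : IsTest φ), tform K f (weighted hφ.cpx.toS) = 0 :=
    fun φ hφ => eq_zero_of_tests _ fun ψ hψ =>
      ⟨(tform_tests hK hf hφ hψ).1, (tform_tests hK hf hφ hψ).2.1⟩
  have h2 : ∀ (φ : R3 → R3) (hφ : IsTest φ), tform K f (Complex.I • weighted hφ.cpx.toS) = 0 :=
    fun φ hφ => eq_zero_of_tests _ fun ψ hψ =>
      ⟨(tform_comm _ _ _).trans (tform_tests hK hf hψ hφ).2.1, (tform_tests hK hf hφ hψ).2.2⟩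
  have h3 : tform K f G = 0 := eq_zero_of_tests _ fun φ hφ =>
    ⟨by rw [tform_comm, h1 φ hφ]; rfl, by rw [tform_comm, h2 φ hφ]; rfl⟩
  rw [h3]; rfl

/-- A band-limited field is not a test field, which is why the cancellation had to be extended by
density. For `G = 1_S (1 + |ξ|²) p` the weights cancel and the two halves of the symmetric form
coincide. -/
theorem sum_inner_conv_proj (hK : IsMollifier K) {f : L2} (hf : f ∈ L2σ) {S : Set R3}
    (hS : IsCut S) (p : LC) :
    ∑ j, inner ℝ (conv K f j (proj S p)) (dop S (sD j) p) = 0 := by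
  have h := tform_self hK hf (dop S (fun ξ => wt ξ • ContinuousLinearMap.id ℝ V) p)
  rw [tform_apply] at h
  have b1 : mul (bsym fun _ => ContinuousLinearMap.id ℝ V)
      (dop S (fun ξ => wt ξ • ContinuousLinearMap.id ℝ V) p) = proj S p :=
    (IsOp.id.mono zero_le_two).mul_bsym_dop hS p
  have b2 : ∀ j, mul (bsym (sD j)) (dop S (fun ξ => wt ξ • ContinuousLinearMap.id ℝ V) p)
      = dop S (sD j) p := fun j => ((isOp_pd j).mono one_le_two).mul_bsym_dop hS p
  simp_rw [b1, b2, ← two_mul, ← Finset.mul_sum] at h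
  linarith

end Moll

end

section

/-! ### The dissipation form -/

/-- The (polarised) rate of dissipation of the linear system at the frequencies in `S`. -/
def dform (c : Coeffs) (S : Set R3) (p q p' q' : LC) : ℝ :=
  c.μ * ∑ j, inner ℝ (dop S (sD j) p) (dop S (sD j) p')
    + c.γ * ∑ j, inner ℝ (dop S (sD j) q) (dop S (sD j) q')
    + c.κ * inner ℝ (dop S sDiv q) (dop S sDiv q')
    + c.χ * inner ℝ (dop S sCurl p - (2 : ℝ) • proj S q) (dop S sCurl p' - (2 : ℝ) • proj S q')

section Form

variable {c : Coeffs} {S : Set R3}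

theorem dform_comm (p q p' q' : LC) : dform c S p q p' q' = dform c S p' q' p q := by
  simp only [dform]
  congr 1
  · congr 1
    · congr 1
      · congr 1; exact Finset.sum_congr rfl fun j _ => real_inner_comm _ _
      · congr 1; exact Finset.sum_congr rfl fun j _ => real_inner_comm _ _
    · rw [real_inner_comm]
  · rw [real_inner_comm]

theorem dform_sub_left (p₁ q₁ p₂ q₂ p' q' : LC) :
    dform c S (p₁ - p₂) (q₁ - q₂) p' q' = dform c S p₁ q₁ p' q' - dform c S p₂ q₂ p' q' := by
  simp only [dform, map_sub, inner_sub_left, Finset.sum_sub_distrib, smul_sub]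
  ring

theorem dform_sub_right (p₁ q₁ p₂ q₂ p' q' : LC) :
    dform c S p' q' (p₁ - p₂) (q₁ - q₂) = dform c S p' q' p₁ q₁ - dform c S p' q' p₂ q₂ := by
  rw [dform_comm, dform_sub_left, dform_comm p₁, dform_comm p₂]

theorem dform_self (p q : LC) : dform c S p q p q =
    c.μ * ∑ j, ‖dop S (sD j) p‖ ^ 2 + c.γ * ∑ j, ‖dop S (sD j) q‖ ^ 2
    + c.κ * ‖dop S sDiv q‖ ^ 2 + c.χ * ‖dop S sCurl p - (2 : ℝ) • proj S q‖ ^ 2 := by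
  simp only [dform, real_inner_self_eq_norm_sq]

theorem dform_self_nonneg (p q : LC) : 0 ≤ dform c S p q p q := by
  rw [dform_self]
  have := c.μ_pos; have := c.χ_pos; have := c.γ_nonneg; have := c.κ_nonneg
  positivity

theorem inner_dop_sLap (hS : IsCut S) (p p' : LC) :
    inner ℝ p (dop S sLap p') = - ∑ j, inner ℝ (dop S (sD j) p) (dop S (sD j) p') := by
  rw [inner_dop_right hS isOp_lap.cont]
  simp_rw [inner_sLap, inner_dop_dop hS (continuous_sD _) (continuous_sD _)]
  rw [integral_neg, integral_finsetSum _ fun j _ =>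
    integrableOn_inner_dop hS (continuous_sD j) (continuous_sD j) p p']

theorem inner_dop_sCurl (hS : IsCut S) (p p' : LC) :
    inner ℝ p (dop S sCurl p') = inner ℝ (dop S sCurl p) (proj S p') := by
  rw [inner_dop_adjoint hS isOp_curl.cont isOp_curl.cont inner_sCurl, real_inner_comm,
    ← inner_dop_proj hS isOp_curl.cont, real_inner_comm]

theorem inner_dop_gradDiv (hS : IsCut S) (p p' : LC) :
    inner ℝ p (dop S (fun ξ => (sGrad ξ).comp (sDiv ξ)) p')
      = - inner ℝ (dop S sDiv p) (dop S sDiv p') := by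
  rw [inner_dop_right hS isOp_gradDiv.cont, inner_dop_dop hS isOp_div.cont isOp_div.cont,
    ← integral_neg]
  simp_rw [ContinuousLinearMap.comp_apply, inner_sGrad]

theorem inner_dop_sCurl_sCurl (hS : IsCut S) (p p' : LC) :
    inner ℝ (dop S sCurl p) (dop S sCurl p') =
      ∑ j, inner ℝ (dop S (sD j) p) (dop S (sD j) p')
        - inner ℝ (dop S sDiv p) (dop S sDiv p') := by
  rw [inner_dop_dop hS isOp_curl.cont isOp_curl.cont]
  simp_rw [inner_sCurl_sCurl, inner_dop_dop hS (continuous_sD _) (continuous_sD _)]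
  rw [inner_dop_dop hS isOp_div.cont isOp_div.cont, integral_sub, integral_finsetSum]
  · exact fun j _ => integrableOn_inner_dop hS (continuous_sD j) (continuous_sD j) p p'
  · exact integrable_finsetSum _ fun j _ =>
      integrableOn_inner_dop hS (continuous_sD j) (continuous_sD j) p p'
  · exact integrableOn_inner_dop hS isOp_div.cont isOp_div.cont p p'

/-- For divergence free `p'`, the part `χΔ` of the viscosity may be replaced by `-χ curl curl`.
Combined with the coupling and damping terms, it completes the square `‖curl p - 2q‖²`. -/
theorem linear_rate_eq (hS : IsCut S) {p p' : LC} (q q' : LC) (hp' : dop S sDiv p' = 0) :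
    (c.μ + c.χ) * inner ℝ p (dop S sLap p') + 2 * c.χ * inner ℝ q (dop S sCurl p')
      + (c.γ * inner ℝ q (dop S sLap q')
        + c.κ * inner ℝ q (dop S (fun ξ => (sGrad ξ).comp (sDiv ξ)) q')
        + 2 * c.χ * inner ℝ p (dop S sCurl q') - 4 * c.χ * inner ℝ q (proj S q'))
      = - dform c S p q p' q' := by
  have h1 : inner ℝ q (dop S sCurl p') = inner ℝ (proj S q) (dop S sCurl p') :=
    (inner_dop_proj hS isOp_curl.cont q p').symm
  rw [inner_dop_sLap hS, inner_dop_sLap hS, inner_dop_gradDiv hS, h1, inner_dop_sCurl hS p q',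
    inner_proj_right hS q q']
  have h2 := inner_dop_sCurl_sCurl hS p p'
  rw [hp', inner_zero_right, sub_zero] at h2
  simp only [dform, inner_sub_left, inner_sub_right, real_inner_smul_left, real_inner_smul_right]
  rw [h2]
  ring

theorem norm_dop_sCurl_sq_le (hS : IsCut S) (p : LC) :
    ‖dop S sCurl p‖ ^ 2 ≤ ∑ j, ‖dop S (sD j) p‖ ^ 2 := by
  have := inner_dop_sCurl_sCurl hS p p
  simp only [real_inner_self_eq_norm_sq] at this
  rw [this]
  linarith [sq_nonneg ‖dop S sDiv p‖]

/-- The coercivity constant of the dissipation form. -/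
def Coeffs.low (c : Coeffs) : ℝ := min (c.μ / 2) (min (c.μ / 2) c.χ)

theorem Coeffs.low_pos (c : Coeffs) : 0 < c.low := by
  have := c.μ_pos; have := c.χ_pos
  unfold low; positivity

/-- From `‖2q‖ ≤ ‖curl p‖ + ‖curl p - 2q‖` and `‖curl p‖ ≤ ‖∇p‖`, the `χ` term and part of the
viscosity of `p` pay for `‖q‖²`. The damping of `q` needs neither `γ` nor `κ`, and holds uniformly
in frequency. -/
theorem le_dform_self (hS : IsCut S) (p q : LC) :
    c.low * (∑ j, ‖dop S (sD j) p‖ ^ 2 + ‖proj S q‖ ^ 2)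
      + c.γ * ∑ j, ‖dop S (sD j) q‖ ^ 2 ≤ dform c S p q p q := by
  rw [dform_self]
  have h1 := norm_dop_sCurl_sq_le hS p
  set X := ∑ j, ‖dop S (sD j) p‖ ^ 2
  have hm1 : c.low ≤ c.μ / 2 := min_le_left _ _
  have hm2 : c.low ≤ c.χ := (min_le_right _ _).trans (min_le_right _ _)
  have hl := c.low_pos
  have h2 : ‖(2 : ℝ) • proj S q‖ ^ 2
      ≤ 2 * ‖dop S sCurl p‖ ^ 2 + 2 * ‖dop S sCurl p - (2 : ℝ) • proj S q‖ ^ 2 := by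
    have h3 : ‖(2 : ℝ) • proj S q‖ ≤ ‖dop S sCurl p‖ + ‖dop S sCurl p - (2 : ℝ) • proj S q‖ := by
      have := norm_sub_le (dop S sCurl p) (dop S sCurl p - (2 : ℝ) • proj S q)
      rwa [sub_sub_cancel] at this
    nlinarith [norm_nonneg ((2 : ℝ) • proj S q),
      sq_nonneg (‖dop S sCurl p‖ - ‖dop S sCurl p - (2 : ℝ) • proj S q‖)]
  rw [norm_smul, mul_pow] at h2
  norm_num at h2
  set Y := ‖dop S sCurl p - (2 : ℝ) • proj S q‖ ^ 2
  have hY : 0 ≤ Y := sq_nonneg _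
  have hX : 0 ≤ X := Finset.sum_nonneg fun _ _ => sq_nonneg _
  have hk : 0 ≤ c.κ * ‖dop S sDiv q‖ ^ 2 := mul_nonneg c.κ_nonneg (sq_nonneg _)
  have h4 : c.low * ‖proj S q‖ ^ 2 ≤ c.low * (X / 2 + Y / 2) :=
    mul_le_mul_of_nonneg_left (by linarith) hl.le
  nlinarith [mul_le_mul_of_nonneg_right hm1 hX, mul_le_mul_of_nonneg_right hm2 hY]

theorem sum_norm_dop_sD_sq (hS : IsCut S) (p : LC) :
    ∑ j, ‖dop S (sD j) p‖ ^ 2 = ∫ ξ in S, (2 * Real.pi) ^ 2 * ‖ξ‖ ^ 2 * ‖p ξ‖ ^ 2 := by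
  simp_rw [norm_dop_sq hS (continuous_sD _)]
  rw [← integral_finsetSum _ fun j _ => integrableOn_norm_dop_sq hS (continuous_sD j) p]
  simp_rw [sum_norm_sD_sq]

theorem integrableOn_norm_sq_mul (hS : IsCut S) (p : LC) :
    IntegrableOn (fun ξ => (2 * Real.pi) ^ 2 * ‖ξ‖ ^ 2 * ‖p ξ‖ ^ 2) S := by
  have := integrable_finsetSum (μ := volume.restrict S) Finset.univ fun j _ =>
    integrableOn_norm_dop_sq hS (continuous_sD j) p
  simp only [sum_norm_sD_sq] at this
  exact this

theorem integrableOn_norm_sq (hS : IsCut S) (p : LC) : IntegrableOn (fun ξ => ‖p ξ‖ ^ 2) S :=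
  integrableOn_norm_dop_sq hS (σ := fun _ => ContinuousLinearMap.id ℝ V) continuous_const p

/-- If the frequencies in `S \ A` are larger than `r`, the gradient controls `r` times the part of
the field at those frequencies. -/
theorem le_sum_norm_dop_sD_sq {A : Set R3} (hS : IsCut S) (hA : IsCut A) (hAS : A ⊆ S) {r : ℝ}
    (hr : ∀ ξ ∈ S, ξ ∉ A → r ≤ ‖ξ‖) (hr0 : 0 ≤ r) (p : LC) :
    r ^ 2 * (‖proj S p‖ ^ 2 - ‖proj A p‖ ^ 2) ≤ ∑ j, ‖dop S (sD j) p‖ ^ 2 := by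
  rw [sum_norm_dop_sD_sq hS, norm_proj_sq hS, norm_proj_sq hA,
    ← setIntegral_sdiff₀ hA.meas.nullMeasurableSet (integrableOn_norm_sq hS p) hAS,
    ← integral_const_mul]
  refine (setIntegral_mono_on
    (((integrableOn_norm_sq hS p).mono_set sdiff_subset).const_mul _)
    ((integrableOn_norm_sq_mul hS p).mono_set sdiff_subset) (hS.meas.diff hA.meas)
    fun ξ hξ => ?_).trans
    (setIntegral_mono_set (integrableOn_norm_sq_mul hS p) (.of_forall fun ξ => ?_)
      sdiff_subset.eventuallyLE)
  · have h1 := hr ξ hξ.1 hξ.2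
    have h2 : r ^ 2 ≤ ‖ξ‖ ^ 2 := by gcongr
    have h3 : (1 : ℝ) ≤ (2 * Real.pi) ^ 2 := by nlinarith [Real.pi_gt_three]
    gcongr
    nlinarith [sq_nonneg ‖ξ‖]
  · simp only [Pi.zero_apply]; positivity

end Form

/-! ### Flows -/

/-- `(p,q)` solves, at the frequencies in `S`, the linear system with the additional forcing
`N`. -/
structure IsFlow (c : Coeffs) (S : Set R3) (p q : ℝ → LC) (N : ℝ → LC → LC → ℝ) : Prop where
  divP : ∀ t, 0 ≤ t → dop S sDiv (p t) = 0
  rates : ∃ Fp Fq : ℝ → LC, HasWeakDeriv (fun t => proj S (p t)) Fp ∧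
    HasWeakDeriv (fun t => proj S (q t)) Fq ∧
    -- Only divergence free `p'` are admitted as tests: for these the projector drops out and
    -- `dform` is the exact linear rate.
    ∀ t, 0 ≤ t → ∀ p' q', dop S sDiv p' = 0 →
      inner ℝ (Fp t) (proj S p') + inner ℝ (Fq t) (proj S q')
        = - dform c S (p t) (q t) p' q' + N t p' q'

theorem continuousOn_inner_LC {f g : ℝ → LC} {s : Set ℝ} (hf : ContinuousOn f s)
    (hg : ContinuousOn g s) : ContinuousOn (fun t => inner ℝ (f t) (g t)) s :=
  hf.inner (𝕜 := ℝ) hg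

namespace IsFlow

variable {c : Coeffs} {S : Set R3} {p q p₁ q₁ p₂ q₂ : ℝ → LC} {N N₁ N₂ : ℝ → LC → LC → ℝ}

theorem congr (h : IsFlow c S p q N₁)
    (hN : ∀ t, 0 ≤ t → ∀ p' q', dop S sDiv p' = 0 → N₁ t p' q' = N₂ t p' q') :
    IsFlow c S p q N₂ := by
  obtain ⟨Fp, Fq, h1, h2, h3⟩ := h.rates
  exact ⟨h.divP, Fp, Fq, h1, h2, fun t ht p' q' hp => by rw [h3 t ht p' q' hp, hN t ht p' q' hp]⟩

theorem sub (h₁ : IsFlow c S p₁ q₁ N₁) (h₂ : IsFlow c S p₂ q₂ N₂) :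
    IsFlow c S (fun t => p₁ t - p₂ t) (fun t => q₁ t - q₂ t)
      (fun t p' q' => N₁ t p' q' - N₂ t p' q') := by
  obtain ⟨Fp₁, Fq₁, a1, a2, a3⟩ := h₁.rates
  obtain ⟨Fp₂, Fq₂, b1, b2, b3⟩ := h₂.rates
  refine ⟨fun t ht => by rw [map_sub, h₁.divP t ht, h₂.divP t ht, sub_zero],
    fun t => Fp₁ t - Fp₂ t, fun t => Fq₁ t - Fq₂ t, ?_, ?_, fun t ht p' q' hp => ?_⟩
  · simpa only [map_sub] using a1.sub b1
  · simpa only [map_sub] using a2.sub b2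
  · rw [inner_sub_left, inner_sub_left, dform_sub_left]
    linarith [a3 t ht p' q' hp, b3 t ht p' q' hp]

theorem continuousOn_proj_fst (h : IsFlow c S p q N) :
    ContinuousOn (fun t => proj S (p t)) (Ici 0) := by
  obtain ⟨_, _, h1, _, _⟩ := h.rates
  exact h1.continuousOn

theorem continuousOn_proj_snd (h : IsFlow c S p q N) :
    ContinuousOn (fun t => proj S (q t)) (Ici 0) := by
  obtain ⟨_, _, _, h1, _⟩ := h.rates
  exact h1.continuousOn

theorem continuousOn_dop_fst (h : IsFlow c S p q N) (hS : IsCut S) {σ : R3 → V →L[ℝ] V}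
    (hσ : Continuous σ) : ContinuousOn (fun t => dop S σ (p t)) (Ici 0) := by
  simp_rw [← dop_proj hS hσ (p _)]
  exact (dop S σ).continuous.comp_continuousOn h.continuousOn_proj_fst

theorem continuousOn_dop_snd (h : IsFlow c S p q N) (hS : IsCut S) {σ : R3 → V →L[ℝ] V}
    (hσ : Continuous σ) : ContinuousOn (fun t => dop S σ (q t)) (Ici 0) := by
  simp_rw [← dop_proj hS hσ (q _)]
  exact (dop S σ).continuous.comp_continuousOn h.continuousOn_proj_snd

theorem continuousOn_dform (h₁ : IsFlow c S p₁ q₁ N₁) (h₂ : IsFlow c S p₂ q₂ N₂) (hS : IsCut S) :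
    ContinuousOn (fun t => dform c S (p₁ t) (q₁ t) (p₂ t) (q₂ t)) (Ici 0) := by
  have s1 := fun j => h₁.continuousOn_dop_fst hS (continuous_sD j)
  have s2 := fun j => h₂.continuousOn_dop_fst hS (continuous_sD j)
  have s3 := fun j => h₁.continuousOn_dop_snd hS (continuous_sD j)
  have s4 := fun j => h₂.continuousOn_dop_snd hS (continuous_sD j)
  have s5 := h₁.continuousOn_dop_snd hS isOp_div.cont
  have s6 := h₂.continuousOn_dop_snd hS isOp_div.cont
  have s7 := h₁.continuousOn_dop_fst hS isOp_curl.cont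
  have s8 := h₂.continuousOn_dop_fst hS isOp_curl.cont
  have s9 := h₁.continuousOn_proj_snd
  have s10 := h₂.continuousOn_proj_snd
  have s11 : ContinuousOn (fun t => (2 : ℝ) • proj S (q₁ t)) (Ici 0) :=
    (continuous_const_smul (2 : ℝ)).comp_continuousOn s9
  have s12 : ContinuousOn (fun t => (2 : ℝ) • proj S (q₂ t)) (Ici 0) :=
    (continuous_const_smul (2 : ℝ)).comp_continuousOn s10
  unfold dform
  refine ((ContinuousOn.add ?_ ?_).add ?_).add ?_
  · exact continuousOn_const.mul
      (continuousOn_finsetSum _ fun j _ => continuousOn_inner_LC (s1 j) (s2 j))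
  · exact continuousOn_const.mul
      (continuousOn_finsetSum _ fun j _ => continuousOn_inner_LC (s3 j) (s4 j))
  · exact continuousOn_const.mul (continuousOn_inner_LC s5 s6)
  · exact continuousOn_const.mul (continuousOn_inner_LC (s7.sub s11) (s8.sub s12))

theorem continuousOn_rate (h₁ : IsFlow c S p₁ q₁ N₁) (h₂ : IsFlow c S p₂ q₂ N₂) :
    ContinuousOn (fun r => -2 * dform c S (p₁ r) (q₁ r) (p₂ r) (q₂ r)
      + (N₁ r (p₂ r) (q₂ r) + N₂ r (p₁ r) (q₁ r))) (Ici 0) := by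
  obtain ⟨Fp₁, Fq₁, a1, a2, a3⟩ := h₁.rates
  obtain ⟨Fp₂, Fq₂, b1, b2, b3⟩ := h₂.rates
  refine ((a1.continuousOn_rate b1).add (a2.continuousOn_rate b2)).congr fun r hr => ?_
  simp only [Pi.add_apply]
  have e1 := a3 r hr (p₂ r) (q₂ r) (h₂.divP r hr)
  have e2 := b3 r hr (p₁ r) (q₁ r) (h₁.divP r hr)
  rw [dform_comm (p₂ r)] at e2
  linarith

theorem inner_sub_inner (h₁ : IsFlow c S p₁ q₁ N₁) (h₂ : IsFlow c S p₂ q₂ N₂)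
    {s t : ℝ} (hs : 0 ≤ s) (hst : s ≤ t) :
    (inner ℝ (proj S (p₁ t)) (proj S (p₂ t)) + inner ℝ (proj S (q₁ t)) (proj S (q₂ t)))
      - (inner ℝ (proj S (p₁ s)) (proj S (p₂ s)) + inner ℝ (proj S (q₁ s)) (proj S (q₂ s)))
    = ∫ r in s..t, (-2 * dform c S (p₁ r) (q₁ r) (p₂ r) (q₂ r)
      + (N₁ r (p₂ r) (q₂ r) + N₂ r (p₁ r) (q₁ r))) := by
  obtain ⟨Fp₁, Fq₁, a1, a2, a3⟩ := h₁.rates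
  obtain ⟨Fp₂, Fq₂, b1, b2, b3⟩ := h₂.rates
  have e1 := a1.inner_sub_inner b1 hs hst
  have e2 := a2.inner_sub_inner b2 hs hst
  have e3 : (∫ r in s..t, (-2 * dform c S (p₁ r) (q₁ r) (p₂ r) (q₂ r)
      + (N₁ r (p₂ r) (q₂ r) + N₂ r (p₁ r) (q₁ r)))) =
    (∫ r in s..t, (inner ℝ (Fp₁ r) (proj S (p₂ r)) + inner ℝ (Fp₂ r) (proj S (p₁ r))))
    + ∫ r in s..t, (inner ℝ (Fq₁ r) (proj S (q₂ r)) + inner ℝ (Fq₂ r) (proj S (q₁ r))) := by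
    rw [← intervalIntegral.integral_add
      (intervalIntegrable_of_continuousOn_Ici (a1.continuousOn_rate b1) hs (hs.trans hst))
      (intervalIntegrable_of_continuousOn_Ici (a2.continuousOn_rate b2) hs (hs.trans hst))]
    refine intervalIntegral.integral_congr fun r hr => ?_
    rw [uIcc_of_le hst] at hr
    have hr0 : 0 ≤ r := hs.trans hr.1
    have e1 := a3 r hr0 (p₂ r) (q₂ r) (h₂.divP r hr0)
    have e2 := b3 r hr0 (p₁ r) (q₁ r) (h₁.divP r hr0)
    rw [dform_comm (p₂ r)] at e2
    linarith
  rw [e3, ← e1, ← e2]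
  ring

theorem norm_sq_sub (h : IsFlow c S p q N) {s t : ℝ} (hs : 0 ≤ s) (hst : s ≤ t) :
    (‖proj S (p t)‖ ^ 2 + ‖proj S (q t)‖ ^ 2) - (‖proj S (p s)‖ ^ 2 + ‖proj S (q s)‖ ^ 2)
    = ∫ r in s..t, (-2 * dform c S (p r) (q r) (p r) (q r) + 2 * N r (p r) (q r)) := by
  have := h.inner_sub_inner h hs hst
  simp only [real_inner_self_eq_norm_sq] at this
  rw [this]
  exact intervalIntegral.integral_congr fun r _ => by ring

end IsFlow

/-! ### Flows from weak solutions -/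

theorem pair_smul (a : ℝ) (f : L2) {φ : R3 → R3} (hφ : IsTest φ) :
    pair (a • f) φ = a * pair f φ := by
  rw [← inner_toL2 _ hφ, ← inner_toL2 _ hφ, real_inner_smul_left]

/-- The curves `T j` and `T' j` are the fluxes of the transport terms. They vanish for the linear
flow and are products with the mollified velocity for mollified solutions, so a single lemma serves
both. -/
theorem isFlow_of_weak {c : Coeffs} {u w : ℝ → L2} {T T' : Fin 3 → ℝ → L2} (hu : WCont u)
    (hw : WCont w) (hT : ∀ j, WCont (T j)) (hT' : ∀ j, WCont (T' j))
    (hdiv : ∀ t, 0 ≤ t → u t ∈ L2σ)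
    (eqU : ∀ φ : R3 → R3, IsTest φ → ∀ t, 0 ≤ t → pair (u t) φ = pair (u 0) φ +
      ∫ s in (0 : ℝ)..t, ((∑ j, pair (T j s) (pd j φ)) + (c.μ + c.χ) * pair (u s) (Δ φ)
        + 2 * c.χ * pair (w s) (curl φ)))
    (eqW : ∀ φ : R3 → R3, IsTest φ → ∀ t, 0 ≤ t → pair (w t) φ = pair (w 0) φ +
      ∫ s in (0 : ℝ)..t, ((∑ j, pair (T' j s) (pd j φ)) + c.γ * pair (w s) (Δ φ)
        + c.κ * pair (w s) (∇ (div φ)) + 2 * c.χ * pair (u s) (curl φ)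
        - 4 * c.χ * pair (w s) φ)) {S : Set R3} (hS : IsCut S) :
    IsFlow c S (fun t => Ftr (u t)) (fun t => Ftr (w t)) (fun t p' q' =>
      (∑ j, inner ℝ (Ftr (T j t)) (dop S (sD j) p'))
        + ∑ j, inner ℝ (Ftr (T' j t)) (dop S (sD j) q')) := by
  have hid : IsOp 2 (fun φ => φ) (fun _ => ContinuousLinearMap.id ℝ V) := IsOp.id.mono zero_le_two
  have hpd : ∀ j, IsOp 2 (pd j) (sD j) := fun j => (isOp_pd j).mono one_le_two
  have hcurl : IsOp 2 curl sCurl := isOp_curl.mono one_le_two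
  refine ⟨fun t ht => dop_sDiv_of_mem (hdiv t ht) hS, ?_⟩
  -- `Fin 2` indexes the viscous and coupling terms, `Fin 3` the derivatives of the fluxes; for `w`
  -- there are four terms of the first kind.
  have hU := hasWeakDeriv_of_weak (ι := Fin 2 ⊕ Fin 3)
    (D := Sum.elim ![fun φ => Δ φ, curl] pd) (σ := Sum.elim ![sLap, sCurl] sD) (u := u)
    (f := Sum.elim ![fun s => (c.μ + c.χ) • u s, fun s => (2 * c.χ) • w s] T)
    (by rintro (i | j)
        · fin_cases i
          · exact isOp_lap
          · exact hcurl
        · exact hpd j)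
    (by rintro (i | j)
        · fin_cases i
          · exact hu.const_smul _
          · exact hw.const_smul _
        · exact hT j)
    (fun φ hφ t ht => by
      rw [eqU φ hφ t ht]
      congr 1
      refine intervalIntegral.integral_congr fun s _ => ?_
      simp [Fintype.sum_sum_type, Fin.sum_univ_two, pair_smul _ _ (isOp_lap.test hφ),
        pair_smul _ _ (isOp_curl.test hφ)]
      ring) hS
  have hW := hasWeakDeriv_of_weak (ι := Fin 4 ⊕ Fin 3)
    (D := Sum.elim ![fun φ => Δ φ, fun φ => ∇ (div φ), curl, fun φ => φ] pd)
    (σ := Sum.elim ![sLap, fun ξ => (sGrad ξ).comp (sDiv ξ), sCurl,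
      fun _ => ContinuousLinearMap.id ℝ V] sD) (u := w)
    (f := Sum.elim ![fun s => c.γ • w s, fun s => c.κ • w s, fun s => (2 * c.χ) • u s,
      fun s => (-(4 * c.χ)) • w s] T')
    (by rintro (i | j)
        · fin_cases i
          · exact isOp_lap
          · exact isOp_gradDiv
          · exact hcurl
          · exact hid
        · exact hpd j)
    (by rintro (i | j)
        · fin_cases i
          · exact hw.const_smul _
          · exact hw.const_smul _
          · exact hu.const_smul _
          · exact hw.const_smul _
        · exact hT' j)
    (fun φ hφ t ht => by
      rw [eqW φ hφ t ht]
      congr 1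
      refine intervalIntegral.integral_congr fun s _ => ?_
      simp [Fintype.sum_sum_type, Fin.sum_univ_four, pair_smul _ _ (isOp_lap.test hφ),
        pair_smul _ _ (isOp_curl.test hφ), pair_smul _ _ (isOp_gradDiv.test hφ),
        pair_smul _ _ hφ, pair_neg _ hφ]
      ring) hS
  refine ⟨_, _, hU, hW, fun t ht p' q' hp' => ?_⟩
  have e : ∀ {σ : R3 → V →L[ℝ] V}, Continuous σ → ∀ f g : LC,
      inner ℝ (ContinuousLinearMap.adjoint (dop S σ) f) (proj S g) = inner ℝ f (dop S σ g) := by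
    intro σ hσ f g
    rw [ContinuousLinearMap.adjoint_inner_left, dop_proj hS hσ]
  have e2 := linear_rate_eq (c := c) hS (p := Ftr (u t)) (Ftr (w t)) q' hp'
  simp only [Fintype.sum_sum_type, Sum.elim_inl, Sum.elim_inr, Fin.sum_univ_two, Fin.sum_univ_four,
    inner_add_left, sum_inner, Matrix.cons_val_zero, Matrix.cons_val_one, Matrix.cons_val,
    e (continuous_sD _), e isOp_lap.cont, e isOp_curl.cont, e isOp_gradDiv.cont,
    e hid.cont, map_smul, real_inner_smul_left]
  have e3 : proj S q' = dop S (fun _ => ContinuousLinearMap.id ℝ V) q' := rfl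
  rw [e3] at e2
  linear_combination e2

end

section

/-! ### The flow of a mollified solution -/

theorem eq_of_pair {f g : L2} (H : ∀ φ, IsTest φ → pair f φ = pair g φ) : f = g := by
  refine sub_eq_zero.1 (eq_zero_of_pair fun φ hφ => ?_)
  rw [← inner_toL2 _ hφ, inner_sub_left, inner_toL2, inner_toL2, H φ hφ, sub_self]

/-- The rescaled mollifying kernel. -/
def ker (θ : R3 → ℝ) (ε : ℝ) (z : R3) : ℝ := (ε ^ 3)⁻¹ * θ (ε⁻¹ • z)

/-- The transport terms, tested against `(p',q')`. -/
def transp (K : R3 → ℝ) (S : Set R3) (u : L2) (p q p' q' : LC) : ℝ :=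
  (∑ j, inner ℝ (conv K u j p) (dop S (sD j) p'))
    + ∑ j, inner ℝ (conv K u j q) (dop S (sD j) q')

variable {c : Coeffs} {θ : R3 → ℝ} {ε : ℝ} {u₀ w₀ : L2} {u w uL wL : ℝ → L2} {S : Set R3}

theorem pair_leray_rmul {K : R3 → ℝ} (hK : IsMollifier K) (f g : L2) (j : Fin 3) {φ : R3 → R3}
    (hφ : IsTest φ) : pair (leray (rmul (fun x => moll K f x j) g)) φ
      = ∫ x, moll K f x j * inner ℝ (g x) (leray hφ.toL2 x) := by
  rw [← inner_toL2 _ hφ, leray, Submodule.inner_starProjection_left_eq_right,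
    inner_rmul (isBC_moll hK f j)]

theorem pair_rmul {K : R3 → ℝ} (hK : IsMollifier K) (f g : L2) (j : Fin 3) {φ : R3 → R3}
    (hφ : IsTest φ) : pair (rmul (fun x => moll K f x j) g) φ
      = ∫ x, moll K f x j * inner ℝ (g x) (φ x) := by
  rw [← inner_toL2 _ hφ, inner_rmul (isBC_moll hK f j)]
  refine integral_congr_ae ?_
  filter_upwards [hφ.memLp.coeFn_toLp] with x h1
  rw [IsTest.toL2, h1]

namespace IsMollifiedSolution

theorem u_zero (h : IsMollifiedSolution c θ ε u₀ w₀ u w) : u 0 = u₀ :=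
  eq_of_pair fun φ hφ => by simpa using h.eqU φ hφ 0 le_rfl

theorem w_zero (h : IsMollifiedSolution c θ ε u₀ w₀ u w) : w 0 = w₀ :=
  eq_of_pair fun φ hφ => by simpa using h.eqW φ hφ 0 le_rfl

theorem isFlow (h : IsMollifiedSolution c θ ε u₀ w₀ u w) (hθ : IsMollifier θ) (hε : 0 < ε)
    (hS : IsCut S) : IsFlow c S (fun t => Ftr (u t)) (fun t => Ftr (w t))
      (fun t p' q' => transp (ker θ ε) S (u t) (Ftr (u t)) (Ftr (w t)) p' q') := by
  have hK : IsMollifier (ker θ ε) := hθ.scale hε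
  have hu : WCont u := h.contU
  have hw : WCont w := h.contW
  have hm : ∀ f, mollify θ ε f = moll (ker θ ε) f := fun _ => rfl
  refine (isFlow_of_weak (c := c) hu hw
    (T := fun j s => leray (rmul (fun x => moll (ker θ ε) (u s) x j) (u s)))
    (T' := fun j s => rmul (fun x => moll (ker θ ε) (u s) x j) (w s))
    (fun j => (hu.rmul hK hu j).map leray) (fun j => hu.rmul hK hw j) h.divFree
    (fun φ hφ t ht => ?_) (fun φ hφ t ht => ?_) hS).congr fun t ht p' q' hp' => ?_
  · rw [h.eqU φ hφ t ht, h.u_zero]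
    simp only [pair_leray_rmul hK _ _ _ (hφ.pd _), hm]
  · rw [h.eqW φ hφ t ht, h.w_zero]
    simp only [pair_rmul hK _ _ _ (hφ.pd _), hm]
  · simp only [inner_Ftr_leray_dop _ hS _ hp', Ftr_rmul hK, transp]

end IsMollifiedSolution

/-! ### The flow of a linear solution -/

namespace IsLinearSolution

theorem u_zero (h : IsLinearSolution c u₀ w₀ uL wL) : uL 0 = u₀ :=
  eq_of_pair fun φ hφ => by simpa using h.eqU φ hφ 0 le_rfl

theorem w_zero (h : IsLinearSolution c u₀ w₀ uL wL) : wL 0 = w₀ :=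
  eq_of_pair fun φ hφ => by simpa using h.eqW φ hφ 0 le_rfl

theorem isFlow (h : IsLinearSolution c u₀ w₀ uL wL) (hS : IsCut S) :
    IsFlow c S (fun t => Ftr (uL t)) (fun t => Ftr (wL t)) (fun _ _ _ => 0) := by
  refine (isFlow_of_weak (c := c) h.contU h.contW (T := fun _ _ => 0) (T' := fun _ _ => 0)
    (fun _ => WCont.zero) (fun _ => WCont.zero) h.divFree
    (fun φ hφ t ht => ?_) (fun φ hφ t ht => ?_) hS).congr fun t ht p' q' hp' => ?_
  · rw [h.eqU φ hφ t ht, h.u_zero]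
    simp only [← inner_toL2 0 (hφ.pd _), inner_zero_left, Finset.sum_const_zero, zero_add]
  · rw [h.eqW φ hφ t ht, h.w_zero]
    simp only [← inner_toL2 0 (hφ.pd _), inner_zero_left, Finset.sum_const_zero, zero_add]
  · simp

end IsLinearSolution

/-! ### The energy inequality -/

/-- Monotonicity of the lower integral needs no measurability of `g`. This matters because the
dissipation terms of the energy equality are infima over weak derivatives, whose measurability in
time is not established. -/
theorem ofReal_integral_le {f : ℝ → ℝ} {g : ℝ → ℝ≥0∞} (hf : ContinuousOn f (Ici 0))
    (hf0 : ∀ r, 0 ≤ f r) (hfg : ∀ r, ENNReal.ofReal (f r) ≤ g r) {s t : ℝ} (hs : 0 ≤ s)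
    (hst : s ≤ t) : ENNReal.ofReal (∫ r in s..t, f r) ≤ ∫⁻ r in Ioc s t, g r := by
  rw [intervalIntegral.integral_of_le hst, ofReal_integral_eq_lintegral_ofReal]
  · exact lintegral_mono fun r => hfg r
  · exact (intervalIntegrable_iff_integrableOn_Ioc_of_le hst).1
      (intervalIntegrable_of_continuousOn_Ici hf hs (hs.trans hst))
  · exact .of_forall hf0

namespace IsFlow

variable {p q : ℝ → LC} {N : ℝ → LC → LC → ℝ}

theorem continuousOn_grad_fst (h : IsFlow c S p q N) (hS : IsCut S) :
    ContinuousOn (fun r => ∑ j, ‖dop S (sD j) (p r)‖ ^ 2) (Ici 0) :=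
  continuousOn_finsetSum _ fun j _ => (h.continuousOn_dop_fst hS (continuous_sD j)).norm.pow 2

theorem continuousOn_grad_snd (h : IsFlow c S p q N) (hS : IsCut S) :
    ContinuousOn (fun r => ∑ j, ‖dop S (sD j) (q r)‖ ^ 2) (Ici 0) :=
  continuousOn_finsetSum _ fun j _ => (h.continuousOn_dop_snd hS (continuous_sD j)).norm.pow 2

theorem continuousOn_div_snd (h : IsFlow c S p q N) (hS : IsCut S) :
    ContinuousOn (fun r => ‖dop S sDiv (q r)‖ ^ 2) (Ici 0) :=
  (h.continuousOn_dop_snd hS isOp_div.cont).norm.pow 2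

theorem continuousOn_curlSub (h : IsFlow c S p q N) (hS : IsCut S) :
    ContinuousOn (fun r => ‖dop S sCurl (p r) - (2 : ℝ) • proj S (q r)‖ ^ 2) (Ici 0) := by
  have h2 : ContinuousOn (fun t => (2 : ℝ) • proj S (q t)) (Ici 0) :=
    (continuous_const_smul (2 : ℝ)).comp_continuousOn h.continuousOn_proj_snd
  exact ((h.continuousOn_dop_fst hS isOp_curl.cont).sub h2).norm.pow 2

theorem integral_dform_self (h : IsFlow c S p q N) (hS : IsCut S) {s t : ℝ} (hs : 0 ≤ s)
    (ht : 0 ≤ t) : ∫ r in s..t, dform c S (p r) (q r) (p r) (q r)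
      = c.μ * (∫ r in s..t, ∑ j, ‖dop S (sD j) (p r)‖ ^ 2)
        + c.γ * (∫ r in s..t, ∑ j, ‖dop S (sD j) (q r)‖ ^ 2)
        + c.κ * (∫ r in s..t, ‖dop S sDiv (q r)‖ ^ 2)
        + c.χ * (∫ r in s..t, ‖dop S sCurl (p r) - (2 : ℝ) • proj S (q r)‖ ^ 2) := by
  have iA := (intervalIntegrable_of_continuousOn_Ici (h.continuousOn_grad_fst hS) hs ht).const_mul c.μ
  have iB := (intervalIntegrable_of_continuousOn_Ici (h.continuousOn_grad_snd hS) hs ht).const_mul c.γ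
  have iD := (intervalIntegrable_of_continuousOn_Ici (h.continuousOn_div_snd hS) hs ht).const_mul c.κ
  have iG := (intervalIntegrable_of_continuousOn_Ici (h.continuousOn_curlSub hS) hs ht).const_mul c.χ
  rw [← intervalIntegral.integral_const_mul, ← intervalIntegral.integral_const_mul,
    ← intervalIntegral.integral_const_mul, ← intervalIntegral.integral_const_mul,
    ← intervalIntegral.integral_add iA iB, ← intervalIntegral.integral_add (iA.add iB) iD,
    ← intervalIntegral.integral_add ((iA.add iB).add iD) iG]
  exact intervalIntegral.integral_congr fun r _ => dform_self _ _

end IsFlow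

theorem add_le_of_enorm {f g f' g' : L2} {a b d e : ℝ} {A B D G : ℝ≥0∞} {m₁ m₂ m₃ m₄ : ℝ}
    (ha : 0 ≤ a) (hb : 0 ≤ b) (hd : 0 ≤ d) (he : 0 ≤ e) (h₁ : 0 ≤ m₁) (h₂ : 0 ≤ m₂) (h₃ : 0 ≤ m₃)
    (h₄ : 0 ≤ m₄) (hA : ENNReal.ofReal a ≤ A) (hB : ENNReal.ofReal b ≤ B)
    (hD : ENNReal.ofReal d ≤ D) (hG : ENNReal.ofReal e ≤ G)
    (H : ‖f‖ₑ ^ 2 + ‖g‖ₑ ^ 2 + ENNReal.ofReal m₁ * A + ENNReal.ofReal m₂ * B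
      + ENNReal.ofReal m₃ * D + ENNReal.ofReal m₄ * G = ‖f'‖ₑ ^ 2 + ‖g'‖ₑ ^ 2) :
    ‖f‖ ^ 2 + ‖g‖ ^ 2 + m₁ * a + m₂ * b + m₃ * d + m₄ * e ≤ ‖f'‖ ^ 2 + ‖g'‖ ^ 2 := by
  have en : ∀ f : L2, ‖f‖ₑ ^ 2 = ENNReal.ofReal (‖f‖ ^ 2) := fun f => by
    rw [ENNReal.ofReal_pow (norm_nonneg _), ofReal_norm]
  rw [← ENNReal.ofReal_le_ofReal_iff (by positivity)]
  rw [ENNReal.ofReal_add (by positivity) (by positivity),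
    ENNReal.ofReal_add (by positivity) (by positivity),
    ENNReal.ofReal_add (by positivity) (by positivity),
    ENNReal.ofReal_add (by positivity) (by positivity),
    ENNReal.ofReal_add (by positivity) (by positivity),
    ENNReal.ofReal_add (by positivity) (by positivity),
    ENNReal.ofReal_mul h₁, ENNReal.ofReal_mul h₂, ENNReal.ofReal_mul h₃, ENNReal.ofReal_mul h₄,
    ← en, ← en, ← en, ← en, ← H]
  gcongr

theorem IsMollifiedSolution.energy_le (h : IsMollifiedSolution c θ ε u₀ w₀ u w)
    (hθ : IsMollifier θ) (hε : 0 < ε) (hS : IsCut S) {s t : ℝ} (hs : 0 ≤ s) (hst : s ≤ t) :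
    Micropolar.energy (u t) (w t)
        + 2 * ∫ r in s..t, dform c S (Ftr (u r)) (Ftr (w r)) (Ftr (u r)) (Ftr (w r))
      ≤ Micropolar.energy (u s) (w s) := by
  have hF := h.isFlow hθ hε hS
  have hμ := c.μ_pos; have hχ := c.χ_pos; have hγ := c.γ_nonneg; have hκ := c.κ_nonneg
  have pos : ∀ {f : ℝ → ℝ}, (∀ r, 0 ≤ f r) → 0 ≤ ∫ r in s..t, f r := fun hf =>
    intervalIntegral.integral_nonneg hst fun r _ => hf r
  have nA : ∀ (f : ℝ → LC) r, 0 ≤ ∑ j, ‖dop S (sD j) (f r)‖ ^ 2 :=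
    fun f r => Finset.sum_nonneg fun _ _ => sq_nonneg _
  have key := add_le_of_enorm (pos (nA fun r => Ftr (u r))) (pos (nA fun r => Ftr (w r)))
    (pos fun r => sq_nonneg ‖dop S sDiv (Ftr (w r))‖)
    (pos fun r => sq_nonneg ‖dop S sCurl (Ftr (u r)) - (2 : ℝ) • proj S (Ftr (w r))‖)
    (by linarith : 0 ≤ 2 * c.μ) (by linarith : 0 ≤ 2 * c.γ) (by linarith : 0 ≤ 2 * c.κ)
    (by linarith : 0 ≤ 2 * c.χ)
    (ofReal_integral_le (hF.continuousOn_grad_fst hS) (nA _) (fun r => le_gradSq hS (u r)) hs hst)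
    (ofReal_integral_le (hF.continuousOn_grad_snd hS) (nA _) (fun r => le_gradSq hS (w r)) hs hst)
    (ofReal_integral_le (hF.continuousOn_div_snd hS) (fun r => sq_nonneg _)
      (fun r => le_divSq hS (w r)) hs hst)
    (ofReal_integral_le (hF.continuousOn_curlSub hS) (fun r => sq_nonneg _)
      (fun r => le_curlSubSq hS (u r) (w r)) hs hst)
    (h.energy s t hs hst)
  rw [hF.integral_dform_self hS hs (hs.trans hst)]
  unfold Micropolar.energy
  linarith

theorem energy_nonneg (f g : L2) : 0 ≤ energy f g := by unfold energy; positivity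

theorem IsMollifiedSolution.antitoneOn (h : IsMollifiedSolution c θ ε u₀ w₀ u w)
    (hθ : IsMollifier θ) (hε : 0 < ε) : AntitoneOn (fun t => Micropolar.energy (u t) (w t)) (Ici 0) := by
  intro s hs t _ hst
  -- Any bounded set of frequencies would do, since only the sign of the dissipation is used.
  have h1 := h.energy_le hθ hε (IsCut.closedBall 0) hs hst
  have h2 : 0 ≤ ∫ r in s..t, dform c (Metric.closedBall 0 0) (Ftr (u r)) (Ftr (w r))
      (Ftr (u r)) (Ftr (w r)) :=
    intervalIntegral.integral_nonneg hst fun r _ => dform_self_nonneg _ _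
  simp only
  linarith

theorem IsMollifiedSolution.energy_le_zero (h : IsMollifiedSolution c θ ε u₀ w₀ u w)
    (hθ : IsMollifier θ) (hε : 0 < ε) {t : ℝ} (ht : 0 ≤ t) :
    Micropolar.energy (u t) (w t) ≤ Micropolar.energy u₀ w₀ := by
  have := h.antitoneOn hθ hε (mem_Ici.2 le_rfl) ht ht
  simp only at this
  rwa [h.u_zero, h.w_zero] at this

/-! ### Bounds for the transport terms -/

theorem abs_transp_le {K : R3 → ℝ} (hK : IsMollifier K) (hS : IsCut S) (f : L2)
    (p q p' q' : LC) : |transp K S f p q p' q'| ≤ 6 * Real.pi * ‖f‖ *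
      (‖p‖ * (∫ ξ in S, ‖ξ‖ * ‖p' ξ‖) + ‖q‖ * ∫ ξ in S, ‖ξ‖ * ‖q' ξ‖) := by
  have h1 := abs_sum_inner_conv_le hK f p p' hS
  have h2 := abs_sum_inner_conv_le hK f q q' hS
  refine (abs_add_le _ _).trans ((add_le_add h1 h2).trans (le_of_eq (by ring)))

theorem integrableOn_norm_sq_id (hS : IsCut S) : IntegrableOn (fun ξ : R3 => ‖ξ‖ ^ 2) S := by
  obtain ⟨R, hR⟩ := hS.bdd.exists_norm_le
  refine IntegrableOn.mono_set (t := Metric.closedBall 0 R) ?_ fun x hx => by simpa using hR x hx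
  exact (continuous_norm.pow 2).continuousOn.integrableOn_compact (isCompact_closedBall 0 R)

theorem setIntegral_norm_mul_le (hS : IsCut S) (p : LC) :
    ∫ ξ in S, ‖ξ‖ * ‖p ξ‖ ≤ √(∫ ξ in S, ‖ξ‖ ^ 2) * ‖proj S p‖ := by
  have h1 : MemLp (fun ξ : R3 => ‖ξ‖) 2 (volume.restrict S) :=
    (memLp_two_iff_integrable_sq continuous_norm.aestronglyMeasurable).2 (integrableOn_norm_sq_id hS)
  have h2 : MemLp (fun ξ => ‖p ξ‖) 2 (volume.restrict S) := (Lp.memLp p).norm.restrict S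
  have h3 := integral_mul_norm_le h1 h2 (fun _ => norm_nonneg _) fun _ => norm_nonneg _
  rwa [← norm_proj_sq hS, Real.sqrt_sq (norm_nonneg _)] at h3

theorem setIntegral_norm_sq_le {ρ : ℝ} (hρ : 0 ≤ ρ) :
    ∫ ξ in Metric.closedBall (0 : R3) ρ, ‖ξ‖ ^ 2
      ≤ ρ ^ 5 * (volume : Measure R3).real (Metric.closedBall 0 1) := by
  have h1 := setIntegral_mono_on (integrableOn_norm_sq_id (IsCut.closedBall ρ))
    (integrableOn_const (C := ρ ^ 2) (isCompact_closedBall (0 : R3) ρ).measure_lt_top.ne)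
    measurableSet_closedBall fun ξ hξ => by
      have : ‖ξ‖ ≤ ρ := by simpa using hξ
      gcongr
  refine h1.trans (le_of_eq ?_)
  have h2 := Measure.addHaar_real_closedBall' (volume : Measure R3) 0 hρ
  rw [setIntegral_const, h2]
  simp
  ring

/-- A bound for the nonlinear contribution at low frequencies. -/
def lowConst : ℝ := (24 * Real.pi) ^ 2 * (volume : Measure R3).real (Metric.closedBall 0 1)

theorem lowConst_nonneg : 0 ≤ lowConst := by unfold lowConst; positivity

theorem abs_transp_le_energy {K : R3 → ℝ} (hK : IsMollifier K) (hS : IsCut S) (f g : L2)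
    (p' q' : LC) : |transp K S f (Ftr f) (Ftr g) p' q'| ≤ 12 * Real.pi * √(∫ ξ in S, ‖ξ‖ ^ 2)
      * (energy f g * √(‖proj S p'‖ ^ 2 + ‖proj S q'‖ ^ 2)) := by
  refine (abs_transp_le hK hS _ _ _ _ _).trans ?_
  set k := √(∫ ξ in S, ‖ξ‖ ^ 2)
  set X := ‖proj S p'‖ ^ 2 + ‖proj S q'‖ ^ 2
  have hk : 0 ≤ k := Real.sqrt_nonneg _
  have a1 := setIntegral_norm_mul_le hS p'
  have a2 := setIntegral_norm_mul_le hS q'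
  have b1 : ‖proj S p'‖ ≤ √X :=
    Real.le_sqrt_of_sq_le (by simp only [X]; nlinarith [sq_nonneg ‖proj S q'‖])
  have b2 : ‖proj S q'‖ ≤ √X :=
    Real.le_sqrt_of_sq_le (by simp only [X]; nlinarith [sq_nonneg ‖proj S p'‖])
  rw [LinearIsometry.norm_map, LinearIsometry.norm_map]
  have e1 : ‖f‖ * ‖f‖ ≤ energy f g := by simp only [energy]; nlinarith [sq_nonneg ‖g‖]
  have e2 : ‖f‖ * ‖g‖ ≤ energy f g := by
    simp only [energy]; nlinarith [sq_nonneg (‖g‖ - ‖f‖), sq_nonneg ‖g‖, sq_nonneg ‖f‖]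
  have c1 : (∫ ξ in S, ‖ξ‖ * ‖p' ξ‖) ≤ k * √X := a1.trans (by gcongr)
  have c2 : (∫ ξ in S, ‖ξ‖ * ‖q' ξ‖) ≤ k * √X := a2.trans (by gcongr)
  calc _ ≤ 6 * Real.pi * ‖f‖ * (‖f‖ * (k * √X) + ‖g‖ * (k * √X)) := by gcongr
    _ = 6 * Real.pi * ((‖f‖ * ‖f‖) * (k * √X) + (‖f‖ * ‖g‖) * (k * √X)) := by ring
    _ ≤ 6 * Real.pi * (energy f g * (k * √X) + energy f g * (k * √X)) := by gcongr
    _ = _ := by ring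

/-- Formally `(√X)' ≤ k E`, but `√X` need not be differentiable where `X` vanishes. At a maximum
point `s` of `X` on `[0,t]` one has `X s ≤ X 0 + 2k √(X s) ∫ E`, and division by `√(X s)` gives the
bound. -/
theorem IsFlow.sqrt_le {p q : ℝ → LC} {N : ℝ → LC → LC → ℝ} (hF : IsFlow c S p q N)
    {E X : ℝ → ℝ} (hE0 : ∀ r, 0 ≤ E r) (hX : ∀ r, X r = ‖proj S (p r)‖ ^ 2 + ‖proj S (q r)‖ ^ 2)
    {k t : ℝ} (hk : 0 ≤ k) (ht : 0 ≤ t) (iE : IntervalIntegrable E volume 0 t)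
    (hN : ∀ r, 0 ≤ r → |N r (p r) (q r)| ≤ k * (E r * √(X r))) :
    √(X t) ≤ √(X 0) + 2 * k * ∫ r in (0 : ℝ)..t, E r := by
  have hX0 : ∀ r, 0 ≤ X r := fun r => by rw [hX]; positivity
  have cX : ContinuousOn X (Ici 0) :=
    ((hF.continuousOn_proj_fst.norm.pow 2).add (hF.continuousOn_proj_snd.norm.pow 2)).congr
      fun r _ => hX r
  obtain ⟨s, hs, hmax⟩ := isCompact_Icc.exists_isMaxOn (nonempty_Icc.2 ht)
    (cX.mono fun x hx => hx.1 : ContinuousOn X (Icc 0 t))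
  have iEs : IntervalIntegrable E volume 0 s :=
    iE.mono_set (by rw [uIcc_of_le hs.1, uIcc_of_le ht]; exact Icc_subset_Icc_right hs.2)
  have h1 := hF.norm_sq_sub le_rfl hs.1
  rw [← hX, ← hX] at h1
  have h2 : X s - X 0 ≤ ∫ r in (0 : ℝ)..s, 2 * k * √(X s) * E r := by
    refine h1.le.trans ?_
    refine intervalIntegral.integral_mono_on hs.1 ?_ (iEs.const_mul _) fun r hr => ?_
    · refine intervalIntegrable_of_continuousOn_Ici ?_ le_rfl hs.1
      refine (hF.continuousOn_rate hF).congr fun r _ => ?_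
      ring
    · have d := dform_self_nonneg (c := c) (S := S) (p r) (q r)
      have n := (abs_le.1 (hN r hr.1)).2
      have m : √(X r) ≤ √(X s) := Real.sqrt_le_sqrt (hmax ⟨hr.1, hr.2.trans hs.2⟩)
      have m2 : k * (E r * √(X r)) ≤ k * (E r * √(X s)) := by
        have := hE0 r
        gcongr
      nlinarith
  rw [intervalIntegral.integral_const_mul] at h2
  have h3 : ∫ r in (0 : ℝ)..s, E r ≤ ∫ r in (0 : ℝ)..t, E r :=
    intervalIntegral.integral_mono_interval le_rfl hs.1 hs.2 (.of_forall hE0) iE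
  set I := ∫ r in (0 : ℝ)..t, E r
  have hI : 0 ≤ I := intervalIntegral.integral_nonneg ht fun r _ => hE0 r
  have h6 : √(X t) ≤ √(X s) := Real.sqrt_le_sqrt (hmax ⟨ht, le_rfl⟩)
  have h7 : √(X 0) ≤ √(X s) := Real.sqrt_le_sqrt (hmax ⟨le_rfl, ht⟩)
  refine h6.trans ?_
  by_cases h0 : √(X s) = 0
  · rw [h0]; positivity
  have h0' : 0 < √(X s) := lt_of_le_of_ne (Real.sqrt_nonneg _) (Ne.symm h0)
  refine le_of_mul_le_mul_right ?_ h0'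
  have h8 : X 0 ≤ √(X 0) * √(X s) := by
    calc X 0 = √(X 0) * √(X 0) := (Real.mul_self_sqrt (hX0 0)).symm
      _ ≤ _ := by gcongr
  have h9 : 2 * k * √(X s) * (∫ r in (0 : ℝ)..s, E r) ≤ 2 * k * √(X s) * I := by gcongr
  rw [Real.mul_self_sqrt (hX0 s)]
  linarith

theorem IsMollifiedSolution.intervalIntegrable_energy (h : IsMollifiedSolution c θ ε u₀ w₀ u w)
    (hθ : IsMollifier θ) (hε : 0 < ε) {a b : ℝ} (ha : 0 ≤ a) (hb : 0 ≤ b) :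
    IntervalIntegrable (fun r => Micropolar.energy (u r) (w r)) volume a b :=
  ((h.antitoneOn hθ hε).mono fun _ hx => (le_min ha hb).trans hx.1).intervalIntegrable

theorem sq_low_const_le {ρ I : ℝ} (hρ : 0 ≤ ρ) :
    (2 * (12 * Real.pi * √(∫ ξ in Metric.closedBall (0 : R3) ρ, ‖ξ‖ ^ 2)) * I) ^ 2
      ≤ lowConst * ρ ^ 5 * I ^ 2 := by
  have h8 : √(∫ ξ in Metric.closedBall (0 : R3) ρ, ‖ξ‖ ^ 2) ^ 2
      ≤ ρ ^ 5 * (volume : Measure R3).real (Metric.closedBall 0 1) := by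
    rw [Real.sq_sqrt (integral_nonneg fun _ => by positivity)]
    exact setIntegral_norm_sq_le hρ
  calc _ = (24 * Real.pi) ^ 2 * √(∫ ξ in Metric.closedBall (0 : R3) ρ, ‖ξ‖ ^ 2) ^ 2 * I ^ 2 := by
        ring
    _ ≤ (24 * Real.pi) ^ 2 * (ρ ^ 5 * (volume : Measure R3).real (Metric.closedBall 0 1)) * I ^ 2 := by
        gcongr
    _ = _ := by rw [lowConst]; ring

/-- The low frequencies of the difference with the linear flow. -/
theorem low_freq (h : IsMollifiedSolution c θ ε u₀ w₀ u w) (hθ : IsMollifier θ) (hε : 0 < ε)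
    (hL : IsLinearSolution c u₀ w₀ uL wL) {ρ : ℝ} (hρ : 0 ≤ ρ) {t : ℝ} (ht : 0 ≤ t) :
    ‖proj (Metric.closedBall 0 ρ) (Ftr (u t) - Ftr (uL t))‖ ^ 2
      + ‖proj (Metric.closedBall 0 ρ) (Ftr (w t) - Ftr (wL t))‖ ^ 2
    ≤ lowConst * ρ ^ 5 * (∫ r in (0 : ℝ)..t, energy (u r) (w r)) ^ 2 := by
  have hS := IsCut.closedBall ρ
  have hF := (h.isFlow hθ hε hS).sub (hL.isFlow hS)
  have h1 := hF.sqrt_le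
    (k := 12 * Real.pi * √(∫ ξ in Metric.closedBall (0 : R3) ρ, ‖ξ‖ ^ 2)) (fun _ => energy_nonneg _ _) (fun _ => rfl) (by positivity) ht
    (h.intervalIntegrable_energy hθ hε le_rfl ht) fun r _ => by
      rw [sub_zero]; exact abs_transp_le_energy (hθ.scale hε) hS (u r) (w r) _ _
  have e : ‖proj (Metric.closedBall 0 ρ) (Ftr (u 0) - Ftr (uL 0))‖ ^ 2
      + ‖proj (Metric.closedBall 0 ρ) (Ftr (w 0) - Ftr (wL 0))‖ ^ 2 = 0 := by
    simp [h.u_zero, h.w_zero, hL.u_zero, hL.w_zero]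
  simp only [e] at h1
  rw [Real.sqrt_zero, zero_add] at h1
  refine le_trans ?_ (sq_low_const_le hρ)
  exact (Real.sqrt_le_iff.1 h1).2

/-- The low frequencies of the solution. -/
theorem low_freq_self (h : IsMollifiedSolution c θ ε u₀ w₀ u w) (hθ : IsMollifier θ) (hε : 0 < ε)
    {ρ : ℝ} (hρ : 0 ≤ ρ) {t : ℝ} (ht : 0 ≤ t) :
    ‖proj (Metric.closedBall 0 ρ) (Ftr (u t))‖ ^ 2
      + ‖proj (Metric.closedBall 0 ρ) (Ftr (w t))‖ ^ 2
    ≤ 2 * (‖proj (Metric.closedBall 0 ρ) (Ftr u₀)‖ ^ 2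
        + ‖proj (Metric.closedBall 0 ρ) (Ftr w₀)‖ ^ 2)
      + 2 * (lowConst * ρ ^ 5 * (∫ r in (0 : ℝ)..t, energy (u r) (w r)) ^ 2) := by
  have hS := IsCut.closedBall ρ
  have h1 := (h.isFlow hθ hε hS).sqrt_le
    (k := 12 * Real.pi * √(∫ ξ in Metric.closedBall (0 : R3) ρ, ‖ξ‖ ^ 2)) (fun _ => energy_nonneg _ _) (fun _ => rfl)
    (by positivity) ht (h.intervalIntegrable_energy hθ hε le_rfl ht) fun r _ =>
      abs_transp_le_energy (hθ.scale hε) hS (u r) (w r) _ _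
  simp only [h.u_zero, h.w_zero] at h1
  have h2 := sq_low_const_le (I := ∫ r in (0 : ℝ)..t, energy (u r) (w r)) hρ
  set X := ‖proj (Metric.closedBall 0 ρ) (Ftr (u t))‖ ^ 2
      + ‖proj (Metric.closedBall 0 ρ) (Ftr (w t))‖ ^ 2
  set X₀ := ‖proj (Metric.closedBall 0 ρ) (Ftr u₀)‖ ^ 2
      + ‖proj (Metric.closedBall 0 ρ) (Ftr w₀)‖ ^ 2
  set y := 2 * (12 * Real.pi * √(∫ ξ in Metric.closedBall (0 : R3) ρ, ‖ξ‖ ^ 2))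
    * ∫ r in (0 : ℝ)..t, energy (u r) (w r)
  have h3 := Real.sq_sqrt (by positivity : 0 ≤ X)
  have h4 := Real.sq_sqrt (by positivity : 0 ≤ X₀)
  nlinarith [Real.sqrt_nonneg X, sq_nonneg (√X₀ - y)]

end

section

/-! ### Decay of the linear flow, frequency by frequency -/

/-- A lower bound for the rate of decay of the linear flow at the frequencies larger than `r`. -/
def Coeffs.rate (c : Coeffs) (r : ℝ) : ℝ := max (c.low * min (r ^ 2) 1) (min c.low c.γ * r ^ 2)

variable {c : Coeffs} {u₀ w₀ : L2} {uL wL : ℝ → L2} {S : Set R3}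

/-- The first branch of the maximum uses the frequency-independent damping of `q`, hence the cap at
one; it is the useful one when `γ = 0`. The second uses the spin viscosity and grows quadratically
when `γ > 0`. -/
theorem rate_mul_le_dform (hS : IsCut S) {r : ℝ} (hr0 : 0 ≤ r) (hr : ∀ ξ ∈ S, r ≤ ‖ξ‖) (p q : LC) :
    c.rate r * (‖proj S p‖ ^ 2 + ‖proj S q‖ ^ 2) ≤ dform c S p q p q := by
  have h0 := le_dform_self (c := c) hS p q
  have he : IsCut (∅ : Set R3) := ⟨MeasurableSet.empty, Bornology.isBounded_empty⟩
  have h1 := fun f : LC =>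
    le_sum_norm_dop_sD_sq hS he (empty_subset S) (fun ξ hξ _ => hr ξ hξ) hr0 f
  have h2 : ∀ f : LC, ‖proj ∅ f‖ ^ 2 = 0 := fun f => by
    rw [norm_proj_sq he]; simp
  simp only [h2, sub_zero] at h1
  have hl := c.low_pos
  have hγ := c.γ_nonneg
  have h3 := mul_le_mul_of_nonneg_left (h1 p) hl.le
  have h4 := mul_le_mul_of_nonneg_left (h1 q) hγ
  refine le_trans ?_ h0
  set P := ‖proj S p‖ ^ 2
  set Q := ‖proj S q‖ ^ 2
  have hP : 0 ≤ P := sq_nonneg _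
  have hQ : 0 ≤ Q := sq_nonneg _
  rw [Coeffs.rate, max_mul_of_nonneg _ _ (by positivity)]
  refine max_le ?_ ?_
  · have a1 : c.low * min (r ^ 2) 1 * P ≤ c.low * (r ^ 2) * P := by
      gcongr; exact min_le_left _ _
    have a2 : c.low * min (r ^ 2) 1 * Q ≤ c.low * 1 * Q := by
      gcongr; exact min_le_right _ _
    have a3 : 0 ≤ c.γ * (r ^ 2 * Q) := by positivity
    linarith
  · have a1 : min c.low c.γ * r ^ 2 * P ≤ c.low * r ^ 2 * P := by
      gcongr; exact min_le_left _ _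
    have a2 : min c.low c.γ * r ^ 2 * Q ≤ c.γ * r ^ 2 * Q := by
      gcongr; exact min_le_right _ _
    have a3 : 0 ≤ c.low * Q := by positivity
    linarith

namespace IsFlow

variable {p q : ℝ → LC}

theorem hasDerivAt_norm_sq {N : ℝ → LC → LC → ℝ} (h : IsFlow c S p q N) {r : ℝ} (hr : 0 < r) :
    HasDerivAt (fun t => ‖proj S (p t)‖ ^ 2 + ‖proj S (q t)‖ ^ 2)
      (-2 * dform c S (p r) (q r) (p r) (q r) + 2 * N r (p r) (q r)) r := by
  obtain ⟨Fp, Fq, a1, a2, a3⟩ := h.rates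
  have d := (a1.hasDerivAt_inner a1 hr).add (a2.hasDerivAt_inner a2 hr)
  simp only [real_inner_self_eq_norm_sq] at d
  have e := a3 r hr.le (p r) (q r) (h.divP r hr.le)
  convert! d using 1
  linarith

theorem decay (h : IsFlow c S p q fun _ _ _ => 0) (hS : IsCut S) {r : ℝ} (hr0 : 0 ≤ r)
    (hr : ∀ ξ ∈ S, r ≤ ‖ξ‖) {s t : ℝ} (hs : 0 ≤ s) (hst : s ≤ t) :
    ‖proj S (p t)‖ ^ 2 + ‖proj S (q t)‖ ^ 2
      ≤ Real.exp (-(2 * c.rate r * (t - s))) * (‖proj S (p s)‖ ^ 2 + ‖proj S (q s)‖ ^ 2) := by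
  set Y : ℝ → ℝ := fun t => ‖proj S (p t)‖ ^ 2 + ‖proj S (q t)‖ ^ 2
  set l := c.rate r
  have hc : ContinuousOn Y (Ici 0) :=
    (h.continuousOn_proj_fst.norm.pow 2).add (h.continuousOn_proj_snd.norm.pow 2)
  have hd : ∀ x, 0 < x → HasDerivAt (fun t => Real.exp (2 * l * t) * Y t)
      (Real.exp (2 * l * x) * (2 * l) * Y x + Real.exp (2 * l * x) *
        (-2 * dform c S (p x) (q x) (p x) (q x) + 2 * 0)) x := by
    intro x hx
    have e1 : HasDerivAt (fun t => Real.exp (2 * l * t)) (Real.exp (2 * l * x) * (2 * l)) x := by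
      simpa using ((hasDerivAt_id x).const_mul (2 * l)).exp
    exact e1.mul (h.hasDerivAt_norm_sq hx)
  have hanti : AntitoneOn (fun t => Real.exp (2 * l * t) * Y t) (Ici 0) := by
    refine antitoneOn_of_deriv_nonpos (convex_Ici 0) ?_ ?_ fun x hx => ?_
    · exact (by fun_prop : Continuous fun t => Real.exp (2 * l * t)).continuousOn.mul hc
    · intro x hx
      rw [interior_Ici] at hx
      exact (hd x hx).differentiableAt.differentiableWithinAt
    · rw [interior_Ici] at hx
      rw [(hd x hx).deriv]
      have := rate_mul_le_dform (c := c) hS hr0 hr (p x) (q x)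
      have hpos := Real.exp_pos (2 * l * x)
      have e : Real.exp (2 * l * x) * (2 * l) * Y x + Real.exp (2 * l * x) *
        (-2 * dform c S (p x) (q x) (p x) (q x) + 2 * 0)
        = 2 * Real.exp (2 * l * x) * (l * Y x - dform c S (p x) (q x) (p x) (q x)) := by ring
      rw [e]
      exact mul_nonpos_of_nonneg_of_nonpos (by positivity) (by linarith)
  have h1 := hanti (mem_Ici.2 hs) (mem_Ici.2 (hs.trans hst)) hst
  simp only at h1
  have e2 : Real.exp (-(2 * l * (t - s))) = Real.exp (-(2 * l * t)) * Real.exp (2 * l * s) := by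
    rw [← Real.exp_add]; ring_nf
  rw [e2, mul_assoc]
  calc Y t = Real.exp (-(2 * l * t)) * (Real.exp (2 * l * t) * Y t) := by
        rw [← mul_assoc, ← Real.exp_add]; simp
    _ ≤ _ := by gcongr

end IsFlow

/-- The modulus of the Fourier transform of `(u,w)`. -/
def fmod (u w : L2) (ξ : R3) : ℝ := √(‖Ftr u ξ‖ ^ 2 + ‖Ftr w ξ‖ ^ 2)

theorem fmod_nonneg (u w : L2) (ξ : R3) : 0 ≤ fmod u w ξ := Real.sqrt_nonneg _

theorem fmod_sq (u w : L2) (ξ : R3) : fmod u w ξ ^ 2 = ‖Ftr u ξ‖ ^ 2 + ‖Ftr w ξ‖ ^ 2 :=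
  Real.sq_sqrt (by positivity)

theorem integrable_norm_LC_sq (f : LC) : Integrable (fun ξ => ‖f ξ‖ ^ 2) :=
  (memLp_two_iff_integrable_sq_norm (Lp.aestronglyMeasurable f)).1 (Lp.memLp f)

theorem integrable_fmod_sq (u w : L2) : Integrable (fun ξ => fmod u w ξ ^ 2) := by
  simp only [fmod_sq]
  exact (integrable_norm_LC_sq _).add (integrable_norm_LC_sq _)

theorem aestronglyMeasurable_fmod (u w : L2) : AEStronglyMeasurable (fmod u w) volume :=
  Real.continuous_sqrt.comp_aestronglyMeasurable
    (((Lp.aestronglyMeasurable (Ftr u)).norm.pow 2).add ((Lp.aestronglyMeasurable (Ftr w)).norm.pow 2))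

theorem memLp_fmod (u w : L2) : MemLp (fmod u w) 2 volume :=
  (memLp_two_iff_integrable_sq (aestronglyMeasurable_fmod u w)).2 (integrable_fmod_sq u w)

theorem integral_fmod_sq (u w : L2) : ∫ ξ, fmod u w ξ ^ 2 = energy u w := by
  simp only [fmod_sq]
  rw [integral_add (integrable_norm_LC_sq _) (integrable_norm_LC_sq _), integral_norm_LC_sq,
    integral_norm_LC_sq, LinearIsometry.norm_map, LinearIsometry.norm_map, energy]

theorem setIntegral_fmod_sq (hS : IsCut S) (u w : L2) :
    ∫ ξ in S, fmod u w ξ ^ 2 = ‖proj S (Ftr u)‖ ^ 2 + ‖proj S (Ftr w)‖ ^ 2 := by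
  simp only [fmod_sq]
  rw [integral_add (integrable_norm_LC_sq _).integrableOn (integrable_norm_LC_sq _).integrableOn,
    norm_proj_sq hS, norm_proj_sq hS]

theorem Coeffs.rate_mono (c : Coeffs) {r r' : ℝ} (hr : 0 ≤ r) (h : r ≤ r') :
    c.rate r ≤ c.rate r' := by
  have h1 := c.low_pos
  have h2 : 0 ≤ min c.low c.γ := le_min h1.le c.γ_nonneg
  unfold rate
  gcongr

namespace IsLinearSolution

/-- The decay estimate holds on every bounded measurable set of frequencies larger than `r`.
Comparison of the integrals over all such sets gives a comparison almost everywhere. -/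
theorem fmod_sq_le_of_le (hL : IsLinearSolution c u₀ w₀ uL wL) {r : ℝ} (hr0 : 0 ≤ r) {s t : ℝ}
    (hs : 0 ≤ s) (hst : s ≤ t) : ∀ᵐ ξ, r ≤ ‖ξ‖ → fmod (uL t) (wL t) ξ ^ 2
      ≤ Real.exp (-(2 * c.rate r * (t - s))) * fmod (uL s) (wL s) ξ ^ 2 := by
  have key : ∀ n : ℕ, ∀ᵐ ξ, r ≤ ‖ξ‖ → ‖ξ‖ ≤ n → fmod (uL t) (wL t) ξ ^ 2
      ≤ Real.exp (-(2 * c.rate r * (t - s))) * fmod (uL s) (wL s) ξ ^ 2 := by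
    intro n
    set A : Set R3 := {ξ | r ≤ ‖ξ‖} ∩ Metric.closedBall 0 n
    have hA : MeasurableSet A :=
      (measurableSet_le measurable_const measurable_norm).inter measurableSet_closedBall
    have h1 := ae_le_of_forall_setIntegral_le
      (f := A.indicator fun ξ => fmod (uL t) (wL t) ξ ^ 2)
      (g := A.indicator fun ξ => Real.exp (-(2 * c.rate r * (t - s))) * fmod (uL s) (wL s) ξ ^ 2)
      ((integrable_fmod_sq _ _).indicator hA) (((integrable_fmod_sq _ _).const_mul _).indicator hA)
      fun T hT _ => by
        have hS : IsCut (T ∩ A) :=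
          ⟨hT.inter hA, Metric.isBounded_closedBall.subset (inter_subset_right.trans inter_subset_right)⟩
        rw [setIntegral_indicator hA, setIntegral_indicator hA, integral_const_mul,
          setIntegral_fmod_sq hS, setIntegral_fmod_sq hS]
        exact (hL.isFlow hS).decay hS hr0 (fun ξ hξ => hξ.2.1) hs hst
    filter_upwards [h1] with ξ hξ hr hn
    have hm : ξ ∈ A := ⟨hr, by simpa using hn⟩
    simpa only [indicator_of_mem hm] using hξ
  filter_upwards [ae_all_iff.2 key] with ξ hξ hr
  obtain ⟨n, hn⟩ := exists_nat_ge ‖ξ‖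
  exact hξ n hr hn

/-- The exceptional null set depends on `r`, so only rational `r` are used. A rational between
`‖ξ‖/2` and `‖ξ‖` gives the rate at `‖ξ‖/2`, at the cost of constants only. -/
theorem fmod_le (hL : IsLinearSolution c u₀ w₀ uL wL) {s t : ℝ} (hs : 0 ≤ s) (hst : s ≤ t) :
    ∀ᵐ ξ, fmod (uL t) (wL t) ξ
      ≤ Real.exp (-(c.rate (‖ξ‖ / 2) * (t - s))) * fmod (uL s) (wL s) ξ := by
  have h0 : ∀ᵐ ξ : R3, ξ ≠ 0 := by
    rw [ae_iff]; simp
  have h1 : ∀ᵐ ξ : R3, ∀ r : ℚ, 0 ≤ (r : ℝ) → (r : ℝ) ≤ ‖ξ‖ → fmod (uL t) (wL t) ξ ^ 2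
      ≤ Real.exp (-(2 * c.rate r * (t - s))) * fmod (uL s) (wL s) ξ ^ 2 := by
    refine ae_all_iff.2 fun r => ?_
    by_cases hr : 0 ≤ (r : ℝ)
    · filter_upwards [hL.fmod_sq_le_of_le hr hs hst] with ξ hξ _ h using hξ h
    · exact .of_forall fun ξ h => absurd h hr
  filter_upwards [h0, h1] with ξ hξ0 hξ
  have hpos : 0 < ‖ξ‖ := norm_pos_iff.2 hξ0
  obtain ⟨r, hr1, hr2⟩ := exists_rat_btwn (half_lt_self hpos)
  have h2 := hξ r (by linarith) hr2.le
  have h3 : c.rate (‖ξ‖ / 2) ≤ c.rate r := c.rate_mono (by positivity) hr1.le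
  refine le_of_sq_le_sq ?_ (mul_nonneg (Real.exp_pos _).le (fmod_nonneg _ _ _))
  rw [mul_pow, ← Real.exp_nat_mul]
  refine h2.trans ?_
  gcongr
  have : c.rate (‖ξ‖ / 2) * (t - s) ≤ c.rate r * (t - s) :=
    mul_le_mul_of_nonneg_right h3 (by linarith)
  push_cast
  linarith

end IsLinearSolution

/-! ### The energy of the linear flow -/

theorem dop_eq_proj_dop {S' : Set R3} (hS : IsCut S) (hS' : IsCut S') (hSS : S ⊆ S')
    {σ : R3 → V →L[ℝ] V} (hσ : Continuous σ) (f : LC) : dop S σ f = proj S (dop S' σ f) := by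
  refine Lp.ext ?_
  filter_upwards [dop_coe hS hσ f, dop_coe hS' hσ f, proj_coe hS (dop S' σ f)] with ξ h1 h2 h3
  rw [h1, h3]
  by_cases h : ξ ∈ S
  · simp [h, h2, hSS h]
  · simp [h]

theorem norm_dop_mono {S' : Set R3} (hS : IsCut S) (hS' : IsCut S') (hSS : S ⊆ S')
    {σ : R3 → V →L[ℝ] V} (hσ : Continuous σ) (f : LC) : ‖dop S σ f‖ ≤ ‖dop S' σ f‖ := by
  rw [dop_eq_proj_dop hS hS' hSS hσ]; exact norm_proj_le hS _

theorem dform_mono {S' : Set R3} (hS : IsCut S) (hS' : IsCut S') (hSS : S ⊆ S') (p q : LC) :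
    dform c S p q p q ≤ dform c S' p q p q := by
  rw [dform_self, dform_self]
  have := c.μ_pos; have := c.χ_pos; have := c.γ_nonneg; have := c.κ_nonneg
  have h1 : ‖dop S sCurl p - (2 : ℝ) • proj S q‖ ≤ ‖dop S' sCurl p - (2 : ℝ) • proj S' q‖ := by
    rw [dop_eq_proj_dop hS hS' hSS isOp_curl.cont, ← proj_proj_subset hS hS' hSS q, ← map_smul,
      ← map_sub]
    exact norm_proj_le hS _
  gcongr
  · exact norm_dop_mono hS hS' hSS (continuous_sD _) _
  · exact norm_dop_mono hS hS' hSS (continuous_sD _) _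
  · exact norm_dop_mono hS hS' hSS isOp_div.cont _

namespace IsLinearSolution

theorem energy_le (hL : IsLinearSolution c u₀ w₀ uL wL) (hS : IsCut S) {s t : ℝ} (hs : 0 ≤ s)
    (hst : s ≤ t) : energy (uL t) (wL t)
        + 2 * ∫ r in s..t, dform c S (Ftr (uL r)) (Ftr (wL r)) (Ftr (uL r)) (Ftr (wL r))
      ≤ energy (uL s) (wL s) := by
  have hlim : ∀ r, Tendsto (fun R : ℝ => ‖proj (Metric.closedBall 0 R) (Ftr (uL r))‖ ^ 2
      + ‖proj (Metric.closedBall 0 R) (Ftr (wL r))‖ ^ 2) atTop (𝓝 (energy (uL r) (wL r))) := by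
    intro r
    have := (tendsto_norm_proj_sq (Ftr (uL r))).add (tendsto_norm_proj_sq (Ftr (wL r)))
    simp only [LinearIsometry.norm_map] at this
    exact this
  obtain ⟨R₀, hR₀⟩ := hS.bdd.exists_norm_le
  refine le_of_tendsto_of_tendsto ((hlim t).add_const _) (hlim s) ?_
  filter_upwards [eventually_ge_atTop R₀] with R hR
  have hB : IsCut (Metric.closedBall (0 : R3) R) := IsCut.closedBall R
  have hSB : S ⊆ Metric.closedBall 0 R := fun x hx => by simpa using (hR₀ x hx).trans hR
  have h1 := (hL.isFlow hB).norm_sq_sub hs hst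
  simp only [mul_zero, add_zero] at h1
  rw [intervalIntegral.integral_const_mul] at h1
  have h2 : ∫ r in s..t, dform c S (Ftr (uL r)) (Ftr (wL r)) (Ftr (uL r)) (Ftr (wL r))
      ≤ ∫ r in s..t, dform c (Metric.closedBall 0 R) (Ftr (uL r)) (Ftr (wL r)) (Ftr (uL r))
        (Ftr (wL r)) := by
    refine intervalIntegral.integral_mono_on hst ?_ ?_ fun r _ => dform_mono hS hB hSB _ _
    · exact intervalIntegrable_of_continuousOn_Ici
        ((hL.isFlow hS).continuousOn_dform (hL.isFlow hS) hS) hs (hs.trans hst)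
    · exact intervalIntegrable_of_continuousOn_Ici
        ((hL.isFlow hB).continuousOn_dform (hL.isFlow hB) hB) hs (hs.trans hst)
  linarith

theorem antitoneOn (hL : IsLinearSolution c u₀ w₀ uL wL) :
    AntitoneOn (fun t => energy (uL t) (wL t)) (Ici 0) := by
  intro s hs t _ hst
  have h1 := hL.energy_le (IsCut.closedBall 0) hs hst
  have h2 : 0 ≤ ∫ r in s..t, dform c (Metric.closedBall 0 0) (Ftr (uL r)) (Ftr (wL r))
      (Ftr (uL r)) (Ftr (wL r)) :=
    intervalIntegral.integral_nonneg hst fun r _ => dform_self_nonneg _ _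
  simp only
  linarith

end IsLinearSolution

end

section

variable {c : Coeffs} {u₀ w₀ : L2} {uL wL : ℝ → L2} {S : Set R3}

/-! ### Gaussian moments -/

theorem integrable_exp_neg_mul_norm_sq {b : ℝ} (hb : 0 < b) :
    Integrable (fun ξ : R3 => Real.exp (-(b * ‖ξ‖ ^ 2))) := by
  have h := (GaussianFourier.integrable_cexp_neg_mul_sq_norm_add (V := R3) (b := (b : ℂ))
    (by simpa using hb) 0 0).norm
  refine h.congr (.of_forall fun ξ => ?_)
  simp only [Complex.norm_exp]
  congr 1
  simp [← Complex.ofReal_pow, ← Complex.ofReal_mul]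

theorem integrable_norm_sq_mul_exp {b : ℝ} (hb : 0 < b) :
    Integrable (fun ξ : R3 => (‖ξ‖ * Real.exp (-(b * ‖ξ‖ ^ 2))) ^ 2) := by
  refine ((integrable_exp_neg_mul_norm_sq hb).const_mul (b⁻¹)).mono'
    (by fun_prop : Continuous _).aestronglyMeasurable (.of_forall fun ξ => ?_)
  rw [Real.norm_of_nonneg (by positivity), mul_pow, ← Real.exp_nat_mul]
  have h1 : b * ‖ξ‖ ^ 2 ≤ Real.exp (b * ‖ξ‖ ^ 2) :=
    (by linarith : b * ‖ξ‖ ^ 2 ≤ b * ‖ξ‖ ^ 2 + 1).trans (Real.add_one_le_exp _)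
  have h2 : ‖ξ‖ ^ 2 ≤ b⁻¹ * Real.exp (b * ‖ξ‖ ^ 2) := by
    rw [← div_eq_inv_mul, le_div_iff₀ hb]; linarith
  calc _ ≤ b⁻¹ * Real.exp (b * ‖ξ‖ ^ 2) * Real.exp ((2 : ℕ) * (-(b * ‖ξ‖ ^ 2))) := by gcongr
    _ = _ := by rw [mul_assoc, ← Real.exp_add]; congr 2; push_cast; ring

/-- Dilation by `√t`: the exponent `5/2` is the sum of `1`, from `‖ξ‖²`, and `3/2`, from the volume
element. It is written as a square because a square root is taken afterwards. -/
theorem integral_norm_sq_mul_exp {b t : ℝ} (ht : 0 < t) :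
    ∫ ξ : R3, (‖ξ‖ * Real.exp (-(b * t * ‖ξ‖ ^ 2))) ^ 2
      = (t ^ (-(5 / 4) : ℝ)) ^ 2 * ∫ ξ : R3, (‖ξ‖ * Real.exp (-(b * ‖ξ‖ ^ 2))) ^ 2 := by
  have h := Measure.integral_comp_smul (volume : Measure R3)
    (fun ξ : R3 => (‖ξ‖ * Real.exp (-(b * ‖ξ‖ ^ 2))) ^ 2) (√t)
  have hs : 0 < √t := Real.sqrt_pos.2 ht
  have e : ∀ ξ : R3, (‖√t • ξ‖ * Real.exp (-(b * ‖√t • ξ‖ ^ 2))) ^ 2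
      = t * (‖ξ‖ * Real.exp (-(b * t * ‖ξ‖ ^ 2))) ^ 2 := by
    intro ξ
    rw [norm_smul, Real.norm_of_nonneg hs.le, mul_pow (√t), Real.sq_sqrt ht.le, mul_assoc b t]
    rw [mul_assoc, mul_pow (√t), Real.sq_sqrt ht.le]
  simp_rw [e] at h
  rw [integral_const_mul] at h
  have e2 : (t ^ (-(5 / 4) : ℝ)) ^ 2 = t⁻¹ * |(√t ^ Module.finrank ℝ R3)⁻¹| := by
    rw [abs_of_pos (by positivity), finrank_euclideanSpace, Fintype.card_fin, Real.sqrt_eq_rpow,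
      ← Real.rpow_natCast, ← Real.rpow_natCast, ← Real.rpow_mul ht.le, ← Real.rpow_mul ht.le,
      ← Real.rpow_neg ht.le, ← Real.rpow_neg_one, ← Real.rpow_add ht]
    norm_num
  rw [e2, mul_assoc, ← smul_eq_mul (|_|), ← h, ← mul_assoc, inv_mul_cancel₀ ht.ne', one_mul]

/-! ### The gradient of the linear flow in the Wiener algebra -/

theorem integrableOn_norm_mul_fmod (hS : IsCut S) (f g : L2) :
    IntegrableOn (fun ξ => ‖ξ‖ * fmod f g ξ) S := by
  have h1 : MemLp (fun ξ : R3 => ‖ξ‖) 2 (volume.restrict S) :=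
    (memLp_two_iff_integrable_sq continuous_norm.aestronglyMeasurable).2 (integrableOn_norm_sq_id hS)
  exact h1.integrable_mul ((memLp_fmod f g).restrict S)

namespace IsLinearSolution

/-- The evolution from `t/2` to `t` provides a Gaussian weight, and Cauchy–Schwarz pairs it with the
Fourier transform at time `t/2`. The decay of the linear energy is thus retained in addition to
`t^(-5/4)`. -/
theorem setIntegral_le_of_rate (hL : IsLinearSolution c u₀ w₀ uL wL) {a : ℝ} (ha : 0 < a) :
    ∃ C, 0 ≤ C ∧ ∀ S, IsCut S → (∀ ξ ∈ S, a * ‖ξ‖ ^ 2 ≤ c.rate (‖ξ‖ / 2)) → ∀ t, 0 < t →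
      ∫ ξ in S, ‖ξ‖ * fmod (uL t) (wL t) ξ
        ≤ C * (t ^ (-(5 / 4) : ℝ) * √(energy (uL (t / 2)) (wL (t / 2)))) := by
  refine ⟨√(∫ ξ : R3, (‖ξ‖ * Real.exp (-(a / 2 * ‖ξ‖ ^ 2))) ^ 2), Real.sqrt_nonneg _,
    fun S hS hrate t ht => ?_⟩
  set g : R3 → ℝ := fun ξ => ‖ξ‖ * Real.exp (-(a / 2 * t * ‖ξ‖ ^ 2))
  set F : R3 → ℝ := fmod (uL (t / 2)) (wL (t / 2))
  have hg2 : Integrable (fun ξ => g ξ ^ 2) := integrable_norm_sq_mul_exp (by positivity)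
  have hgm : Continuous g := by fun_prop
  have hg : MemLp g 2 volume := (memLp_two_iff_integrable_sq hgm.aestronglyMeasurable).2 hg2
  have hF : MemLp F 2 volume := memLp_fmod _ _
  have hg0 : ∀ ξ, 0 ≤ g ξ := fun ξ => by positivity
  have hF0 : ∀ ξ, 0 ≤ F ξ := fun ξ => fmod_nonneg _ _ _
  have hi : Integrable fun ξ => g ξ * F ξ := hg.integrable_mul hF
  calc ∫ ξ in S, ‖ξ‖ * fmod (uL t) (wL t) ξ ≤ ∫ ξ in S, g ξ * F ξ := by
        refine setIntegral_mono_on_ae (integrableOn_norm_mul_fmod hS _ _) hi.integrableOn hS.meas ?_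
        filter_upwards [hL.fmod_le (by positivity : 0 ≤ t / 2) (by linarith : t / 2 ≤ t)]
          with ξ hξ hm
        simp only [g]
        rw [mul_assoc]
        have h1 := mul_le_mul_of_nonneg_right (hrate ξ hm) (by linarith : 0 ≤ t - t / 2)
        refine mul_le_mul_of_nonneg_left (hξ.trans ?_) (norm_nonneg _)
        refine mul_le_mul_of_nonneg_right (Real.exp_le_exp.2 ?_) (hF0 ξ)
        have h2 : a * ‖ξ‖ ^ 2 * (t - t / 2) = a / 2 * t * ‖ξ‖ ^ 2 := by ring
        linarith
    _ ≤ ∫ ξ, g ξ * F ξ :=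
        setIntegral_le_integral hi (.of_forall fun ξ => mul_nonneg (hg0 ξ) (hF0 ξ))
    _ ≤ √(∫ ξ, g ξ ^ 2) * √(∫ ξ, F ξ ^ 2) := integral_mul_norm_le hg hF hg0 hF0
    _ = _ := by
        rw [integral_fmod_sq, integral_norm_sq_mul_exp ht, Real.sqrt_mul (sq_nonneg _),
          Real.sqrt_sq (by positivity)]
        ring

/-- For `γ > 0` the Gaussian bound holds at all frequencies. For `γ = 0` the rate stays bounded as
`‖ξ‖ → ∞`: the Gaussian bound is used for `‖ξ‖ ≤ 2`, and beyond it the initial data times an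
exponential in time, where the condition on their Fourier transform enters. -/
theorem exists_grad_bound (hL : IsLinearSolution c u₀ w₀ uL wL)
    (hF : c.γ = 0 → FourierCond u₀ w₀) :
    ∃ C b, 0 ≤ C ∧ 0 < b ∧ ∀ S, IsCut S → ∀ t, 0 < t → ∫ ξ in S, ‖ξ‖ * fmod (uL t) (wL t) ξ
      ≤ C * (t ^ (-(5 / 4) : ℝ) * √(energy (uL (t / 2)) (wL (t / 2))) + Real.exp (-(b * t))) := by
  have hl := c.low_pos
  rcases c.γ_nonneg.lt_or_eq with hγ | hγ
  · have hm : 0 < min c.low c.γ := lt_min hl hγ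
    obtain ⟨C, hC0, hC⟩ := hL.setIntegral_le_of_rate (a := min c.low c.γ / 4) (by positivity)
    refine ⟨C, 1, hC0, one_pos, fun S hS t ht => (hC S hS (fun ξ _ => ?_) t ht).trans ?_⟩
    · refine le_trans (le_of_eq ?_) (le_max_right _ _)
      ring
    · have := Real.exp_pos (-(1 * t))
      gcongr
      linarith
  · obtain ⟨C, hC0, hC⟩ := hL.setIntegral_le_of_rate (a := c.low / 4) (by positivity)
    have hF' := hF hγ.symm
    have hi : Integrable (fun ξ => ‖ξ‖ * fmod (uL 0) (wL 0) ξ) := by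
      rw [hL.u_zero, hL.w_zero]
      refine Integrable.mono' hF' (continuous_norm.aestronglyMeasurable.mul
        (aestronglyMeasurable_fmod _ _)) (.of_forall fun ξ => ?_)
      rw [Real.norm_of_nonneg (mul_nonneg (norm_nonneg _) (fmod_nonneg _ _ _))]
      exact mul_le_mul_of_nonneg_right (by linarith) (fmod_nonneg _ _ _)
    set G := ∫ ξ, ‖ξ‖ * fmod (uL 0) (wL 0) ξ
    have hG : 0 ≤ G := integral_nonneg fun ξ => mul_nonneg (norm_nonneg _) (fmod_nonneg _ _ _)
    refine ⟨max C G, c.low, hC0.trans (le_max_left _ _), hl, fun S hS t ht => ?_⟩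
    -- At `‖ξ‖ = 2` one has `(‖ξ‖/2)² = 1`, where the minimum in `Coeffs.rate` changes branch.
    set A : Set R3 := Metric.closedBall 0 2
    have hA : MeasurableSet A := measurableSet_closedBall
    have hSA : IsCut (S ∩ A) := hS.inter hA
    have hSA' : IsCut (S \ A) := ⟨hS.meas.diff hA, hS.bdd.subset sdiff_subset⟩
    rw [← integral_inter_add_sdiff hA (integrableOn_norm_mul_fmod hS _ _), mul_add]
    refine add_le_add ?_ ?_
    · refine (hC _ hSA (fun ξ hξ => ?_) t ht).trans ?_
      · have h2 : ‖ξ‖ ≤ 2 := by simpa [A] using hξ.2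
        refine le_trans (le_of_eq ?_) (le_max_left _ _)
        rw [min_eq_left]
        · ring
        · nlinarith [norm_nonneg ξ]
      · gcongr; exact le_max_left _ _
    · have h1 : ∫ ξ in S \ A, ‖ξ‖ * fmod (uL t) (wL t) ξ
          ≤ ∫ ξ in S \ A, Real.exp (-(c.low * t)) * (‖ξ‖ * fmod (uL 0) (wL 0) ξ) := by
        refine setIntegral_mono_on_ae (integrableOn_norm_mul_fmod hSA' _ _)
          (hi.const_mul _).integrableOn hSA'.meas ?_
        filter_upwards [hL.fmod_le le_rfl ht.le] with ξ hξ hm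
        have h2 : 2 < ‖ξ‖ := by simpa [A] using hm.2
        rw [sub_zero] at hξ
        have h3 : c.low ≤ c.rate (‖ξ‖ / 2) := by
          refine le_trans (le_of_eq ?_) (le_max_left _ _)
          rw [min_eq_right, mul_one]
          nlinarith
        have h4 : Real.exp (-(c.rate (‖ξ‖ / 2) * t)) ≤ Real.exp (-(c.low * t)) := by
          gcongr
        have h5 := hξ.trans (mul_le_mul_of_nonneg_right h4 (fmod_nonneg _ _ _))
        calc _ ≤ ‖ξ‖ * (Real.exp (-(c.low * t)) * fmod (uL 0) (wL 0) ξ) := by gcongr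
          _ = _ := by ring
      rw [integral_const_mul] at h1
      have h6 : ∫ ξ in S \ A, ‖ξ‖ * fmod (uL 0) (wL 0) ξ ≤ G :=
        setIntegral_le_integral hi (.of_forall fun ξ => mul_nonneg (norm_nonneg _) (fmod_nonneg _ _ _))
      calc _ ≤ _ := h1
        _ ≤ Real.exp (-(c.low * t)) * max C G := by gcongr; exact h6.trans (le_max_right _ _)
        _ = _ := mul_comm _ _

end IsLinearSolution

end

section

variable {c : Coeffs} {θ : R3 → ℝ} {ε : ℝ} {u₀ w₀ : L2} {u w uL wL : ℝ → L2} {S : Set R3}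

/-! ### Fourier splitting -/

theorem IsCut.subset_closedBall {ρ R : ℝ} (h : ρ ≤ R) :
    Metric.closedBall (0 : R3) ρ ⊆ Metric.closedBall 0 R := Metric.closedBall_subset_closedBall h

/-- A family of dissipation inequalities at the frequencies smaller than `R` gives, as `R → ∞`,
a damping estimate in terms of the low frequencies of the first field. -/
theorem add_mul_le_of_dform {p q : ℝ → LC} {a b ρ m R₀ Ya Yb : ℝ} (ha : 0 ≤ a) (hab : a ≤ b)
    (hρ0 : 0 ≤ ρ) (hρ1 : ρ ≤ 1) (hρR : ρ ≤ R₀)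
    (hp : ∀ R, R₀ ≤ R → ContinuousOn (fun t => proj (Metric.closedBall 0 R) (p t)) (Ici 0))
    (hq : ∀ R, R₀ ≤ R → ContinuousOn (fun t => proj (Metric.closedBall 0 R) (q t)) (Ici 0))
    (hd : ∀ R, R₀ ≤ R → ContinuousOn
      (fun t => dform c (Metric.closedBall 0 R) (p t) (q t) (p t) (q t)) (Ici 0))
    (H : ∀ R, R₀ ≤ R →
      Yb + 2 * ∫ r in a..b, dform c (Metric.closedBall 0 R) (p r) (q r) (p r) (q r) ≤ Ya)
    (hm : ∀ r ∈ Icc a b, m ≤ ‖p r‖ ^ 2 + ‖q r‖ ^ 2 - ‖proj (Metric.closedBall 0 ρ) (p r)‖ ^ 2) :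
    Yb + 2 * c.low * ρ ^ 2 * (b - a) * m ≤ Ya := by
  have hl := c.low_pos
  have hcρ : IsCut (Metric.closedBall (0 : R3) ρ) := IsCut.closedBall ρ
  set f : ℝ → ℝ → ℝ := fun R r => ‖proj (Metric.closedBall 0 R) (p r)‖ ^ 2
    + ‖proj (Metric.closedBall 0 R) (q r)‖ ^ 2 - ‖proj (Metric.closedBall 0 ρ) (p r)‖ ^ 2
  have hρp : ContinuousOn (fun t => proj (Metric.closedBall 0 ρ) (p t)) (Ici 0) := by
    have := (proj (Metric.closedBall (0 : R3) ρ)).continuous.comp_continuousOn (hp R₀ le_rfl)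
    refine this.congr fun t _ => ?_
    exact (proj_proj_subset hcρ (IsCut.closedBall R₀) (IsCut.subset_closedBall hρR) _).symm
  have hfc : ∀ R, R₀ ≤ R → ContinuousOn (fun r => min (f R r) m) (Ici 0) := fun R hR => by
    have : ContinuousOn (f R) (Ici 0) :=
      (((hp R hR).norm.pow 2).add ((hq R hR).norm.pow 2)).sub (hρp.norm.pow 2)
    exact this.inf continuousOn_const
  have hf0 : ∀ R, R₀ ≤ R → ∀ r, 0 ≤ f R r := by
    intro R hR r
    have h1 := norm_proj_le_of_subset hcρ (IsCut.closedBall R)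
      (IsCut.subset_closedBall (hρR.trans hR)) (p r)
    have h2 : ‖proj (Metric.closedBall 0 ρ) (p r)‖ ^ 2
      ≤ ‖proj (Metric.closedBall 0 R) (p r)‖ ^ 2 := by gcongr
    simp only [f]
    nlinarith [sq_nonneg ‖proj (Metric.closedBall 0 R) (q r)‖]
  have hfd : ∀ R, R₀ ≤ R → ∀ r, c.low * ρ ^ 2 * min (f R r) m
      ≤ dform c (Metric.closedBall 0 R) (p r) (q r) (p r) (q r) := by
    intro R hR r
    have hcR : IsCut (Metric.closedBall (0 : R3) R) := IsCut.closedBall R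
    have h1 := le_dform_self (c := c) hcR (p r) (q r)
    have h2 := le_sum_norm_dop_sD_sq hcR hcρ (IsCut.subset_closedBall (hρR.trans hR)) (r := ρ)
      (fun ξ _ hξ => by
        have : ρ < ‖ξ‖ := by simpa using hξ
        exact this.le) hρ0 (p r)
    have h3 : 0 ≤ c.γ * ∑ j, ‖dop (Metric.closedBall 0 R) (sD j) (q r)‖ ^ 2 :=
      mul_nonneg c.γ_nonneg (Finset.sum_nonneg fun _ _ => sq_nonneg _)
    -- Because `ρ ≤ 1`, the zeroth order damping of `q` covers all its frequencies, so only the low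
    -- frequencies of `p` are lost.
    have h4 : ρ ^ 2 * ‖proj (Metric.closedBall 0 R) (q r)‖ ^ 2
        ≤ ‖proj (Metric.closedBall 0 R) (q r)‖ ^ 2 :=
      mul_le_of_le_one_left (sq_nonneg _) (pow_le_one₀ hρ0 hρ1)
    have h5 : c.low * ρ ^ 2 * min (f R r) m ≤ c.low * ρ ^ 2 * f R r := by
      gcongr; exact min_le_left _ _
    have h6 : c.low * (ρ ^ 2 * f R r) ≤ c.low * (∑ j, ‖dop (Metric.closedBall 0 R) (sD j) (p r)‖ ^ 2
        + ‖proj (Metric.closedBall 0 R) (q r)‖ ^ 2) := by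
      refine mul_le_mul_of_nonneg_left ?_ hl.le
      simp only [f]
      linarith
    linarith
  -- Capping the integrand at `m` gives the constant majorant `|m|`, and by `hm` the capped
  -- integrand tends to `m` itself as `R → ∞`.
  have hlim : Tendsto (fun R => ∫ r in a..b, min (f R r) m) atTop (𝓝 (∫ _ in a..b, m)) := by
    refine intervalIntegral.tendsto_integral_filter_of_dominated_convergence (fun _ => |m|) ?_ ?_
      intervalIntegrable_const ?_
    · filter_upwards [eventually_ge_atTop R₀] with R hR
      exact (intervalIntegrable_iff.1 (intervalIntegrable_of_continuousOn_Ici (hfc R hR) ha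
        (ha.trans hab))).aestronglyMeasurable
    · filter_upwards [eventually_ge_atTop R₀] with R hR
      refine .of_forall fun r _ => ?_
      have := hf0 R hR r
      rw [Real.norm_eq_abs, abs_le]
      constructor
      · refine le_min ?_ (neg_abs_le m)
        linarith [abs_nonneg m]
      · exact (min_le_right _ _).trans (le_abs_self m)
    · refine .of_forall fun r hr => ?_
      rw [uIoc_of_le hab] at hr
      have h1 : Tendsto (fun R => f R r) atTop
          (𝓝 (‖p r‖ ^ 2 + ‖q r‖ ^ 2 - ‖proj (Metric.closedBall 0 ρ) (p r)‖ ^ 2)) :=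
        ((tendsto_norm_proj_sq (p r)).add (tendsto_norm_proj_sq (q r))).sub_const _
      have h2 := h1.min (tendsto_const_nhds (x := m))
      rwa [min_eq_right (hm r ⟨hr.1.le, hr.2⟩)] at h2
  rw [intervalIntegral.integral_const, smul_eq_mul] at hlim
  have h1 := ((hlim.const_mul (2 * c.low * ρ ^ 2)).const_add Yb)
  rw [← mul_assoc] at h1
  refine le_of_tendsto h1 ?_
  filter_upwards [eventually_ge_atTop R₀] with R hR
  refine le_trans ?_ (H R hR)
  have h2 : ∫ r in a..b, c.low * ρ ^ 2 * min (f R r) m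
      ≤ ∫ r in a..b, dform c (Metric.closedBall 0 R) (p r) (q r) (p r) (q r) :=
    intervalIntegral.integral_mono_on hab
      ((intervalIntegrable_of_continuousOn_Ici (hfc R hR) ha (ha.trans hab)).const_mul _)
      (intervalIntegrable_of_continuousOn_Ici (hd R hR) ha (ha.trans hab)) fun r _ => hfd R hR r
  rw [intervalIntegral.integral_const_mul] at h2
  linarith

/-- The scale at which frequencies are split at time `T`. -/
def splitScale (c : Coeffs) : ℝ := 31 / (2 * c.low)

theorem splitScale_pos (c : Coeffs) : 0 < splitScale c := by
  have := c.low_pos; unfold splitScale; positivity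

/-- The frequency at which one splits at time `T`. -/
def splitFreq (c : Coeffs) (T : ℝ) : ℝ := √(splitScale c / T)

theorem splitFreq_nonneg (T : ℝ) : 0 ≤ splitFreq c T := Real.sqrt_nonneg _

theorem splitFreq_le_one {T : ℝ} (hT : splitScale c ≤ T) : splitFreq c T ≤ 1 := by
  have h0 := splitScale_pos c
  exact Real.sqrt_le_one.2 ((div_le_one (h0.trans_le hT)).2 hT)

/-- With this choice the damping estimate reads `E(2T) + 31 (E(2T) - l) ≤ E(T)`, which leaves only
`E(T)/32`. The factor `1/16` kept below beats the loss of `8` allowed per doubling of time in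
`exists_dyadic_bound`. -/
theorem splitFreq_sq {T : ℝ} (hT : 0 < T) : 2 * c.low * splitFreq c T ^ 2 * T = 31 := by
  have h0 := splitScale_pos c
  have := c.low_pos
  rw [splitFreq, Real.sq_sqrt (by positivity), splitScale]
  field_simp

/-- The energy is non-increasing, so its value at `2T`, less the bound `l` on low frequencies, is a
lower bound `m` for the damped quantity on the whole interval. The nonlinear recursion uses the same
choice of `m`. -/
theorem IsLinearSolution.energy_two_mul_le (hL : IsLinearSolution c u₀ w₀ uL wL) {T l : ℝ}
    (hT : splitScale c ≤ T) (hl : ∀ r ∈ Icc T (2 * T), ‖uL r‖ ^ 2 ≤ l) :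
    Micropolar.energy (uL (2 * T)) (wL (2 * T))
      ≤ 1 / 16 * Micropolar.energy (uL T) (wL T) + l := by
  have hT0 : 0 < T := (splitScale_pos c).trans_le hT
  have hρ := splitFreq_le_one hT
  have h := add_mul_le_of_dform (c := c) (p := fun t => Ftr (uL t)) (q := fun t => Ftr (wL t))
    (R₀ := 1) (m := Micropolar.energy (uL (2 * T)) (wL (2 * T)) - l) hT0.le
    (by linarith : T ≤ 2 * T) (splitFreq_nonneg (c := c) T) hρ hρ
    (fun R _ => (hL.isFlow (IsCut.closedBall R)).continuousOn_proj_fst)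
    (fun R _ => (hL.isFlow (IsCut.closedBall R)).continuousOn_proj_snd)
    (fun R _ => (hL.isFlow (IsCut.closedBall R)).continuousOn_dform
      (hL.isFlow (IsCut.closedBall R)) (IsCut.closedBall R))
    (fun R _ => hL.energy_le (IsCut.closedBall R) hT0.le (by linarith : T ≤ 2 * T)) ?_
  · have e : 2 * T - T = T := by ring
    rw [e, splitFreq_sq hT0] at h
    have := energy_nonneg (uL T) (wL T)
    have hl0 : 0 ≤ l := (sq_nonneg _).trans (hl T ⟨le_rfl, by linarith⟩)
    linarith
  · intro r hr
    have h1 := hL.antitoneOn (mem_Ici.2 (hT0.le.trans hr.1)) (mem_Ici.2 (by linarith)) hr.2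
    have h2 : ‖proj (Metric.closedBall 0 (splitFreq c T)) (Ftr (uL r))‖ ≤ ‖uL r‖ := by
      have := norm_proj_le (IsCut.closedBall (splitFreq c T)) (Ftr (uL r))
      rwa [LinearIsometry.norm_map] at this
    have h3 : ‖proj (Metric.closedBall 0 (splitFreq c T)) (Ftr (uL r))‖ ^ 2 ≤ ‖uL r‖ ^ 2 := by
      gcongr
    have h4 := hl r hr
    simp only [Micropolar.energy, LinearIsometry.norm_map] at h1 ⊢
    linarith

theorem low_freq_le (h : IsMollifiedSolution c θ ε u₀ w₀ u w) (hθ : IsMollifier θ) (hε : 0 < ε)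
    (hL : IsLinearSolution c u₀ w₀ uL wL) {ρ : ℝ} (hρ : 0 ≤ ρ) {r T : ℝ} (hr : 0 ≤ r)
    (hrT : r ≤ T) : ‖proj (Metric.closedBall 0 ρ) (Ftr (u r) - Ftr (uL r))‖ ^ 2
      ≤ lowConst * ρ ^ 5 * (∫ r in (0 : ℝ)..T, energy (u r) (w r)) ^ 2 := by
  have h1 := low_freq h hθ hε hL hρ hr
  have h2 : ∫ r in (0 : ℝ)..r, energy (u r) (w r) ≤ ∫ r in (0 : ℝ)..T, energy (u r) (w r) :=
    intervalIntegral.integral_mono_interval le_rfl hr hrT (.of_forall fun _ => energy_nonneg _ _)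
      (h.intervalIntegrable_energy hθ hε le_rfl (hr.trans hrT))
  have h3 : 0 ≤ ∫ r in (0 : ℝ)..r, energy (u r) (w r) :=
    intervalIntegral.integral_nonneg hr fun _ _ => energy_nonneg _ _
  have h4 : lowConst * ρ ^ 5 * (∫ r in (0 : ℝ)..r, energy (u r) (w r)) ^ 2
      ≤ lowConst * ρ ^ 5 * (∫ r in (0 : ℝ)..T, energy (u r) (w r)) ^ 2 := by
    have := lowConst_nonneg
    gcongr
  linarith [sq_nonneg ‖proj (Metric.closedBall 0 ρ) (Ftr (w r) - Ftr (wL r))‖]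

theorem energy_two_mul_le_of_low (h : IsMollifiedSolution c θ ε u₀ w₀ u w) (hθ : IsMollifier θ)
    (hε : 0 < ε) {T l : ℝ} (hT : splitScale c ≤ T)
    (hl : ∀ r ∈ Icc T (2 * T), ‖proj (Metric.closedBall 0 (splitFreq c T)) (Ftr (u r))‖ ^ 2 ≤ l) :
    energy (u (2 * T)) (w (2 * T)) ≤ 1 / 16 * energy (u T) (w T) + l := by
  have hT0 : 0 < T := (splitScale_pos c).trans_le hT
  have hρ := splitFreq_le_one hT
  have hl0 : 0 ≤ l := (sq_nonneg _).trans (hl T ⟨le_rfl, by linarith⟩)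
  have h' := add_mul_le_of_dform (c := c) (p := fun t => Ftr (u t)) (q := fun t => Ftr (w t))
    (R₀ := 1) (m := energy (u (2 * T)) (w (2 * T)) - l) hT0.le
    (by linarith : T ≤ 2 * T) (splitFreq_nonneg (c := c) T) hρ hρ
    (fun R _ => (h.isFlow hθ hε (IsCut.closedBall R)).continuousOn_proj_fst)
    (fun R _ => (h.isFlow hθ hε (IsCut.closedBall R)).continuousOn_proj_snd)
    (fun R _ => (h.isFlow hθ hε (IsCut.closedBall R)).continuousOn_dform
      (h.isFlow hθ hε (IsCut.closedBall R)) (IsCut.closedBall R))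
    (fun R _ => h.energy_le hθ hε (IsCut.closedBall R) hT0.le (by linarith : T ≤ 2 * T)) ?_
  · have e : 2 * T - T = T := by ring
    rw [e, splitFreq_sq hT0] at h'
    have := energy_nonneg (u T) (w T)
    linarith
  · intro r hr
    have h1 := h.antitoneOn hθ hε (mem_Ici.2 (hT0.le.trans hr.1)) (mem_Ici.2 (by linarith)) hr.2
    have h4 := hl r hr
    simp only [energy, LinearIsometry.norm_map] at h1 ⊢
    linarith

/-- The contribution of the nonlinear term at low frequencies. -/
def lowForce (c : Coeffs) (u w : ℝ → L2) (T : ℝ) : ℝ :=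
  lowConst * splitFreq c T ^ 5 * (∫ r in (0 : ℝ)..2 * T, energy (u r) (w r)) ^ 2

theorem lowForce_nonneg (T : ℝ) : 0 ≤ lowForce c u w T := by
  have := lowConst_nonneg
  have := splitFreq_nonneg (c := c) T
  unfold lowForce; positivity

theorem energy_two_mul_le (h : IsMollifiedSolution c θ ε u₀ w₀ u w) (hθ : IsMollifier θ)
    (hε : 0 < ε) (hL : IsLinearSolution c u₀ w₀ uL wL) {T l : ℝ} (hT : splitScale c ≤ T)
    (hl : ∀ r ∈ Icc T (2 * T), ‖uL r‖ ^ 2 ≤ l) :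
    energy (u (2 * T)) (w (2 * T))
      ≤ 1 / 16 * energy (u T) (w T) + (2 * l + 2 * lowForce c u w T) := by
  have hT0 : 0 < T := (splitScale_pos c).trans_le hT
  refine energy_two_mul_le_of_low h hθ hε hT fun r hr => ?_
  have h2 : ‖proj (Metric.closedBall 0 (splitFreq c T)) (Ftr (uL r))‖ ≤ ‖uL r‖ := by
    have := norm_proj_le (IsCut.closedBall (splitFreq c T)) (Ftr (uL r))
    rwa [LinearIsometry.norm_map] at this
  have h3 : ‖proj (Metric.closedBall 0 (splitFreq c T)) (Ftr (uL r))‖ ^ 2 ≤ ‖uL r‖ ^ 2 := by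
    gcongr
  have h4 := hl r hr
  have h5 := low_freq_le h hθ hε hL (splitFreq_nonneg (c := c) T) (hT0.le.trans hr.1) hr.2
  rw [map_sub] at h5
  unfold lowForce
  set a := proj (Metric.closedBall 0 (splitFreq c T)) (Ftr (u r))
  set b := proj (Metric.closedBall 0 (splitFreq c T)) (Ftr (uL r))
  have h7 : ‖a‖ ≤ ‖b‖ + ‖a - b‖ := by
    have := norm_add_le b (a - b)
    rwa [add_sub_cancel] at this
  nlinarith [norm_nonneg a, sq_nonneg (‖b‖ - ‖a - b‖)]

/-- Here the initial data replace the linear flow, so that no decay assumption is needed. -/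
theorem energy_two_mul_le_self (h : IsMollifiedSolution c θ ε u₀ w₀ u w) (hθ : IsMollifier θ)
    (hε : 0 < ε) {T : ℝ} (hT : splitScale c ≤ T) :
    energy (u (2 * T)) (w (2 * T)) ≤ 1 / 16 * energy (u T) (w T)
      + (2 * (‖proj (Metric.closedBall 0 (splitFreq c T)) (Ftr u₀)‖ ^ 2
        + ‖proj (Metric.closedBall 0 (splitFreq c T)) (Ftr w₀)‖ ^ 2) + 2 * lowForce c u w T) := by
  have hT0 : 0 < T := (splitScale_pos c).trans_le hT
  refine energy_two_mul_le_of_low h hθ hε hT fun r hr => ?_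
  have hr0 : 0 ≤ r := hT0.le.trans hr.1
  have hρ := splitFreq_nonneg (c := c) T
  have h1 := low_freq_self h hθ hε hρ hr0
  have h2 : ∫ r in (0 : ℝ)..r, energy (u r) (w r) ≤ ∫ r in (0 : ℝ)..2 * T, energy (u r) (w r) :=
    intervalIntegral.integral_mono_interval le_rfl hr0 hr.2 (.of_forall fun _ => energy_nonneg _ _)
      (h.intervalIntegrable_energy hθ hε le_rfl (by linarith))
  have h3 : 0 ≤ ∫ r in (0 : ℝ)..r, energy (u r) (w r) :=
    intervalIntegral.integral_nonneg hr0 fun _ _ => energy_nonneg _ _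
  have h4 : lowConst * splitFreq c T ^ 5 * (∫ r in (0 : ℝ)..r, energy (u r) (w r)) ^ 2
      ≤ lowForce c u w T := by
    have := lowConst_nonneg
    unfold lowForce
    gcongr
  linarith [sq_nonneg ‖proj (Metric.closedBall 0 (splitFreq c T)) (Ftr (w r))‖]

/-! ### The difference with the linear flow -/

theorem transp_sub_left (K : R3 → ℝ) (f : L2) (p q p₁ q₁ p' q' : LC) :
    transp K S f (p - p₁) (q - q₁) p' q' = transp K S f p q p' q' - transp K S f p₁ q₁ p' q' := by
  simp only [transp, map_sub, inner_sub_left, Finset.sum_sub_distrib]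
  ring

theorem transp_proj_self {K : R3 → ℝ} (hK : IsMollifier K) (hS : IsCut S) {f : L2} (hf : f ∈ L2σ)
    (p q : LC) : transp K S f (proj S p) (proj S q) p q = 0 := by
  rw [transp, sum_inner_conv_proj hK hf hS, sum_inner_conv_proj hK hf hS, add_zero]

theorem dform_proj_left (hS : IsCut S) (p q p' q' : LC) :
    dform c S (proj S p) (proj S q) p' q' = dform c S p q p' q' := by
  simp only [dform, dop_proj hS (continuous_sD _), dop_proj hS isOp_div.cont,
    dop_proj hS isOp_curl.cont, proj_proj_subset hS hS subset_rfl]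

theorem dop_proj_superset {S' : Set R3} (hS : IsCut S) (hS' : IsCut S') (hSS : S ⊆ S')
    {σ : R3 → V →L[ℝ] V} (hσ : Continuous σ) (f : LC) : dop S' σ (proj S f) = dop S σ f := by
  refine Lp.ext ?_
  filter_upwards [dop_coe hS hσ f, dop_coe hS' hσ (proj S f), proj_coe hS f] with ξ h1 h2 h3
  rw [h1, h2]
  by_cases h : ξ ∈ S
  · simp [h, h3, hSS h]
  · by_cases h' : ξ ∈ S' <;> simp [h, h', h3]

theorem inner_dop_dop_subset {S' : Set R3} (hS : IsCut S) (hS' : IsCut S') (hSS : S ⊆ S')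
    {σ τ : R3 → V →L[ℝ] V} (hσ : Continuous σ) (hτ : Continuous τ) (f g : LC) :
    inner ℝ (dop S' σ f) (dop S τ g) = inner ℝ (dop S σ f) (dop S τ g) := by
  rw [dop_eq_proj_dop hS hS' hSS hσ f, inner_dop_proj hS hτ]

theorem dform_proj_superset {S' : Set R3} (hS : IsCut S) (hS' : IsCut S') (hSS : S ⊆ S')
    (p q p' q' : LC) : dform c S' p q (proj S p') (proj S q') = dform c S p q p' q' := by
  have h1 : proj S' (proj S q') = proj S q' := dop_proj_superset hS hS' hSS continuous_const q'
  have h2 : ∀ a b : LC, inner ℝ (proj S' a) (dop S sCurl b) = inner ℝ (proj S a) (dop S sCurl b) :=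
    fun a b => inner_dop_dop_subset hS hS' hSS continuous_const isOp_curl.cont a b
  have h3 : ∀ a b : LC, inner ℝ (proj S' a) (proj S b) = inner ℝ (proj S a) (proj S b) :=
    fun a b => inner_dop_dop_subset hS hS' hSS continuous_const continuous_const a b
  have h4 : ∀ a b : LC, inner ℝ (dop S' sCurl a) (proj S b) = inner ℝ (dop S sCurl a) (proj S b) :=
    fun a b => inner_dop_dop_subset hS hS' hSS isOp_curl.cont continuous_const a b
  simp only [dform, dop_proj_superset hS hS' hSS (continuous_sD _),
    dop_proj_superset hS hS' hSS isOp_div.cont, dop_proj_superset hS hS' hSS isOp_curl.cont, h1,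
    inner_dop_dop_subset hS hS' hSS (continuous_sD _) (continuous_sD _),
    inner_dop_dop_subset hS hS' hSS isOp_div.cont isOp_div.cont,
    inner_dop_dop_subset hS hS' hSS isOp_curl.cont isOp_curl.cont, inner_sub_left, inner_sub_right,
    real_inner_smul_left, real_inner_smul_right, h2, h3, h4]

theorem dform_sub_proj {S' : Set R3} (hS : IsCut S) (hS' : IsCut S') (hSS : S ⊆ S')
    (p q p' q' : LC) :
    dform c S' (p - proj S p') (q - proj S q') (p - proj S p') (q - proj S q')
      = dform c S' p q p q - 2 * dform c S p q p' q' + dform c S p' q' p' q' := by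
  rw [dform_sub_left, dform_sub_right, dform_sub_right, dform_proj_superset hS hS' hSS,
    dform_proj_superset hS hS' hSS, dform_comm (proj S p'), dform_proj_superset hS hS' hSS,
    dform_proj_left hS]
  ring

theorem norm_sub_proj_sq' (hS : IsCut S) (p p' : LC) :
    ‖p - proj S p'‖ ^ 2 = ‖p‖ ^ 2 - 2 * inner ℝ (proj S p) (proj S p') + ‖proj S p'‖ ^ 2 := by
  rw [norm_sub_sq_real, inner_proj_right hS]

/-- The square of the difference is expanded: the energy inequality of the solution, minus twice the
cross identity between the two flows, plus the identity of the linear flow. Only the linear field is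
truncated to `S`, which suffices for the cross terms; the dissipation of the solution is available
on any larger `S'`. -/
theorem diff_energy_le (h : IsMollifiedSolution c θ ε u₀ w₀ u w) (hθ : IsMollifier θ)
    (hε : 0 < ε) (hL : IsLinearSolution c u₀ w₀ uL wL) {S' : Set R3} (hS : IsCut S)
    (hS' : IsCut S') (hSS : S ⊆ S') {s t : ℝ} (hs : 0 ≤ s) (hst : s ≤ t) :
    (‖Ftr (u t) - proj S (Ftr (uL t))‖ ^ 2 + ‖Ftr (w t) - proj S (Ftr (wL t))‖ ^ 2)
      + 2 * ∫ r in s..t, dform c S' (Ftr (u r) - proj S (Ftr (uL r)))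
          (Ftr (w r) - proj S (Ftr (wL r))) (Ftr (u r) - proj S (Ftr (uL r)))
          (Ftr (w r) - proj S (Ftr (wL r)))
      ≤ (‖Ftr (u s) - proj S (Ftr (uL s))‖ ^ 2 + ‖Ftr (w s) - proj S (Ftr (wL s))‖ ^ 2)
      - 2 * ∫ r in s..t, transp (ker θ ε) S (u r) (Ftr (u r)) (Ftr (w r)) (Ftr (uL r))
          (Ftr (wL r)) := by
  have ht := hs.trans hst
  have hF := h.isFlow hθ hε hS
  have hF' := h.isFlow hθ hε hS'
  have hFL := hL.isFlow hS
  have e1 := hF.inner_sub_inner hFL hs hst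
  have e2 := hFL.norm_sq_sub hs hst
  have e3 := h.energy_le hθ hε hS' hs hst
  have c1 := hF'.continuousOn_dform hF' hS'
  have c2 := hF.continuousOn_dform hFL hS
  have c3 := hFL.continuousOn_dform hFL hS
  have c4 : ContinuousOn (fun r => transp (ker θ ε) S (u r) (Ftr (u r)) (Ftr (w r)) (Ftr (uL r))
      (Ftr (wL r))) (Ici 0) :=
    ((hF.continuousOn_rate hFL).add (c2.const_smul (2 : ℝ))).congr fun r _ => by
      simp only [Pi.add_apply, Pi.smul_apply, smul_eq_mul]; ring
  have i1 := intervalIntegrable_of_continuousOn_Ici c1 hs ht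
  have i2 := intervalIntegrable_of_continuousOn_Ici c2 hs ht
  have i3 := intervalIntegrable_of_continuousOn_Ici c3 hs ht
  have i4 := intervalIntegrable_of_continuousOn_Ici c4 hs ht
  simp only [mul_zero, add_zero] at e1 e2
  rw [intervalIntegral.integral_add (i2.const_mul _) i4, intervalIntegral.integral_const_mul] at e1
  rw [intervalIntegral.integral_const_mul] at e2
  simp only [dform_sub_proj hS hS' hSS, norm_sub_proj_sq' hS, LinearIsometry.norm_map]
  rw [intervalIntegral.integral_add (i1.sub (i2.const_mul 2)) i3,
    intervalIntegral.integral_sub i1 (i2.const_mul 2), intervalIntegral.integral_const_mul]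
  simp only [energy] at e3
  linarith

end

/-! ### The contraction estimate for the difference with the linear flow. -/

section

variable {c : Coeffs} {θ : R3 → ℝ} {ε : ℝ} {u₀ w₀ : L2} {u w uL wL : ℝ → L2} {S : Set R3}

/-- By the cancellation property, the truncated linear field may be subtracted from the transported
field at no cost. This produces the factor measuring the difference instead of the whole field. -/
theorem abs_transp_le_fmod {K : R3 → ℝ} (hK : IsMollifier K) (hS : IsCut S) {f f' g' : L2}
    (hf : f ∈ L2σ) (p q : LC) : |transp K S f p q (Ftr f') (Ftr g')|
      ≤ (12 * Real.pi * ‖f‖ * ∫ ξ in S, ‖ξ‖ * fmod f' g' ξ)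
        * √(‖p - proj S (Ftr f')‖ ^ 2 + ‖q - proj S (Ftr g')‖ ^ 2) := by
  have e : transp K S f p q (Ftr f') (Ftr g')
      = transp K S f (p - proj S (Ftr f')) (q - proj S (Ftr g')) (Ftr f') (Ftr g') := by
    rw [transp_sub_left, transp_proj_self hK hS hf, sub_zero]
  rw [e]
  set a := p - proj S (Ftr f')
  set b := q - proj S (Ftr g')
  set g := ∫ ξ in S, ‖ξ‖ * fmod f' g' ξ
  have hg : 0 ≤ g := integral_nonneg fun ξ => mul_nonneg (norm_nonneg _) (fmod_nonneg _ _ _)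
  have h1 : ∫ ξ in S, ‖ξ‖ * ‖Ftr f' ξ‖ ≤ g := by
    refine setIntegral_mono (integrableOn_norm_mul hS _) (integrableOn_norm_mul_fmod hS _ _)
      fun ξ => ?_
    exact mul_le_mul_of_nonneg_left (Real.le_sqrt_of_sq_le (by nlinarith [sq_nonneg ‖Ftr g' ξ‖]))
      (norm_nonneg _)
  have h2 : ∫ ξ in S, ‖ξ‖ * ‖Ftr g' ξ‖ ≤ g := by
    refine setIntegral_mono (integrableOn_norm_mul hS _) (integrableOn_norm_mul_fmod hS _ _)
      fun ξ => ?_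
    exact mul_le_mul_of_nonneg_left (Real.le_sqrt_of_sq_le (by nlinarith [sq_nonneg ‖Ftr f' ξ‖]))
      (norm_nonneg _)
  have h3 : ‖a‖ ≤ √(‖a‖ ^ 2 + ‖b‖ ^ 2) := Real.le_sqrt_of_sq_le (by nlinarith [sq_nonneg ‖b‖])
  have h4 : ‖b‖ ≤ √(‖a‖ ^ 2 + ‖b‖ ^ 2) := Real.le_sqrt_of_sq_le (by nlinarith [sq_nonneg ‖a‖])
  have hp := Real.pi_pos
  calc _ ≤ 6 * Real.pi * ‖f‖ * (‖a‖ * (∫ ξ in S, ‖ξ‖ * ‖Ftr f' ξ‖)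
        + ‖b‖ * ∫ ξ in S, ‖ξ‖ * ‖Ftr g' ξ‖) := abs_transp_le hK hS _ _ _ _ _
    _ ≤ 6 * Real.pi * ‖f‖ * (√(‖a‖ ^ 2 + ‖b‖ ^ 2) * g + √(‖a‖ ^ 2 + ‖b‖ ^ 2) * g) := by
        gcongr
    _ = _ := by ring

theorem norm_sub_sq_le {E : Type*} [NormedAddCommGroup E] (a b : E) :
    ‖a - b‖ ^ 2 ≤ 2 * ‖a‖ ^ 2 + 2 * ‖b‖ ^ 2 := by
  nlinarith [norm_sub_le a b, norm_nonneg (a - b), sq_nonneg (‖a‖ - ‖b‖)]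

/-- Unlike the energy, `X` need not be monotone. On `[T, 2T]` it increases by at most `B √M`, where
`M` is its supremum, so `X (2T) - B √M` can serve as lower bound in the Fourier splitting. The
products `B √M` are absorbed by Young's inequality. -/
theorem diff_proj_two_mul_le (h : IsMollifiedSolution c θ ε u₀ w₀ u w) (hθ : IsMollifier θ)
    (hε : 0 < ε) (hL : IsLinearSolution c u₀ w₀ uL wL) {T β R : ℝ} (hT : splitScale c ≤ T)
    (hR : 1 ≤ R) (hβ0 : 0 ≤ β) (hβ : ∀ r ∈ Icc T (2 * T), 12 * Real.pi * ‖u r‖ *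
      (∫ ξ in Metric.closedBall 0 R, ‖ξ‖ * fmod (uL r) (wL r) ξ) ≤ β)
    {X : ℝ → ℝ} (hX : ∀ r, X r = ‖Ftr (u r) - proj (Metric.closedBall 0 R) (Ftr (uL r))‖ ^ 2
      + ‖Ftr (w r) - proj (Metric.closedBall 0 R) (Ftr (wL r))‖ ^ 2) :
    X (2 * T) ≤ 1 / 16 * X T + (33 * (2 * β * T) ^ 2
      + lowForce c u w T) := by
  have hT0 : 0 < T := (splitScale_pos c).trans_le hT
  have hT2 : T ≤ 2 * T := by linarith
  have hρ := splitFreq_le_one hT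
  have hρ0 := splitFreq_nonneg (c := c) T
  set S := Metric.closedBall (0 : R3) R
  have hS : IsCut S := IsCut.closedBall R
  have hK : IsMollifier (ker θ ε) := hθ.scale hε
  set L := lowForce c u w T
  have hL0 : 0 ≤ L := lowForce_nonneg T
  have hX0 : ∀ r, 0 ≤ X r := fun r => by rw [hX]; positivity
  have hbd : ∀ r ∈ Icc T (2 * T), X r ≤ 2 * energy (u 0) (w 0) + 2 * energy (uL 0) (wL 0) := by
    intro r hr
    have hr0 : 0 ≤ r := hT0.le.trans hr.1
    have a1 := h.antitoneOn hθ hε (mem_Ici.2 le_rfl) (mem_Ici.2 hr0) hr0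
    have a2 := hL.antitoneOn (mem_Ici.2 le_rfl) (mem_Ici.2 hr0) hr0
    have b1 := norm_sub_sq_le (Ftr (u r)) (proj S (Ftr (uL r)))
    have b2 := norm_sub_sq_le (Ftr (w r)) (proj S (Ftr (wL r)))
    have d1 := pow_le_pow_left₀ (norm_nonneg _) (norm_proj_le hS (Ftr (uL r))) 2
    have d2 := pow_le_pow_left₀ (norm_nonneg _) (norm_proj_le hS (Ftr (wL r))) 2
    rw [hX]
    simp only [LinearIsometry.norm_map, energy] at *
    linarith
  have hne : (X '' Icc T (2 * T)).Nonempty := ⟨X T, T, ⟨le_rfl, hT2⟩, rfl⟩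
  have hbdd : BddAbove (X '' Icc T (2 * T)) :=
    ⟨_, by rintro _ ⟨r, hr, rfl⟩; exact hbd r hr⟩
  -- A supremum is taken instead of a maximum because the solution is only weakly continuous, so
  -- that `X` is not known to be continuous.
  set M := sSup (X '' Icc T (2 * T))
  have hXM : ∀ r ∈ Icc T (2 * T), X r ≤ M := fun r hr => le_csSup hbdd ⟨r, hr, rfl⟩
  have hM0 : 0 ≤ M := (hX0 T).trans (hXM T ⟨le_rfl, hT2⟩)
  set B := 2 * β * T
  have hB0 : 0 ≤ B := by positivity
  have hN : ∀ r ∈ Icc T (2 * T), |transp (ker θ ε) S (u r) (Ftr (u r)) (Ftr (w r)) (Ftr (uL r))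
      (Ftr (wL r))| ≤ β * √M := by
    intro r hr
    refine (abs_transp_le_fmod hK hS (h.divFree r (hT0.le.trans hr.1)) _ _).trans ?_
    rw [← hX]
    exact mul_le_mul (hβ r hr) (Real.sqrt_le_sqrt (hXM r hr)) (Real.sqrt_nonneg _) hβ0
  have hNi : ∀ s t, T ≤ s → s ≤ t → t ≤ 2 * T → - (2 * ∫ r in s..t, transp (ker θ ε) S (u r)
      (Ftr (u r)) (Ftr (w r)) (Ftr (uL r)) (Ftr (wL r))) ≤ B * √M := by
    intro s t hs hst ht
    have h1 := intervalIntegral.norm_integral_le_of_norm_le_const (a := s) (b := t) (C := β * √M)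
      (f := fun r => transp (ker θ ε) S (u r) (Ftr (u r)) (Ftr (w r)) (Ftr (uL r)) (Ftr (wL r)))
      fun r hr => by
        rw [uIoc_of_le hst] at hr
        exact hN r ⟨hs.trans hr.1.le, hr.2.trans ht⟩
    rw [abs_of_nonneg (sub_nonneg.2 hst), Real.norm_eq_abs] at h1
    have h2 : β * √M * (t - s) ≤ β * √M * T := by
      have := Real.sqrt_nonneg M
      gcongr
      linarith
    have h3 := neg_abs_le (∫ r in s..t, transp (ker θ ε) S (u r)
      (Ftr (u r)) (Ftr (w r)) (Ftr (uL r)) (Ftr (wL r)))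
    simp only [B]
    linarith
  have hstep : ∀ s t, T ≤ s → s ≤ t → t ≤ 2 * T → X t ≤ X s + B * √M := by
    intro s t hs hst ht
    have h1 := diff_energy_le h hθ hε hL hS hS subset_rfl (hT0.le.trans hs) hst
    have h2 := hNi s t hs hst ht
    have h3 : 0 ≤ ∫ r in s..t, dform c S (Ftr (u r) - proj S (Ftr (uL r)))
          (Ftr (w r) - proj S (Ftr (wL r))) (Ftr (u r) - proj S (Ftr (uL r)))
          (Ftr (w r) - proj S (Ftr (wL r))) :=
      intervalIntegral.integral_nonneg hst fun r _ => dform_self_nonneg _ _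
    rw [hX, hX]
    linarith
  have hproj : ∀ (R' : ℝ), R ≤ R' → ∀ f : LC, proj (Metric.closedBall 0 R') (proj S f) = proj S f :=
    fun R' hR' f => dop_proj_superset hS (IsCut.closedBall R') (IsCut.subset_closedBall hR')
      continuous_const f
  have main := add_mul_le_of_dform (c := c) (p := fun r => Ftr (u r) - proj S (Ftr (uL r)))
    (q := fun r => Ftr (w r) - proj S (Ftr (wL r))) (R₀ := R) (Ya := X T + B * √M)
    (Yb := X (2 * T)) (m := X (2 * T) - B * √M - L) hT0.le hT2 hρ0 hρ (hρ.trans hR)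
    (fun R' hR' => by
      simp only [map_sub, hproj R' hR']
      exact (h.isFlow hθ hε (IsCut.closedBall R')).continuousOn_proj_fst.sub
        (hL.isFlow hS).continuousOn_proj_fst)
    (fun R' hR' => by
      simp only [map_sub, hproj R' hR']
      exact (h.isFlow hθ hε (IsCut.closedBall R')).continuousOn_proj_snd.sub
        (hL.isFlow hS).continuousOn_proj_snd)
    (fun R' hR' => by
      simp only [dform_sub_proj hS (IsCut.closedBall R') (IsCut.subset_closedBall hR')]
      have f1 := h.isFlow hθ hε (IsCut.closedBall R')
      have f2 := h.isFlow hθ hε hS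
      have f3 := hL.isFlow hS
      exact ((f1.continuousOn_dform f1 (IsCut.closedBall R')).sub
        (continuousOn_const.mul (f2.continuousOn_dform f3 hS))).add (f3.continuousOn_dform f3 hS))
    (fun R' hR' => by
      have h1 := diff_energy_le h hθ hε hL hS (IsCut.closedBall R') (IsCut.subset_closedBall hR')
        hT0.le hT2
      have h2 := hNi T (2 * T) le_rfl hT2 le_rfl
      rw [hX, hX]
      linarith)
    (fun r hr => by
      have h1 := hstep r (2 * T) hr.1 hr.2 le_rfl
      have h2 := low_freq_le h hθ hε hL hρ0 (hT0.le.trans hr.1) hr.2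
      have h3 : proj (Metric.closedBall 0 (splitFreq c T)) (Ftr (u r) - proj S (Ftr (uL r)))
          = proj (Metric.closedBall 0 (splitFreq c T)) (Ftr (u r) - Ftr (uL r)) := by
        rw [map_sub, map_sub, proj_proj_subset (IsCut.closedBall _) hS
          (IsCut.subset_closedBall (hρ.trans hR))]
      rw [h3, ← hX]
      simp only [L, lowForce]
      linarith)
  have e : 2 * T - T = T := by ring
  rw [e, splitFreq_sq hT0] at main
  have hMle : M ≤ X T + B * √M := csSup_le hne (by
    rintro _ ⟨r, hr, rfl⟩; exact hstep T r le_rfl hr.1 hr.2)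
  have hsq := Real.sq_sqrt hM0
  -- `k1` gives `M ≤ 2 X T + B²`. In `k2` the weight `1/128` then leaves at most `X T / 64`, and
  -- `1/32 + 1/64 < 1/16`.
  have k1 : B * √M ≤ M / 2 + B ^ 2 / 2 := by nlinarith [sq_nonneg (√M - B)]
  have k2 : B * √M ≤ M / 128 + 32 * B ^ 2 := by nlinarith [sq_nonneg (√M - 64 * B)]
  nlinarith [sq_nonneg B]

theorem diff_two_mul_le (h : IsMollifiedSolution c θ ε u₀ w₀ u w) (hθ : IsMollifier θ)
    (hε : 0 < ε) (hL : IsLinearSolution c u₀ w₀ uL wL) {T β : ℝ} (hT : splitScale c ≤ T)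
    (hβ0 : 0 ≤ β) (hβ : ∀ S, IsCut S → ∀ r ∈ Icc T (2 * T), 12 * Real.pi * ‖u r‖ *
      (∫ ξ in S, ‖ξ‖ * fmod (uL r) (wL r) ξ) ≤ β) :
    energy (u (2 * T) - uL (2 * T)) (w (2 * T) - wL (2 * T))
      ≤ 1 / 16 * energy (u T - uL T) (w T - wL T) + (33 * (2 * β * T) ^ 2
      + lowForce c u w T) := by
  have hlim : ∀ r, Tendsto (fun R : ℝ => ‖Ftr (u r) - proj (Metric.closedBall 0 R) (Ftr (uL r))‖ ^ 2
      + ‖Ftr (w r) - proj (Metric.closedBall 0 R) (Ftr (wL r))‖ ^ 2) atTop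
      (𝓝 (energy (u r - uL r) (w r - wL r))) := by
    intro r
    have h1 := (((tendsto_proj (Ftr (uL r))).const_sub (Ftr (u r))).norm.pow 2).add
      (((tendsto_proj (Ftr (wL r))).const_sub (Ftr (w r))).norm.pow 2)
    simp only [← map_sub, LinearIsometry.norm_map] at h1
    exact h1
  refine le_of_tendsto_of_tendsto (hlim (2 * T)) (((hlim T).const_mul (1 / 16)).add_const _) ?_
  filter_upwards [eventually_ge_atTop 1] with R hR
  exact diff_proj_two_mul_le h hθ hε hL hT hR hβ0 (hβ _ (IsCut.closedBall R)) fun _ => rfl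

end

section

/-! ### Dyadic recursions and decay rates -/

theorem dyadic_induction {P : ℝ → Prop} {T₀ : ℝ} (hT : 0 < T₀) (h0 : ∀ t ∈ Icc T₀ (2 * T₀), P t)
    (h : ∀ t, T₀ ≤ t → P t → P (2 * t)) (t : ℝ) (ht : T₀ ≤ t) : P t := by
  have key : ∀ n : ℕ, ∀ t, T₀ ≤ t → t ≤ 2 ^ n * T₀ → P t := by
    intro n
    induction n with
    | zero => intro t h1 h2; exact h0 t ⟨h1, by linarith⟩
    | succ n ih =>
      intro t h1 h2
      rcases le_total t (2 * T₀) with h3 | h3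
      · exact h0 t ⟨h1, h3⟩
      · have := h (t / 2) (by linarith) (ih (t / 2) (by linarith) (by rw [pow_succ] at h2; linarith))
        rwa [mul_div_cancel₀ t two_ne_zero] at this
  obtain ⟨n, hn⟩ := pow_unbounded_of_one_lt (t / T₀) (one_lt_two (α := ℝ))
  exact key n t ht ((div_le_iff₀ hT).1 hn.le)

/-- Per doubling of time `X` contracts by `16`, while `h` loses at most a factor `8`; half of the
margin absorbs the forcing `C h`, since `C ≤ C'/16`. The constant is chosen before `X`, hence is
uniform over all mollified solutions. -/
theorem exists_dyadic_bound {h : ℝ → ℝ} (hpos : ∀ t, 0 ≤ t → 0 < h t) (hc : ContinuousOn h (Ici 0))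
    {T₀ : ℝ} (hT : 0 < T₀) (hd : ∀ T, T₀ ≤ T → h T ≤ 8 * h (2 * T)) (M C : ℝ) :
    ∃ C', 0 ≤ C' ∧ ∀ X : ℝ → ℝ, (∀ t, 0 ≤ t → X t ≤ M) →
      (∀ T, T₀ ≤ T → X (2 * T) ≤ 1 / 16 * X T + C * h T) → ∀ t, 0 ≤ t → X t ≤ C' * h t := by
  obtain ⟨t₀, ht₀, hmin⟩ := isCompact_Icc.exists_isMinOn
    (nonempty_Icc.2 (by linarith : (0 : ℝ) ≤ 2 * T₀)) (hc.mono Icc_subset_Ici_self)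
  have hm := hpos t₀ ht₀.1
  refine ⟨max (max (M / h t₀) (16 * C)) 0, le_max_right _ _, fun X hM hX => ?_⟩
  set C' := max (max (M / h t₀) (16 * C)) 0
  have hC0 : 0 ≤ C' := le_max_right _ _
  have hC1 : M / h t₀ ≤ C' := (le_max_left _ _).trans (le_max_left _ _)
  have hC2 : 16 * C ≤ C' := (le_max_right _ _).trans (le_max_left _ _)
  have hsmall : ∀ t, 0 ≤ t → t ≤ 2 * T₀ → X t ≤ C' * h t := fun t h1 h2 => by
    have h3 : h t₀ ≤ h t := hmin ⟨h1, h2⟩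
    calc X t ≤ M := hM t h1
      _ ≤ C' * h t₀ := (div_le_iff₀ hm).1 hC1
      _ ≤ C' * h t := by gcongr
  have hlarge := dyadic_induction (P := fun t => X t ≤ C' * h t) hT
    (fun t ht => hsmall t (hT.le.trans ht.1) ht.2) (fun T h1 h2 => by
      have h3 := hpos T (hT.le.trans h1)
      have h4 := hd T h1
      calc X (2 * T) ≤ 1 / 16 * X T + C * h T := hX T h1
        _ ≤ 1 / 16 * (C' * h T) + C' / 16 * h T := by gcongr; linarith
        _ = C' * (h T / 8) := by ring
        _ ≤ C' * h (2 * T) := by gcongr; linarith)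
  intro t ht
  rcases le_total t (2 * T₀) with h1 | h1
  · exact hsmall t ht h1
  · exact hlarge t (by linarith)

/-- The bound `δ/2 + const/t` is preserved under doubling, because the contraction factor `1/4` is
smaller than the factor `1/2` by which `1/t` decreases. -/
theorem dyadic_small {ι : Type*} {X : ι → ℝ → ℝ} (hM : ∀ T, ∃ M, ∀ i, ∀ t ∈ Icc 0 T, X i t ≤ M)
    (hX : ∀ δ, 0 < δ → ∃ T₁, 0 < T₁ ∧ ∀ i T, T₁ ≤ T → X i (2 * T) ≤ 1 / 4 * X i T + δ) (δ : ℝ)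
    (hδ : 0 < δ) : ∃ T₁, 0 < T₁ ∧ ∀ i t, T₁ ≤ t → X i t ≤ δ := by
  obtain ⟨T, hT, hXT⟩ := hX (δ / 4) (by positivity)
  obtain ⟨M, hM⟩ := hM (2 * T)
  refine ⟨max T (2 * (|M| * (2 * T)) / δ), lt_max_of_lt_left hT, fun i t ht => ?_⟩
  have h1 := dyadic_induction (P := fun t => X i t ≤ δ / 2 + |M| * (2 * T) / t) hT
    (fun t ht => by
      have h0 : 0 < t := hT.trans_le ht.1
      have h2 : |M| ≤ |M| * (2 * T) / t := by
        rw [le_div_iff₀ h0]; exact mul_le_mul_of_nonneg_left ht.2 (abs_nonneg _)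
      have h3 := (hM i t ⟨h0.le, ht.2⟩).trans (le_abs_self M)
      linarith)
    (fun t ht h2 => by
      have h0 : 0 < t := hT.trans_le ht
      have h3 := hXT i t ht
      have h4 : |M| * (2 * T) / (2 * t) = 1 / 2 * (|M| * (2 * T) / t) := by field_simp
      have h5 : 0 ≤ |M| * (2 * T) / t := by positivity
      rw [h4]
      linarith) t ((le_max_left _ _).trans ht)
  have h0 : 0 < t := hT.trans_le ((le_max_left _ _).trans ht)
  have h2 : |M| * (2 * T) / t ≤ δ / 2 := by
    have := (le_max_right T _).trans ht
    rw [div_le_iff₀ hδ] at this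
    rw [div_le_iff₀ h0]
    linarith
  linarith

theorem continuousOn_one_add_rpow (a : ℝ) : ContinuousOn (fun t : ℝ => (1 + t) ^ a) (Ici 0) :=
  (continuous_const.add continuous_id).continuousOn.rpow_const fun t ht =>
    Or.inl (by
      have h : (0 : ℝ) ≤ t := ht
      exact (by positivity : (1 : ℝ) + t ≠ 0))

theorem one_add_rpow_le_mul {a T t : ℝ} (ha : 0 ≤ a) (hT : 0 ≤ T) (ht : 0 ≤ t)
    (h : 1 + t ≤ 2 * (1 + T)) : (1 + T) ^ (-a) ≤ 2 ^ a * (1 + t) ^ (-a) := by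
  rw [Real.rpow_neg (by positivity), Real.rpow_neg (by positivity), ← div_eq_mul_inv,
    inv_eq_one_div, div_le_div_iff₀ (by positivity) (by positivity), one_mul,
    ← Real.mul_rpow (by positivity) (by positivity)]
  exact Real.rpow_le_rpow (by positivity) h ha

theorem one_add_rpow_le_eight {a T : ℝ} (ha : 0 ≤ a) (ha' : a ≤ 3) (hT : 0 ≤ T) :
    (1 + T) ^ (-a) ≤ 8 * (1 + 2 * T) ^ (-a) := by
  refine (one_add_rpow_le_mul ha hT (by positivity : 0 ≤ 2 * T) (by linarith)).trans ?_
  gcongr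
  calc (2 : ℝ) ^ a ≤ 2 ^ (3 : ℝ) := Real.rpow_le_rpow_of_exponent_le one_le_two ha'
    _ = 8 := by norm_num

theorem intervalIntegrable_one_add_rpow (a : ℝ) {b : ℝ} (hb : 0 ≤ b) :
    IntervalIntegrable (fun r : ℝ => (1 + r) ^ a) volume 0 b :=
  ((continuousOn_one_add_rpow a).mono fun x hx => by
    rw [uIcc_of_le hb] at hx; exact hx.1).intervalIntegrable

theorem integral_one_add_rpow {a : ℝ} (ha : a ≠ 1) {b : ℝ} (hb : 0 ≤ b) :
    ∫ r in (0 : ℝ)..b, (1 + r) ^ (-a) = ((1 + b) ^ (1 - a) - 1) / (1 - a) := by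
  rw [intervalIntegral.integral_comp_add_left (fun x : ℝ => x ^ (-a)) 1, add_zero, integral_rpow]
  · rw [Real.one_rpow, neg_add_eq_sub]
  · refine Or.inr ⟨fun h => ha (by linarith), ?_⟩
    rw [uIcc_of_le (by linarith)]
    intro h; linarith [h.1]

theorem integral_one_add_rpow_neg_one {b : ℝ} (hb : 0 ≤ b) :
    ∫ r in (0 : ℝ)..b, (1 + r) ^ (-1 : ℝ) = Real.log (1 + b) := by
  rw [intervalIntegral.integral_comp_add_left (fun x : ℝ => x ^ (-1 : ℝ)) 1, add_zero]
  simp_rw [Real.rpow_neg_one]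
  rw [integral_inv_of_pos one_pos (by linarith), div_one]

theorem log_one_add_two_mul_le {T : ℝ} (hT : 0 ≤ T) :
    Real.log (1 + 2 * T) ≤ 2 * Real.log (Real.exp 1 + T) := by
  have he := Real.add_one_le_exp (1 : ℝ)
  have h2 : 2 * Real.log (Real.exp 1 + T) = Real.log ((Real.exp 1 + T) ^ 2) := by
    rw [Real.log_pow]; norm_num
  rw [h2]
  exact Real.log_le_log (by positivity) (by nlinarith)

theorem exists_exp_neg_le {b m : ℝ} (hb : 0 < b) (hm : m ≤ 4) :
    ∃ C, 0 ≤ C ∧ ∀ T, 0 ≤ T → Real.exp (-(b * T)) ≤ C * (1 + T) ^ (-m) := by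
  refine ⟨Real.exp b * (24 / b ^ 4), by positivity, fun T hT => ?_⟩
  have h1 := Real.pow_div_factorial_le_exp (x := b * (1 + T)) (by positivity) 4
  have h2 : Real.exp (-(b * T)) = Real.exp b * (Real.exp (b * (1 + T)))⁻¹ := by
    rw [← Real.exp_neg, ← Real.exp_add]; ring_nf
  have h3 : (Real.exp (b * (1 + T)))⁻¹ ≤ 24 / b ^ 4 * (1 + T) ^ (-4 : ℝ) := by
    have h4 : (1 + T) ^ (-4 : ℝ) = ((1 + T) ^ 4)⁻¹ := by
      rw [Real.rpow_neg (by positivity)]; norm_cast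
    rw [h4]
    calc _ ≤ ((b * (1 + T)) ^ 4 / (Nat.factorial 4 : ℕ))⁻¹ := inv_anti₀ (by positivity) h1
      _ = _ := by simp [Nat.factorial]; field_simp
  have h4 : (1 + T) ^ (-4 : ℝ) ≤ (1 + T) ^ (-m) :=
    Real.rpow_le_rpow_of_exponent_le (by linarith) (by linarith)
  rw [h2, mul_assoc]
  gcongr
  exact h3.trans (by gcongr)

theorem splitFreq_pow_le {c : Coeffs} {T : ℝ} (hT : 1 ≤ T) :
    splitFreq c T ^ 5 ≤ (2 * splitScale c) ^ (5 / 2 : ℝ) * (1 + T) ^ (-(5 / 2) : ℝ) := by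
  have h0 := splitScale_pos c
  have e : splitFreq c T ^ 5 = (splitScale c / T) ^ (5 / 2 : ℝ) := by
    rw [splitFreq, Real.sqrt_eq_rpow, ← Real.rpow_natCast, ← Real.rpow_mul (by positivity)]
    norm_num
  rw [e, Real.rpow_neg (by positivity), ← div_eq_mul_inv,
    ← Real.div_rpow (by positivity) (by positivity)]
  refine Real.rpow_le_rpow (by positivity) ?_ (by norm_num)
  rw [div_le_div_iff₀ (by positivity) (by positivity)]
  nlinarith

theorem lowForce_le {c : Coeffs} {u w : ℝ → L2} {f : ℝ → ℝ} {T : ℝ} (hT : 1 ≤ T)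
    (hE : ∀ t, 0 ≤ t → energy (u t) (w t) ≤ f t)
    (hi : IntervalIntegrable (fun r => energy (u r) (w r)) volume 0 (2 * T))
    (hf : IntervalIntegrable f volume 0 (2 * T)) :
    lowForce c u w T ≤ lowConst * (2 * splitScale c) ^ (5 / 2 : ℝ)
      * ((1 + T) ^ (-(5 / 2) : ℝ) * (∫ r in (0 : ℝ)..2 * T, f r) ^ 2) := by
  have h0 := splitScale_pos c
  have h1 := lowConst_nonneg
  have h2 : 0 ≤ ∫ r in (0 : ℝ)..2 * T, energy (u r) (w r) :=
    intervalIntegral.integral_nonneg (by linarith) fun r _ => energy_nonneg _ _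
  have h3 : ∫ r in (0 : ℝ)..2 * T, energy (u r) (w r) ≤ ∫ r in (0 : ℝ)..2 * T, f r :=
    intervalIntegral.integral_mono_on (by linarith) hi hf fun r hr => hE r hr.1
  calc lowForce c u w T ≤ lowConst * ((2 * splitScale c) ^ (5 / 2 : ℝ) * (1 + T) ^ (-(5 / 2) : ℝ))
        * (∫ r in (0 : ℝ)..2 * T, f r) ^ 2 := by
        unfold lowForce; gcongr; exact splitFreq_pow_le hT
    _ = _ := by ring

/-- Since `splitFreq` is of order `T^(-1/2)`, its fifth power gives `T^(-5/2)`. The squared integral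
of the energy is `O(T^(2-2a))` for `a < 1` and bounded for `a > 1`. The case `a = 1`, with its
logarithm, is treated apart. -/
theorem exists_lowForce_le (c : Coeffs) {a b K : ℝ} (hK : 0 ≤ K)
    (hab : (a < 1 ∧ b ≤ 1 / 2 + 2 * a) ∨ (1 < a ∧ b ≤ 5 / 2)) :
    ∃ C, 0 ≤ C ∧ ∀ u w : ℝ → L2, (∀ t, 0 ≤ t → energy (u t) (w t) ≤ K * (1 + t) ^ (-a)) →
      (∀ T, 0 ≤ T → IntervalIntegrable (fun r => energy (u r) (w r)) volume 0 T) →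
      ∀ T, 1 ≤ T → lowForce c u w T ≤ C * (1 + T) ^ (-b) := by
  have h0 := splitScale_pos c
  have h1 := lowConst_nonneg
  set D := lowConst * (2 * splitScale c) ^ (5 / 2 : ℝ)
  have hD : 0 ≤ D := by positivity
  rcases hab with ⟨ha, hb⟩ | ⟨ha, hb⟩
  · have ha' : 0 < 1 - a := by linarith
    refine ⟨D * (K * (2 ^ (1 - a) / (1 - a))) ^ 2, by positivity, fun u w hE hi T hT => ?_⟩
    have hT0 : 0 ≤ T := by linarith
    refine (lowForce_le hT hE (hi _ (by linarith))
      ((intervalIntegrable_one_add_rpow _ (by linarith)).const_mul _)).trans ?_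
    rw [intervalIntegral.integral_const_mul, integral_one_add_rpow ha.ne (by linarith), mul_assoc D]
    refine mul_le_mul_of_nonneg_left ?_ hD
    have h2 : ((1 + 2 * T) ^ (1 - a) - 1) / (1 - a) ≤ 2 ^ (1 - a) / (1 - a) * (1 + T) ^ (1 - a) := by
      rw [div_mul_eq_mul_div, ← Real.mul_rpow (by positivity) (by positivity)]
      gcongr
      exact (sub_le_self _ zero_le_one).trans
        (Real.rpow_le_rpow (by positivity) (by linarith) ha'.le)
    have h3 : 0 ≤ ((1 + 2 * T) ^ (1 - a) - 1) / (1 - a) :=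
      div_nonneg (sub_nonneg.2 (Real.one_le_rpow (by linarith) ha'.le)) ha'.le
    calc (1 + T) ^ (-(5 / 2) : ℝ) * (K * (((1 + 2 * T) ^ (1 - a) - 1) / (1 - a))) ^ 2
        ≤ (1 + T) ^ (-(5 / 2) : ℝ) * (K * (2 ^ (1 - a) / (1 - a) * (1 + T) ^ (1 - a))) ^ 2 := by
          gcongr
      _ = (K * (2 ^ (1 - a) / (1 - a))) ^ 2
          * ((1 + T) ^ (-(5 / 2) : ℝ) * ((1 + T) ^ (1 - a) * (1 + T) ^ (1 - a))) := by ring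
      _ = (K * (2 ^ (1 - a) / (1 - a))) ^ 2 * (1 + T) ^ (-(1 / 2 + 2 * a)) := by
          rw [← Real.rpow_add (by positivity), ← Real.rpow_add (by positivity)]
          ring_nf
      _ ≤ _ := by
          gcongr
          · linarith
  · have ha' : 0 < a - 1 := by linarith
    refine ⟨D * (K * (1 / (a - 1))) ^ 2, by positivity, fun u w hE hi T hT => ?_⟩
    have hT0 : 0 ≤ T := by linarith
    refine (lowForce_le hT hE (hi _ (by linarith))
      ((intervalIntegrable_one_add_rpow _ (by linarith)).const_mul _)).trans ?_
    rw [intervalIntegral.integral_const_mul, integral_one_add_rpow ha.ne' (by linarith), mul_assoc D]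
    refine mul_le_mul_of_nonneg_left ?_ hD
    have h2 : ((1 + 2 * T) ^ (1 - a) - 1) / (1 - a) = (1 - (1 + 2 * T) ^ (1 - a)) / (a - 1) := by
      rw [← neg_sub 1 ((1 + 2 * T) ^ (1 - a)), ← neg_sub a 1, neg_div_neg_eq]
    have h3 : (1 + 2 * T) ^ (1 - a) ≤ 1 :=
      Real.rpow_le_one_of_one_le_of_nonpos (by linarith) (by linarith)
    have h4 : 0 ≤ (1 + 2 * T) ^ (1 - a) := by positivity
    have h5 : 0 ≤ (1 - (1 + 2 * T) ^ (1 - a)) / (a - 1) := div_nonneg (by linarith) ha'.le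
    rw [h2, mul_comm]
    gcongr
    · linarith
    · linarith

theorem exists_lowForce_le_log (c : Coeffs) {K : ℝ} (hK : 0 ≤ K) :
    ∃ C, 0 ≤ C ∧ ∀ u w : ℝ → L2, (∀ t, 0 ≤ t → energy (u t) (w t) ≤ K * (1 + t) ^ (-1 : ℝ)) →
      (∀ T, 0 ≤ T → IntervalIntegrable (fun r => energy (u r) (w r)) volume 0 T) →
      ∀ T, 1 ≤ T → lowForce c u w T
        ≤ C * ((1 + T) ^ (-(5 / 2) : ℝ) * Real.log (Real.exp 1 + T) ^ 2) := by
  have h0 := splitScale_pos c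
  have h1 := lowConst_nonneg
  set D := lowConst * (2 * splitScale c) ^ (5 / 2 : ℝ) with hD
  have hD : 0 ≤ D := by positivity
  refine ⟨D * (K * 2) ^ 2, by positivity, fun u w hE hi T hT => ?_⟩
  have hT0 : 0 ≤ T := by linarith
  refine (lowForce_le hT hE (hi _ (by linarith))
    ((intervalIntegrable_one_add_rpow _ (by linarith)).const_mul _)).trans ?_
  rw [intervalIntegral.integral_const_mul, integral_one_add_rpow_neg_one (by linarith)]
  have h2 := log_one_add_two_mul_le hT0
  have h3 : 0 ≤ Real.log (1 + 2 * T) := Real.log_nonneg (by linarith)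
  calc D * ((1 + T) ^ (-(5 / 2) : ℝ) * (K * Real.log (1 + 2 * T)) ^ 2)
      ≤ D * ((1 + T) ^ (-(5 / 2) : ℝ) * (K * (2 * Real.log (Real.exp 1 + T))) ^ 2) := by gcongr
    _ = _ := by ring

end

section

/-! ### Decay of the mollified solutions, uniformly in the mollification parameter -/

variable {c : Coeffs} {θ : R3 → ℝ} {u₀ w₀ : L2} {uL wL : ℝ → L2}

theorem tendsto_splitFreq (c : Coeffs) : Tendsto (splitFreq c) atTop (𝓝 0) := by
  have h : Tendsto (fun T => splitScale c / T) atTop (𝓝 0) := tendsto_const_nhds.div_atTop tendsto_id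
  have h1 := (Real.continuous_sqrt.tendsto 0).comp h
  rwa [Real.sqrt_zero] at h1

theorem tendsto_norm_proj_sq_zero (f : LC) {ρ : ℝ → ℝ} (hρ : Tendsto ρ atTop (𝓝 0)) :
    Tendsto (fun T => ‖proj (Metric.closedBall 0 (ρ T)) f‖ ^ 2) atTop (𝓝 0) := by
  have h0 : ∀ᵐ ξ : R3, ξ ≠ 0 := by rw [ae_iff]; simp
  have h1 : Tendsto (fun T => ∫ ξ, (Metric.closedBall (0 : R3) (ρ T)).indicator
      (fun ξ => ‖f ξ‖ ^ 2) ξ) atTop (𝓝 (∫ _ : R3, (0 : ℝ))) := by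
    refine tendsto_integral_filter_of_dominated_convergence (fun ξ => ‖f ξ‖ ^ 2)
      (.of_forall fun T => (integrable_norm_LC_sq f).aestronglyMeasurable.indicator
        measurableSet_closedBall) (.of_forall fun T => .of_forall fun ξ => ?_)
      (integrable_norm_LC_sq f) ?_
    · refine (norm_indicator_le_norm_self _ _).trans (le_of_eq ?_)
      rw [Real.norm_of_nonneg (by positivity)]
    · filter_upwards [h0] with ξ hξ
      refine tendsto_const_nhds.congr' ?_
      filter_upwards [hρ.eventually_lt_const (norm_pos_iff.2 hξ)] with T hT
      rw [indicator_of_notMem]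
      simpa using hT
  simp only [integral_zero] at h1
  refine h1.congr fun T => ?_
  rw [norm_proj_sq (IsCut.closedBall _), integral_indicator measurableSet_closedBall]

/-- No rate is available, but the low frequencies of the fixed data tend to zero and, with bounded
energy, `lowForce` is `O(T^(-1/2))`. -/
theorem exists_energy_le (hθ : IsMollifier θ) {δ : ℝ} (hδ : 0 < δ) :
    ∃ T, 0 < T ∧ ∀ ε (u w : ℝ → L2), 0 < ε → IsMollifiedSolution c θ ε u₀ w₀ u w →
      ∀ t, T ≤ t → energy (u t) (w t) ≤ δ := by
  -- The index runs over all mollified solutions and all parameters at once, so the time obtained is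
  -- uniform.
  let ι := {i : ℝ × (ℝ → L2) × (ℝ → L2) // 0 < i.1 ∧ IsMollifiedSolution c θ i.1 u₀ w₀ i.2.1 i.2.2}
  obtain ⟨T, hT, h⟩ := dyadic_small (ι := ι) (X := fun i t => energy (i.1.2.1 t) (i.1.2.2 t))
    (fun T => ⟨energy u₀ w₀, fun i t ht => i.2.2.energy_le_zero hθ i.2.1 ht.1⟩) (fun δ hδ => by
      have h1 := (tendsto_norm_proj_sq_zero (Ftr u₀) (tendsto_splitFreq c)).add
        (tendsto_norm_proj_sq_zero (Ftr w₀) (tendsto_splitFreq c))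
      have h2 := (h1.const_mul 2)
      obtain ⟨D, hD0, hD⟩ := exists_lowForce_le c (a := 0) (b := 1 / 2)
        (energy_nonneg u₀ w₀) (Or.inl ⟨zero_lt_one, by norm_num⟩)
      have h3 : Tendsto (fun T : ℝ => 2 * (D * (1 + T) ^ (-(1 / 2) : ℝ))) atTop (𝓝 (2 * (D * 0))) :=
        (((tendsto_rpow_neg_atTop (by norm_num : (0 : ℝ) < 1 / 2)).comp
          (tendsto_atTop_add_const_left _ 1 tendsto_id)).const_mul D).const_mul 2
      have h4 := h2.add h3
      simp only [add_zero, mul_zero] at h4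
      obtain ⟨T, hT⟩ := eventually_atTop.1 ((h4.eventually_le_const hδ).and
        ((eventually_ge_atTop (splitScale c)).and (eventually_ge_atTop 1)))
      refine ⟨max T 1, by positivity, fun i t ht => ?_⟩
      obtain ⟨h5, h6, h7⟩ := hT t ((le_max_left _ _).trans ht)
      have h8 := energy_two_mul_le_self i.2.2 hθ i.2.1 h6
      have h9 := hD i.1.2.1 i.1.2.2 (fun t ht => by
        simpa using i.2.2.energy_le_zero hθ i.2.1 ht)
        (fun T hT => i.2.2.intervalIntegrable_energy hθ i.2.1 le_rfl hT) t h7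
      have := energy_nonneg (i.1.2.1 t) (i.1.2.2 t)
      linarith) δ hδ
  exact ⟨T, hT, fun ε u w hε hs t ht => h ⟨⟨ε, u, w⟩, hε, hs⟩ t ht⟩

theorem IsLinearSolution.energy_le_zero (hL : IsLinearSolution c u₀ w₀ uL wL) {t : ℝ} (ht : 0 ≤ t) :
    Micropolar.energy (uL t) (wL t) ≤ Micropolar.energy u₀ w₀ := by
  have := hL.antitoneOn (mem_Ici.2 le_rfl) ht ht
  simp only at this
  rwa [hL.u_zero, hL.w_zero] at this

theorem IsLinearSolution.exists_norm_sq_le (hL : IsLinearSolution c u₀ w₀ uL wL) {Γ : ℝ} (hΓ : 0 ≤ Γ)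
    (hO : (fun t => ‖uL t‖ ^ 2) =O[atTop] (fun t : ℝ => t ^ (-Γ))) :
    ∃ K, 0 ≤ K ∧ ∀ t, 0 ≤ t → ‖uL t‖ ^ 2 ≤ K * (1 + t) ^ (-Γ) := by
  obtain ⟨C, hC, hb⟩ := hO.exists_pos
  obtain ⟨T, hT⟩ := eventually_atTop.1 hb.bound
  have hE := Micropolar.energy_nonneg u₀ w₀
  have hT1 : (1 : ℝ) ≤ max T 1 := le_max_right _ _
  refine ⟨C * 2 ^ Γ + Micropolar.energy u₀ w₀ * (1 + max T 1) ^ Γ, by positivity, fun t ht => ?_⟩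
  rcases le_total (max T 1) t with h | h
  · have h1 := hT t ((le_max_left _ _).trans h)
    have ht0 : 0 < t := by linarith
    rw [Real.norm_of_nonneg (by positivity), Real.norm_of_nonneg (by positivity)] at h1
    have h2 : t ^ (-Γ) ≤ 2 ^ Γ * (1 + t) ^ (-Γ) := by
      have := one_add_rpow_le_mul hΓ (by linarith : 0 ≤ t - 1) ht (by linarith)
      rwa [add_sub_cancel] at this
    calc ‖uL t‖ ^ 2 ≤ C * t ^ (-Γ) := h1
      _ ≤ C * (2 ^ Γ * (1 + t) ^ (-Γ)) := by gcongr
      _ ≤ (C * 2 ^ Γ + Micropolar.energy u₀ w₀ * (1 + max T 1) ^ Γ) * (1 + t) ^ (-Γ) := by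
        rw [← mul_assoc]; gcongr; exact le_add_of_nonneg_right (by positivity)
  · have h1 : ‖uL t‖ ^ 2 ≤ Micropolar.energy u₀ w₀ :=
      (le_add_of_nonneg_right (by positivity)).trans (hL.energy_le_zero ht)
    have h2 : 1 ≤ (1 + max T 1) ^ Γ * (1 + t) ^ (-Γ) := by
      rw [Real.rpow_neg (by positivity), ← div_eq_mul_inv, one_le_div (by positivity)]
      gcongr
    calc ‖uL t‖ ^ 2 ≤ Micropolar.energy u₀ w₀ * 1 := by rwa [mul_one]
      _ ≤ Micropolar.energy u₀ w₀ * ((1 + max T 1) ^ Γ * (1 + t) ^ (-Γ)) := by gcongr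
      _ ≤ (C * 2 ^ Γ + Micropolar.energy u₀ w₀ * (1 + max T 1) ^ Γ) * (1 + t) ^ (-Γ) := by
        rw [← mul_assoc]; gcongr; exact le_add_of_nonneg_left (by positivity)

theorem one_add_rpow_le_of_le {a T t : ℝ} (ha : 0 ≤ a) (hT : 0 ≤ T) (h : T ≤ t) :
    (1 + t) ^ (-a) ≤ (1 + T) ^ (-a) :=
  Real.rpow_le_rpow_of_nonpos (by positivity) (by linarith) (by linarith)

theorem IsLinearSolution.exists_energy_le (hL : IsLinearSolution c u₀ w₀ uL wL) {Γ : ℝ} (hΓ : 0 ≤ Γ)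
    (hΓ' : Γ ≤ 5 / 2) {K : ℝ} (hK : 0 ≤ K) (hl : ∀ t, 0 ≤ t → ‖uL t‖ ^ 2 ≤ K * (1 + t) ^ (-Γ)) :
    ∃ C, 0 ≤ C ∧ ∀ t, 0 ≤ t → Micropolar.energy (uL t) (wL t) ≤ C * (1 + t) ^ (-Γ) := by
  obtain ⟨C, hC0, hC⟩ := exists_dyadic_bound (h := fun t => (1 + t) ^ (-Γ)) (T₀ := splitScale c)
    (fun t ht => by positivity) (continuousOn_one_add_rpow _) (splitScale_pos c)
    (fun T hT => one_add_rpow_le_eight hΓ (by linarith) ((splitScale_pos c).le.trans hT))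
    (Micropolar.energy u₀ w₀) K
  refine ⟨C, hC0, hC _ (fun t ht => hL.energy_le_zero ht) fun T hT => ?_⟩
  have hT0 := (splitScale_pos c).le.trans hT
  refine hL.energy_two_mul_le hT fun r hr => (hl r (hT0.trans hr.1)).trans ?_
  exact mul_le_mul_of_nonneg_left (one_add_rpow_le_of_le hΓ hT0 hr.1) hK

theorem exists_energy_decay_step (hθ : IsMollifier θ) (hL : IsLinearSolution c u₀ w₀ uL wL) {Γ : ℝ}
    {K : ℝ} (hK : 0 ≤ K) (hl : ∀ t, 0 ≤ t → ‖uL t‖ ^ 2 ≤ K * (1 + t) ^ (-Γ))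
    {a b : ℝ} (hb : 0 ≤ b) (hbΓ : b ≤ Γ) (hb' : b ≤ 5 / 2)
    (hab : (a < 1 ∧ b ≤ 1 / 2 + 2 * a) ∨ (1 < a ∧ b ≤ 5 / 2))
    (ha : ∃ C, 0 ≤ C ∧ ∀ ε (u w : ℝ → L2), 0 < ε → IsMollifiedSolution c θ ε u₀ w₀ u w →
      ∀ t, 0 ≤ t → energy (u t) (w t) ≤ C * (1 + t) ^ (-a)) :
    ∃ C, 0 ≤ C ∧ ∀ ε (u w : ℝ → L2), 0 < ε → IsMollifiedSolution c θ ε u₀ w₀ u w →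
      ∀ t, 0 ≤ t → energy (u t) (w t) ≤ C * (1 + t) ^ (-b) := by
  obtain ⟨A, hA0, hA⟩ := ha
  obtain ⟨D, hD0, hD⟩ := exists_lowForce_le c hA0 hab
  have hs : splitScale c ≤ max (splitScale c) 1 := le_max_left _ _
  obtain ⟨C, hC0, hC⟩ := exists_dyadic_bound (h := fun t => (1 + t) ^ (-b))
    (T₀ := max (splitScale c) 1)
    (fun t ht => by positivity) (continuousOn_one_add_rpow _) (by positivity)
    (fun T hT => one_add_rpow_le_eight hb (by linarith) ((splitScale_pos c).le.trans (hs.trans hT)))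
    (Micropolar.energy u₀ w₀) (2 * K + 2 * D)
  refine ⟨C, hC0, fun ε u w hε h => hC _ (fun t ht => h.energy_le_zero hθ hε ht) fun T hT => ?_⟩
  have hT0 := (splitScale_pos c).le.trans (hs.trans hT)
  have hT1 : 1 ≤ T := (le_max_right _ _).trans hT
  have h1 := energy_two_mul_le h hθ hε hL (hs.trans hT) (l := K * (1 + T) ^ (-b)) fun r hr => by
    have hr0 := hT0.trans hr.1
    refine (hl r hr0).trans (mul_le_mul_of_nonneg_left ?_ hK)
    exact (Real.rpow_le_rpow_of_exponent_le (by linarith) (by linarith)).trans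
      (one_add_rpow_le_of_le hb hT0 hr.1)
  have h2 := hD u w (hA ε u w hε h)
    (fun T hT => h.intervalIntegrable_energy hθ hε le_rfl hT) T hT1
  linarith

/-- The bootstrap `a ↦ 1/2 + 2a` goes from `0` to `1/2` to `3/2`. An exponent above one makes the
energy integrable, and the next step reaches `5/2`. The exponents fed into a step avoid `a = 1`, so
no logarithm appears, and each gain is capped at `Γ`. -/
theorem exists_energy_decay (hθ : IsMollifier θ) (hL : IsLinearSolution c u₀ w₀ uL wL) {Γ : ℝ}
    (hΓ : 0 ≤ Γ) (hΓ' : Γ ≤ 5 / 2) {K : ℝ} (hK : 0 ≤ K)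
    (hl : ∀ t, 0 ≤ t → ‖uL t‖ ^ 2 ≤ K * (1 + t) ^ (-Γ)) :
    ∃ C, 0 ≤ C ∧ ∀ ε (u w : ℝ → L2), 0 < ε → IsMollifiedSolution c θ ε u₀ w₀ u w →
      ∀ t, 0 ≤ t → energy (u t) (w t) ≤ C * (1 + t) ^ (-Γ) := by
  have h0 : ∃ C, 0 ≤ C ∧ ∀ ε (u w : ℝ → L2), 0 < ε → IsMollifiedSolution c θ ε u₀ w₀ u w →
      ∀ t, 0 ≤ t → energy (u t) (w t) ≤ C * (1 + t) ^ (-0 : ℝ) :=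
    ⟨energy u₀ w₀, energy_nonneg _ _, fun ε u w hε h t ht => by
      simpa using h.energy_le_zero hθ hε ht⟩
  have h1 := exists_energy_decay_step hθ hL hK hl (b := min Γ (1 / 2)) (by positivity)
    (min_le_left _ _) ((min_le_left _ _).trans hΓ')
    (Or.inl ⟨zero_lt_one, (min_le_right _ _).trans (by norm_num)⟩) h0
  rcases le_total Γ (1 / 2) with h | h
  · rwa [min_eq_left h] at h1
  rw [min_eq_right h] at h1
  have h2 := exists_energy_decay_step hθ hL hK hl (b := min Γ (3 / 2)) (by positivity)
    (min_le_left _ _) ((min_le_left _ _).trans hΓ')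
    (Or.inl ⟨by norm_num, (min_le_right _ _).trans (by norm_num)⟩) h1
  rcases le_total Γ (3 / 2) with h | h
  · rwa [min_eq_left h] at h2
  rw [min_eq_right h] at h2
  exact exists_energy_decay_step hθ hL hK hl hΓ le_rfl hΓ' (Or.inr ⟨by norm_num, hΓ'⟩) h2

/-! ### Decay of the difference with the linear flow -/

theorem IsLinearSolution.exists_grad_decay (hL : IsLinearSolution c u₀ w₀ uL wL)
    (hF : c.γ = 0 → FourierCond u₀ w₀) {Γ : ℝ} (hΓ : 0 ≤ Γ) (hΓ' : Γ ≤ 5 / 2) {K : ℝ} (hK : 0 ≤ K)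
    (hl : ∀ t, 0 ≤ t → Micropolar.energy (uL t) (wL t) ≤ K * (1 + t) ^ (-Γ)) :
    ∃ C, 0 ≤ C ∧ ∀ S, IsCut S → ∀ T, 1 ≤ T → ∀ r, T ≤ r → ∫ ξ in S, ‖ξ‖ * fmod (uL r) (wL r) ξ
      ≤ C * (1 + T) ^ (-(5 / 4 + Γ / 2)) := by
  obtain ⟨C, b, hC0, hb, h⟩ := hL.exists_grad_bound hF
  obtain ⟨D, hD0, hD⟩ := exists_exp_neg_le hb (m := 5 / 4 + Γ / 2) (by linarith)
  refine ⟨C * (2 ^ (5 / 4 : ℝ) * √(K * 2 ^ Γ) + D), by positivity, fun S hS T hT r hr => ?_⟩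
  have hr0 : 0 < r := by linarith
  refine (h S hS r hr0).trans ?_
  rw [mul_assoc]
  refine mul_le_mul_of_nonneg_left ?_ hC0
  rw [add_mul]
  refine add_le_add ?_ ((Real.exp_le_exp.2 (by nlinarith)).trans (hD T (by linarith)))
  have h1 : r ^ (-(5 / 4) : ℝ) ≤ 2 ^ (5 / 4 : ℝ) * (1 + T) ^ (-(5 / 4) : ℝ) := by
    have := one_add_rpow_le_mul (a := 5 / 4) (by norm_num) (by linarith : 0 ≤ r - 1)
      (by linarith : 0 ≤ T) (by linarith)
    rwa [add_sub_cancel] at this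
  have h2 : Micropolar.energy (uL (r / 2)) (wL (r / 2)) ≤ K * 2 ^ Γ * (1 + T) ^ (-Γ) := by
    refine (hl (r / 2) (by linarith)).trans ?_
    rw [mul_assoc]
    gcongr
    exact one_add_rpow_le_mul hΓ (by linarith) (by linarith) (by linarith)
  have h3 : √((1 + T) ^ (-Γ)) = (1 + T) ^ (-(Γ / 2)) := by
    rw [Real.sqrt_eq_rpow, ← Real.rpow_mul (by linarith)]; ring_nf
  calc _ ≤ 2 ^ (5 / 4 : ℝ) * (1 + T) ^ (-(5 / 4) : ℝ) * √(K * 2 ^ Γ * (1 + T) ^ (-Γ)) := by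
        gcongr
    _ = 2 ^ (5 / 4 : ℝ) * √(K * 2 ^ Γ) * ((1 + T) ^ (-(5 / 4) : ℝ) * (1 + T) ^ (-(Γ / 2))) := by
        rw [Real.sqrt_mul (by positivity), h3]; ring
    _ = _ := by
        rw [← Real.rpow_add (by linarith)]; ring_nf

/-- The recursion for the difference with the linear flow. -/
theorem exists_diff_two_mul_le (hθ : IsMollifier θ) (hL : IsLinearSolution c u₀ w₀ uL wL)
    (hF : c.γ = 0 → FourierCond u₀ w₀) {Γ : ℝ} (hΓ : 0 ≤ Γ) (hΓ' : Γ ≤ 5 / 2) {K : ℝ} (hK : 0 ≤ K)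
    (hl : ∀ t, 0 ≤ t → energy (uL t) (wL t) ≤ K * (1 + t) ^ (-Γ)) :
    ∃ C, 0 ≤ C ∧ ∀ ε (u w : ℝ → L2), 0 < ε → IsMollifiedSolution c θ ε u₀ w₀ u w →
      ∀ T, splitScale c ≤ T → 1 ≤ T → energy (u (2 * T) - uL (2 * T)) (w (2 * T) - wL (2 * T))
        ≤ 1 / 16 * energy (u T - uL T) (w T - wL T)
          + (C * ((1 + T) ^ (-(1 / 2 + Γ)) * energy (u T) (w T)) + lowForce c u w T) := by
  obtain ⟨C, hC0, hC⟩ := hL.exists_grad_decay hF hΓ hΓ' hK hl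
  refine ⟨33 * 4 * (12 * Real.pi * C) ^ 2, by positivity, fun ε u w hε h T hT hT1 => ?_⟩
  have hE := energy_nonneg (u T) (w T)
  have hT0 : 0 ≤ T := by linarith
  have h1 := diff_two_mul_le h hθ hε hL hT
    (β := 12 * Real.pi * √(energy (u T) (w T)) * (C * (1 + T) ^ (-(5 / 4 + Γ / 2))))
    (by positivity) fun S hS r hr => by
      have h2 : ‖u r‖ ≤ √(energy (u T) (w T)) := by
        refine Real.le_sqrt_of_sq_le (le_trans ?_ (h.antitoneOn hθ hε (mem_Ici.2 hT0)
          (mem_Ici.2 (hT0.trans hr.1)) hr.1))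
        simp only [energy]
        exact le_add_of_nonneg_right (by positivity)
      have h3 := hC S hS T hT1 r hr.1
      have h4 : 0 ≤ ∫ ξ in S, ‖ξ‖ * fmod (uL r) (wL r) ξ :=
        integral_nonneg fun ξ => mul_nonneg (norm_nonneg _) (fmod_nonneg _ _ _)
      gcongr
  refine h1.trans (add_le_add le_rfl (add_le_add ?_ le_rfl))
  -- The square of the gradient bound is `(1+T)^(-5/2-Γ)`; the length of the time interval
  -- contributes `T²`, leaving `(1+T)^(-1/2-Γ)`.
  have e1 : ((1 + T) ^ (-(5 / 4 + Γ / 2))) ^ 2 = (1 + T) ^ (-(1 / 2 + Γ)) * (1 + T) ^ (-2 : ℝ) := by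
    rw [← Real.rpow_add (by linarith), ← Real.rpow_natCast, ← Real.rpow_mul (by linarith)]
    norm_num; ring_nf
  have e2 : (1 + T) ^ (-2 : ℝ) * T ^ 2 ≤ 1 := by
    have : (1 + T) ^ (-2 : ℝ) = ((1 + T) ^ 2)⁻¹ := by
      rw [Real.rpow_neg (by positivity)]; norm_cast
    rw [this, ← div_eq_inv_mul, div_le_one (by positivity)]
    gcongr; linarith
  calc 33 * (2 * (12 * Real.pi * √(energy (u T) (w T)) * (C * (1 + T) ^ (-(5 / 4 + Γ / 2)))) * T) ^ 2
      = 33 * 4 * (12 * Real.pi * C) ^ 2 * (√(energy (u T) (w T)) ^ 2 *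
        (((1 + T) ^ (-(5 / 4 + Γ / 2))) ^ 2 * T ^ 2)) := by ring
    _ = 33 * 4 * (12 * Real.pi * C) ^ 2 * (energy (u T) (w T) *
        ((1 + T) ^ (-(1 / 2 + Γ)) * ((1 + T) ^ (-2 : ℝ) * T ^ 2))) := by
        rw [e1, Real.sq_sqrt hE, mul_assoc ((1 + T) ^ (-(1 / 2 + Γ)))]
    _ ≤ 33 * 4 * (12 * Real.pi * C) ^ 2 * (energy (u T) (w T) * ((1 + T) ^ (-(1 / 2 + Γ)) * 1)) := by
        gcongr
    _ = _ := by ring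

theorem energy_sub_le (hθ : IsMollifier θ) (hL : IsLinearSolution c u₀ w₀ uL wL) {ε : ℝ} {u w : ℝ → L2}
    (hε : 0 < ε) (h : IsMollifiedSolution c θ ε u₀ w₀ u w) {t : ℝ} (ht : 0 ≤ t) :
    energy (u t - uL t) (w t - wL t) ≤ 4 * energy u₀ w₀ := by
  have h1 := h.energy_le_zero hθ hε ht
  have h2 := hL.energy_le_zero ht
  have h3 := norm_sub_sq_le (u t) (uL t)
  have h4 := norm_sub_sq_le (w t) (wL t)
  simp only [energy] at *
  linarith

/-- With `E = O(t^(-Γ))`, the forcing through `∇z_L` has order `1/2 + 2Γ`. The low-frequency forcing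
has the same order for `Γ < 1` but never more than `5/2`, whence the cap. The case `Γ = 1` is
excluded because of the logarithm. -/
theorem exists_diff_decay (hθ : IsMollifier θ) (hL : IsLinearSolution c u₀ w₀ uL wL)
    (hF : c.γ = 0 → FourierCond u₀ w₀) {Γ : ℝ} (hΓ : 0 ≤ Γ) (hΓ' : Γ ≤ 5 / 2) {K : ℝ} (hK : 0 ≤ K)
    (hl : ∀ t, 0 ≤ t → ‖uL t‖ ^ 2 ≤ K * (1 + t) ^ (-Γ)) {b : ℝ} (hb : 0 ≤ b) (hb' : b ≤ 5 / 2)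
    (hb2 : b ≤ 1 / 2 + 2 * Γ) (hne : Γ ≠ 1) :
    ∃ C, 0 ≤ C ∧ ∀ ε (u w : ℝ → L2), 0 < ε → IsMollifiedSolution c θ ε u₀ w₀ u w →
      ∀ t, 0 ≤ t → energy (u t - uL t) (w t - wL t) ≤ C * (1 + t) ^ (-b) := by
  obtain ⟨A, hA0, hA⟩ := exists_energy_decay hθ hL hΓ hΓ' hK hl
  obtain ⟨K', hK', hl'⟩ := hL.exists_energy_le hΓ hΓ' hK hl
  obtain ⟨B, hB0, hB⟩ := exists_diff_two_mul_le hθ hL hF hΓ hΓ' hK' hl'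
  obtain ⟨D, hD0, hD⟩ := exists_lowForce_le c (a := Γ) (b := b) hA0
    (by rcases hne.lt_or_gt with h | h; exacts [Or.inl ⟨h, hb2⟩, Or.inr ⟨h, hb'⟩])
  have hs : splitScale c ≤ max (splitScale c) 1 := le_max_left _ _
  obtain ⟨C, hC0, hC⟩ := exists_dyadic_bound (h := fun t => (1 + t) ^ (-b))
    (T₀ := max (splitScale c) 1)
    (fun t ht => by positivity) (continuousOn_one_add_rpow _) (by positivity)
    (fun T hT => one_add_rpow_le_eight hb (by linarith) ((splitScale_pos c).le.trans (hs.trans hT)))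
    (4 * energy u₀ w₀) (B * A + D)
  refine ⟨C, hC0, fun ε u w hε h => hC _ (fun t ht => energy_sub_le hθ hL hε h ht) fun T hT => ?_⟩
  have hT1 : 1 ≤ T := (le_max_right _ _).trans hT
  have h1 := hB ε u w hε h T (hs.trans hT) hT1
  have h2 := hD u w (hA ε u w hε h)
    (fun T hT => h.intervalIntegrable_energy hθ hε le_rfl hT) T hT1
  have h3 : (1 + T) ^ (-(1 / 2 + Γ)) * energy (u T) (w T) ≤ A * (1 + T) ^ (-b) := by
    calc _ ≤ (1 + T) ^ (-(1 / 2 + Γ)) * (A * (1 + T) ^ (-Γ)) := by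
          gcongr; exact hA ε u w hε h T (by linarith)
      _ = A * (1 + T) ^ (-(1 / 2 + 2 * Γ)) := by
          rw [mul_left_comm, ← Real.rpow_add (by linarith)]; ring_nf
      _ ≤ _ := by
          gcongr
          linarith
  have h4 := mul_le_mul_of_nonneg_left h3 hB0
  linarith

theorem exists_diff_decay_log (hθ : IsMollifier θ) (hL : IsLinearSolution c u₀ w₀ uL wL)
    (hF : c.γ = 0 → FourierCond u₀ w₀) {K : ℝ} (hK : 0 ≤ K)
    (hl : ∀ t, 0 ≤ t → ‖uL t‖ ^ 2 ≤ K * (1 + t) ^ (-1 : ℝ)) :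
    ∃ C, 0 ≤ C ∧ ∀ ε (u w : ℝ → L2), 0 < ε → IsMollifiedSolution c θ ε u₀ w₀ u w →
      ∀ t, 0 ≤ t → energy (u t - uL t) (w t - wL t)
        ≤ C * ((1 + t) ^ (-(5 / 2) : ℝ) * Real.log (Real.exp 1 + t) ^ 2) := by
  obtain ⟨A, hA0, hA⟩ := exists_energy_decay hθ hL zero_le_one (by norm_num) hK hl
  obtain ⟨K', hK', hl'⟩ := hL.exists_energy_le zero_le_one (by norm_num) hK hl
  obtain ⟨B, hB0, hB⟩ := exists_diff_two_mul_le hθ hL hF zero_le_one (by norm_num) hK' hl'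
  obtain ⟨D, hD0, hD⟩ := exists_lowForce_le_log c hA0
  have hs : splitScale c ≤ max (splitScale c) 1 := le_max_left _ _
  have he := Real.exp_pos 1
  have hlog : ∀ t : ℝ, 0 ≤ t → 1 ≤ Real.log (Real.exp 1 + t) := fun t ht => by
    rw [Real.le_log_iff_exp_le (by positivity)]; linarith
  have hcont : ContinuousOn (fun t => (1 + t) ^ (-(5 / 2) : ℝ) * Real.log (Real.exp 1 + t) ^ 2)
      (Ici (0 : ℝ)) :=
    (continuousOn_one_add_rpow _).mul (((continuous_const.add continuous_id).continuousOn.log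
      fun t ht => by
        have h : (0 : ℝ) ≤ t := ht
        exact (by positivity : Real.exp 1 + t ≠ 0)).pow 2)
  obtain ⟨C, hC0, hC⟩ := exists_dyadic_bound
    (h := fun t => (1 + t) ^ (-(5 / 2) : ℝ) * Real.log (Real.exp 1 + t) ^ 2)
    (T₀ := max (splitScale c) 1)
    (fun t ht => mul_pos (by positivity) (pow_pos (zero_lt_one.trans_le (hlog t ht)) 2)) hcont
    (by positivity) (fun T hT => by
      have hT0 := (splitScale_pos c).le.trans (hs.trans hT)
      have h1 := one_add_rpow_le_eight (a := 5 / 2) (by norm_num) (by norm_num) hT0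
      have h2 := hlog T hT0
      have h3 : Real.log (Real.exp 1 + T) ≤ Real.log (Real.exp 1 + 2 * T) :=
        Real.log_le_log (by positivity) (by linarith)
      rw [← mul_assoc]
      gcongr)
    (4 * energy u₀ w₀) (B * A + D)
  refine ⟨C, hC0, fun ε u w hε h => hC _ (fun t ht => energy_sub_le hθ hL hε h ht) fun T hT => ?_⟩
  have hT1 : 1 ≤ T := (le_max_right _ _).trans hT
  have h1 := hB ε u w hε h T (hs.trans hT) hT1
  have h2 := hD u w (hA ε u w hε h)
    (fun T hT => h.intervalIntegrable_energy hθ hε le_rfl hT) T hT1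
  have h3 : (1 + T) ^ (-(1 / 2 + 1) : ℝ) * energy (u T) (w T)
      ≤ A * ((1 + T) ^ (-(5 / 2) : ℝ) * Real.log (Real.exp 1 + T) ^ 2) := by
    calc _ ≤ (1 + T) ^ (-(1 / 2 + 1) : ℝ) * (A * (1 + T) ^ (-1 : ℝ)) := by
          gcongr; exact hA ε u w hε h T (by linarith)
      _ = A * ((1 + T) ^ (-(5 / 2) : ℝ) * 1) := by
          rw [mul_left_comm, ← Real.rpow_add (by linarith)]; norm_num
      _ ≤ _ := by
          gcongr
          exact one_le_pow₀ (hlog T (by linarith))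
  have h4 := mul_le_mul_of_nonneg_left h3 hB0
  linarith

/-- With bounded linear energy the two forcings are of critical order `T^(-1/2)`; their smallness
comes from `E(T) → 0` and from the resulting convergence to zero of the time average of `E`. The
weight at most doubles when `T` does, so the factor `1/16` becomes `1/8`. -/
theorem exists_sqrt_mul_diff_le (hθ : IsMollifier θ) (hL : IsLinearSolution c u₀ w₀ uL wL)
    (hF : c.γ = 0 → FourierCond u₀ w₀) {δ : ℝ} (hδ : 0 < δ) :
    ∃ T, 0 < T ∧ ∀ ε (u w : ℝ → L2), 0 < ε → IsMollifiedSolution c θ ε u₀ w₀ u w →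
      ∀ t, T ≤ t → (1 + t) ^ (1 / 2 : ℝ) * energy (u t - uL t) (w t - wL t) ≤ δ := by
  let ι := {i : ℝ × (ℝ → L2) × (ℝ → L2) // 0 < i.1 ∧ IsMollifiedSolution c θ i.1 u₀ w₀ i.2.1 i.2.2}
  have hE0 := energy_nonneg u₀ w₀
  obtain ⟨B, hB0, hB⟩ := exists_diff_two_mul_le hθ hL hF le_rfl (by norm_num) hE0
    (fun t ht => by simpa using hL.energy_le_zero ht)
  set D := lowConst * (2 * splitScale c) ^ (5 / 2 : ℝ)
  have hD : 0 ≤ D := by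
    have := lowConst_nonneg
    have := splitScale_pos c
    positivity
  obtain ⟨T, hT, h⟩ := dyadic_small (ι := ι)
    (X := fun i t => (1 + t) ^ (1 / 2 : ℝ) * energy (i.1.2.1 t - uL t) (i.1.2.2 t - wL t))
    (fun T => ⟨(1 + T) ^ (1 / 2 : ℝ) * (4 * energy u₀ w₀), fun i t ht => by
      have h0 : 0 ≤ 1 + t := by linarith [ht.1]
      have h1 : 0 ≤ 1 + T := by linarith [ht.1, ht.2]
      have h2 := energy_nonneg (i.1.2.1 t - uL t) (i.1.2.2 t - wL t)
      exact mul_le_mul (Real.rpow_le_rpow h0 (by linarith [ht.2]) (by norm_num))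
        (energy_sub_le hθ hL i.2.1 i.2.2 ht.1) h2 (by positivity)⟩)
    (fun δ hδ => by
      -- `2` is the growth of the weight and `18 = 2 · 3²`, the `3` coming from the bound on the
      -- time integral of the energy below.
      obtain ⟨η, hη, hη1⟩ : ∃ η, 0 < η ∧ 2 * B * η + 18 * D * η ^ 2 ≤ δ := by
        have : Tendsto (fun η : ℝ => 2 * B * η + 18 * D * η ^ 2) (𝓝[>] 0)
            (𝓝 (2 * B * 0 + 18 * D * 0 ^ 2)) :=
          ((continuous_const.mul continuous_id).add
            (continuous_const.mul (continuous_id.pow 2))).continuousWithinAt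
        simp only [mul_zero, ne_eq, OfNat.ofNat_ne_zero, not_false_eq_true, zero_pow, add_zero]
          at this
        obtain ⟨η, h1, h2⟩ := ((this.eventually_le_const hδ).and self_mem_nhdsWithin).exists
        exact ⟨η, h2, h1⟩
      obtain ⟨T₁, hT₁, hE⟩ := exists_energy_le (c := c) (u₀ := u₀) (w₀ := w₀) hθ hη
      -- The last threshold makes the times before `T₁` contribute at most `T η` to the integral of
      -- the energy; the later ones contribute at most `2T η`.
      refine ⟨max (max (splitScale c) 1) (max T₁ (T₁ * energy u₀ w₀ / η)), by positivity,
        fun i T hT => ?_⟩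
      have hTs : splitScale c ≤ T := (le_max_left _ _).trans ((le_max_left _ _).trans hT)
      have hT1 : 1 ≤ T := (le_max_right _ _).trans ((le_max_left _ _).trans hT)
      have hTT : T₁ ≤ T := (le_max_left _ _).trans ((le_max_right _ _).trans hT)
      have hTη : T₁ * energy u₀ w₀ ≤ T * η :=
        (div_le_iff₀ hη).1 ((le_max_right _ _).trans ((le_max_right _ _).trans hT))
      obtain ⟨⟨ε, u, w⟩, hε, hs⟩ := i
      simp only at hε hs ⊢
      have hi : ∀ {a b : ℝ}, 0 ≤ a → 0 ≤ b →
          IntervalIntegrable (fun r => energy (u r) (w r)) volume a b :=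
        fun ha hb => hs.intervalIntegrable_energy hθ hε ha hb
      have h1 := hB ε u w hε hs T hTs hT1
      have h2 := lowForce_le (c := c) hT1 (fun t _ => le_rfl) (hi le_rfl (by linarith))
        (hi le_rfl (by linarith))
      have h3 := hE ε u w hε hs T hTT
      have h4 : ∫ r in (0 : ℝ)..2 * T, energy (u r) (w r) ≤ 3 * (1 + T) * η := by
        rw [← intervalIntegral.integral_add_adjacent_intervals (hi le_rfl hT₁.le)
          (hi hT₁.le (by linarith : 0 ≤ 2 * T))]
        have h5 : ∫ r in (0 : ℝ)..T₁, energy (u r) (w r) ≤ ∫ _ in (0 : ℝ)..T₁, energy u₀ w₀ :=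
          intervalIntegral.integral_mono_on hT₁.le (hi le_rfl hT₁.le) (by simp)
            fun r hr => hs.energy_le_zero hθ hε hr.1
        have h6 : ∫ r in T₁..2 * T, energy (u r) (w r) ≤ ∫ _ in T₁..2 * T, η :=
          intervalIntegral.integral_mono_on (by linarith) (hi hT₁.le (by linarith)) (by simp)
            fun r hr => hE ε u w hε hs r hr.1
        simp only [intervalIntegral.integral_const, smul_eq_mul, sub_zero] at h5 h6
        nlinarith
      have h4' : 0 ≤ ∫ r in (0 : ℝ)..2 * T, energy (u r) (w r) :=
        intervalIntegral.integral_nonneg (by linarith) fun r _ => energy_nonneg _ _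
      have hp : 0 < 1 + T := by linarith
      have h5 : (1 + 2 * T) ^ (1 / 2 : ℝ) ≤ 2 * (1 + T) ^ (1 / 2 : ℝ) := by
        calc (1 + 2 * T) ^ (1 / 2 : ℝ) ≤ (4 * (1 + T)) ^ (1 / 2 : ℝ) := by gcongr; linarith
          _ = 2 * (1 + T) ^ (1 / 2 : ℝ) := by
            rw [Real.mul_rpow (by norm_num) hp.le, ← Real.sqrt_eq_rpow,
              (by norm_num : (4 : ℝ) = 2 ^ 2), Real.sqrt_sq (by norm_num)]
      have e1 : (1 + T) ^ (1 / 2 : ℝ) * (1 + T) ^ (-(1 / 2 + 0) : ℝ) = 1 := by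
        rw [← Real.rpow_add hp]; norm_num
      have e2 : (1 + T) ^ (1 / 2 : ℝ) * (1 + T) ^ (-(5 / 2) : ℝ) * (1 + T) ^ 2 = 1 := by
        rw [← Real.rpow_add hp, ← Real.rpow_natCast, ← Real.rpow_add hp]; norm_num
      have h6 : lowForce c u w T ≤ D * ((1 + T) ^ (-(5 / 2) : ℝ) * (3 * (1 + T) * η) ^ 2) :=
        h2.trans (by gcongr)
      have h7 := energy_nonneg (u T - uL T) (w T - wL T)
      have h8 := energy_nonneg (u (2 * T) - uL (2 * T)) (w (2 * T) - wL (2 * T))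
      have h9 := energy_nonneg (u T) (w T)
      set P := (1 + T) ^ (1 / 2 : ℝ)
      set Q := (1 + T) ^ (-(1 / 2 + 0) : ℝ)
      set Q' := (1 + T) ^ (-(5 / 2) : ℝ)
      have hP : 0 ≤ P := by positivity
      have hQ : 0 ≤ Q := by positivity
      set X := energy (u T - uL T) (w T - wL T)
      calc _ ≤ 2 * P * (1 / 16 * X + (B * (Q * η) + D * (Q' * (3 * (1 + T) * η) ^ 2))) := by
            refine mul_le_mul h5 (h1.trans ?_) h8 (by positivity)
            gcongr
        _ = 1 / 8 * (P * X) + (2 * B * η * (P * Q) + 18 * D * η ^ 2 * (P * Q' * (1 + T) ^ 2)) := by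
            ring
        _ ≤ 1 / 4 * (P * X) + δ := by
            rw [e1, e2]
            have : 0 ≤ P * X := by positivity
            linarith) δ hδ
  exact ⟨T, hT, fun ε u w hε hs t ht => h ⟨⟨ε, u, w⟩, hε, hs⟩ t ht⟩

end

section

/-! ### Equicontinuity of the mollified solutions -/

section Equicontinuity

variable {c : Coeffs} {θ : R3 → ℝ} {u₀ w₀ : L2} {S : Set R3}

theorem exists_dform_le (c : Coeffs) (S : Set R3) (p' q' : LC) :
    ∃ C, 0 ≤ C ∧ ∀ p q, |dform c S p q p' q'| ≤ C * (‖p‖ + ‖q‖) := by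
  set b := dop S sCurl p' - (2 : ℝ) • proj S q'
  set A : LC →L[ℝ] ℝ := c.μ • ∑ j, (innerSL ℝ (dop S (sD j) p')).comp (dop S (sD j))
    + c.χ • (innerSL ℝ b).comp (dop S sCurl) with hA
  set B : LC →L[ℝ] ℝ := c.γ • ∑ j, (innerSL ℝ (dop S (sD j) q')).comp (dop S (sD j))
    + c.κ • (innerSL ℝ (dop S sDiv q')).comp (dop S sDiv)
    - c.χ • (innerSL ℝ b).comp ((2 : ℝ) • proj S) with hB
  have h : ∀ p q, dform c S p q p' q' = A p + B q := by
    intro p q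
    simp only [hA, hB, dform, _root_.add_apply, _root_.sub_apply,
      _root_.smul_apply, _root_.sum_apply, ContinuousLinearMap.comp_apply,
      innerSL_apply_apply, smul_eq_mul]
    rw [real_inner_comm b, inner_sub_right, real_inner_comm (dop S sDiv q')]
    simp only [real_inner_comm (dop S (sD _) p') (dop S (sD _) p),
      real_inner_comm (dop S (sD _) q') (dop S (sD _) q)]
    ring
  refine ⟨‖A‖ + ‖B‖, by positivity, fun p q => ?_⟩
  rw [h, add_mul]
  refine (abs_add_le _ _).trans (add_le_add ?_ ?_)
  · refine (A.le_opNorm p).trans ?_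
    gcongr
    exact le_add_of_nonneg_right (norm_nonneg _)
  · refine (B.le_opNorm q).trans ?_
    gcongr
    exact le_add_of_nonneg_left (norm_nonneg _)

theorem norm_le_sqrt_energy_left (f g : L2) : ‖f‖ ≤ √(energy f g) :=
  Real.le_sqrt_of_sq_le (le_add_of_nonneg_right (sq_nonneg _))

theorem norm_le_sqrt_energy_right (f g : L2) : ‖g‖ ≤ √(energy f g) :=
  Real.le_sqrt_of_sq_le (le_add_of_nonneg_left (sq_nonneg _))

theorem exists_lipschitz_proj (hθ : IsMollifier θ) (hS : IsCut S) {p' : LC} (hp' : dop S sDiv p' = 0)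
    (q' : LC) : ∃ C, 0 ≤ C ∧ ∀ ε (u w : ℝ → L2), 0 < ε → IsMollifiedSolution c θ ε u₀ w₀ u w →
      ∀ s t, 0 ≤ s → 0 ≤ t →
        |inner ℝ (Ftr (u t) - Ftr (u s)) (proj S p') + inner ℝ (Ftr (w t) - Ftr (w s)) (proj S q')|
          ≤ C * |t - s| := by
  obtain ⟨D, hD0, hD⟩ := exists_dform_le c S p' q'
  set m := √(energy u₀ w₀)
  set I := ∫ ξ in S, ‖ξ‖ * ‖p' ξ‖
  set J := ∫ ξ in S, ‖ξ‖ * ‖q' ξ‖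
  have hI : 0 ≤ I := integral_nonneg fun _ => by positivity
  have hJ : 0 ≤ J := integral_nonneg fun _ => by positivity
  have hm : 0 ≤ m := Real.sqrt_nonneg _
  refine ⟨D * (m + m) + 6 * Real.pi * m * (m * I + m * J), by positivity,
    fun ε u w hε h s t hs ht => ?_⟩
  obtain ⟨Fp, Fq, h1, h2, h3⟩ := (h.isFlow hθ hε hS).rates
  have e : inner ℝ (Ftr (u t) - Ftr (u s)) (proj S p') + inner ℝ (Ftr (w t) - Ftr (w s)) (proj S q')
      = ∫ r in s..t, (inner ℝ (Fp r) (proj S p') + inner ℝ (Fq r) (proj S q')) := by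
    rw [intervalIntegral.integral_add
      (intervalIntegrable_of_continuousOn_Ici (h1.cont _) hs ht)
      (intervalIntegrable_of_continuousOn_Ici (h2.cont _) hs ht), ← h1.sub_eq _ hs ht,
      ← h2.sub_eq _ hs ht, inner_proj_right hS (Ftr (u t) - Ftr (u s)),
      inner_proj_right hS (Ftr (w t) - Ftr (w s)), map_sub (proj S), map_sub (proj S),
      inner_sub_left, inner_sub_left]
  rw [e, ← Real.norm_eq_abs]
  refine intervalIntegral.norm_integral_le_of_norm_le_const fun r hr => ?_
  have hr0 : 0 ≤ r := (le_min hs ht).trans hr.1.le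
  have hu : ‖Ftr (u r)‖ ≤ m := by
    rw [Ftr.norm_map]
    exact (norm_le_sqrt_energy_left _ (w r)).trans (Real.sqrt_le_sqrt (h.energy_le_zero hθ hε hr0))
  have hw : ‖Ftr (w r)‖ ≤ m := by
    rw [Ftr.norm_map]
    exact (norm_le_sqrt_energy_right (u r) _).trans (Real.sqrt_le_sqrt (h.energy_le_zero hθ hε hr0))
  rw [h3 r hr0 p' q' hp', Real.norm_eq_abs]
  refine (abs_add_le _ _).trans (add_le_add ?_ ?_)
  · rw [abs_neg]
    exact (hD _ _).trans (by gcongr)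
  · refine (abs_transp_le (hθ.scale hε) hS _ _ _ _ _).trans ?_
    rw [Ftr.norm_map] at hu
    gcongr
    rwa [Ftr.norm_map]

theorem inner_leray {f g : L2} (hf : f ∈ L2σ) : inner ℝ f (leray g) = inner ℝ f g := by
  rw [leray, ← Submodule.inner_starProjection_left_eq_right, Submodule.starProjection_eq_self_iff.2 hf]

theorem leray_mem (g : L2) : leray g ∈ L2σ := Submodule.starProjection_apply_mem _ _

/-- The high frequencies of the test field cost at most `δ`, by the uniform energy bound; the low
ones give a Lipschitz bound uniform in `ε`. As `u` is divergence free, `f` may be replaced by its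
Leray projection, which is an admissible test. -/
theorem exists_modulus (hθ : IsMollifier θ) (f g : L2) {δ : ℝ} (hδ : 0 < δ) :
    ∃ C, 0 ≤ C ∧ ∀ ε (u w : ℝ → L2), 0 < ε → IsMollifiedSolution c θ ε u₀ w₀ u w →
      ∀ s t, 0 ≤ s → 0 ≤ t →
        |inner ℝ (u t - u s) f + inner ℝ (w t - w s) g| ≤ δ + C * |t - s| := by
  set m := √(energy u₀ w₀)
  have hm : 0 ≤ m := Real.sqrt_nonneg _
  set p := Ftr (leray f)
  set q := Ftr g
  have hlim : Tendsto (fun R : ℝ => 2 * m * ‖p - proj (Metric.closedBall 0 R) p‖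
      + 2 * m * ‖q - proj (Metric.closedBall 0 R) q‖) atTop (𝓝 (2 * m * 0 + 2 * m * 0)) :=
    ((tendsto_norm_sub_proj p).const_mul _).add ((tendsto_norm_sub_proj q).const_mul _)
  simp only [mul_zero, add_zero] at hlim
  obtain ⟨R, hR⟩ := (hlim.eventually_le_const hδ).exists
  have hS := IsCut.closedBall R
  obtain ⟨C, hC0, hC⟩ := exists_lipschitz_proj (c := c) (u₀ := u₀) (w₀ := w₀) hθ hS
    (dop_sDiv_of_mem (leray_mem f) hS) q
  refine ⟨C, hC0, fun ε u w hε h s t hs ht => ?_⟩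
  have h1 := hC ε u w hε h s t hs ht
  have hu : ∀ r, 0 ≤ r → ‖u r‖ ≤ m := fun r hr => (norm_le_sqrt_energy_left _ (w r)).trans
    (Real.sqrt_le_sqrt (h.energy_le_zero hθ hε hr))
  have hw : ∀ r, 0 ≤ r → ‖w r‖ ≤ m := fun r hr => (norm_le_sqrt_energy_right (u r) _).trans
    (Real.sqrt_le_sqrt (h.energy_le_zero hθ hε hr))
  have hu2 : ‖Ftr (u t) - Ftr (u s)‖ ≤ 2 * m := (norm_sub_le _ _).trans (by
    rw [Ftr.norm_map, Ftr.norm_map]; linarith [hu t ht, hu s hs])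
  have hw2 : ‖Ftr (w t) - Ftr (w s)‖ ≤ 2 * m := (norm_sub_le _ _).trans (by
    rw [Ftr.norm_map, Ftr.norm_map]; linarith [hw t ht, hw s hs])
  have e1 : inner ℝ (u t - u s) f = inner ℝ (Ftr (u t) - Ftr (u s)) p := by
    rw [← inner_leray (Submodule.sub_mem _ (h.divFree t ht) (h.divFree s hs)), ← inner_Ftr, map_sub]
  have e2 : inner ℝ (w t - w s) g = inner ℝ (Ftr (w t) - Ftr (w s)) q := by
    rw [← inner_Ftr, map_sub]
  set S := Metric.closedBall (0 : R3) R
  have e3 : inner ℝ (Ftr (u t) - Ftr (u s)) p = inner ℝ (Ftr (u t) - Ftr (u s)) (p - proj S p)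
      + inner ℝ (Ftr (u t) - Ftr (u s)) (proj S p) := by rw [← inner_add_right, sub_add_cancel]
  have e4 : inner ℝ (Ftr (w t) - Ftr (w s)) q = inner ℝ (Ftr (w t) - Ftr (w s)) (q - proj S q)
      + inner ℝ (Ftr (w t) - Ftr (w s)) (proj S q) := by rw [← inner_add_right, sub_add_cancel]
  have h2 : |inner ℝ (Ftr (u t) - Ftr (u s)) (p - proj S p)| ≤ 2 * m * ‖p - proj S p‖ :=
    (abs_real_inner_le_norm _ _).trans (by gcongr)
  have h3 : |inner ℝ (Ftr (w t) - Ftr (w s)) (q - proj S q)| ≤ 2 * m * ‖q - proj S q‖ :=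
    (abs_real_inner_le_norm _ _).trans (by gcongr)
  rw [e1, e2, e3, e4]
  rw [abs_le] at *
  constructor <;> linarith [h1.1, h1.2, h2.1, h2.2, h3.1, h3.2]

end Equicontinuity

end

section

/-! ### Weak limits of equicontinuous sequences -/

/-- The support lies strictly to the right of `t`, so that even `t = 0` is reached by test functions
on `(0,∞)`. -/
theorem exists_bump (t : ℝ) {δ : ℝ} (hδ : 0 < δ) : ∃ η : ℝ → ℝ, ContDiff ℝ ∞ η ∧ HasCompactSupport η ∧
    tsupport η ⊆ Ioo t (t + δ) ∧ (∀ s, 0 ≤ η s) ∧ ∫ s, η s = 1 := by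
  let f : ContDiffBump (t + δ / 2) := ⟨δ / 8, δ / 4, by positivity, by linarith⟩
  refine ⟨f.normed volume, f.contDiff_normed, f.hasCompactSupport_normed, ?_,
    fun s => f.nonneg_normed s, f.integral_normed⟩
  rw [f.tsupport_normed_eq, Real.closedBall_eq_Icc]
  intro s hs
  have h : f.rOut = δ / 4 := rfl
  rw [h] at hs
  exact ⟨by linarith [hs.1], by linarith [hs.2]⟩

theorem integrable_mul_of_tsupport {η g : ℝ → ℝ} (hη : Continuous η) (hc : HasCompactSupport η)
    (hs : tsupport η ⊆ Ioi 0) (hg : ContinuousOn g (Ici 0)) : Integrable fun s => η s * g s := by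
  refine (integrableOn_iff_integrable_of_support_subset (s := tsupport η) ?_).1 ?_
  · exact (Function.support_mul_subset_left _ _).trans (subset_tsupport η)
  · exact (hη.continuousOn.mul (hg.mono (hs.trans Ioi_subset_Ici_self))).integrableOn_compact hc

theorem abs_integral_bump_sub_le {η g : ℝ → ℝ} {t δ a : ℝ} (ht : 0 ≤ t) (hη : Continuous η)
    (hc : HasCompactSupport η) (hs : tsupport η ⊆ Ioo t (t + δ)) (h0 : ∀ s, 0 ≤ η s)
    (h1 : ∫ s, η s = 1) (hg : ContinuousOn g (Ici 0)) (h : ∀ s ∈ Ioo t (t + δ), |g s - g t| ≤ a) :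
    |(∫ s in Ioi (0 : ℝ), η s * g s) - g t| ≤ a := by
  have hs0 : tsupport η ⊆ Ioi 0 := fun s hs' => ht.trans_lt (hs hs').1
  have hz : ∀ s, s ∉ tsupport η → η s = 0 := fun s => image_eq_zero_of_notMem_tsupport
  have e : ∫ s in Ioi (0 : ℝ), η s * g s = ∫ s, η s * g s :=
    setIntegral_eq_integral_of_forall_compl_eq_zero fun s hs' => by
      rw [hz s fun h => hs' (hs0 h), zero_mul]
  have e2 : g t = ∫ s, η s * g t := by rw [integral_mul_const, h1, one_mul]
  have hi := integrable_mul_of_tsupport hη hc hs0 hg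
  have hηi : Integrable η := hη.integrable_of_hasCompactSupport hc
  rw [e]
  nth_rewrite 1 [e2]
  rw [← integral_sub hi (hηi.mul_const _), ← Real.norm_eq_abs]
  have e3 : a = ∫ s, η s * a := by rw [integral_mul_const, h1, one_mul]
  rw [e3]
  refine norm_integral_le_of_norm_le (hηi.mul_const _) (.of_forall fun s => ?_)
  rw [← mul_sub, norm_mul, Real.norm_of_nonneg (h0 s)]
  by_cases hs' : s ∈ tsupport η
  · exact mul_le_mul_of_nonneg_left (h s (hs hs')) (h0 s)
  · simp [hz s hs']

/-- A function which is continuous on `[0,∞)` and vanishes there in the sense of distributions. -/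
theorem eq_zero_of_bumps {g : ℝ → ℝ} (hg : ContinuousOn g (Ici 0))
    (h : ∀ η : ℝ → ℝ, ContDiff ℝ ∞ η → HasCompactSupport η → tsupport η ⊆ Ioi 0 →
      ∫ s in Ioi (0 : ℝ), η s * g s = 0) {t : ℝ} (ht : 0 ≤ t) : g t = 0 := by
  refine abs_eq_zero.1 (le_antisymm (le_of_forall_pos_le_add fun a ha => ?_) (abs_nonneg _))
  obtain ⟨δ, hδ, hc⟩ := Metric.continuousOn_iff.1 hg t ht a ha
  obtain ⟨η, h1, h2, h3, h4, h5⟩ := exists_bump t hδ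
  have h6 := abs_integral_bump_sub_le ht h1.continuous h2 h3 h4 h5 hg (a := a) fun s hs =>
    (hc s (ht.trans hs.1.le) (by rw [Real.dist_eq, abs_of_pos (by linarith [hs.1])]; linarith [hs.2])).le
  rwa [h η h1 h2 fun s hs => ht.trans_lt (h3 hs).1, zero_sub, abs_neg, ← zero_add a] at h6

section WeakLimit

variable {H : Type*} [NormedAddCommGroup H] [InnerProductSpace ℝ H] [CompleteSpace H]

/-- By boundedness, the vectors along which the pairings converge form a closed subspace; it
contains the total set `D`, hence is everything. The limit functional is represented by the Riesz
theorem. -/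
theorem exists_tendsto_inner {x : ℕ → H} {M : ℝ} (hM : ∀ n, ‖x n‖ ≤ M) {D : Set H}
    (hD : ∀ h : H, (∀ f ∈ D, inner ℝ h f = 0) → h = 0)
    (hx : ∀ f ∈ D, CauchySeq fun n => (inner ℝ (x n) f : ℝ)) :
    ∃ y : H, ∀ f, Tendsto (fun n => (inner ℝ (x n) f : ℝ)) atTop (𝓝 (inner ℝ y f)) := by
  let K : Submodule ℝ H :=
    { carrier := {f | CauchySeq fun n => (inner ℝ (x n) f : ℝ)}
      add_mem' := fun {f g} hf hg => by
        simp only [mem_ofPred_eq, inner_add_right] at *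
        exact hf.add hg
      zero_mem' := by simpa using cauchySeq_const (0 : ℝ)
      smul_mem' := fun a f hf => by
        simp only [mem_ofPred_eq, inner_smul_right] at *
        obtain ⟨l, hl⟩ := cauchySeq_tendsto_of_complete hf
        exact (hl.const_mul a).cauchySeq }
  have hK : ∀ f, f ∈ K ↔ CauchySeq fun n => (inner ℝ (x n) f : ℝ) := fun f => Iff.rfl
  have hM0 : 0 ≤ M := (norm_nonneg _).trans (hM 0)
  have hcl : IsClosed (K : Set H) := by
    refine isClosed_of_closure_subset fun f hf => ?_
    refine (hK f).2 (Metric.cauchySeq_iff'.2 fun ε hε => ?_)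
    obtain ⟨g, hg, hfg⟩ := Metric.mem_closure_iff.1 hf (ε / (4 * (M + 1))) (by positivity)
    obtain ⟨N, hN⟩ := Metric.cauchySeq_iff'.1 ((hK g).1 hg) (ε / 4) (by positivity)
    have hb : ∀ n, |inner ℝ (x n) f - inner ℝ (x n) g| ≤ ε / 4 := fun n => by
      rw [← inner_sub_right]
      refine (abs_real_inner_le_norm _ _).trans ?_
      rw [dist_eq_norm] at hfg
      calc ‖x n‖ * ‖f - g‖ ≤ (M + 1) * (ε / (4 * (M + 1))) := by
            gcongr
            linarith [hM n]
        _ = ε / 4 := by field_simp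
    refine ⟨N, fun n hn => ?_⟩
    have h1 := hN n hn
    have h2 := hb n
    have h3 := hb N
    rw [Real.dist_eq] at *
    rw [abs_lt] at *
    rw [abs_le] at h2 h3
    constructor <;> linarith [h1.1, h1.2, h2.1, h2.2, h3.1, h3.2]
  have : CompleteSpace K := hcl.completeSpace_coe
  have htop : K = ⊤ := by
    rw [← Submodule.orthogonal_eq_bot_iff, Submodule.eq_bot_iff]
    intro h hh
    refine hD h fun f hf => ?_
    rw [real_inner_comm]
    exact hh f ((hK f).2 (hx f hf))
  have hlim : ∀ f, ∃ l, Tendsto (fun n => (inner ℝ (x n) f : ℝ)) atTop (𝓝 l) := fun f =>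
    cauchySeq_tendsto_of_complete ((hK f).1 (htop ▸ Submodule.mem_top))
  choose l hl using hlim
  let L := continuousLinearMapOfTendsto (fun n => innerSL ℝ (x n)) (f := l)
    (tendsto_pi_nhds.2 fun f => by simpa using hl f)
  refine ⟨(InnerProductSpace.toDual ℝ H).symm L, fun f => ?_⟩
  rw [InnerProductSpace.toDual_symm_apply]
  exact hl f

/-- Distributional convergence controls only averages in time. Equicontinuity makes an average over
a short interval after `t` close to the value at `t`, uniformly in `n`, so the values themselves are
Cauchy and no subsequence is needed. -/
theorem exists_weak_limit {x : ℕ → ℝ → H} {M : ℝ} (hM : ∀ n t, 0 ≤ t → ‖x n t‖ ≤ M)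
    (hc : ∀ n, WCont (x n))
    (heq : ∀ f, ∀ δ, 0 < δ → ∃ C, 0 ≤ C ∧ ∀ n s t, 0 ≤ s → 0 ≤ t →
      |inner ℝ (x n t - x n s) f| ≤ δ + C * |t - s|)
    {D : Set H} (hD : ∀ h : H, (∀ f ∈ D, inner ℝ h f = 0) → h = 0)
    (hx : ∀ f ∈ D, ∀ η : ℝ → ℝ, ContDiff ℝ ∞ η → HasCompactSupport η → tsupport η ⊆ Ioi 0 →
      CauchySeq fun n => ∫ t in Ioi (0 : ℝ), η t * inner ℝ (x n t) f) :
    ∃ y : ℝ → H, WCont y ∧ ∀ t, 0 ≤ t → ∀ f,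
      Tendsto (fun n => (inner ℝ (x n t) f : ℝ)) atTop (𝓝 (inner ℝ (y t) f)) := by
  have key : ∀ t, ∃ y : H, 0 ≤ t → ∀ f,
      Tendsto (fun n => (inner ℝ (x n t) f : ℝ)) atTop (𝓝 (inner ℝ y f)) := by
    intro t
    by_cases ht : 0 ≤ t
    · obtain ⟨y, hy⟩ := exists_tendsto_inner (x := fun n => x n t) (fun n => hM n t ht) hD
        fun f hf => Metric.cauchySeq_iff'.2 fun ε hε => by
          obtain ⟨C, hC0, hC⟩ := heq f (ε / 8) (by positivity)
          have hδ : 0 < ε / (8 * (C + 1)) := by positivity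
          obtain ⟨η, h1, h2, h3, h4, h5⟩ := exists_bump t hδ
          obtain ⟨N, hN⟩ := Metric.cauchySeq_iff'.1
            (hx f hf η h1 h2 fun s hs => ht.trans_lt (h3 hs).1) (ε / 4) (by positivity)
          have hb : ∀ n, |(∫ s in Ioi (0 : ℝ), η s * inner ℝ (x n s) f) - inner ℝ (x n t) f|
              ≤ ε / 4 := fun n =>
            abs_integral_bump_sub_le ht h1.continuous h2 h3 h4 h5 (hc n f) fun s hs => by
              have h6 := hC n t s ht (ht.trans hs.1.le)
              rw [inner_sub_left] at h6
              refine h6.trans ?_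
              have h7 : C * |s - t| ≤ (C + 1) * (ε / (8 * (C + 1))) := by
                rw [abs_of_pos (by linarith [hs.1])]
                exact mul_le_mul (by linarith) (by linarith [hs.2]) (by linarith [hs.1])
                  (by positivity)
              have h8 : (C + 1) * (ε / (8 * (C + 1))) = ε / 8 := by field_simp
              linarith
          refine ⟨N, fun n hn => ?_⟩
          have h1 := hN n hn
          have h2 := hb n
          have h3 := hb N
          rw [Real.dist_eq] at *
          rw [abs_lt] at *
          rw [abs_le] at h2 h3
          constructor <;> linarith [h1.1, h1.2, h2.1, h2.2, h3.1, h3.2]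
      exact ⟨y, fun _ => hy⟩
    · exact ⟨0, fun h => absurd h ht⟩
  choose y hy using key
  refine ⟨y, fun f => Metric.continuousOn_iff.2 fun t ht ε hε => ?_, hy⟩
  obtain ⟨C, hC0, hC⟩ := heq f (ε / 2) (by positivity)
  refine ⟨ε / (4 * (C + 1)), by positivity, fun s hs hst => ?_⟩
  have h1 : |inner ℝ (y s) f - inner ℝ (y t) f| ≤ ε / 2 + C * |s - t| :=
    le_of_tendsto (((hy s hs f).sub (hy t ht f)).abs) (.of_forall fun n => by
      rw [← inner_sub_left]; exact hC n t s ht hs)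
  rw [Real.dist_eq] at *
  have h7 : C * |s - t| ≤ (C + 1) * (ε / (4 * (C + 1))) := by
    gcongr
    linarith
  have h8 : (C + 1) * (ε / (4 * (C + 1))) = ε / 4 := by field_simp
  linarith

/-- Weak lower semicontinuity of the norm: testing against the limit itself, `2⟨x, f⟩ ≤ ‖x‖² + ‖f‖²`
is passed to the limit. -/
theorem energy_le_of_tendsto {x y : ℕ → L2} {f g : L2} {B : ℝ}
    (hx : Tendsto (fun n => (inner ℝ (x n) f : ℝ)) atTop (𝓝 (inner ℝ f f)))
    (hy : Tendsto (fun n => (inner ℝ (y n) g : ℝ)) atTop (𝓝 (inner ℝ g g)))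
    (hB : ∀ n, energy (x n) (y n) ≤ B) : energy f g ≤ B := by
  have h := le_of_tendsto (b := (B + energy f g) / 2) (hx.add hy) (.of_forall fun n => by
    have h1 := real_inner_le_norm (x n) f
    have h2 := real_inner_le_norm (y n) g
    have h3 := hB n
    have h4 := sq_nonneg (‖x n‖ - ‖f‖)
    have h5 := sq_nonneg (‖y n‖ - ‖g‖)
    simp only [energy] at *
    nlinarith)
  rw [real_inner_self_eq_norm_sq, real_inner_self_eq_norm_sq] at h
  simp only [energy] at *
  linarith

end WeakLimit

end

section

/-! ### Time slices of test functions -/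

theorem integrable_pair (f : L2) {φ : R3 → R3} (hφ : IsTest φ) :
    Integrable fun x => (inner ℝ (f x) (φ x) : ℝ) := by
  refine (L2.integrable_inner f hφ.toL2).congr ?_
  filter_upwards [hφ.memLp.coeFn_toLp] with x hx
  rw [IsTest.toL2, hx]

theorem IsTest.smul_const {ψ : R3 → ℝ} (h : IsTest ψ) (e : R3) : IsTest fun x => ψ x • e :=
  ⟨h.1.smul contDiff_const, h.2.smul_right⟩

theorem isTest_slice (φ : 𝓓(SpaceTime, ℝ)) (t : ℝ) : IsTest fun x => φ (t, x) := by
  refine ⟨φ.contDiff.comp (contDiff_const.prodMk contDiff_id), ?_⟩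
  refine HasCompactSupport.intro (φ.hasCompactSupport.isCompact.image continuous_snd) fun x hx => ?_
  exact image_eq_zero_of_notMem_tsupport fun h => hx ⟨(t, x), h, rfl⟩

/-- The field `φ(t,·) e`, as an element of `L²`. -/
def slice (φ : 𝓓(SpaceTime, ℝ)) (e : R3) (t : ℝ) : L2 := ((isTest_slice φ t).smul_const e).toL2

theorem inner_slice (f : L2) (φ : 𝓓(SpaceTime, ℝ)) (e : R3) (t : ℝ) :
    inner ℝ f (slice φ e t) = ∫ x, (inner ℝ (f x) (φ (t, x) • e) : ℝ) :=
  inner_toL2 f _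

theorem slice_eq_zero (φ : 𝓓(SpaceTime, ℝ)) (e : R3) {t : ℝ}
    (ht : t ∉ Prod.fst '' tsupport φ) : slice φ e t = 0 := by
  refine ext_inner_left ℝ fun f => ?_
  rw [inner_slice, inner_zero_right]
  refine integral_eq_zero_of_ae (.of_forall fun x => ?_)
  have : φ (t, x) = 0 := image_eq_zero_of_notMem_tsupport fun h => ht ⟨(t, x), h, rfl⟩
  simp [this]

/-- The squared distance between two slices expands into integrals over one fixed compact set, which
depend continuously on the time. -/
theorem continuous_slice (φ : 𝓓(SpaceTime, ℝ)) (e : R3) : Continuous (slice φ e) := by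
  set K := Prod.snd '' tsupport φ
  have hK : IsCompact K := φ.hasCompactSupport.isCompact.image continuous_snd
  have h1 : ∀ s t, (inner ℝ (slice φ e s) (slice φ e t) : ℝ)
      = ∫ x in K, φ (s, x) * φ (t, x) * ‖e‖ ^ 2 := by
    intro s t
    rw [inner_slice, setIntegral_eq_integral_of_forall_compl_eq_zero]
    · refine integral_congr_ae ?_
      filter_upwards [((isTest_slice φ s).smul_const e).memLp.coeFn_toLp] with x hx
      rw [slice, IsTest.toL2, hx, real_inner_smul_left, real_inner_smul_right,
        real_inner_self_eq_norm_sq]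
      ring
    · intro x hx
      have : φ (s, x) = 0 := image_eq_zero_of_notMem_tsupport fun h => hx ⟨(s, x), h, rfl⟩
      simp [this]
  have hφ := φ.continuous
  refine continuous_iff_continuousAt.2 fun s => ?_
  have h2 : Continuous fun t => ∫ x in K, φ (t, x) * φ (t, x) * ‖e‖ ^ 2 :=
    continuous_parametric_integral_of_continuous (by unfold Function.uncurry; fun_prop) hK
  have h3 : Continuous fun t => ∫ x in K, φ (t, x) * φ (s, x) * ‖e‖ ^ 2 :=
    continuous_parametric_integral_of_continuous (by unfold Function.uncurry; fun_prop) hK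
  have h4 : Continuous fun t => ‖slice φ e t - slice φ e s‖ ^ 2 := by
    have e1 : (fun t => ‖slice φ e t - slice φ e s‖ ^ 2) = fun t =>
        (∫ x in K, φ (t, x) * φ (t, x) * ‖e‖ ^ 2) - 2 * (∫ x in K, φ (t, x) * φ (s, x) * ‖e‖ ^ 2)
          + ‖slice φ e s‖ ^ 2 := by
      funext t
      rw [norm_sub_sq_real, h1, ← real_inner_self_eq_norm_sq, h1]
    rw [e1]
    exact (h2.sub (h3.const_mul 2)).add continuous_const
  have h5 := (Real.continuous_sqrt.comp h4).tendsto s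
  simp only [Function.comp_def, Real.sqrt_sq_eq_abs, abs_norm, sub_self, norm_zero, abs_zero] at h5
  exact tendsto_iff_norm_sub_tendsto_zero.2 h5

theorem WeaklyCont.continuousOn_inner_slice {u : ℝ → L2} (hu : WeaklyCont u) (φ : 𝓓(SpaceTime, ℝ))
    (e : R3) : ContinuousOn (fun t => (inner ℝ (u t) (slice φ e t) : ℝ)) (Ici 0) := by
  intro t ht
  obtain ⟨C, hC0, hC⟩ := WCont.exists_bound (F := u) hu (t + 1)
  have h1 : Tendsto (fun s => (inner ℝ (u s) (slice φ e t) : ℝ)) (𝓝[Ici 0] t)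
      (𝓝 (inner ℝ (u t) (slice φ e t))) := hu (slice φ e t) t ht
  have h2 : Tendsto (fun s => (inner ℝ (u s) (slice φ e s - slice φ e t) : ℝ)) (𝓝[Ici 0] t) (𝓝 0) := by
    have h3 : Tendsto (fun s => C * ‖slice φ e s - slice φ e t‖) (𝓝[Ici 0] t) (𝓝 (C * 0)) :=
      (tendsto_nhdsWithin_of_tendsto_nhds (tendsto_iff_norm_sub_tendsto_zero.1
        ((continuous_slice φ e).tendsto t))).const_mul C
    rw [mul_zero] at h3
    refine squeeze_zero_norm' ?_ h3
    filter_upwards [self_mem_nhdsWithin,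
      mem_nhdsWithin_of_mem_nhds (Iio_mem_nhds (lt_add_one t))] with s hs hs'
    refine (norm_inner_le_norm _ _).trans ?_
    gcongr
    exact hC s hs (le_of_lt hs')
  have h3 := h1.add h2
  rw [add_zero] at h3
  refine h3.congr fun s => ?_
  rw [← inner_add_right, add_sub_cancel]

theorem fst_image_tsupport_subset (φ : 𝓓(SpaceTime, ℝ)) : Prod.fst '' tsupport φ ⊆ Ioi 0 := by
  rintro _ ⟨p, hp, rfl⟩
  exact (φ.tsupport_subset hp).1

theorem WeaklyCont.integrableOn_inner_slice {u : ℝ → L2} (hu : WeaklyCont u) (φ : 𝓓(SpaceTime, ℝ))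
    (e : R3) : IntegrableOn (fun t => (inner ℝ (u t) (slice φ e t) : ℝ)) (Ioi 0) := by
  refine Integrable.integrableOn ?_
  refine (integrableOn_iff_integrable_of_support_subset (s := Prod.fst '' tsupport φ)
    fun t ht => ?_).1 (((hu.continuousOn_inner_slice φ e).mono
      ((fst_image_tsupport_subset φ).trans Ioi_subset_Ici_self)).integrableOn_compact
        (φ.hasCompactSupport.isCompact.image continuous_fst))
  by_contra h
  exact ht (by simp [slice_eq_zero φ e h])

theorem inner_act {u : ℝ → L2} (hu : WeaklyCont u) (φ : 𝓓(SpaceTime, ℝ)) (e : R3) :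
    inner ℝ (act u φ) e = ∫ t in Ioi (0 : ℝ), (inner ℝ (u t) (slice φ e t) : ℝ) := by
  set G : ℝ → R3 := fun t => ∫ x, φ (t, x) • u t x
  have hG : ∀ t (e : R3), (inner ℝ (G t) e : ℝ) = inner ℝ (u t) (slice φ e t) := by
    intro t e
    have hi : Integrable fun x => φ (t, x) • u t x := by
      have h : MemLp (fun x => φ (t, x)) 2 (volume : Measure R3) :=
        (isTest_slice φ t).1.continuous.memLp_of_hasCompactSupport (isTest_slice φ t).2
      exact memLp_one_iff_integrable.1 ((Lp.memLp (u t)).smul h)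
    rw [inner_slice, real_inner_comm, ← integral_inner hi]
    refine integral_congr_ae (.of_forall fun x => ?_)
    simp only [real_inner_smul_right]
    rw [real_inner_comm]
  have hGi : IntegrableOn G (Ioi 0) := by
    have h1 : G = fun t => ∑ i, (inner ℝ (u t) (slice φ (EuclideanSpace.single i 1) t) : ℝ)
        • (EuclideanSpace.single i 1 : R3) := by
      funext t
      have := (EuclideanSpace.basisFun (Fin 3) ℝ).sum_repr' (G t)
      simp only [EuclideanSpace.basisFun_apply] at this
      rw [← this]
      refine Finset.sum_congr rfl fun i _ => ?_
      rw [real_inner_comm, hG]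
    rw [h1]
    exact integrable_finsetSum _ fun i _ => (hu.integrableOn_inner_slice φ _).smul_const _
  calc inner ℝ (act u φ) e = inner ℝ (∫ t in Ioi (0 : ℝ), G t) e := rfl
    _ = ∫ t in Ioi (0 : ℝ), (inner ℝ e (G t) : ℝ) := by rw [real_inner_comm, ← integral_inner hGi]
    _ = _ := by
      refine integral_congr_ae (.of_forall fun t => ?_)
      simp only
      rw [real_inner_comm, hG]

/-- The test function `η(t) ψ(x)`. -/
def tensor {η : ℝ → ℝ} (hη : ContDiff ℝ ∞ η) (hc : HasCompactSupport η) (hs : tsupport η ⊆ Ioi 0)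
    {ψ : R3 → ℝ} (hψ : IsTest ψ) : 𝓓(SpaceTime, ℝ) where
  toFun p := η p.1 * ψ p.2
  contDiff' := (hη.comp contDiff_fst).mul (hψ.1.comp contDiff_snd)
  hasCompactSupport' := by
    refine HasCompactSupport.intro (hc.isCompact.prod hψ.2.isCompact) fun p hp => ?_
    by_cases h : p.1 ∈ tsupport η
    · rw [image_eq_zero_of_notMem_tsupport fun h' => hp ⟨h, h'⟩, mul_zero]
    · rw [image_eq_zero_of_notMem_tsupport h, zero_mul]
  tsupport_subset' := by
    refine (closure_minimal (fun p hp => ?_)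
      ((isClosed_tsupport η).prod (isClosed_tsupport ψ))).trans
      (prod_mono hs (subset_univ _) : tsupport η ×ˢ tsupport ψ ⊆ _)
    exact ⟨subset_tsupport η (left_ne_zero_of_mul hp), subset_tsupport ψ (right_ne_zero_of_mul hp)⟩

theorem inner_slice_tensor {η : ℝ → ℝ} (hη : ContDiff ℝ ∞ η) (hc : HasCompactSupport η)
    (hs : tsupport η ⊆ Ioi 0) {ψ : R3 → ℝ} (hψ : IsTest ψ) (f : L2) (e : R3) (t : ℝ) :
    inner ℝ f (slice (tensor hη hc hs hψ) e t) = η t * inner ℝ f (hψ.smul_const e).toL2 := by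
  rw [inner_slice, inner_toL2, pair, ← integral_const_mul]
  refine integral_congr_ae (.of_forall fun x => ?_)
  have : tensor hη hc hs hψ (t, x) = η t * ψ x := rfl
  simp only [this, real_inner_smul_right]
  ring

/-- The fields `ψ e` with a test function `ψ` and a vector `e`. -/
def scalarTests : Set L2 := {f | ∃ (ψ : R3 → ℝ) (hψ : IsTest ψ) (e : R3), f = (hψ.smul_const e).toL2}

theorem eq_zero_of_scalarTests (h : L2) (H : ∀ f ∈ scalarTests, inner ℝ h f = 0) : h = 0 := by
  refine eq_zero_of_pair fun φ hφ => ?_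
  have hi : ∀ i : Fin 3, IsTest fun x => φ x i := fun i =>
    ⟨(EuclideanSpace.proj (𝕜 := ℝ) i).contDiff.comp hφ.1,
      hφ.2.comp_left (g := fun v : R3 => v i) rfl⟩
  have h1 : ∀ x, (inner ℝ (h x) (φ x) : ℝ)
      = ∑ i, inner ℝ (h x) (φ x i • (EuclideanSpace.single i 1 : R3)) := fun x => by
    rw [← inner_sum]
    congr 1
    have := (EuclideanSpace.basisFun (Fin 3) ℝ).sum_repr (φ x)
    simpa using this.symm
  rw [pair]
  simp only [h1]
  rw [integral_finsetSum _ fun i _ => integrable_pair h ((hi i).smul_const _)]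
  refine Finset.sum_eq_zero fun i _ => ?_
  have := H _ ⟨_, hi i, EuclideanSpace.single i 1, rfl⟩
  rwa [inner_toL2] at this

theorem Represents.eq {u v : ℝ → L2} {U : 𝓓'(SpaceTime, R3)} (hu : Represents u U)
    (hv : Represents v U) {t : ℝ} (ht : 0 ≤ t) : u t = v t := by
  refine sub_eq_zero.1 (eq_zero_of_scalarTests _ ?_)
  rintro f ⟨ψ, hψ, e, rfl⟩
  set f := (hψ.smul_const e).toL2
  rw [inner_sub_left]
  refine eq_zero_of_bumps (g := fun t => inner ℝ (u t) f - inner ℝ (v t) f)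
    ((hu.1 f).sub (hv.1 f)) (fun η h1 h2 h3 => ?_) ht
  have e1 := inner_act hu.1 (tensor h1 h2 h3 hψ) e
  have e2 := inner_act hv.1 (tensor h1 h2 h3 hψ) e
  rw [← hu.2] at e1
  rw [← hv.2, e1] at e2
  simp only [inner_slice_tensor] at e2
  have i : ∀ {u : ℝ → L2}, WeaklyCont u → IntegrableOn (fun t => η t * inner ℝ (u t) f) (Ioi 0) :=
    fun hu => (integrable_mul_of_tsupport h1.continuous h2 h3 (hu f)).integrableOn
  simp only [mul_sub]
  rw [integral_sub (i hu.1) (i hv.1), e2, sub_self]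

theorem tendsto_act {x : ℕ → ℝ → L2} {y : ℝ → L2} (hx : ∀ n, WeaklyCont (x n)) (hy : WeaklyCont y)
    {M : ℝ} (hM : ∀ n t, 0 ≤ t → ‖x n t‖ ≤ M)
    (h : ∀ t, 0 ≤ t → ∀ f, Tendsto (fun n => (inner ℝ (x n t) f : ℝ)) atTop (𝓝 (inner ℝ (y t) f)))
    (φ : 𝓓(SpaceTime, ℝ)) (e : R3) :
    Tendsto (fun n => (inner ℝ (act (x n) φ) e : ℝ)) atTop (𝓝 (inner ℝ (act y φ) e)) := by
  rw [inner_act hy]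
  simp only [inner_act (hx _)]
  have hcs : HasCompactSupport fun t => M * ‖slice φ e t‖ :=
    HasCompactSupport.intro (φ.hasCompactSupport.isCompact.image continuous_fst) fun t ht => by
      rw [slice_eq_zero φ e ht]; simp
  refine tendsto_integral_of_dominated_convergence (fun t => M * ‖slice φ e t‖)
    (fun n => ((hx n).integrableOn_inner_slice φ e).aestronglyMeasurable)
    (((continuous_slice φ e).norm.const_mul M).integrable_of_hasCompactSupport hcs).integrableOn
    (fun n => ?_) ?_
  · filter_upwards [ae_restrict_mem measurableSet_Ioi] with t ht
    refine (norm_inner_le_norm _ _).trans ?_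
    gcongr
    exact hM n t (le_of_lt ht)
  · filter_upwards [ae_restrict_mem measurableSet_Ioi] with t ht
    exact h t (le_of_lt ht) _

/-- The weak limit represents the distributional limit. -/
theorem exists_represents {x : ℕ → ℝ → L2} {U : 𝓓'(SpaceTime, R3)} (hx : ∀ n, WeaklyCont (x n))
    {M : ℝ} (hM : ∀ n t, 0 ≤ t → ‖x n t‖ ≤ M)
    (heq : ∀ f, ∀ δ, 0 < δ → ∃ C, 0 ≤ C ∧ ∀ n s t, 0 ≤ s → 0 ≤ t →
      |inner ℝ (x n t - x n s) f| ≤ δ + C * |t - s|)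
    (hU : ∀ φ : 𝓓(SpaceTime, ℝ), Tendsto (fun n => act (x n) φ) atTop (𝓝 (U φ))) :
    ∃ y : ℝ → L2, Represents y U ∧ ∀ t, 0 ≤ t → ∀ f,
      Tendsto (fun n => (inner ℝ (x n t) f : ℝ)) atTop (𝓝 (inner ℝ (y t) f)) := by
  obtain ⟨y, hy, hlim⟩ := exists_weak_limit hM hx heq eq_zero_of_scalarTests (by
    rintro _ ⟨ψ, hψ, e, rfl⟩ η h1 h2 h3
    refine (((hU (tensor h1 h2 h3 hψ)).inner (𝕜 := ℝ)
      (tendsto_const_nhds (x := e))).congr fun n => ?_).cauchySeq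
    rw [inner_act (hx n)]
    simp only [inner_slice_tensor])
  refine ⟨y, ⟨hy, fun φ => ext_inner_right ℝ fun e => ?_⟩, hlim⟩
  exact tendsto_nhds_unique ((hU φ).inner (𝕜 := ℝ) tendsto_const_nhds)
    (tendsto_act hx hy hM hlim φ e)

end

section

/-! ### Restricted Leray solutions as weak limits -/

variable {c : Coeffs} {θ : R3 → ℝ} {u₀ w₀ : L2}

/-- A restricted Leray solution is represented by a weak limit, at every time, of mollified
solutions. -/
theorem IsRestrictedLeray.exists_limit (hθ : IsMollifier θ) {U W : 𝓓'(SpaceTime, R3)}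
    (h : IsRestrictedLeray c θ u₀ w₀ U W) :
    ∃ (ε : ℕ → ℝ) (x y : ℕ → ℝ → L2) (u w : ℝ → L2), (∀ n, 0 < ε n) ∧
      (∀ n, IsMollifiedSolution c θ (ε n) u₀ w₀ (x n) (y n)) ∧ Represents u U ∧ Represents w W ∧
      (∀ t, 0 ≤ t → ∀ f, Tendsto (fun n => (inner ℝ (x n t) f : ℝ)) atTop (𝓝 (inner ℝ (u t) f))) ∧
      ∀ t, 0 ≤ t → ∀ f, Tendsto (fun n => (inner ℝ (y n t) f : ℝ)) atTop (𝓝 (inner ℝ (w t) f)) := by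
  obtain ⟨ε, x, y, hε, -, hs, hlim⟩ := h
  have hE : ∀ n t, 0 ≤ t → √(energy (x n t) (y n t)) ≤ √(energy u₀ w₀) := fun n t ht =>
    Real.sqrt_le_sqrt ((hs n).energy_le_zero hθ (hε n) ht)
  obtain ⟨u, hu, hu'⟩ := exists_represents (fun n => (hs n).contU) (M := √(energy u₀ w₀))
    (fun n t ht => (norm_le_sqrt_energy_left _ _).trans (hE n t ht)) (fun f δ hδ => by
      obtain ⟨C, hC0, hC⟩ := exists_modulus (c := c) (u₀ := u₀) (w₀ := w₀) hθ f 0 hδ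
      exact ⟨C, hC0, fun n s t h1 h2 => by simpa using hC _ _ _ (hε n) (hs n) s t h1 h2⟩)
    fun φ => (hlim φ).1
  obtain ⟨w, hw, hw'⟩ := exists_represents (fun n => (hs n).contW) (M := √(energy u₀ w₀))
    (fun n t ht => (norm_le_sqrt_energy_right _ _).trans (hE n t ht)) (fun f δ hδ => by
      obtain ⟨C, hC0, hC⟩ := exists_modulus (c := c) (u₀ := u₀) (w₀ := w₀) hθ 0 f hδ
      exact ⟨C, hC0, fun n s t h1 h2 => by simpa using hC _ _ _ (hε n) (hs n) s t h1 h2⟩)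
    fun φ => (hlim φ).2
  exact ⟨ε, x, y, u, w, hε, hs, hu, hw, hu', hw'⟩

/-- A bound at time `t` valid for all mollified solutions passes to any representative, by
uniqueness of representatives and weak lower semicontinuity. The shifts `a` and `b` allow the linear
flow to be subtracted. -/
theorem IsRestrictedLeray.energy_le (hθ : IsMollifier θ) {U W : 𝓓'(SpaceTime, R3)}
    (h : IsRestrictedLeray c θ u₀ w₀ U W) {u w : ℝ → L2} (hu : Represents u U)
    (hw : Represents w W) {t : ℝ} (ht : 0 ≤ t) (a b : L2) {B : ℝ}
    (hB : ∀ ε (x y : ℝ → L2), 0 < ε → IsMollifiedSolution c θ ε u₀ w₀ x y →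
      Micropolar.energy (x t - a) (y t - b) ≤ B) : Micropolar.energy (u t - a) (w t - b) ≤ B := by
  obtain ⟨ε, x, y, u', w', hε, hs, hu', hw', hx, hy⟩ := h.exists_limit hθ
  rw [hu.eq hu' ht, hw.eq hw' ht]
  refine energy_le_of_tendsto (x := fun n => x n t - a) (y := fun n => y n t - b) ?_ ?_
    fun n => hB _ _ _ (hε n) (hs n)
  · simp only [inner_sub_left _ a]
    exact (hx t ht _).sub_const _
  · simp only [inner_sub_left _ b]
    exact (hy t ht _).sub_const _

end

end Micropolar

end

/-! ### Assembly: the uniform bounds are transferred to the restricted Leray solution. -/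

open Micropolar in
theorem theorem1p2 (c : Coeffs) (θ : R3 → ℝ) (hθ : IsMollifier θ)
    (u₀ w₀ : L2) (hu₀ : u₀ ∈ L2σ) (U W : 𝓓'(SpaceTime, R3))
    (hUW : IsRestrictedLeray c θ u₀ w₀ U W) :
    (∃ u w : ℝ → L2, Represents u U ∧ Represents w W) ∧
    ∀ u w : ℝ → L2, Represents u U → Represents w W →
      Tendsto (fun t => energy (u t) (w t)) atTop (𝓝 0) ∧
      ∀ (uL wL : ℝ → L2), IsLinearSolution c u₀ w₀ uL wL →
        ∀ Γ : ℝ, 0 ≤ Γ → Γ ≤ 5 / 2 →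
          (fun t => ‖uL t‖ ^ 2) =O[atTop] (fun t : ℝ => t ^ (-Γ)) →
          (fun t => energy (u t) (w t)) =O[atTop] (fun t : ℝ => t ^ (-Γ)) ∧
          ((c.γ = 0 → FourierCond u₀ w₀) →
            (Γ = 0 → ∃ ζ : ℝ → ℝ, Tendsto ζ atTop (𝓝 0) ∧ ∃ C : ℝ, ∀ t : ℝ, 0 ≤ t →
              energy (u t - uL t) (w t - wL t) ≤ C * ((1 + t) ^ (-(1 / 2) : ℝ) * ζ t)) ∧
            (0 < Γ → Γ < 1 → ∃ C : ℝ, ∀ t : ℝ, 0 ≤ t →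
              energy (u t - uL t) (w t - wL t) ≤ C * (1 + t) ^ (-(1 / 2) - 2 * Γ)) ∧
            (Γ = 1 → ∃ C : ℝ, ∀ t : ℝ, 0 ≤ t →
              energy (u t - uL t) (w t - wL t)
                ≤ C * ((1 + t) ^ (-(5 / 2) : ℝ) * Real.log (Real.exp 1 + t) ^ 2)) ∧
            (1 < Γ → ∃ C : ℝ, ∀ t : ℝ, 0 ≤ t →
              energy (u t - uL t) (w t - wL t) ≤ C * (1 + t) ^ (-(5 / 2) : ℝ))) := by

  have hE : ∀ {u w : ℝ → L2}, Represents u U → Represents w W → ∀ {t : ℝ}, 0 ≤ t → ∀ {B : ℝ},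
      (∀ ε (x y : ℝ → L2), 0 < ε → IsMollifiedSolution c θ ε u₀ w₀ x y →
        energy (x t) (y t) ≤ B) → energy (u t) (w t) ≤ B := fun hu hw t ht B hB => by
    simpa using hUW.energy_le hθ hu hw ht 0 0 fun ε x y hε hs => by simpa using hB ε x y hε hs
  obtain ⟨-, -, -, u', w', -, -, hu', hw', -, -⟩ := hUW.exists_limit hθ
  refine ⟨⟨u', w', hu', hw'⟩, fun u w hu hw => ⟨?_, fun uL wL hL Γ hΓ hΓ' hO => ?_⟩⟩
  · refine tendsto_order.2 ⟨fun a ha => .of_forall fun t => ha.trans_le (energy_nonneg _ _),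
      fun a ha => ?_⟩
    obtain ⟨T, hT, h⟩ := exists_energy_le (c := c) (u₀ := u₀) (w₀ := w₀) hθ (half_pos ha)
    filter_upwards [eventually_ge_atTop T] with t ht
    exact (hE hu hw (hT.le.trans ht) fun ε x y hε hs => h ε x y hε hs t ht).trans_lt (half_lt_self ha)
  obtain ⟨K, hK, hl⟩ := hL.exists_norm_sq_le hΓ hO
  refine ⟨?_, fun hF => ⟨?_, fun h0 h1 => ?_, ?_, fun h1 => ?_⟩⟩
  · obtain ⟨C, hC0, hC⟩ := exists_energy_decay hθ hL hΓ hΓ' hK hl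
    refine Asymptotics.IsBigO.of_bound C ?_
    filter_upwards [eventually_gt_atTop 0] with t ht
    rw [Real.norm_of_nonneg (energy_nonneg _ _), Real.norm_of_nonneg (by positivity)]
    refine (hE hu hw ht.le fun ε x y hε hs => hC ε x y hε hs t ht.le).trans ?_
    refine mul_le_mul_of_nonneg_left ?_ hC0
    exact Real.rpow_le_rpow_of_nonpos ht (by linarith) (by linarith)
  · rintro -
    -- The rescaled difference itself serves as `ζ`, with constant one; only its convergence to zero
    -- requires proof.
    refine ⟨fun t => (1 + t) ^ (1 / 2 : ℝ) * energy (u t - uL t) (w t - wL t), ?_, 1, fun t ht => ?_⟩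
    · refine tendsto_order.2 ⟨fun a ha => ?_, fun a ha => ?_⟩
      · filter_upwards [eventually_ge_atTop 0] with t ht
        exact ha.trans_le (mul_nonneg (by positivity) (energy_nonneg _ _))
      · obtain ⟨T, hT, h⟩ := exists_sqrt_mul_diff_le hθ hL hF (half_pos ha)
        filter_upwards [eventually_ge_atTop T] with t ht
        have ht0 : 0 ≤ t := hT.le.trans ht
        have hp : 0 < (1 + t) ^ (1 / 2 : ℝ) := by positivity
        refine lt_of_le_of_lt ?_ (half_lt_self ha)
        rw [mul_comm, ← le_div_iff₀ hp]
        refine hUW.energy_le hθ hu hw ht0 _ _ fun ε x y hε hs => ?_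
        rw [le_div_iff₀ hp, mul_comm]
        exact h ε x y hε hs t ht
    · rw [one_mul, ← mul_assoc, ← Real.rpow_add (by positivity), neg_add_cancel, Real.rpow_zero,
        one_mul]
  · obtain ⟨C, hC0, hC⟩ := exists_diff_decay hθ hL hF hΓ hΓ' hK hl (b := 1 / 2 + 2 * Γ)
      (by positivity) (by linarith) le_rfl h1.ne
    refine ⟨C, fun t ht => ?_⟩
    rw [show -(1 / 2) - 2 * Γ = -(1 / 2 + 2 * Γ) by ring]
    exact hUW.energy_le hθ hu hw ht _ _ fun ε x y hε hs => hC ε x y hε hs t ht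
  · rintro rfl
    obtain ⟨C, hC0, hC⟩ := exists_diff_decay_log hθ hL hF hK hl
    exact ⟨C, fun t ht => hUW.energy_le hθ hu hw ht _ _ fun ε x y hε hs => hC ε x y hε hs t ht⟩
  · obtain ⟨C, hC0, hC⟩ := exists_diff_decay hθ hL hF hΓ hΓ' hK hl (b := 5 / 2)
      (by norm_num) le_rfl (by linarith) h1.ne'
    exact ⟨C, fun t ht => hUW.energy_le hθ hu hw ht _ _ fun ε x y hε hs => hC ε x y hε hs t ht⟩
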